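/- Let $(M,g)$ be a connected, Hausdorff, second countable, smooth four-dimensional Lorentzian manifold of signature $(-,+,+,+)$ which is time-oriented and globally hyperbolic. Let $\nabla$ be the Levi-Civita connection, with curvature conventions $(\nabla_a\nabla_b-\nabla_b\nabla_a)v_c=R_{abc}{}^d v_d$, $R_{ab}=R_{acb}{}^c$, $R=R_a{}^a$, $G_{ab}=R_{ab}-\frac12Rg_{ab}$. Let $\xi\in\mathbb R$, let $\phi:M\to\mathbb R$ be smooth and let $V$ be a real function of one real variable that is smooth at all values of $\phi$; write $V,\partial_\phi V,\partial_\phi^2V$ for $V(\phi),V'(\phi),V''(\phi)$ and $(\nabla\phi)^2=(\nabla^c\phi)\nabla_c\phi$. Assume that $(g,\phi)$ solves the Einstein-Klein-Gordon equations $$G_{ab}=(1-2\xi)(\nabla_a\phi)\nabla_b\phi-2\xi\phi\nabla_a\nabla_b\phi+\xi G_{ab}\phi^2+g_{ab}\left(2\xi\phi\nabla_c\nabla^c\phi+\left(2\xi-\tfrac12\right)(\nabla\phi)^2-V\right),\qquad -\nabla_a\nabla^a\phi+\xi R\phi+\partial_\phi V=0,$$ and that $\alpha:=1-\xi\phi^2$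 and $\beta:=1+\kappa\phi^2$, $\kappa:=(6\xi-1)\xi$, vanish nowhere on $M$. Let $\Gamma(\mathcal V)$ be the space of smooth sections $\Theta=(\theta_{ab},\zeta)$ of $\mathcal V=\bigvee^2T^*M\oplus(M\times\mathbb R)$. Put $$\langle\langle\Theta_1,\Theta_2\rangle\rangle=\frac4\alpha\theta_{1,ab}\theta_2^{ab}+\frac{4\xi^2\phi^2-2\beta}{\beta\alpha}\theta_{1,c}{}^{c}\,\theta_{2,d}{}^{d}+\frac{2\xi\phi}\beta\left(\theta_{1,c}{}^{c}\zeta_2+\theta_{2,c}{}^{c}\zeta_1\right)+\frac\alpha\beta\zeta_1\zeta_2 ,$$ $\langle\Theta_1,\Theta_2\rangle=\int_M\mathrm{vol}_M\,\langle\langle\Theta_1,\Theta_2\rangle\rangle$, and let $\bar P(\theta,\zeta)=(\bar P_0\theta+\bar P_2\zeta,\ \bar P_3\theta+\bar P_1\zeta)$ be the linearised Einstein-Klein-Gordon operator after field redefinition, that is (round brackets denote idempotent symmetrisation) $$\begin{aligned}(\bar P_0\theta)_{ab}=&-\nabla_c\nabla^c\theta_{ab}+2\nabla^c\nabla_{(a}\theta_{b)c}-g_{ab}\nabla^c\nabla^d\theta_{cd}+\tfrac{4\xi\phi}\alpha(\nabla_{(a}\phi)\nabla^c\theta_{b)c}-\tfrac{2\xi\phi}\alpha(\nabla^c\phi)\nabla_c\theta_{ab}-\tfrac2\alpha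 V\theta_{ab}\\&-\tfrac{2\xi}{\beta\alpha}(\nabla_a\phi)(\nabla_b\phi)\theta_c{}^c+\tfrac{4\xi(2-\alpha)}{\alpha^2}(\nabla^c\phi)(\nabla_{(a}\phi)\theta_{b)c}-\tfrac{4\xi^2\phi^2}{\alpha^2}(\nabla\phi)^2\theta_{ab}+\tfrac{4\xi\phi}\alpha(\nabla^c\nabla_{(a}\phi)\theta_{b)c},\end{aligned}$$ $$(\bar P_2\zeta)_{ab}=-(\nabla_{(a}\phi)\nabla_{b)}\zeta+\tfrac{\kappa\phi}\beta(\nabla_a\phi)(\nabla_b\phi)\zeta+\tfrac12g_{ab}(\nabla^c\phi)\nabla_c\zeta+\tfrac{4\xi\phi V+\alpha\partial_\phi V}{2\beta}g_{ab}\zeta-\tfrac{\kappa\phi}{2\beta}(\nabla\phi)^2g_{ab}\zeta,$$ $$\begin{aligned}\bar P_3\theta=4\Big(&\tfrac{\xi\phi}\alpha\nabla^a\nabla^b\theta_{ab}+\Big[\tfrac{\xi\phi(2\xi\alpha-\alpha-2\xi)}{\beta\alpha^2}V+\tfrac{\xi\alpha-\alpha-2\xi}{2\beta\alpha}\partial_\phi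 V+\tfrac{\xi\phi}{2\beta}\partial_\phi^2V+\tfrac{3\xi^2\phi(4\xi-\beta)}{\beta^2\alpha^2}(\nabla\phi)^2\Big]\theta_c{}^c\\&+\tfrac{4\xi+\alpha-4\xi\alpha}{\alpha^2}(\nabla^a\phi)\nabla^b\theta_{ab}-\tfrac\xi{\beta\alpha}(\nabla^c\phi)\nabla_c\theta_d{}^d+\tfrac{\xi\phi(8\xi+\alpha-4\xi\alpha)}{\alpha^3}(\nabla^a\phi)(\nabla^b\phi)\theta_{ab}+\tfrac{4\xi+\alpha-4\xi\alpha}{\alpha^2}(\nabla^a\nabla^b\phi)\theta_{ab}\Big),\end{aligned}$$ $$\bar P_1\zeta=-\nabla_a\nabla^a\zeta+\Big[\xi R+\tfrac{2\xi(1+3\xi)}\beta\phi\,\partial_\phi V+\tfrac\alpha\beta\partial_\phi^2V-\tfrac{2\kappa(\kappa\phi^2-1)}{\beta^2}(\nabla\phi)^2\Big]\zeta+\tfrac{2\kappa\phi}\beta(\nabla^a\phi)\nabla_a\zeta .$$ Define the current $$\begin{aligned}\bar j_a(\Theta_1,\Theta_2)=&-\tfrac4\alpha\theta_1^{bc}\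nabla_a\theta_{2,bc}+\tfrac8\alpha\theta_{1,a}{}^{c}\nabla^b\theta_{2,bc}-\tfrac{4\xi^2\phi^2-2\beta}{\beta\alpha}\theta_{1,c}{}^{c}\nabla_a\theta_{2,d}{}^{d}-\tfrac{2\xi\phi}\beta\theta_{1,c}{}^{c}\nabla_a\zeta_2-\tfrac{2\xi\phi}\beta\zeta_1\nabla_a\theta_{2,c}{}^{c}\\&-\tfrac\alpha\beta\zeta_1\nabla_a\zeta_2+\tfrac{2\xi(2-\alpha)}{\beta\alpha}\theta_{1,c}{}^{c}(\nabla_a\phi)\zeta_2+\tfrac4\alpha\zeta_1(\nabla^b\phi)\theta_{2,ab}\ -\ (1\leftrightarrow2).\end{aligned}$$ A Cauchy surface is a subset of $M$ that every inextendible timelike curve meets exactly once; a subset of $M$ is space-like compact if its intersection with every Cauchy surface is compact. A future part of $\Theta\in\Gamma(\mathcal V)$ is a $\Theta^+\in\Gamma(\mathcal V)$ for which there are Cauchy surfaces $\Sigma^\pm$ such that $\Theta^+=\Theta$ on $J^+(\Sigma^+)$ and $\Theta^+=0$ on $J^-(\Sigma^-)$. Let $\overline{\mathrm{Sol}}=\{\Theta\in\Gamma(\mathcal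 V):\bar P\Theta=0\}$. For $\Theta_1,\Theta_2\in\overline{\mathrm{Sol}}$ with $\operatorname{supp}\Theta_1\cap\operatorname{supp}\Theta_2$ space-like compact, the symplectic form is $$\langle\Theta_1,\Theta_2\rangle_{\overline{\mathrm{Sol}}}:=\langle\bar P\Theta_1^+,\Theta_2\rangle,$$ where $\Theta_1^+$ is any future part of $\Theta_1$ such that $\operatorname{supp}\Theta_1^+\cap\operatorname{supp}\Theta_2$ is space-like compact (for instance $\Theta_1^+=\chi\Theta_1$ with a smooth function $\chi$ equal to $1$ on some $J^+(\Sigma^+)$ and to $0$ on some $J^-(\Sigma^-)$). Then the following hold. 1. For all $\Theta_1,\Theta_2\in\Gamma(\mathcal V)$, $\ \nabla^a\bar j_a(\Theta_1,\Theta_2)=\langle\langle\Theta_1,\bar P\Theta_2\rangle\rangle-\langle\langle\bar P\Theta_1,\Theta_2\rangle\rangle$ on $M$. 2. For all $\Theta_1,\Theta_2\in\overline{\mathrm{Sol}}$ such that $\operatorname{supp}\Theta_1\cap\operatorname{supp}\Theta_2$ is space-like compact, every $\Theta_1^+$ as above, and every smooth embedded space-like Cauchy surface $\Sigma$ with future directed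 unit normal vector field $n$, the functions $\langle\langle\bar P\Theta_1^+,\Theta_2\rangle\rangle$ and $n^a\bar j_a(\Theta_1,\Theta_2)|_\Sigma$ are integrable on $M$ and on $\Sigma$ respectively, and $$\langle\Theta_1,\Theta_2\rangle_{\overline{\mathrm{Sol}}}=\langle\bar P\Theta_1^+,\Theta_2\rangle=\int_\Sigma\mathrm{vol}_\Sigma\,n^a\bar j_a(\Theta_1,\Theta_2).$$ -/

import Mathlib

open Set Filter Topology MeasureTheory
open scoped Manifold ContDiff

noncomputable section

namespace LinEKG

/-! ## Tensor calculus in one coordinate system of a four-dimensional Lorentzian manifold -/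

/-- Partial derivative in the `i`-th coordinate direction. -/
def pd (i : Fin 4) (f : EuclideanSpace ℝ (Fin 4) → ℝ) (z : EuclideanSpace ℝ (Fin 4)) : ℝ :=
  fderiv ℝ f z (EuclideanSpace.single i 1)

/-- Coordinate expression of the background: metric components `G i j`, scalar field `φ`, together
with the coupling constant `ξ` and the potential `V`. -/
structure LocalBackground where
  G : Fin 4 → Fin 4 → EuclideanSpace ℝ (Fin 4) → ℝ
  φ : EuclideanSpace ℝ (Fin 4) → ℝ
  ξ : ℝ
  V : ℝ → ℝ

/-- Coordinate expression of a section `(θ, ζ)` of `⋁² T*M ⊕ (M × ℝ)`. -/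
structure LocalSection where
  θ : Fin 4 → Fin 4 → EuclideanSpace ℝ (Fin 4) → ℝ
  ζ : EuclideanSpace ℝ (Fin 4) → ℝ

namespace LocalBackground

variable (B : LocalBackground)

/-- Inverse metric `g^{ij}`. -/
def gi (i j : Fin 4) (z : EuclideanSpace ℝ (Fin 4)) : ℝ :=
  (Matrix.of fun k l => B.G k l z)⁻¹ i j

/-- Christoffel symbols `Γ^k_{ij}` of the Levi-Civita connection. -/
def chr (k i j : Fin 4) (z : EuclideanSpace ℝ (Fin 4)) : ℝ :=
  1 / 2 * ∑ l, B.gi k l z * (pd i (B.G j l) z + pd j (B.G i l) z - pd l (B.G i j) z)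

/-- `∇_a w_b` for a covector field. -/
def cov1 (w : Fin 4 → EuclideanSpace ℝ (Fin 4) → ℝ) (a b : Fin 4)
    (z : EuclideanSpace ℝ (Fin 4)) : ℝ :=
  pd a (w b) z - ∑ l, B.chr l a b z * w l z

/-- `∇_a t_{bc}` for a covariant tensor field of rank two. -/
def cov2 (t : Fin 4 → Fin 4 → EuclideanSpace ℝ (Fin 4) → ℝ) (a b c : Fin 4)
    (z : EuclideanSpace ℝ (Fin 4)) : ℝ :=
  pd a (t b c) z - ∑ l, B.chr l a b z * t l c z - ∑ l, B.chr l a c z * t b l z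

/-- `∇_a t_{bcd}` for a covariant tensor field of rank three. -/
def cov3 (t : Fin 4 → Fin 4 → Fin 4 → EuclideanSpace ℝ (Fin 4) → ℝ) (a b c d : Fin 4)
    (z : EuclideanSpace ℝ (Fin 4)) : ℝ :=
  pd a (t b c d) z - ∑ l, B.chr l a b z * t l c d z - ∑ l, B.chr l a c z * t b l d z
    - ∑ l, B.chr l a d z * t b c l z

/-- `R_{abc}^d`, with the convention `(∇_a ∇_b - ∇_b ∇_a) v_c = R_{abc}^d v_d`. -/
def riem (a b c d : Fin 4) (z : EuclideanSpace ℝ (Fin 4)) : ℝ :=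
  pd b (B.chr d a c) z - pd a (B.chr d b c) z
    + ∑ e, (B.chr e a c z * B.chr d e b z - B.chr e b c z * B.chr d e a z)

/-- `R_{ab} = R_{acb}^c`. -/
def ricci (a b : Fin 4) (z : EuclideanSpace ℝ (Fin 4)) : ℝ := ∑ c, B.riem a c b c z

/-- `R = R_a^a`. -/
def scal (z : EuclideanSpace ℝ (Fin 4)) : ℝ := ∑ a, ∑ b, B.gi a b z * B.ricci a b z

/-- `G_{ab} = R_{ab} - R g_{ab} / 2`. -/
def einstein (a b : Fin 4) (z : EuclideanSpace ℝ (Fin 4)) : ℝ :=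
  B.ricci a b z - 1 / 2 * B.scal z * B.G a b z

/-- `∇_a φ`. -/
def dφ (a : Fin 4) (z : EuclideanSpace ℝ (Fin 4)) : ℝ := pd a B.φ z

/-- `∇^a φ`. -/
def uφ (a : Fin 4) (z : EuclideanSpace ℝ (Fin 4)) : ℝ := ∑ b, B.gi a b z * B.dφ b z

/-- `∇_a ∇_b φ`. -/
def ddφ (a b : Fin 4) (z : EuclideanSpace ℝ (Fin 4)) : ℝ := B.cov1 B.dφ a b z

/-- `∇_c ∇^c φ`. -/
def boxφ (z : EuclideanSpace ℝ (Fin 4)) : ℝ := ∑ a, ∑ b, B.gi a b z * B.ddφ a b z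

/-- `(∇φ)² = (∇^c φ) ∇_c φ`. -/
def nφ (z : EuclideanSpace ℝ (Fin 4)) : ℝ := ∑ a, B.uφ a z * B.dφ a z

/-- The potential `V(φ)`, and its first and second derivatives with respect to `φ`. -/
def V0 (z : EuclideanSpace ℝ (Fin 4)) : ℝ := B.V (B.φ z)
def V1 (z : EuclideanSpace ℝ (Fin 4)) : ℝ := deriv B.V (B.φ z)
def V2 (z : EuclideanSpace ℝ (Fin 4)) : ℝ := deriv (deriv B.V) (B.φ z)

/-- `α = 1 - ξ φ²`, `κ = (6 ξ - 1) ξ`, `β = 1 + κ φ²`. -/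
def α (z : EuclideanSpace ℝ (Fin 4)) : ℝ := 1 - B.ξ * B.φ z ^ 2
def κ : ℝ := (6 * B.ξ - 1) * B.ξ
def β (z : EuclideanSpace ℝ (Fin 4)) : ℝ := 1 + B.κ * B.φ z ^ 2

/-- The stress-energy tensor `T_{ab}(g, φ)`. -/
def stress (a b : Fin 4) (z : EuclideanSpace ℝ (Fin 4)) : ℝ :=
  (1 - 2 * B.ξ) * B.dφ a z * B.dφ b z - 2 * B.ξ * B.φ z * B.ddφ a b z
    + B.ξ * B.einstein a b z * B.φ z ^ 2
    + B.G a b z * (2 * B.ξ * B.φ z * B.boxφ z + (2 * B.ξ - 1 / 2) * B.nφ z - B.V0 z)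

/-- The Einstein-Klein-Gordon equations at the point `z`. -/
def EKGAt (z : EuclideanSpace ℝ (Fin 4)) : Prop :=
  (∀ a b, B.einstein a b z = B.stress a b z) ∧
    -B.boxφ z + B.ξ * B.scal z * B.φ z + B.V1 z = 0

/-- `∇^a w_a` for a covector field. -/
def div1 (w : Fin 4 → EuclideanSpace ℝ (Fin 4) → ℝ) (z : EuclideanSpace ℝ (Fin 4)) : ℝ :=
  ∑ a, ∑ b, B.gi a b z * B.cov1 w a b z

/-- `t_c^c`. -/
def tr (t : Fin 4 → Fin 4 → EuclideanSpace ℝ (Fin 4) → ℝ) (z : EuclideanSpace ℝ (Fin 4)) : ℝ :=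
  ∑ a, ∑ b, B.gi a b z * t a b z

/-- `t_1^{ab} t_{2,ab}`. -/
def dot2 (t₁ t₂ : Fin 4 → Fin 4 → EuclideanSpace ℝ (Fin 4) → ℝ)
    (z : EuclideanSpace ℝ (Fin 4)) : ℝ :=
  ∑ a, ∑ b, ∑ c, ∑ d, B.gi a c z * B.gi b d z * t₁ a b z * t₂ c d z

/-- `∇_d ∇_c t_{ab}`. -/
def cov22 (t : Fin 4 → Fin 4 → EuclideanSpace ℝ (Fin 4) → ℝ) (d c a b : Fin 4)
    (z : EuclideanSpace ℝ (Fin 4)) : ℝ := B.cov3 (B.cov2 t) d c a b z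

/-- `∇^c t_{cb}`. -/
def div2 (t : Fin 4 → Fin 4 → EuclideanSpace ℝ (Fin 4) → ℝ) (b : Fin 4)
    (z : EuclideanSpace ℝ (Fin 4)) : ℝ :=
  ∑ c, ∑ d, B.gi c d z * B.cov2 t c d b z

/-- `∇^a ∇^b t_{ab}`. -/
def divdiv2 (t : Fin 4 → Fin 4 → EuclideanSpace ℝ (Fin 4) → ℝ)
    (z : EuclideanSpace ℝ (Fin 4)) : ℝ :=
  ∑ a, ∑ b, ∑ c, ∑ d, B.gi a c z * B.gi b d z * B.cov22 t c d a b z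

/-- Components `ab` of the tensor part `P̄₀ θ + P̄₂ ζ` of `P̄ (θ, ζ)`. -/
def PbarTensor (Θ : LocalSection) (a b : Fin 4) (z : EuclideanSpace ℝ (Fin 4)) : ℝ :=
  -(∑ c, ∑ d, B.gi c d z * B.cov22 Θ.θ c d a b z)
  + (∑ c, ∑ d, B.gi c d z * (B.cov22 Θ.θ c a b d z + B.cov22 Θ.θ c b a d z))
  - B.G a b z * B.divdiv2 Θ.θ z
  + 4 * B.ξ * B.φ z / B.α z
      * (1 / 2 * (B.dφ a z * B.div2 Θ.θ b z + B.dφ b z * B.div2 Θ.θ a z))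
  - 2 * B.ξ * B.φ z / B.α z * (∑ c, B.uφ c z * B.cov2 Θ.θ c a b z)
  - 2 / B.α z * B.V0 z * Θ.θ a b z
  - 2 * B.ξ / (B.β z * B.α z) * B.dφ a z * B.dφ b z * B.tr Θ.θ z
  + 4 * B.ξ * (2 - B.α z) / B.α z ^ 2
      * (∑ c, B.uφ c z * (1 / 2 * (B.dφ a z * Θ.θ b c z + B.dφ b z * Θ.θ a c z)))
  - 4 * B.ξ ^ 2 * B.φ z ^ 2 / B.α z ^ 2 * B.nφ z * Θ.θ a b z
  + 4 * B.ξ * B.φ z / B.α z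
      * (∑ c, ∑ d, B.gi c d z * (1 / 2 * (B.ddφ d a z * Θ.θ b c z + B.ddφ d b z * Θ.θ a c z)))
  - 1 / 2 * (B.dφ a z * pd b Θ.ζ z + B.dφ b z * pd a Θ.ζ z)
  + B.κ * B.φ z / B.β z * B.dφ a z * B.dφ b z * Θ.ζ z
  + 1 / 2 * B.G a b z * (∑ c, B.uφ c z * pd c Θ.ζ z)
  + (4 * B.ξ * B.φ z * B.V0 z + B.α z * B.V1 z) / (2 * B.β z) * B.G a b z * Θ.ζ z
  - B.κ * B.φ z / (2 * B.β z) * B.nφ z * B.G a b z * Θ.ζ z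

/-- The scalar part `P̄₃ θ + P̄₁ ζ` of `P̄ (θ, ζ)`. -/
def PbarScalar (Θ : LocalSection) (z : EuclideanSpace ℝ (Fin 4)) : ℝ :=
  4 * (B.ξ * B.φ z / B.α z * B.divdiv2 Θ.θ z
    + B.ξ * B.φ z * (2 * B.ξ * B.α z - B.α z - 2 * B.ξ) / (B.β z * B.α z ^ 2)
        * B.V0 z * B.tr Θ.θ z
    + (B.ξ * B.α z - B.α z - 2 * B.ξ) / (2 * B.β z * B.α z) * B.V1 z * B.tr Θ.θ z
    + B.ξ * B.φ z / (2 * B.β z) * B.V2 z * B.tr Θ.θ z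
    + 3 * B.ξ ^ 2 * B.φ z * (4 * B.ξ - B.β z) / (B.β z ^ 2 * B.α z ^ 2) * B.nφ z * B.tr Θ.θ z
    + (4 * B.ξ + B.α z - 4 * B.ξ * B.α z) / B.α z ^ 2 * (∑ a, B.uφ a z * B.div2 Θ.θ a z)
    - B.ξ / (B.β z * B.α z) * (∑ c, B.uφ c z * pd c (B.tr Θ.θ) z)
    + B.ξ * B.φ z * (8 * B.ξ + B.α z - 4 * B.ξ * B.α z) / B.α z ^ 3
        * (∑ a, ∑ b, B.uφ a z * B.uφ b z * Θ.θ a b z)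
    + (4 * B.ξ + B.α z - 4 * B.ξ * B.α z) / B.α z ^ 2 * B.dot2 B.ddφ Θ.θ z)
  - (∑ a, ∑ b, B.gi a b z * B.cov1 (fun c => pd c Θ.ζ) a b z)
  + (B.ξ * B.scal z
    + 2 * B.ξ * (1 + 3 * B.ξ) / B.β z * B.φ z * B.V1 z
    + B.α z / B.β z * B.V2 z
    - 2 * B.κ * (B.κ * B.φ z ^ 2 - 1) * B.nφ z / B.β z ^ 2) * Θ.ζ z
  + 2 * B.κ * B.φ z / B.β z * (∑ a, B.uφ a z * pd a Θ.ζ z)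

/-- The integrand `⟨⟨Θ₁, Θ₂⟩⟩` of the bilinear form on sections. -/
def pairing (Θ₁ Θ₂ : LocalSection) (z : EuclideanSpace ℝ (Fin 4)) : ℝ :=
  4 / B.α z * B.dot2 Θ₁.θ Θ₂.θ z
  + (4 * B.ξ ^ 2 * B.φ z ^ 2 - 2 * B.β z) / (B.β z * B.α z) * B.tr Θ₁.θ z * B.tr Θ₂.θ z
  + 2 * B.ξ * B.φ z / B.β z * (B.tr Θ₁.θ z * Θ₂.ζ z + B.tr Θ₂.θ z * Θ₁.ζ z)
  + B.α z / B.β z * Θ₁.ζ z * Θ₂.ζ z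

/-- The terms of the current `j̄_a(Θ₁, Θ₂)` from which the same terms with `Θ₁` and `Θ₂`
exchanged are to be subtracted. -/
def jhalf (Θ₁ Θ₂ : LocalSection) (a : Fin 4) (z : EuclideanSpace ℝ (Fin 4)) : ℝ :=
  -(4 / B.α z) * (∑ b, ∑ c, ∑ d, ∑ e,
      B.gi b d z * B.gi c e z * Θ₁.θ d e z * B.cov2 Θ₂.θ a b c z)
  + 8 / B.α z * (∑ c, ∑ d, B.gi c d z * Θ₁.θ a d z * B.div2 Θ₂.θ c z)
  - (4 * B.ξ ^ 2 * B.φ z ^ 2 - 2 * B.β z) / (B.β z * B.α z)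
      * B.tr Θ₁.θ z * pd a (B.tr Θ₂.θ) z
  - 2 * B.ξ * B.φ z / B.β z * B.tr Θ₁.θ z * pd a Θ₂.ζ z
  - 2 * B.ξ * B.φ z / B.β z * Θ₁.ζ z * pd a (B.tr Θ₂.θ) z
  - B.α z / B.β z * Θ₁.ζ z * pd a Θ₂.ζ z
  + 2 * B.ξ * (2 - B.α z) / (B.β z * B.α z) * B.tr Θ₁.θ z * B.dφ a z * Θ₂.ζ z
  + 4 / B.α z * Θ₁.ζ z * (∑ b, B.uφ b z * Θ₂.θ a b z)

/-- Components of the current `j̄_a(Θ₁, Θ₂)`. -/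
def current (Θ₁ Θ₂ : LocalSection) (a : Fin 4) (z : EuclideanSpace ℝ (Fin 4)) : ℝ :=
  B.jhalf Θ₁ Θ₂ a z - B.jhalf Θ₂ Θ₁ a z

end LocalBackground

/-! ## Coordinate frames and volume measures on manifolds -/

section Manifolds

variable {n : ℕ} {X : Type*} [TopologicalSpace X] [ChartedSpace (EuclideanSpace ℝ (Fin n)) X]

/-- A field of bilinear forms on the tangent spaces. -/
abbrev FormField (n : ℕ) (X : Type*) [TopologicalSpace X]
    [ChartedSpace (EuclideanSpace ℝ (Fin n)) X] :=
  ∀ x : X, TangentSpace (𝓡 n) x →L[ℝ] TangentSpace (𝓡 n) x →L[ℝ] ℝ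

/-- Smoothness of a field of bilinear forms, as a section of the bundle of bilinear forms. -/
def SmoothForm [IsManifold (𝓡 n) ∞ X] (h : FormField n X) : Prop :=
  ContMDiff (𝓡 n)
    ((𝓡 n).prod 𝓘(ℝ, EuclideanSpace ℝ (Fin n) →L[ℝ] EuclideanSpace ℝ (Fin n) →L[ℝ] ℝ)) ∞
    (fun x => Bundle.TotalSpace.mk'
      (EuclideanSpace ℝ (Fin n) →L[ℝ] EuclideanSpace ℝ (Fin n) →L[ℝ] ℝ)
      (E := fun x => TangentSpace (𝓡 n) x →L[ℝ] TangentSpace (𝓡 n) x →L[ℝ] ℝ) x (h x))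

/-- The coordinate vector `∂_i` of the chart around `x₀`, at the point with coordinates `z`. -/
def frame (x₀ : X) (z : EuclideanSpace ℝ (Fin n)) (i : Fin n) :
    TangentSpace (𝓡 n) ((extChartAt (𝓡 n) x₀).symm z) :=
  mfderiv 𝓘(ℝ, EuclideanSpace ℝ (Fin n)) (𝓡 n) (extChartAt (𝓡 n) x₀).symm z
    (EuclideanSpace.single i 1 : EuclideanSpace ℝ (Fin n))

/-- The coordinate covector `dx^i` at `x` of the chart around `x`. -/
def coframe (x : X) (i : Fin n) : TangentSpace (𝓡 n) x →L[ℝ] ℝ :=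
  (EuclideanSpace.proj i : EuclideanSpace ℝ (Fin n) →L[ℝ] ℝ).comp
    (mfderiv (𝓡 n) 𝓘(ℝ, EuclideanSpace ℝ (Fin n)) (extChartAt (𝓡 n) x) x)

/-- Components of a field of bilinear forms in the chart around `x₀`. -/
def comp (h : FormField n X) (x₀ : X) (i j : Fin n) (z : EuclideanSpace ℝ (Fin n)) : ℝ :=
  h ((extChartAt (𝓡 n) x₀).symm z) (frame x₀ z i) (frame x₀ z j)

open scoped Classical in
/-- The volume measure `√|det h_{ij}| dx¹ ⋯ dxⁿ` of a field of bilinear forms `h` on a second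
countable manifold. The manifold is cut into countably many disjoint Borel pieces, each inside the
domain of a chart; the result does not depend on how this is done. -/
def volMeasure [MeasurableSpace X] (h : FormField n X) : Measure X :=
  if hc : ∃ c : ℕ → X, (⋃ k, (extChartAt (𝓡 n) (c k)).source) = univ then
    Measure.sum fun k =>
      (Measure.map (extChartAt (𝓡 n) (hc.choose k)).symm
        ((volume.restrict (extChartAt (𝓡 n) (hc.choose k)).target).withDensity fun z =>
          ENNReal.ofReal √|(Matrix.of fun i j => comp h (hc.choose k) i j z).det|)).restrict
        (disjointed (fun m => (extChartAt (𝓡 n) (hc.choose m)).source) k)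
  else 0

end Manifolds

/-! ## Lorentzian geometry -/

section Lorentz

variable {M : Type*} [TopologicalSpace M] [ChartedSpace (EuclideanSpace ℝ (Fin 4)) M]
  [IsManifold (𝓡 4) ∞ M]

/-- Smooth Lorentzian metrics of signature `(-,+,+,+)`. -/
structure LorentzMetric (M : Type*) [TopologicalSpace M]
    [ChartedSpace (EuclideanSpace ℝ (Fin 4)) M] [IsManifold (𝓡 4) ∞ M] where
  val : FormField 4 M
  smooth : SmoothForm val
  symm : ∀ x v w, val x v w = val x w v
  lorentz : ∀ x, ∃ u : TangentSpace (𝓡 4) x, val x u u < 0 ∧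
    ∀ v : TangentSpace (𝓡 4) x, v ≠ 0 → val x u v = 0 → 0 < val x v v

/-- A time orientation, given by a smooth timelike vector field, which is declared to be future
directed. -/
structure TimeOrientation (g : LorentzMetric M) where
  vec : ∀ x : M, TangentSpace (𝓡 4) x
  smooth : ContMDiff (𝓡 4) ((𝓡 4).prod 𝓘(ℝ, EuclideanSpace ℝ (Fin 4))) ∞
    (fun x => (⟨x, vec x⟩ : TangentBundle (𝓡 4) M))
  timelike : ∀ x, g.val x (vec x) (vec x) < 0

variable (g : LorentzMetric M) (τ : TimeOrientation g)

def FutureTimelike (x : M) (v : TangentSpace (𝓡 4) x) : Prop :=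
  g.val x v v < 0 ∧ g.val x v (τ.vec x) < 0

def FutureCausal (x : M) (v : TangentSpace (𝓡 4) x) : Prop :=
  g.val x v v ≤ 0 ∧ g.val x v (τ.vec x) < 0

/-- `γ` is continuously differentiable on `[a, b]` with all velocities in the class `C`. -/
def ArcOn (C : ∀ x : M, TangentSpace (𝓡 4) x → Prop) (γ : ℝ → M) (a b : ℝ) : Prop :=
  ContMDiffOn 𝓘(ℝ, ℝ) (𝓡 4) 1 γ (Icc a b) ∧
    ∀ r ∈ Icc a b, C (γ r) (mfderivWithin 𝓘(ℝ, ℝ) (𝓡 4) γ (Icc a b) r (1 : ℝ))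

/-- `γ` is a piecewise continuously differentiable curve on the interval `s` whose (one-sided)
velocities are all in the class `C`: every `t` in `s` is the end point of such arcs to its right
and to its left, as far as `s` extends. -/
def CurveOn (C : ∀ x : M, TangentSpace (𝓡 4) x → Prop) (γ : ℝ → M) (s : Set ℝ) : Prop :=
  ∀ t ∈ s, ((∃ u ∈ s, t < u) → ∃ u ∈ s, t < u ∧ ArcOn C γ t u) ∧
    ((∃ u ∈ s, u < t) → ∃ u ∈ s, u < t ∧ ArcOn C γ u t)

/-- The causal future `J⁺(A)`. -/
def JPlus (A : Set M) : Set M :=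
  A ∪ {q | ∃ γ : ℝ → M, CurveOn (FutureCausal g τ) γ (Icc 0 1) ∧ γ 0 ∈ A ∧ γ 1 = q}

/-- The causal past `J⁻(A)`. -/
def JMinus (A : Set M) : Set M :=
  A ∪ {q | ∃ γ : ℝ → M, CurveOn (FutureCausal g τ) γ (Icc 0 1) ∧ γ 0 = q ∧ γ 1 ∈ A}

/-- Strong causality together with compactness of all causal diamonds. -/
def GloballyHyperbolic : Prop :=
  (∀ (p : M) (U : Set M), IsOpen U → p ∈ U → ∃ W ⊆ U, IsOpen W ∧ p ∈ W ∧
    ∀ γ : ℝ → M, CurveOn (FutureCausal g τ) γ (Icc 0 1) → γ 0 ∈ W → γ 1 ∈ W →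
      ∀ t ∈ Icc (0 : ℝ) 1, γ t ∈ U) ∧
  ∀ p q : M, IsCompact (JPlus g τ {p} ∩ JMinus g τ {q})

/-- A future directed timelike curve without end points. The parameter interval of such a curve is
open, and is taken to be `ℝ`. -/
def InextendibleTimelike (γ : ℝ → M) : Prop :=
  CurveOn (FutureTimelike g τ) γ univ ∧
    (¬ ∃ p, Tendsto γ atTop (𝓝 p)) ∧ ¬ ∃ p, Tendsto γ atBot (𝓝 p)

/-- A Cauchy surface is met exactly once by every inextendible timelike curve. -/
def IsCauchy (A : Set M) : Prop :=
  ∀ γ : ℝ → M, InextendibleTimelike g τ γ → ∃! t, γ t ∈ A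

/-- A set is space-like compact if its intersection with every Cauchy surface is compact. -/
def SpacelikeCompact (A : Set M) : Prop :=
  ∀ C : Set M, IsCauchy g τ C → IsCompact (A ∩ C)

/-- The bilinear forms induced by `g` on the tangent spaces of a hypersurface `ι : S → M`. -/
def pullback {S : Type*} [TopologicalSpace S] [ChartedSpace (EuclideanSpace ℝ (Fin 3)) S]
    (ι : S → M) : FormField 3 S := fun s =>
  (ContinuousLinearMap.precomp ℝ (mfderiv (𝓡 3) (𝓡 4) ι s)).comp
    ((g.val (ι s)).comp (mfderiv (𝓡 3) (𝓡 4) ι s))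

/-- `ι : S → M` is the inclusion of a smooth, embedded, space-like Cauchy surface. -/
def IsSmoothCauchy {S : Type*} [TopologicalSpace S] [ChartedSpace (EuclideanSpace ℝ (Fin 3)) S]
    (ι : S → M) : Prop :=
  Manifold.IsSmoothEmbedding (𝓡 3) (𝓡 4) ∞ ι ∧ IsCauchy g τ (range ι) ∧
    ∀ (s : S) (v : TangentSpace (𝓡 3) s), v ≠ 0 → 0 < pullback g ι s v v

/-- `ν` is the future directed unit normal vector field of the hypersurface `ι : S → M`. -/
def IsFutureUnitNormal {S : Type*} [TopologicalSpace S]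
    [ChartedSpace (EuclideanSpace ℝ (Fin 3)) S] (ι : S → M)
    (ν : ∀ s : S, TangentSpace (𝓡 4) (ι s)) : Prop :=
  ∀ s, g.val (ι s) (ν s) (ν s) = -1 ∧ FutureTimelike g τ (ι s) (ν s) ∧
    ∀ v : TangentSpace (𝓡 3) s, g.val (ι s) (ν s) (mfderiv (𝓡 3) (𝓡 4) ι s v) = 0

end Lorentz

/-! ## The linearised Einstein-Klein-Gordon system -/

section Fields

variable {M : Type*} [TopologicalSpace M] [ChartedSpace (EuclideanSpace ℝ (Fin 4)) M]
  [IsManifold (𝓡 4) ∞ M]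

/-- A pair `(θ, ζ)` of a field of bilinear forms and a function on `M`. -/
structure FieldPair (M : Type*) [TopologicalSpace M]
    [ChartedSpace (EuclideanSpace ℝ (Fin 4)) M] where
  θ : FormField 4 M
  ζ : M → ℝ

/-- The pair is a smooth section of `⋁² T*M ⊕ (M × ℝ)`. -/
def IsSection (Θ : FieldPair M) : Prop :=
  (∀ x v w, Θ.θ x v w = Θ.θ x w v) ∧ SmoothForm Θ.θ ∧ ContMDiff (𝓡 4) 𝓘(ℝ, ℝ) ∞ Θ.ζ

/-- The support of a section. -/
def supp (Θ : FieldPair M) : Set M := closure {x | Θ.θ x ≠ 0 ∨ Θ.ζ x ≠ 0}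

/-- The coordinate expression of a pair `(θ, ζ)` in the chart around `x₀`. -/
def localSection (Θ : FieldPair M) (x₀ : M) : LocalSection where
  θ := comp Θ.θ x₀
  ζ := Θ.ζ ∘ (extChartAt (𝓡 4) x₀).symm

/-- Components of a covector field in the chart around `x₀`. -/
def comp1 (j : ∀ x : M, TangentSpace (𝓡 4) x →L[ℝ] ℝ) (x₀ : M) (a : Fin 4)
    (z : EuclideanSpace ℝ (Fin 4)) : ℝ :=
  j ((extChartAt (𝓡 4) x₀).symm z) (frame x₀ z a)

/-- A background `(g, φ)` with coupling constant `ξ` and potential `V`. -/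
structure Background (M : Type*) [TopologicalSpace M]
    [ChartedSpace (EuclideanSpace ℝ (Fin 4)) M] [IsManifold (𝓡 4) ∞ M] where
  g : LorentzMetric M
  φ : M → ℝ
  φ_smooth : ContMDiff (𝓡 4) 𝓘(ℝ, ℝ) ∞ φ
  ξ : ℝ
  V : ℝ → ℝ
  V_smooth : ∀ x, ContDiffAt ℝ ∞ V (φ x)

namespace Background

variable (b : Background M)

/-- The coordinate expression of the background in the chart around `x₀`. -/
def loc (x₀ : M) : LocalBackground where
  G := comp b.g.val x₀
  φ := b.φ ∘ (extChartAt (𝓡 4) x₀).symm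
  ξ := b.ξ
  V := b.V

/-- The background solves the Einstein-Klein-Gordon equations. -/
def OnShell : Prop := ∀ x, (b.loc x).EKGAt (extChartAt (𝓡 4) x x)

/-- `1 - ξ φ²` and `1 + (6 ξ - 1) ξ φ²` vanish nowhere. -/
def NonDegenerate : Prop :=
  ∀ x, 1 - b.ξ * b.φ x ^ 2 ≠ 0 ∧ 1 + (6 * b.ξ - 1) * b.ξ * b.φ x ^ 2 ≠ 0

/-- The operator `P̄`. -/
def Pbar (Θ : FieldPair M) : FieldPair M where
  θ x := ∑ i, ∑ j, (b.loc x).PbarTensor (localSection Θ x) i j (extChartAt (𝓡 4) x x) •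
    (coframe x i).smulRight (coframe x j)
  ζ x := (b.loc x).PbarScalar (localSection Θ x) (extChartAt (𝓡 4) x x)

/-- The integrand `⟨⟨Θ₁, Θ₂⟩⟩`, a function on `M`. -/
def pairing (Θ₁ Θ₂ : FieldPair M) (x : M) : ℝ :=
  (b.loc x).pairing (localSection Θ₁ x) (localSection Θ₂ x) (extChartAt (𝓡 4) x x)

/-- The current `j̄(Θ₁, Θ₂)`, a covector field on `M`. -/
def current (Θ₁ Θ₂ : FieldPair M) (x : M) : TangentSpace (𝓡 4) x →L[ℝ] ℝ :=
  ∑ a, (b.loc x).current (localSection Θ₁ x) (localSection Θ₂ x) a (extChartAt (𝓡 4) x x) •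
    coframe x a

/-- The covariant divergence `∇^a j_a` of a covector field. -/
def divergence (j : ∀ x : M, TangentSpace (𝓡 4) x →L[ℝ] ℝ) (x : M) : ℝ :=
  (b.loc x).div1 (comp1 j x) (extChartAt (𝓡 4) x x)

/-- The space of smooth solutions of `P̄ Θ = 0`. -/
def Sol : Set (FieldPair M) :=
  {Θ | IsSection Θ ∧ ∀ x, (b.Pbar Θ).θ x = 0 ∧ (b.Pbar Θ).ζ x = 0}

/-- `Θp` is a future part of `Θ`: a section that coincides with `Θ` in the future of some Cauchy
surface and vanishes in the past of some Cauchy surface. -/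
def IsFuturePart (τ : TimeOrientation b.g) (Θ Θp : FieldPair M) : Prop :=
  IsSection Θp ∧ ∃ Cp Cm : Set M, IsCauchy b.g τ Cp ∧ IsCauchy b.g τ Cm ∧
    (∀ x ∈ JPlus b.g τ Cp, Θp.θ x = Θ.θ x ∧ Θp.ζ x = Θ.ζ x) ∧
    ∀ x ∈ JMinus b.g τ Cm, Θp.θ x = 0 ∧ Θp.ζ x = 0

end Background

end Fields

end LinEKG

end

open LinEKG

/-! The first assertion is a pointwise identity. In a chart one half of the current is a sum of
functions of φ times covector fields, so its divergence follows from the Leibniz rule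
(`div1_jhalf`), and the contractions of P̄ occurring in the pairing are expanded into the same
scalar quantities (`tr_PbarTensor`, `dot2_PbarTensor`, `PbarScalar_eq`). Curvature matters in two
places only. The commutator term s^{ab}(∇^c∇_a − ∇_a∇^c)t_{bc} is symmetric in s and t; rather than
computing with the Riemann tensor, `commutator_antisymm` reads this off the vanishing double
divergence of the antisymmetric tensor s_a^b t_{cb} − s_c^b t_{ab}. The scalar curvature and the
wave operator applied to φ are eliminated by the Klein-Gordon equation and the trace of the Einstein
equations, which combine to βR = 4V − 6ξφV' − (6ξ−1)(∇φ)². What is left is an identity of rational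
functions (`div1_current`). On M the current is defined at each point through the chart centred
there; `comp1_current` shows that in any fixed chart its components are still given by the local
formula. The current contains first derivatives only, so the transformation laws of ∇ on covectors
and on tensors of rank two suffice.

For the second assertion let J and J⁺ be the currents of (Θ₁, Θ₂) and (Θ₁⁺, Θ₂). By the first
assertion div J = 0 and div J⁺ = −⟨⟨P̄Θ₁⁺, Θ₂⟩⟩. Let I be the chronological future of Σ. On I the
field J⁺ − J has the same divergence as J⁺ and vanishes to the future of Σ⁺; off I the field J⁺
itself vanishes to the past of Σ⁻. Once the remaining supports are known to be compact, the
divergence theorem on I and on M gives ∫ div J⁺ = ∫_Σ (J⁺ − J)(n) − ∫_Σ J⁺(n) = −∫_Σ J(n), which is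
the claim (`integral_pairing_Pbar`).

Compactness is `isCompact_slab`. A sequence between two Cauchy sets has a subsequence that is
chronologically increasing, decreasing, or pairwise unrelated. A monotone one converges, since
otherwise it would extend to an inextendible timelike curve that crosses the Cauchy set in question.
A pairwise unrelated one lies on a single new Cauchy set, the frontier of an open future set, and
there the hypothesis of space-like compactness applies. The argument uses only the abstract
properties collected in `Chronology`; for the spacetime they follow from the local fact
`exists_cone` that coordinate segments close to a timelike direction are timelike.

The divergence theorem `integral_divergence_future` is localised by a partition of unity. Near Σ,
coordinates are built by moving Σ along the time orientation (`exists_collar`); there the future of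
Σ is a half space, and √|det g| times the divergence is a sum of partial derivatives
(`dens_mul_div1`). The boundary term is identified with the flux along the unit normal by the linear
algebra of `normal_flux`. -/

noncomputable section

namespace LinEKG

open Set Filter Topology MeasureTheory
open scoped Manifold ContDiff

/-! ## Partial derivatives -/

section PartialDerivatives

variable {U : Set (EuclideanSpace ℝ (Fin 4))} {z : EuclideanSpace ℝ (Fin 4)}
  {f g : EuclideanSpace ℝ (Fin 4) → ℝ} {i j : Fin 4}

theorem pd_congr (h : f =ᶠ[𝓝 z] g) : pd i f z = pd i g z := by
  unfold pd; rw [h.fderiv_eq]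

theorem pd_add (hf : DifferentiableAt ℝ f z) (hg : DifferentiableAt ℝ g z) :
    pd i (fun w => f w + g w) z = pd i f z + pd i g z := by
  unfold pd; rw [fderiv_fun_add hf hg]; rfl

theorem pd_sub (hf : DifferentiableAt ℝ f z) (hg : DifferentiableAt ℝ g z) :
    pd i (fun w => f w - g w) z = pd i f z - pd i g z := by
  unfold pd; rw [fderiv_fun_sub hf hg]; rfl

theorem pd_neg : pd i (fun w => -f w) z = -pd i f z := by
  unfold pd; rw [fderiv_fun_neg]; rfl

theorem pd_mul (hf : DifferentiableAt ℝ f z) (hg : DifferentiableAt ℝ g z) :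
    pd i (fun w => f w * g w) z = pd i f z * g z + f z * pd i g z := by
  unfold pd; rw [fderiv_fun_mul hf hg]
  simp only [_root_.add_apply, _root_.smul_apply, smul_eq_mul]; ring

theorem pd_const (c : ℝ) : pd i (fun _ => c) z = 0 := by
  unfold pd; simp

theorem pd_sum {ι : Type*} (s : Finset ι) {F : ι → EuclideanSpace ℝ (Fin 4) → ℝ}
    (hF : ∀ k ∈ s, DifferentiableAt ℝ (F k) z) :
    pd i (fun w => ∑ k ∈ s, F k w) z = ∑ k ∈ s, pd i (F k) z := by
  unfold pd; rw [fderiv_fun_sum hF]; simp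

theorem pd_comp_real {h : ℝ → ℝ} {h' : ℝ} (hh : HasDerivAt h h' (f z))
    (hf : DifferentiableAt ℝ f z) : pd i (fun w => h (f w)) z = h' * pd i f z := by
  unfold pd
  have := (hh.comp_hasFDerivAt z hf.hasFDerivAt).fderiv
  rw [show (fun w => h (f w)) = h ∘ f from rfl, this]; simp

theorem _root_.ContDiffOn.diffAt (hf : ContDiffOn ℝ ∞ f U) (hU : IsOpen U) (hz : z ∈ U) :
    DifferentiableAt ℝ f z :=
  ((hf z hz).contDiffAt (hU.mem_nhds hz)).differentiableAt (by simp)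

theorem _root_.ContDiffOn.pd (hf : ContDiffOn ℝ ∞ f U) (hU : IsOpen U) (i : Fin 4) :
    ContDiffOn ℝ ∞ (pd i f) U := by
  have h : ContDiffOn ℝ ∞ (fderiv ℝ f) U := hf.fderiv_of_isOpen hU (by simp)
  exact h.clm_apply contDiffOn_const

theorem pd_pd_comm (hf : ContDiffOn ℝ ∞ f U) (hU : IsOpen U) (hz : z ∈ U) :
    pd i (pd j f) z = pd j (pd i f) z := by
  have hc : ContDiffAt ℝ ∞ f z := (hf z hz).contDiffAt (hU.mem_nhds hz)
  have hs : IsSymmSndFDerivAt ℝ f z := hc.isSymmSndFDerivAt (by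
    rw [minSmoothness_of_isRCLikeNormedField]; exact WithTop.coe_le_coe.2 (le_top : (2 : ℕ∞) ≤ ⊤))
  have hd : DifferentiableAt ℝ (fderiv ℝ f) z :=
    (hc.fderiv_right (m := ∞) (by simp)).differentiableAt (by simp)
  unfold LinEKG.pd
  rw [fderiv_clm_apply hd (differentiableAt_const _), fderiv_clm_apply hd (differentiableAt_const _)]
  simpa using hs (EuclideanSpace.single i 1) (EuclideanSpace.single j 1)

theorem contDiffOn_det {n : ℕ} {E : Type*} [NormedAddCommGroup E] [NormedSpace ℝ E] {U : Set E}
    {k : ℕ∞ω} {A : Fin n → Fin n → E → ℝ} (hA : ∀ i j, ContDiffOn ℝ k (A i j) U) :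
    ContDiffOn ℝ k (fun w => (Matrix.of fun i j => A i j w).det) U := by
  simp only [Matrix.det_apply, Matrix.of_apply]
  refine ContDiffOn.sum fun σ _ => ContDiffOn.const_smul _ (contDiffOn_prod fun i _ => hA _ _)

/-- By Cramer's rule an entry of the inverse is a quotient of two determinants, the numerator being
that of the matrix with one row replaced by a unit vector. Both are polynomials in the smooth
entries. -/
theorem contDiffOn_inv_entry {n : ℕ} {E : Type*} [NormedAddCommGroup E] [NormedSpace ℝ E]
    {U : Set E} {k : ℕ∞ω} {A : Fin n → Fin n → E → ℝ} (hA : ∀ i j, ContDiffOn ℝ k (A i j) U)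
    (hdet : ∀ w ∈ U, (Matrix.of fun i j => A i j w).det ≠ 0) (i j : Fin n) :
    ContDiffOn ℝ k (fun w => (Matrix.of fun i j => A i j w)⁻¹ i j) U := by
  have h : ∀ w, (Matrix.of fun i j => A i j w)⁻¹ i j =
      (Matrix.of fun i j => A i j w).det⁻¹ *
        (Matrix.of fun i' j' => (if i' = j then Pi.single i (1 : ℝ) j' else A i' j' w)).det := by
    intro w
    rw [Matrix.inv_def]
    simp only [Matrix.smul_apply, Ring.inverse_eq_inv', smul_eq_mul, Matrix.adjugate_apply]
    congr 2
    ext i' j'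
    by_cases h : i' = j
    · subst h; simp
    · simp [h]
  simp only [h]
  refine ((contDiffOn_det hA).inv hdet).mul (contDiffOn_det fun i' j' => ?_)
  by_cases h : i' = j
  · simp only [h, if_true]; exact contDiffOn_const
  · simp only [h, if_false]; exact hA _ _

/-- Jacobi's formula. -/
theorem pd_det {A : Fin 4 → Fin 4 → EuclideanSpace ℝ (Fin 4) → ℝ}
    (hA : ∀ i j, DifferentiableAt ℝ (A i j) z) (a : Fin 4) :
    pd a (fun w => (Matrix.of fun i j => A i j w).det) z =
      ∑ i, ∑ j, (Matrix.of fun i j => A i j z).adjugate i j * pd a (A j i) z := by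
  -- Leibniz rule on the expansion over permutations: the inner sum differentiates one factor at a
  -- time.
  have key : pd a (fun w => (Matrix.of fun i j => A i j w).det) z =
      ∑ σ : Equiv.Perm (Fin 4), (Equiv.Perm.sign σ : ℝ) *
        ∑ i, (∏ j ∈ Finset.univ.erase i, A (σ j) j z) * pd a (A (σ i) i) z := by
    simp only [Matrix.det_apply', Matrix.of_apply]
    unfold pd
    have : HasFDerivAt (fun w => ∑ σ : Equiv.Perm (Fin 4),
        ((Equiv.Perm.sign σ : ℤ) : ℝ) * ∏ i, A (σ i) i w)
        (∑ σ : Equiv.Perm (Fin 4), ((Equiv.Perm.sign σ : ℤ) : ℝ) •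
          ∑ i, (∏ j ∈ Finset.univ.erase i, A (σ j) j z) • fderiv ℝ (A (σ i) i) z) z := by
      refine HasFDerivAt.fun_sum fun σ _ => HasFDerivAt.const_mul ?_ _
      exact HasFDerivAt.finsetProd fun i _ => (hA (σ i) i).hasFDerivAt
    rw [this.fderiv]
    simp
  rw [key]
  -- Cramer's rule in reverse: a row of the adjugate times the column of derivatives is the
  -- determinant with column `i` replaced by those derivatives.
  have h2 : ∀ i, ∑ j, (Matrix.of fun i j => A i j z).adjugate i j * pd a (A j i) z =
      ((Matrix.of fun i j => A i j z).updateCol i (fun j => pd a (A j i) z)).det := by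
    intro i
    rw [← Matrix.cramer_apply, Matrix.cramer_eq_adjugate_mulVec]; rfl
  simp only [h2, Matrix.det_apply']
  rw [Finset.sum_comm]
  refine Finset.sum_congr rfl fun σ _ => ?_
  rw [Finset.mul_sum]
  refine Finset.sum_congr rfl fun i _ => ?_
  congr 1
  rw [← Finset.mul_prod_erase Finset.univ _ (Finset.mem_univ i), mul_comm]
  congr 1
  · simp
  · refine Finset.prod_congr rfl fun j hj => ?_
    simp [Matrix.updateCol_ne (Finset.ne_of_mem_erase hj)]

end PartialDerivatives

/-! ## Regular local backgrounds and the Levi-Civita connection -/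

namespace LocalBackground

/-- The metric is smooth, symmetric and nondegenerate on the open set `U`. -/
structure RegularMetric (B : LocalBackground) (U : Set (EuclideanSpace ℝ (Fin 4))) : Prop where
  isOpen : IsOpen U
  smooth : ∀ i j, ContDiffOn ℝ ∞ (B.G i j) U
  symm : ∀ z ∈ U, ∀ i j, B.G i j z = B.G j i z
  det_ne : ∀ z ∈ U, (Matrix.of fun k l => B.G k l z).det ≠ 0

/-- Contraction of two covariant tensors of rank two with two contravariant ones. -/
def quad (X Y s t : Matrix (Fin 4) (Fin 4) ℝ) : ℝ :=
  ∑ a, ∑ b, ∑ c, ∑ d, X a c * Y b d * s a b * t c d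

/-- As a trace of a matrix product, the contraction can be rearranged by noncommutative algebra and
cyclicity instead of by renaming summation indices. -/
theorem quad_eq_trace (X Y s t : Matrix (Fin 4) (Fin 4) ℝ) :
    quad X Y s t = (s.transpose * X * t * Y.transpose).trace := by
  simp only [quad, Matrix.trace, Matrix.diag_apply, Matrix.mul_apply, Matrix.transpose_apply,
    Finset.sum_mul]
  rw [Finset.sum_comm]
  refine Finset.sum_congr rfl fun b _ => ?_
  rw [Finset.sum_comm' (s := Finset.univ) (t := fun _ => Finset.univ) (t' := Finset.univ)
    (s' := fun _ => Finset.univ) (by simp)]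
  rw [Finset.sum_congr rfl fun c _ => Finset.sum_comm]
  rw [Finset.sum_comm]
  refine Finset.sum_congr rfl fun d _ => Finset.sum_congr rfl fun c _ =>
    Finset.sum_congr rfl fun a _ => by ring

namespace RegularMetric

variable {B : LocalBackground} {U : Set (EuclideanSpace ℝ (Fin 4))} (h : B.RegularMetric U)
  {z : EuclideanSpace ℝ (Fin 4)} (hz : z ∈ U)
include h

theorem contDiffOn_gi (i j : Fin 4) : ContDiffOn ℝ ∞ (B.gi i j) U :=
  contDiffOn_inv_entry h.smooth h.det_ne i j

theorem contDiffOn_chr (k i j : Fin 4) : ContDiffOn ℝ ∞ (B.chr k i j) U := by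
  unfold chr
  refine contDiffOn_const.mul (ContDiffOn.sum fun l _ => (h.contDiffOn_gi k l).mul ?_)
  exact (((h.smooth _ _).pd h.isOpen _).add ((h.smooth _ _).pd h.isOpen _)).sub
    ((h.smooth _ _).pd h.isOpen _)

theorem contDiffOn_cov1 {w : Fin 4 → EuclideanSpace ℝ (Fin 4) → ℝ}
    (hw : ∀ i, ContDiffOn ℝ ∞ (w i) U) (a b : Fin 4) : ContDiffOn ℝ ∞ (B.cov1 w a b) U :=
  ((hw _).pd h.isOpen _).sub (ContDiffOn.sum fun _ _ => (h.contDiffOn_chr _ _ _).mul (hw _))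

theorem contDiffOn_cov2 {t : Fin 4 → Fin 4 → EuclideanSpace ℝ (Fin 4) → ℝ}
    (ht : ∀ i j, ContDiffOn ℝ ∞ (t i j) U) (a b c : Fin 4) :
    ContDiffOn ℝ ∞ (B.cov2 t a b c) U :=
  (((ht _ _).pd h.isOpen _).sub (ContDiffOn.sum fun _ _ =>
    (h.contDiffOn_chr _ _ _).mul (ht _ _))).sub (ContDiffOn.sum fun _ _ =>
    (h.contDiffOn_chr _ _ _).mul (ht _ _))

theorem contDiffOn_tr {t : Fin 4 → Fin 4 → EuclideanSpace ℝ (Fin 4) → ℝ}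
    (ht : ∀ i j, ContDiffOn ℝ ∞ (t i j) U) : ContDiffOn ℝ ∞ (B.tr t) U :=
  ContDiffOn.sum fun a _ => ContDiffOn.sum fun b _ => (h.contDiffOn_gi a b).mul (ht a b)

theorem contDiffOn_dot2 {s t : Fin 4 → Fin 4 → EuclideanSpace ℝ (Fin 4) → ℝ}
    (hs : ∀ i j, ContDiffOn ℝ ∞ (s i j) U) (ht : ∀ i j, ContDiffOn ℝ ∞ (t i j) U) :
    ContDiffOn ℝ ∞ (B.dot2 s t) U :=
  ContDiffOn.sum fun a _ => ContDiffOn.sum fun b _ => ContDiffOn.sum fun c _ =>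
    ContDiffOn.sum fun d _ => (((h.contDiffOn_gi a c).mul (h.contDiffOn_gi b d)).mul
      (hs a b)).mul (ht c d)

theorem contDiffOn_div2 {t : Fin 4 → Fin 4 → EuclideanSpace ℝ (Fin 4) → ℝ}
    (ht : ∀ i j, ContDiffOn ℝ ∞ (t i j) U) (b : Fin 4) : ContDiffOn ℝ ∞ (B.div2 t b) U :=
  ContDiffOn.sum fun c _ => ContDiffOn.sum fun d _ =>
    (h.contDiffOn_gi c d).mul (h.contDiffOn_cov2 ht _ _ _)

include hz

theorem mat_symm : (Matrix.of fun k l => B.G k l z).transpose = Matrix.of fun k l => B.G k l z := by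
  ext i j; simpa using h.symm z hz j i

theorem gi_symm (i j : Fin 4) : B.gi i j z = B.gi j i z := by
  unfold gi
  rw [← Matrix.transpose_apply (Matrix.of fun k l => B.G k l z)⁻¹, Matrix.transpose_nonsing_inv,
    h.mat_symm hz]

theorem inv_mul_mat :
    (Matrix.of fun k l => B.gi k l z) * (Matrix.of fun k l => B.G k l z) = 1 :=
  Matrix.nonsing_inv_mul _ (isUnit_iff_ne_zero.2 (h.det_ne z hz))

theorem mat_mul_inv :
    (Matrix.of fun k l => B.G k l z) * (Matrix.of fun k l => B.gi k l z) = 1 :=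
  Matrix.mul_nonsing_inv _ (isUnit_iff_ne_zero.2 (h.det_ne z hz))

theorem gi_mul_G (a c : Fin 4) :
    ∑ b, B.gi a b z * B.G b c z = if a = c then 1 else 0 := by
  have := congrFun₂ (h.inv_mul_mat hz) a c
  simpa [Matrix.mul_apply, Matrix.one_apply] using this

theorem G_mul_gi (a c : Fin 4) :
    ∑ b, B.G a b z * B.gi b c z = if a = c then 1 else 0 := by
  have := congrFun₂ (h.mat_mul_inv hz) a c
  simpa [Matrix.mul_apply, Matrix.one_apply] using this

theorem pd_G_symm (a i j : Fin 4) : pd a (B.G i j) z = pd a (B.G j i) z := by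
  refine pd_congr ?_
  filter_upwards [h.isOpen.mem_nhds hz] with w hw using h.symm w hw i j

theorem chr_symm (k i j : Fin 4) : B.chr k i j z = B.chr k j i z := by
  unfold chr
  congr 1
  refine Finset.sum_congr rfl fun l _ => ?_
  rw [h.pd_G_symm hz l i j]; ring

/-- Lowering the index removes the inverse metric and leaves the Christoffel symbols of the first
kind, which are linear in the derivatives of the metric. Metric compatibility and the transformation
law are both checked in this form. -/
theorem lower_chr (m i j : Fin 4) :
    ∑ k, B.G m k z * B.chr k i j z =
      1 / 2 * (pd i (B.G j m) z + pd j (B.G i m) z - pd m (B.G i j) z) := by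
  have : ∀ k, B.G m k z * B.chr k i j z = ∑ l, B.G m k z * B.gi k l z *
      (1 / 2 * (pd i (B.G j l) z + pd j (B.G i l) z - pd l (B.G i j) z)) := by
    intro k
    simp only [chr, Finset.mul_sum]
    exact Finset.sum_congr rfl fun l _ => by ring
  simp only [this]
  rw [Finset.sum_comm]
  simp only [← Finset.sum_mul, h.G_mul_gi hz, ite_mul, one_mul, zero_mul, Finset.sum_ite_eq,
    Finset.mem_univ, if_true]

/-- Metric compatibility. In the sum of the two symbols of the first kind all derivatives other than
that of the component `b c` in direction `a` cancel by symmetry of the metric. -/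
theorem pd_G (a b c : Fin 4) : pd a (B.G b c) z =
    ∑ l, B.chr l a b z * B.G l c z + ∑ l, B.G b l z * B.chr l a c z := by
  have h1 : ∑ l, B.chr l a b z * B.G l c z = ∑ l, B.G c l z * B.chr l a b z :=
    Finset.sum_congr rfl fun l _ => by rw [h.symm z hz l c]; ring
  rw [h1, h.lower_chr hz, h.lower_chr hz]
  linarith [h.pd_G_symm hz a c b, h.pd_G_symm hz c a b, h.pd_G_symm hz b c a]

/-- With `C` the matrix of Christoffel symbols in direction `a`, compatibility reads dG = CᵀG + GC.
Differentiating HG = 1 and multiplying by H on the right gives dH = −HCᵀ − CH. -/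
theorem pd_gi_mat (a : Fin 4) :
    (Matrix.of fun b c => pd a (B.gi b c) z) =
      - (Matrix.of fun b c => B.gi b c z) * (Matrix.of fun l b => B.chr l a b z).transpose
      - (Matrix.of fun l b => B.chr l a b z) * (Matrix.of fun b c => B.gi b c z) := by
  set H := Matrix.of fun b c => B.gi b c z with hH
  set G := Matrix.of fun b c => B.G b c z with hG
  set C := Matrix.of fun l b => B.chr l a b z with hC
  set dG := Matrix.of fun b c => pd a (B.G b c) z with hdG
  set dH := Matrix.of fun b c => pd a (B.gi b c) z with hdH
  have e1 : dG = C.transpose * G + G * C := by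
    ext b c
    simp only [hdG, hC, hG, Matrix.of_apply, Matrix.add_apply, Matrix.mul_apply,
      Matrix.transpose_apply]
    exact h.pd_G hz a b c
  have e2 : dH * G + H * dG = 0 := by
    ext b c
    have : pd a (fun w => ∑ k, B.gi b k w * B.G k c w) z = 0 := by
      rw [pd_congr (g := fun _ => if b = c then 1 else 0), pd_const]
      filter_upwards [h.isOpen.mem_nhds hz] with w hw using h.gi_mul_G hw b c
    rw [pd_sum] at this
    · simp only [hdG, hdH, hH, hG, Matrix.of_apply, Matrix.add_apply, Matrix.mul_apply,
        Matrix.zero_apply, ← Finset.sum_add_distrib]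
      rw [← this]
      refine Finset.sum_congr rfl fun k _ => ?_
      rw [pd_mul ((h.contDiffOn_gi b k).diffAt h.isOpen hz) ((h.smooth k c).diffAt h.isOpen hz)]
    · intro k _
      exact ((h.contDiffOn_gi b k).diffAt h.isOpen hz).mul ((h.smooth k c).diffAt h.isOpen hz)
  have e3 : G * H = 1 := h.mat_mul_inv hz
  have e4 : H * G = 1 := h.inv_mul_mat hz
  have e5 : dH = dH * G * H := by rw [mul_assoc, e3, mul_one]
  have e6 : dH * G = -(H * dG) := eq_neg_of_add_eq_zero_left e2
  rw [e5, e6, e1]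
  calc -(H * (C.transpose * G + G * C)) * H
      = -(H * C.transpose * (G * H)) - (H * G) * C * H := by noncomm_ring
    _ = _ := by rw [e3, e4]; noncomm_ring

/-- The Leibniz rule for a full contraction. Replacing partial by covariant derivatives of all four
factors produces Christoffel terms whose total is the trace of a commutator. -/
theorem pd_dot2 {s t : Fin 4 → Fin 4 → EuclideanSpace ℝ (Fin 4) → ℝ}
    (hs : ∀ i j, ContDiffOn ℝ ∞ (s i j) U) (ht : ∀ i j, ContDiffOn ℝ ∞ (t i j) U) (a : Fin 4) :
    pd a (B.dot2 s t) z = B.dot2 (B.cov2 s a) t z + B.dot2 s (B.cov2 t a) z := by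
  have dg := fun i j => (h.contDiffOn_gi i j).diffAt h.isOpen hz
  have ds := fun i j => (hs i j).diffAt h.isOpen hz
  have dt := fun i j => (ht i j).diffAt h.isOpen hz
  set H := Matrix.of fun b c => B.gi b c z with hH
  set C := Matrix.of fun l b => B.chr l a b z with hC
  set dH := Matrix.of fun b c => pd a (B.gi b c) z with hdH
  set S := Matrix.of fun b c => s b c z with hS
  set T := Matrix.of fun b c => t b c z with hT
  set dS := Matrix.of fun b c => B.cov2 s a b c z with hdS
  set dT := Matrix.of fun b c => B.cov2 t a b c z with hdT
  have es : (Matrix.of fun b c => pd a (s b c) z) = dS + C.transpose * S + S * C := by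
    ext b c
    simp only [hdS, hC, hS, Matrix.of_apply, Matrix.add_apply, Matrix.mul_apply,
      Matrix.transpose_apply, cov2, mul_comm (s _ _ z)]
    ring
  have et : (Matrix.of fun b c => pd a (t b c) z) = dT + C.transpose * T + T * C := by
    ext b c
    simp only [hdT, hC, hT, Matrix.of_apply, Matrix.add_apply, Matrix.mul_apply,
      Matrix.transpose_apply, cov2, mul_comm (t _ _ z)]
    ring
  have key : pd a (B.dot2 s t) z = quad dH H S T + quad H dH S T +
      quad H H (Matrix.of fun b c => pd a (s b c) z) T +
      quad H H S (Matrix.of fun b c => pd a (t b c) z) := by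
    have e : B.dot2 s t = fun w => ∑ a, ∑ b, ∑ c, ∑ d, B.gi a c w * B.gi b d w * s a b w * t c d w :=
      rfl
    rw [e]
    simp only [quad, ← Finset.sum_add_distrib]
    rw [pd_sum _ (by intros; fun_prop)]
    refine Finset.sum_congr rfl fun i _ => ?_
    rw [pd_sum _ (by intros; fun_prop)]
    refine Finset.sum_congr rfl fun j _ => ?_
    rw [pd_sum _ (by intros; fun_prop)]
    refine Finset.sum_congr rfl fun k _ => ?_
    rw [pd_sum _ (by intros; fun_prop)]
    refine Finset.sum_congr rfl fun l _ => ?_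
    rw [pd_mul (by fun_prop) (by fun_prop), pd_mul (by fun_prop) (by fun_prop),
      pd_mul (by fun_prop) (by fun_prop)]
    simp only [hdH, hH, hS, hT, Matrix.of_apply]
    ring
  have k1 : B.dot2 (B.cov2 s a) t z = quad H H dS T := rfl
  have k2 : B.dot2 s (B.cov2 t a) z = quad H H S dT := rfl
  rw [key, k1, k2, es, et]
  have edH : dH = -H * C.transpose - C * H := h.pd_gi_mat hz a
  simp only [quad_eq_trace, edH]
  -- All Christoffel contributions collapse to the commutator of Cᵀ with SᵀHTHᵀ, which the trace
  -- annihilates.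
  have e : S.transpose * (-H * C.transpose - C * H) * T * H.transpose
      + S.transpose * H * T * (-H * C.transpose - C * H).transpose
      + (dS + C.transpose * S + S * C).transpose * H * T * H.transpose
      + S.transpose * H * (dT + C.transpose * T + T * C) * H.transpose
      = dS.transpose * H * T * H.transpose + S.transpose * H * dT * H.transpose
        + (C.transpose * (S.transpose * H * T * H.transpose)
          - (S.transpose * H * T * H.transpose) * C.transpose) := by
    simp only [Matrix.transpose_add, Matrix.transpose_mul, Matrix.transpose_sub,
      Matrix.transpose_neg, Matrix.transpose_transpose]
    noncomm_ring
  rw [← Matrix.trace_add, ← Matrix.trace_add, ← Matrix.trace_add, e, Matrix.trace_add,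
    Matrix.trace_add, Matrix.trace_sub, Matrix.trace_mul_comm C.transpose, sub_self, add_zero]

theorem cov2_G (a b c : Fin 4) : B.cov2 B.G a b c z = 0 := by
  unfold cov2
  rw [h.pd_G hz]
  simp only [mul_comm (B.G b _ z)]
  ring

/-- Viewing the trace as a contraction with the metric makes the rule for differentiating traces a
special case of `pd_dot2`, because ∇g = 0. -/
theorem dot2_G (t : Fin 4 → Fin 4 → EuclideanSpace ℝ (Fin 4) → ℝ) :
    B.dot2 B.G t z = B.tr t z := by
  unfold dot2 tr
  rw [Finset.sum_comm]
  have : ∀ b, ∑ a, ∑ c, ∑ d, B.gi a c z * B.gi b d z * B.G a b z * t c d z =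
      ∑ c, ∑ d, B.gi b d z * t c d z * ∑ a, B.gi c a z * B.G a b z := by
    intro b
    rw [Finset.sum_comm]
    refine Finset.sum_congr rfl fun c _ => ?_
    rw [Finset.sum_comm]
    refine Finset.sum_congr rfl fun d _ => ?_
    rw [Finset.mul_sum]
    refine Finset.sum_congr rfl fun a _ => ?_
    rw [h.gi_symm hz a c]; ring
  simp only [this, h.gi_mul_G hz, mul_ite, mul_one, mul_zero]
  refine Finset.sum_congr rfl fun b _ => ?_
  rw [Finset.sum_comm]
  simp

theorem pd_tr {t : Fin 4 → Fin 4 → EuclideanSpace ℝ (Fin 4) → ℝ}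
    (ht : ∀ i j, ContDiffOn ℝ ∞ (t i j) U) (a : Fin 4) :
    pd a (B.tr t) z = B.tr (B.cov2 t a) z := by
  rw [pd_congr (g := B.dot2 B.G t), h.pd_dot2 hz h.smooth ht, h.dot2_G hz]
  · have : B.dot2 (B.cov2 B.G a) t z = 0 := by
      unfold dot2
      simp [h.cov2_G hz]
    rw [this, zero_add]
  · filter_upwards [h.isOpen.mem_nhds hz] with w hw using (h.dot2_G hw t).symm

theorem pd_contract {s v : Fin 4 → EuclideanSpace ℝ (Fin 4) → ℝ}
    (hs : ∀ i, ContDiffOn ℝ ∞ (s i) U) (hv : ∀ i, ContDiffOn ℝ ∞ (v i) U) (a : Fin 4) :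
    pd a (fun w => ∑ b, ∑ c, B.gi b c w * (s b w * v c w)) z =
      ∑ b, ∑ c, B.gi b c z * (B.cov1 s a b z * v c z + s b z * B.cov1 v a c z) := by
  refine (h.pd_tr hz (t := fun b c w => s b w * v c w) (fun i j => (hs i).mul (hv j)) a).trans ?_
  unfold tr
  refine Finset.sum_congr rfl fun b _ => Finset.sum_congr rfl fun c _ => ?_
  congr 1
  unfold cov2 cov1
  rw [pd_mul ((hs b).diffAt h.isOpen hz) ((hv c).diffAt h.isOpen hz), sub_mul, mul_sub,
    Finset.sum_mul, Finset.mul_sum, Finset.sum_congr rfl fun l _ => (mul_assoc _ _ _).symm,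
    Finset.sum_congr rfl fun l _ => (mul_left_comm (s b z) (B.chr l a c z) (v l z))]
  ring

end RegularMetric

/-- The density `√|det g|`. -/
def dens (B : LocalBackground) (z : EuclideanSpace ℝ (Fin 4)) : ℝ :=
  √|(Matrix.of fun k l => B.G k l z).det|

namespace RegularMetric

variable {B : LocalBackground} {U : Set (EuclideanSpace ℝ (Fin 4))} (h : B.RegularMetric U)
  {z : EuclideanSpace ℝ (Fin 4)} (hz : z ∈ U)
include h

theorem dens_pos (hz : z ∈ U) : 0 < B.dens z := Real.sqrt_pos.2 (abs_pos.2 (h.det_ne z hz))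

theorem contDiffOn_dens : ContDiffOn ℝ ∞ B.dens U := by
  have h1 : ContDiffOn ℝ ∞ (fun z => (Matrix.of fun k l => B.G k l z).det) U :=
    contDiffOn_det h.smooth
  intro z hz
  have h2 := h1 z hz
  exact (h2.abs (h.det_ne z hz)).sqrt (abs_pos.2 (h.det_ne z hz)).ne'

include hz

/-- Of the three derivatives in the symbol the last two are exchanged by swapping the indices of the
symmetric inverse metric, so they cancel. -/
theorem sum_chr (a : Fin 4) : ∑ b, B.chr b a b z =
    1 / 2 * ∑ b, ∑ l, B.gi b l z * pd a (B.G l b) z := by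
  unfold chr
  rw [← Finset.mul_sum]
  have h1 : ∑ b, ∑ l, B.gi b l z * (pd a (B.G b l) z + pd b (B.G a l) z - pd l (B.G a b) z) =
      ∑ b, ∑ l, B.gi b l z * pd a (B.G l b) z + (∑ b, ∑ l, B.gi b l z * pd b (B.G a l) z -
        ∑ b, ∑ l, B.gi b l z * pd l (B.G a b) z) := by
    simp only [← Finset.sum_add_distrib, ← Finset.sum_sub_distrib]
    refine Finset.sum_congr rfl fun b _ => Finset.sum_congr rfl fun l _ => ?_
    rw [h.pd_G_symm hz a b l]; ring
  have h2 : ∑ b, ∑ l, B.gi b l z * pd b (B.G a l) z = ∑ b, ∑ l, B.gi b l z * pd l (B.G a b) z := by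
    rw [Finset.sum_comm]
    refine Finset.sum_congr rfl fun b _ => Finset.sum_congr rfl fun l _ => ?_
    rw [h.gi_symm hz]
  rw [h1, h2, sub_self, add_zero]

/-- Jacobi's formula for the logarithmic derivative of the determinant, combined with the contracted
Christoffel symbol. -/
theorem pd_dens (a : Fin 4) : pd a B.dens z = B.dens z * ∑ b, B.chr b a b z := by
  set D := fun z => (Matrix.of fun k l => B.G k l z).det with hD
  have hdet : D z ≠ 0 := h.det_ne z hz
  have hsm : ContDiffOn ℝ ∞ D U := contDiffOn_det h.smooth
  have hd : DifferentiableAt ℝ D z := hsm.diffAt h.isOpen hz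
  have hpos := h.dens_pos hz
  -- The fourth power of the density is the square of the determinant, so neither the root nor the
  -- absolute value has to be differentiated.
  have h1 : pd a (fun w => B.dens w * B.dens w * (B.dens w * B.dens w)) z =
      pd a (fun w => D w * D w) z := by
    congr 1; funext w
    have : B.dens w * B.dens w = |D w| := Real.mul_self_sqrt (abs_nonneg _)
    rw [this, abs_mul_abs_self]
  have dd : DifferentiableAt ℝ B.dens z := h.contDiffOn_dens.diffAt h.isOpen hz
  rw [pd_mul (by fun_prop) (by fun_prop), pd_mul (by fun_prop) (by fun_prop),
    pd_mul (by fun_prop) (by fun_prop)] at h1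
  have hJ : pd a D z = D z * ∑ b, ∑ l, B.gi b l z * pd a (B.G l b) z := by
    rw [hD, pd_det (fun i j => (h.smooth i j).diffAt h.isOpen hz), Finset.mul_sum]
    refine Finset.sum_congr rfl fun i _ => ?_
    rw [Finset.mul_sum]
    refine Finset.sum_congr rfl fun j _ => ?_
    rw [← mul_assoc]
    congr 1
    unfold gi
    rw [Matrix.inv_def, Matrix.smul_apply, Ring.inverse_eq_inv', smul_eq_mul,
      mul_inv_cancel_left₀ hdet]
  rw [hJ] at h1
  rw [h.sum_chr hz]
  have hsq : B.dens z * B.dens z * (B.dens z * B.dens z) = D z * D z := by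
    have : B.dens z * B.dens z = |D z| := Real.mul_self_sqrt (abs_nonneg _)
    rw [this, abs_mul_abs_self]
  set X := ∑ b, ∑ l, B.gi b l z * pd a (B.G l b) z
  -- With `hsq`, both sides of `h1` carry a factor of the cube of the density, which is positive and
  -- can be divided out.
  have h3 : B.dens z ^ 3 * (pd a B.dens z - B.dens z * (1 / 2 * X)) = 0 := by
    linear_combination (1 / 4) * h1 - (1/2) * X * hsq
  have h4 := (mul_eq_zero.1 h3).resolve_left (pow_ne_zero _ hpos.ne')
  linarith

end RegularMetric
end LocalBackground

namespace LocalBackground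

namespace RegularMetric

variable {B : LocalBackground} {U : Set (EuclideanSpace ℝ (Fin 4))} (h : B.RegularMetric U)
  {z : EuclideanSpace ℝ (Fin 4)} (hz : z ∈ U)
include h hz

/-! ## Divergences -/

theorem pd_gi (a b c : Fin 4) : pd a (B.gi b c) z =
    -∑ l, B.gi b l z * B.chr c a l z - ∑ l, B.chr b a l z * B.gi l c z := by
  have := congrFun₂ (h.pd_gi_mat hz a) b c
  simpa [Matrix.mul_apply, Matrix.sub_apply, Finset.sum_neg_distrib] using this

/-- The Voss-Weyl formula: the derivative of the density contributes the contracted Christoffel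
symbol, which cancels one of the two Christoffel terms of the inverse metric. Through this formula
the covariant divergence theorem becomes a statement about integrals of partial derivatives. -/
theorem dens_mul_div1 {w : Fin 4 → EuclideanSpace ℝ (Fin 4) → ℝ}
    (hw : ∀ i, ContDiffOn ℝ ∞ (w i) U) :
    B.dens z * B.div1 w z = ∑ a, pd a (fun x => B.dens x * ∑ b, B.gi a b x * w b x) z := by
  have dg := fun i j => (h.contDiffOn_gi i j).diffAt h.isOpen hz
  have dw := fun i => (hw i).diffAt h.isOpen hz
  have dd : DifferentiableAt ℝ B.dens z := h.contDiffOn_dens.diffAt h.isOpen hz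
  have e1 : ∀ a, pd a (fun x => B.dens x * ∑ b, B.gi a b x * w b x) z =
      B.dens z * ((∑ l, B.chr l a l z) * (∑ b, B.gi a b z * w b z) +
        ∑ b, (pd a (B.gi a b) z * w b z + B.gi a b z * pd a (w b) z)) := by
    intro a
    rw [pd_mul dd (by fun_prop), pd_sum _ (by intros; fun_prop), h.pd_dens hz, mul_add, mul_assoc]
    congr 2
    exact Finset.sum_congr rfl fun b _ => pd_mul (dg a b) (dw b)
  simp only [e1, ← Finset.mul_sum]
  congr 1
  simp only [Finset.sum_add_distrib, h.pd_gi hz, sub_mul, neg_mul, Finset.sum_sub_distrib,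
    Finset.sum_neg_distrib, Finset.sum_mul]
  have e2 : ∑ a, ∑ b, ∑ l, B.chr a a l z * B.gi l b z * w b z =
      ∑ a, ∑ l, B.chr l a l z * ∑ b, B.gi a b z * w b z := by
    simp only [Finset.mul_sum]
    rw [Finset.sum_congr rfl fun a _ => Finset.sum_comm, Finset.sum_comm]
    refine Finset.sum_congr rfl fun a _ => Finset.sum_congr rfl fun l _ =>
      Finset.sum_congr rfl fun b _ => ?_
    rw [h.chr_symm hz l a l]; ring
  have e3 : B.div1 w z = ∑ a, ∑ b, B.gi a b z * pd a (w b) z -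
      ∑ a, ∑ b, ∑ l, B.gi a l z * B.chr b a l z * w b z := by
    unfold div1 cov1
    simp only [mul_sub, Finset.sum_sub_distrib, Finset.mul_sum]
    congr 1
    refine Finset.sum_congr rfl fun a _ => ?_
    rw [Finset.sum_comm]
    exact Finset.sum_congr rfl fun l _ => Finset.sum_congr rfl fun b _ => by ring
  rw [e3, e2]
  ring

theorem div1_mul {f : EuclideanSpace ℝ (Fin 4) → ℝ} {w : Fin 4 → EuclideanSpace ℝ (Fin 4) → ℝ}
    (hf : DifferentiableAt ℝ f z) (hw : ∀ i, ContDiffOn ℝ ∞ (w i) U) :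
    B.div1 (fun a x => f x * w a x) z =
      ∑ a, ∑ b, B.gi a b z * pd a f z * w b z + f z * B.div1 w z := by
  unfold div1 cov1
  rw [Finset.mul_sum, ← Finset.sum_add_distrib]
  refine Finset.sum_congr rfl fun a _ => ?_
  rw [Finset.mul_sum, ← Finset.sum_add_distrib]
  refine Finset.sum_congr rfl fun b _ => ?_
  rw [pd_mul hf ((hw b).diffAt h.isOpen hz),
    Finset.sum_congr rfl fun l _ => (mul_left_comm (B.chr l a b z) (f z) (w l z)),
    ← Finset.mul_sum]
  ring

theorem div1_add {v w : Fin 4 → EuclideanSpace ℝ (Fin 4) → ℝ}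
    (hv : ∀ i, ContDiffOn ℝ ∞ (v i) U) (hw : ∀ i, ContDiffOn ℝ ∞ (w i) U) :
    B.div1 (fun a x => v a x + w a x) z = B.div1 v z + B.div1 w z := by
  unfold div1 cov1
  simp only [← Finset.sum_add_distrib]
  refine Finset.sum_congr rfl fun a _ => Finset.sum_congr rfl fun b _ => ?_
  rw [pd_add ((hv b).diffAt h.isOpen hz) ((hw b).diffAt h.isOpen hz)]
  simp only [mul_add, Finset.sum_add_distrib]
  ring

theorem div1_sub {v w : Fin 4 → EuclideanSpace ℝ (Fin 4) → ℝ}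
    (hv : ∀ i, ContDiffOn ℝ ∞ (v i) U) (hw : ∀ i, ContDiffOn ℝ ∞ (w i) U) :
    B.div1 (fun a x => v a x - w a x) z = B.div1 v z - B.div1 w z := by
  unfold div1 cov1
  simp only [← Finset.sum_sub_distrib]
  refine Finset.sum_congr rfl fun a _ => Finset.sum_congr rfl fun b _ => ?_
  rw [pd_sub ((hv b).diffAt h.isOpen hz) ((hw b).diffAt h.isOpen hz)]
  simp only [mul_sub, Finset.sum_sub_distrib]
  ring

omit hz in
theorem _root_.LinEKG.LocalBackground.div1_congr {v w : Fin 4 → EuclideanSpace ℝ (Fin 4) → ℝ}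
    (hz : z ∈ U) (hvw : ∀ x ∈ U, ∀ i, v i x = w i x) : B.div1 v z = B.div1 w z := by
  unfold div1 cov1
  refine Finset.sum_congr rfl fun a _ => Finset.sum_congr rfl fun b _ => ?_
  rw [pd_congr (g := w b)]
  · simp only [hvw z hz]
  · filter_upwards [h.isOpen.mem_nhds hz] with x hx using hvw x hx b

/-- `P^{ab}` for a covariant tensor `P`. -/
def _root_.LinEKG.LocalBackground.raise2 (B : LocalBackground)
    (F : Fin 4 → Fin 4 → EuclideanSpace ℝ (Fin 4) → ℝ)
    (a b : Fin 4) (x : EuclideanSpace ℝ (Fin 4)) : ℝ :=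
  ∑ c, ∑ d, B.gi a c x * B.gi b d x * F c d x

omit hz in
theorem contDiffOn_raise2 {F : Fin 4 → Fin 4 → EuclideanSpace ℝ (Fin 4) → ℝ}
    (hF : ∀ i j, ContDiffOn ℝ ∞ (F i j) U) (a b : Fin 4) : ContDiffOn ℝ ∞ (B.raise2 F a b) U :=
  ContDiffOn.sum fun c _ => ContDiffOn.sum fun d _ =>
    ((h.contDiffOn_gi a c).mul (h.contDiffOn_gi b d)).mul (hF c d)

omit h hz in
-- A raised component is a contraction with a constant unit tensor, so its derivative is again an
-- instance of `pd_dot2`.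
theorem _root_.LinEKG.LocalBackground.raise2_eq_dot2 (B : LocalBackground)
    (F : Fin 4 → Fin 4 → EuclideanSpace ℝ (Fin 4) → ℝ) (a b : Fin 4) :
    B.raise2 F a b = B.dot2 (fun i j _ => (if i = a then 1 else 0) * if j = b then 1 else 0) F := by
  funext x
  simp [raise2, dot2, mul_assoc, Finset.sum_ite_eq', ite_mul, mul_ite]

theorem pd_raise2 {F : Fin 4 → Fin 4 → EuclideanSpace ℝ (Fin 4) → ℝ}
    (hF : ∀ i j, ContDiffOn ℝ ∞ (F i j) U) (e a b : Fin 4) :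
    pd e (B.raise2 F a b) z = B.raise2 (B.cov2 F e) a b z
      - ∑ i, B.chr a e i z * B.raise2 F i b z - ∑ j, B.chr b e j z * B.raise2 F a j z := by
  rw [raise2_eq_dot2, h.pd_dot2 hz (fun i j => contDiffOn_const) hF, raise2_eq_dot2 B _ a b]
  have h1 : B.dot2 (B.cov2 (fun i j _ => (if i = a then 1 else 0) * if j = b then 1 else 0) e) F z
      = - ∑ i, B.chr a e i z * B.raise2 F i b z - ∑ j, B.chr b e j z * B.raise2 F a j z := by
    -- The unit tensor has constant components, so only the Christoffel terms of its covariant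
    -- derivative survive.
    have hc : ∀ i j, B.cov2 (fun i j _ => (if i = a then 1 else 0) * if j = b then 1 else 0) e i j z
        = - (B.chr a e i z * if j = b then 1 else 0) - (if i = a then 1 else 0) * B.chr b e j z := by
      intro i j
      simp [cov2, pd_const]
    simp only [dot2, hc, raise2, mul_sub, sub_mul, Finset.sum_sub_distrib]
    congr 1
    · rw [← Finset.sum_neg_distrib]
      refine Finset.sum_congr rfl fun i _ => ?_
      simp only [mul_ite, mul_neg, mul_one, mul_zero, neg_mul, ite_mul, zero_mul, Finset.mul_sum,
        Finset.sum_neg_distrib]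
      rw [Finset.sum_eq_single b]
      · simp only [if_true, neg_inj]
        exact Finset.sum_congr rfl fun c _ => Finset.sum_congr rfl fun d _ => by ring
      · intro j _ hj; simp [hj]
      · simp
    · rw [Finset.sum_comm]
      refine Finset.sum_congr rfl fun j _ => ?_
      rw [Finset.sum_eq_single a]
      · simp only [if_true, Finset.mul_sum]
        exact Finset.sum_congr rfl fun c _ => Finset.sum_congr rfl fun d _ => by ring
      · intro i _ hi; simp [hi]
      · simp
  rw [h1]; ring

/-- The double divergence of an antisymmetric tensor vanishes. -/
theorem div1_div2_antisymm {F : Fin 4 → Fin 4 → EuclideanSpace ℝ (Fin 4) → ℝ}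
    (hF : ∀ i j, ContDiffOn ℝ ∞ (F i j) U) (hanti : ∀ x ∈ U, ∀ i j, F i j x = -F j i x) :
    B.div1 (B.div2 F) z = 0 := by
  have anti : ∀ x ∈ U, ∀ a b, B.raise2 F a b x = - B.raise2 F b a x := by
    intro x hx a b
    unfold raise2
    rw [Finset.sum_comm]
    simp only [← Finset.sum_neg_distrib]
    refine Finset.sum_congr rfl fun c _ => Finset.sum_congr rfl fun d _ => ?_
    rw [hanti x hx d c]; ring
  have dens_sm := h.contDiffOn_dens
  -- For an antisymmetric tensor the density times its divergence is again a sum of partial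
  -- derivatives, now of the components of a tensor of rank two.
  have key : ∀ x ∈ U, ∀ b, B.dens x * ∑ c, B.gi b c x * B.div2 F c x =
      ∑ a, pd a (fun y => B.dens y * B.raise2 F a b y) x := by
    intro x hx b
    have e1 : ∀ a, pd a (fun y => B.dens y * B.raise2 F a b y) x =
        B.dens x * ((∑ l, B.chr l a l x) * B.raise2 F a b x + (B.raise2 (B.cov2 F a) a b x
          - ∑ i, B.chr a a i x * B.raise2 F i b x - ∑ j, B.chr b a j x * B.raise2 F a j x)) := by
      intro a
      rw [pd_mul (dens_sm.diffAt h.isOpen hx) ((h.contDiffOn_raise2 hF a b).diffAt h.isOpen hx),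
        h.pd_dens hx, h.pd_raise2 hx hF]
      ring
    simp only [e1, ← Finset.mul_sum]
    congr 1
    simp only [Finset.sum_add_distrib, Finset.sum_sub_distrib]
    have e2 : ∑ a, ∑ i, B.chr a a i x * B.raise2 F i b x =
        ∑ a, (∑ l, B.chr l a l x) * B.raise2 F a b x := by
      rw [Finset.sum_comm]
      refine Finset.sum_congr rfl fun a _ => ?_
      rw [Finset.sum_mul]
      exact Finset.sum_congr rfl fun l _ => by rw [h.chr_symm hx l l a]
    -- The Christoffel symbol is symmetric in its lower indices while the raised tensor is
    -- antisymmetric, so the sum equals its own negative.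
    have e3 : ∑ a, ∑ j, B.chr b a j x * B.raise2 F a j x = 0 := by
      have : ∑ a, ∑ j, B.chr b a j x * B.raise2 F a j x =
          -∑ a, ∑ j, B.chr b a j x * B.raise2 F a j x := by
        nth_rewrite 1 [Finset.sum_comm]
        simp only [← Finset.sum_neg_distrib]
        refine Finset.sum_congr rfl fun a _ => Finset.sum_congr rfl fun j _ => ?_
        rw [anti x hx j a, h.chr_symm hx b j a]; ring
      linarith
    rw [e2, e3]
    have e4 : ∑ c, B.gi b c x * B.div2 F c x = ∑ a, B.raise2 (B.cov2 F a) a b x := by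
      simp only [div2, raise2, Finset.mul_sum]
      rw [Finset.sum_comm]
      refine Finset.sum_congr rfl fun a _ => ?_
      rw [Finset.sum_comm]
      exact Finset.sum_congr rfl fun c _ => Finset.sum_congr rfl fun d _ => by ring
    rw [e4]; ring
  have e5 : B.dens z * B.div1 (B.div2 F) z = 0 := by
    rw [h.dens_mul_div1 hz (h.contDiffOn_div2 hF)]
    have e6 : ∀ b, pd b (fun x => B.dens x * ∑ c, B.gi b c x * B.div2 F c x) z =
        ∑ a, pd b (pd a (fun y => B.dens y * B.raise2 F a b y)) z := by
      intro b
      rw [pd_congr (g := fun x => ∑ a, pd a (fun y => B.dens y * B.raise2 F a b y) x), pd_sum]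
      · intro a _
        exact ((dens_sm.mul (h.contDiffOn_raise2 hF a b)).pd h.isOpen a).diffAt h.isOpen hz
      · filter_upwards [h.isOpen.mem_nhds hz] with x hx using key x hx b
    simp only [e6]
    -- Second partial derivatives commute, and they are summed against an antisymmetric density.
    have e7 : ∑ b, ∑ a, pd b (pd a (fun y => B.dens y * B.raise2 F a b y)) z =
        -∑ b, ∑ a, pd b (pd a (fun y => B.dens y * B.raise2 F a b y)) z := by
      nth_rewrite 1 [Finset.sum_comm]
      simp only [← Finset.sum_neg_distrib]
      refine Finset.sum_congr rfl fun a _ => Finset.sum_congr rfl fun b _ => ?_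
      rw [pd_pd_comm (dens_sm.mul (h.contDiffOn_raise2 hF a b)) h.isOpen hz, ← pd_neg]
      refine pd_congr ?_
      filter_upwards [h.isOpen.mem_nhds hz] with x hx
      rw [← pd_neg]
      refine pd_congr ?_
      filter_upwards [h.isOpen.mem_nhds hx] with y hy
      rw [anti y hy a b]; ring
    linarith
  exact (mul_eq_zero.1 e5).resolve_left (h.dens_pos hz).ne'

/-- For fixed `a` the array `B.cov2 t a` is treated as a tensor of rank two, so differentiating it
omits the Christoffel term of the index `a`. That is the term which `cov1` subtracts from the
outside. The same correction occurs in `cov1_contract` and `cov1_pd_tr`. -/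
theorem cov1_dot2_cov2 {s t : Fin 4 → Fin 4 → EuclideanSpace ℝ (Fin 4) → ℝ}
    (hs : ∀ i j, ContDiffOn ℝ ∞ (s i j) U) (ht : ∀ i j, ContDiffOn ℝ ∞ (t i j) U) (e a : Fin 4) :
    B.cov1 (fun a => B.dot2 s (B.cov2 t a)) e a z =
      B.dot2 (B.cov2 s e) (B.cov2 t a) z + B.dot2 s (B.cov22 t e a) z := by
  have hc : ∀ b c, B.cov2 (B.cov2 t a) e b c z =
      B.cov22 t e a b c z + ∑ l, B.chr l e a z * B.cov2 t l b c z := by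
    intro b c
    simp only [cov22, cov3]
    rw [show B.cov2 (B.cov2 t a) e b c z = pd e (B.cov2 t a b c) z
      - ∑ l, B.chr l e b z * B.cov2 t a l c z - ∑ l, B.chr l e c z * B.cov2 t a b l z from rfl]
    ring
  unfold cov1
  rw [h.pd_dot2 hz hs (h.contDiffOn_cov2 ht a), add_sub_assoc]
  congr 1
  simp only [dot2, hc, mul_add, Finset.sum_add_distrib, Finset.mul_sum]
  rw [add_sub_assoc, add_eq_left, sub_eq_zero]
  symm
  rw [Finset.sum_comm]
  refine Finset.sum_congr rfl fun i _ => ?_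
  rw [Finset.sum_comm]
  refine Finset.sum_congr rfl fun j _ => ?_
  rw [Finset.sum_comm]
  refine Finset.sum_congr rfl fun k _ => ?_
  rw [Finset.sum_comm]
  exact Finset.sum_congr rfl fun l _ => Finset.sum_congr rfl fun m _ => by ring

theorem cov1_contract {t : Fin 4 → Fin 4 → EuclideanSpace ℝ (Fin 4) → ℝ}
    {v : Fin 4 → EuclideanSpace ℝ (Fin 4) → ℝ}
    (ht : ∀ i j, ContDiffOn ℝ ∞ (t i j) U) (hv : ∀ i, ContDiffOn ℝ ∞ (v i) U) (e a : Fin 4) :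
    B.cov1 (fun a x => ∑ b, ∑ c, B.gi b c x * (t a b x * v c x)) e a z =
      ∑ b, ∑ c, B.gi b c z * (B.cov2 t e a b z * v c z + t a b z * B.cov1 v e c z) := by
  have hc : ∀ b, B.cov1 (t a) e b z = B.cov2 t e a b z + ∑ l, B.chr l e a z * t l b z := by
    intro b
    simp only [cov1, cov2]; ring
  unfold cov1
  rw [h.pd_contract hz (ht a) hv]
  simp only [hc, add_mul, mul_add, Finset.sum_add_distrib, Finset.mul_sum, Finset.sum_mul]
  have : ∑ b, ∑ c, ∑ l, B.gi b c z * (B.chr l e a z * t l b z * v c z) =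
      ∑ l, ∑ b, ∑ c, B.chr l e a z * (B.gi b c z * (t l b z * v c z)) := by
    rw [Finset.sum_congr rfl fun b _ => Finset.sum_comm, Finset.sum_comm]
    exact Finset.sum_congr rfl fun l _ => Finset.sum_congr rfl fun b _ =>
      Finset.sum_congr rfl fun c _ => by ring
  rw [this]
  unfold cov1
  ring

theorem cov1_pd_tr {t : Fin 4 → Fin 4 → EuclideanSpace ℝ (Fin 4) → ℝ}
    (ht : ∀ i j, ContDiffOn ℝ ∞ (t i j) U) (a b : Fin 4) :
    B.cov1 (fun c => pd c (B.tr t)) a b z = ∑ c, ∑ d, B.gi c d z * B.cov22 t a b c d z := by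
  have hc : ∀ c d, B.cov2 (B.cov2 t b) a c d z =
      B.cov22 t a b c d z + ∑ l, B.chr l a b z * B.cov2 t l c d z := by
    intro c d
    simp only [cov22, cov3]
    rw [show B.cov2 (B.cov2 t b) a c d z = pd a (B.cov2 t b c d) z
      - ∑ l, B.chr l a c z * B.cov2 t b l d z - ∑ l, B.chr l a d z * B.cov2 t b c l z from rfl]
    ring
  unfold cov1
  rw [pd_congr (g := B.tr (B.cov2 t b)), h.pd_tr hz (h.contDiffOn_cov2 ht b)]
  · simp only [h.pd_tr hz ht, tr, hc, mul_add, Finset.sum_add_distrib, Finset.mul_sum]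
    rw [add_sub_assoc, add_eq_left, sub_eq_zero]
    symm
    rw [Finset.sum_comm]
    refine Finset.sum_congr rfl fun i _ => ?_
    rw [Finset.sum_comm]
    exact Finset.sum_congr rfl fun l _ => Finset.sum_congr rfl fun m _ => by ring
  · filter_upwards [h.isOpen.mem_nhds hz] with w hw using h.pd_tr hw ht b

end RegularMetric
end LocalBackground

/-! ### Contractions, their divergences, and the commutator of covariant derivatives -/

namespace LocalBackground

variable (B : LocalBackground)

/-- `s^{ab} x_{ab}` for a contravariant tensor `s` and a covariant tensor `x`. -/
def full (s x : Fin 4 → Fin 4 → ℝ) : ℝ := ∑ a, ∑ b, s a b * x a b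

/-- The pairing `g^{ab} p_a q_b` of covectors at `z`. -/
def gd (z : EuclideanSpace ℝ (Fin 4)) (p q : Fin 4 → ℝ) : ℝ := ∑ a, ∑ b, B.gi a b z * (p a * q b)

/-- `∇^c ∇_a t_{bc}`. -/
def divGrad (t : Fin 4 → Fin 4 → EuclideanSpace ℝ (Fin 4) → ℝ) (z : EuclideanSpace ℝ (Fin 4))
    (a b : Fin 4) : ℝ := ∑ c, ∑ d, B.gi c d z * B.cov22 t c a b d z

/-- `∇^c ∇_c t_{ab}`. -/
def box2 (t : Fin 4 → Fin 4 → EuclideanSpace ℝ (Fin 4) → ℝ) (z : EuclideanSpace ℝ (Fin 4))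
    (a b : Fin 4) : ℝ := ∑ c, ∑ d, B.gi c d z * B.cov22 t c d a b z

/-- `s_a^b v_b`. -/
def mulCovec (s : Fin 4 → Fin 4 → EuclideanSpace ℝ (Fin 4) → ℝ)
    (v : Fin 4 → EuclideanSpace ℝ (Fin 4) → ℝ) (a : Fin 4) (z : EuclideanSpace ℝ (Fin 4)) : ℝ :=
  ∑ b, ∑ c, B.gi b c z * (s a b z * v c z)

/-- `s^{ab} ∇_a t_{bc}`. -/
def mulGrad (s t : Fin 4 → Fin 4 → EuclideanSpace ℝ (Fin 4) → ℝ) (c : Fin 4)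
    (z : EuclideanSpace ℝ (Fin 4)) : ℝ :=
  ∑ a, ∑ b, B.raise2 s a b z * B.cov2 t a b c z

/-- The reordering of indices that exchanges the two factors in the product of the gradients of s
and t in `commutator_antisymm`. -/
theorem sum_comm_six {A : Type*} [AddCommMonoid A]
    (F : Fin 4 → Fin 4 → Fin 4 → Fin 4 → Fin 4 → Fin 4 → A) :
    ∑ e, ∑ c, ∑ a, ∑ b, ∑ i, ∑ j, F e c a b i j = ∑ a, ∑ i, ∑ e, ∑ j, ∑ c, ∑ b, F e c a b i j := by
  refine (Finset.sum_congr rfl fun _ _ => Finset.sum_comm).trans ?_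
  refine Finset.sum_comm.trans ?_
  refine Finset.sum_congr rfl fun a _ => ?_
  refine (Finset.sum_congr rfl fun _ _ => Finset.sum_congr rfl fun _ _ => Finset.sum_comm).trans ?_
  refine (Finset.sum_congr rfl fun _ _ => Finset.sum_comm).trans ?_
  refine Finset.sum_comm.trans ?_
  refine Finset.sum_congr rfl fun i _ => Finset.sum_congr rfl fun e _ => ?_
  refine (Finset.sum_congr rfl fun _ _ => Finset.sum_comm).trans ?_
  exact Finset.sum_comm

/-- Puts all factors of the inverse metric on one argument, so that the other enters linearly
through its covariant components. -/
theorem dot2_eq_full (s t : Fin 4 → Fin 4 → EuclideanSpace ℝ (Fin 4) → ℝ)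
    (hsym : ∀ i j, B.gi i j z = B.gi j i z) :
    B.dot2 s t z = full (fun a b => B.raise2 s a b z) fun a b => t a b z := by
  unfold dot2 full raise2
  simp only [Finset.sum_mul]
  refine (Finset.sum_congr rfl fun _ _ => Finset.sum_comm).trans ?_
  refine Finset.sum_comm.trans ?_
  refine Finset.sum_congr rfl fun c _ => ?_
  refine (Finset.sum_congr rfl fun _ _ => Finset.sum_comm).trans ?_
  refine Finset.sum_comm.trans ?_
  refine Finset.sum_congr rfl fun d _ => Finset.sum_congr rfl fun a _ =>
    Finset.sum_congr rfl fun b _ => ?_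
  rw [hsym a c, hsym b d]

namespace RegularMetric

variable {B : LocalBackground} {U : Set (EuclideanSpace ℝ (Fin 4))} (h : B.RegularMetric U)
  {z : EuclideanSpace ℝ (Fin 4)} (hz : z ∈ U)
include h

theorem contDiffOn_mulCovec {t : Fin 4 → Fin 4 → EuclideanSpace ℝ (Fin 4) → ℝ}
    {v : Fin 4 → EuclideanSpace ℝ (Fin 4) → ℝ}
    (ht : ∀ i j, ContDiffOn ℝ ∞ (t i j) U) (hv : ∀ i, ContDiffOn ℝ ∞ (v i) U) (a : Fin 4) :
    ContDiffOn ℝ ∞ (B.mulCovec t v a) U :=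
  ContDiffOn.sum fun b _ => ContDiffOn.sum fun c _ => (h.contDiffOn_gi b c).mul ((ht a b).mul (hv c))

theorem contDiffOn_mulGrad {s t : Fin 4 → Fin 4 → EuclideanSpace ℝ (Fin 4) → ℝ}
    (hs : ∀ i j, ContDiffOn ℝ ∞ (s i j) U) (ht : ∀ i j, ContDiffOn ℝ ∞ (t i j) U) (c : Fin 4) :
    ContDiffOn ℝ ∞ (B.mulGrad s t c) U :=
  ContDiffOn.sum fun a _ => ContDiffOn.sum fun b _ =>
    (h.contDiffOn_raise2 hs a b).mul (h.contDiffOn_cov2 ht a b c)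

omit h in
theorem _root_.LinEKG.LocalBackground.cov2_symm (hU : IsOpen U) (hz : z ∈ U)
    {t : Fin 4 → Fin 4 → EuclideanSpace ℝ (Fin 4) → ℝ}
    (hsym : ∀ x ∈ U, ∀ i j, t i j x = t j i x) (a b c : Fin 4) :
    B.cov2 t a b c z = B.cov2 t a c b z := by
  unfold cov2
  rw [pd_congr (f := t b c) (g := t c b)
    (by filter_upwards [hU.mem_nhds hz] with x hx using hsym x hx b c), sub_right_comm]
  simp only [hsym z hz b, hsym z hz c]

omit h in
theorem _root_.LinEKG.LocalBackground.cov22_symm (hU : IsOpen U) (hz : z ∈ U)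
    {t : Fin 4 → Fin 4 → EuclideanSpace ℝ (Fin 4) → ℝ}
    (hsym : ∀ x ∈ U, ∀ i j, t i j x = t j i x) (d a b c : Fin 4) :
    B.cov22 t d a b c z = B.cov22 t d a c b z := by
  unfold cov22 cov3
  rw [pd_congr (f := B.cov2 t a b c) (g := B.cov2 t a c b)
    (by filter_upwards [hU.mem_nhds hz] with x hx using cov2_symm hU hx hsym a b c),
    sub_right_comm]
  simp only [cov2_symm hU hz hsym _ b c, cov2_symm hU hz hsym _ b, cov2_symm hU hz hsym _ _ c]

include hz

omit h hz in
theorem _root_.LinEKG.LocalBackground.raise2_symm (hz : z ∈ U) {t : Fin 4 → Fin 4 → EuclideanSpace ℝ (Fin 4) → ℝ}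
    (hsym : ∀ x ∈ U, ∀ i j, t i j x = t j i x) (a b : Fin 4) :
    B.raise2 t a b z = B.raise2 t b a z := by
  unfold raise2
  rw [Finset.sum_comm]
  exact Finset.sum_congr rfl fun c _ => Finset.sum_congr rfl fun d _ => by
    rw [hsym z hz d c]; ring

theorem dot2_comm (s t : Fin 4 → Fin 4 → EuclideanSpace ℝ (Fin 4) → ℝ) :
    B.dot2 s t z = B.dot2 t s z := by
  unfold dot2
  refine (Finset.sum_congr rfl fun _ _ => Finset.sum_comm).trans ?_
  refine Finset.sum_comm.trans (Finset.sum_congr rfl fun c _ => ?_)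
  refine (Finset.sum_congr rfl fun _ _ => Finset.sum_comm).trans ?_
  refine Finset.sum_comm.trans (Finset.sum_congr rfl fun d _ => Finset.sum_congr rfl fun a _ =>
    Finset.sum_congr rfl fun b _ => ?_)
  rw [h.gi_symm hz a c, h.gi_symm hz b d]; ring

theorem gd_comm (p q : Fin 4 → ℝ) : B.gd z p q = B.gd z q p := by
  unfold gd
  rw [Finset.sum_comm]
  exact Finset.sum_congr rfl fun c _ => Finset.sum_congr rfl fun d _ => by
    rw [h.gi_symm hz d c]; ring

theorem full_raise2_mul (s : Fin 4 → Fin 4 → EuclideanSpace ℝ (Fin 4) → ℝ)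
    (p : Fin 4 → ℝ) (q : Fin 4 → EuclideanSpace ℝ (Fin 4) → ℝ) :
    full (fun a b => B.raise2 s a b z) (fun a b => p a * q b z) =
      B.gd z p (fun a => B.mulCovec s q a z) := by
  unfold full raise2 gd mulCovec
  simp only [Finset.mul_sum, Finset.sum_mul]
  refine Finset.sum_congr rfl fun a _ => ?_
  refine Finset.sum_comm.trans (Finset.sum_congr rfl fun c _ => ?_)
  refine Finset.sum_comm.trans (Finset.sum_congr rfl fun d _ => Finset.sum_congr rfl fun b _ => ?_)
  rw [h.gi_symm hz b d]; ring

/-- Leibniz rule for the contraction of an upper with a lower index pair: the Christoffel terms of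
the upper indices of `s` cancel those of the lower indices of the gradient of `t`. -/
theorem cov1_mulGrad {s t : Fin 4 → Fin 4 → EuclideanSpace ℝ (Fin 4) → ℝ}
    (hs : ∀ i j, ContDiffOn ℝ ∞ (s i j) U) (ht : ∀ i j, ContDiffOn ℝ ∞ (t i j) U) (e c : Fin 4) :
    B.cov1 (B.mulGrad s t) e c z =
      ∑ a, ∑ b, (B.raise2 (B.cov2 s e) a b z * B.cov2 t a b c z +
        B.raise2 s a b z * B.cov22 t e a b c z) := by
  have dr := fun a b => (h.contDiffOn_raise2 hs a b).diffAt h.isOpen hz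
  have dc := fun a b c => (h.contDiffOn_cov2 ht a b c).diffAt h.isOpen hz
  unfold cov1
  rw [show B.mulGrad s t c = fun z => ∑ a, ∑ b, B.raise2 s a b z * B.cov2 t a b c z from rfl,
    pd_sum _ (by intros; fun_prop)]
  have e1 : ∀ a, pd e (fun w => ∑ b, B.raise2 s a b w * B.cov2 t a b c w) z =
      ∑ b, (pd e (B.raise2 s a b) z * B.cov2 t a b c z +
        B.raise2 s a b z * pd e (B.cov2 t a b c) z) := by
    intro a
    rw [pd_sum _ (by intros; fun_prop)]
    exact Finset.sum_congr rfl fun b _ => pd_mul (dr a b) (dc a b c)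
  have e2 : ∀ a b, pd e (B.cov2 t a b c) z = B.cov22 t e a b c z +
      (∑ l, B.chr l e a z * B.cov2 t l b c z + ∑ l, B.chr l e b z * B.cov2 t a l c z +
        ∑ l, B.chr l e c z * B.cov2 t a b l z) := by
    intro a b
    unfold cov22 cov3; ring
  simp only [e1, e2, h.pd_raise2 hz hs, mulGrad]
  simp only [sub_mul, mul_add, Finset.sum_add_distrib, Finset.sum_sub_distrib, Finset.sum_mul,
    Finset.mul_sum]
  have f1 : ∑ a, ∑ b, ∑ i, B.chr a e i z * B.raise2 s i b z * B.cov2 t a b c z =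
      ∑ a, ∑ b, ∑ l, B.raise2 s a b z * (B.chr l e a z * B.cov2 t l b c z) := by
    refine (Finset.sum_congr rfl fun _ _ => Finset.sum_comm).trans ?_
    refine Finset.sum_comm.trans (Finset.sum_congr rfl fun i _ => ?_)
    refine Finset.sum_comm.trans (Finset.sum_congr rfl fun b _ => Finset.sum_congr rfl fun a _ => ?_)
    ring
  have f2 : ∑ a, ∑ b, ∑ j, B.chr b e j z * B.raise2 s a j z * B.cov2 t a b c z =
      ∑ a, ∑ b, ∑ l, B.raise2 s a b z * (B.chr l e b z * B.cov2 t a l c z) := by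
    refine Finset.sum_congr rfl fun a _ => Finset.sum_comm.trans ?_
    exact Finset.sum_congr rfl fun b _ => Finset.sum_congr rfl fun j _ => by ring
  have f3 : ∑ l, ∑ a, ∑ b, B.chr l e c z * (B.raise2 s a b z * B.cov2 t a b l z) =
      ∑ a, ∑ b, ∑ l, B.raise2 s a b z * (B.chr l e c z * B.cov2 t a b l z) := by
    refine Finset.sum_comm.trans (Finset.sum_congr rfl fun a _ => ?_)
    refine Finset.sum_comm.trans ?_
    exact Finset.sum_congr rfl fun b _ => Finset.sum_congr rfl fun j _ => by ring
  rw [f1, f2, f3]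
  ring

theorem cov2_contract {s t : Fin 4 → Fin 4 → EuclideanSpace ℝ (Fin 4) → ℝ}
    (hs : ∀ i j, ContDiffOn ℝ ∞ (s i j) U) (ht : ∀ i j, ContDiffOn ℝ ∞ (t i j) U) (e a c : Fin 4) :
    B.cov2 (fun a c x => ∑ b, ∑ d, B.gi b d x * (s a b x * t c d x)) e a c z =
      ∑ b, ∑ d, B.gi b d z * (B.cov2 s e a b z * t c d z + s a b z * B.cov2 t e c d z) := by
  have hc : ∀ (t : Fin 4 → Fin 4 → EuclideanSpace ℝ (Fin 4) → ℝ) a b,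
      B.cov1 (t a) e b z = B.cov2 t e a b z + ∑ l, B.chr l e a z * t l b z := by
    intro t a b
    simp only [cov1, cov2]; ring
  unfold cov2
  rw [h.pd_contract hz (hs a) (ht c)]
  simp only [hc, add_mul, mul_add, Finset.sum_add_distrib, Finset.mul_sum, Finset.sum_mul]
  have e1 : ∑ b, ∑ d, ∑ l, B.gi b d z * (B.chr l e a z * s l b z * t c d z) =
      ∑ l, ∑ b, ∑ d, B.chr l e a z * (B.gi b d z * (s l b z * t c d z)) := by
    refine (Finset.sum_congr rfl fun b _ => Finset.sum_comm).trans (Finset.sum_comm.trans ?_)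
    exact Finset.sum_congr rfl fun l _ => Finset.sum_congr rfl fun b _ =>
      Finset.sum_congr rfl fun c _ => by ring
  have e2 : ∑ b, ∑ d, ∑ l, B.gi b d z * (s a b z * (B.chr l e c z * t l d z)) =
      ∑ l, ∑ b, ∑ d, B.chr l e c z * (B.gi b d z * (s a b z * t l d z)) := by
    refine (Finset.sum_congr rfl fun b _ => Finset.sum_comm).trans (Finset.sum_comm.trans ?_)
    exact Finset.sum_congr rfl fun l _ => Finset.sum_congr rfl fun b _ =>
      Finset.sum_congr rfl fun c _ => by ring
  rw [e1, e2]
  unfold cov2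
  ring

theorem div1_mulCovec {t : Fin 4 → Fin 4 → EuclideanSpace ℝ (Fin 4) → ℝ}
    {v : Fin 4 → EuclideanSpace ℝ (Fin 4) → ℝ}
    (ht : ∀ i j, ContDiffOn ℝ ∞ (t i j) U) (hv : ∀ i, ContDiffOn ℝ ∞ (v i) U) :
    B.div1 (B.mulCovec t v) z = B.gd z (fun b => B.div2 t b z) (fun c => v c z) +
      full (fun a b => B.raise2 t a b z) fun a b => B.cov1 v a b z := by
  unfold div1
  rw [show B.mulCovec t v = fun a x => ∑ b, ∑ c, B.gi b c x * (t a b x * v c x) from rfl]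
  simp only [h.cov1_contract hz ht hv, mul_add, Finset.sum_add_distrib]
  congr 1
  · unfold gd div2
    simp only [Finset.mul_sum, Finset.sum_mul]
    refine (Finset.sum_congr rfl fun _ _ => Finset.sum_comm).trans (Finset.sum_comm.trans ?_)
    refine Finset.sum_congr rfl fun b _ => ?_
    refine (Finset.sum_congr rfl fun _ _ => Finset.sum_comm).trans (Finset.sum_comm.trans ?_)
    exact Finset.sum_congr rfl fun c _ => Finset.sum_congr rfl fun b _ =>
      Finset.sum_congr rfl fun c _ => by ring
  · unfold full raise2
    simp only [Finset.mul_sum, Finset.sum_mul]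
    refine Finset.sum_congr rfl fun e _ => ?_
    refine (Finset.sum_congr rfl fun _ _ => Finset.sum_comm).trans (Finset.sum_comm.trans ?_)
    refine Finset.sum_congr rfl fun c _ => Finset.sum_congr rfl fun a _ =>
      Finset.sum_congr rfl fun b _ => ?_
    rw [h.gi_symm hz b c]; ring

theorem div1_mulGrad {s t : Fin 4 → Fin 4 → EuclideanSpace ℝ (Fin 4) → ℝ}
    (hs : ∀ i j, ContDiffOn ℝ ∞ (s i j) U) (ht : ∀ i j, ContDiffOn ℝ ∞ (t i j) U) :
    B.div1 (B.mulGrad s t) z =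
      ∑ e, ∑ c, ∑ a, ∑ b, ∑ i, ∑ j, B.gi e c z * B.gi a i z * B.gi b j z *
        (B.cov2 s e i j z * B.cov2 t a b c z) +
      full (fun a b => B.raise2 s a b z) (B.divGrad t z) := by
  unfold div1
  simp only [h.cov1_mulGrad hz hs ht, mul_add, Finset.sum_add_distrib]
  congr 1
  · simp only [Finset.mul_sum, raise2, Finset.sum_mul]
    exact Finset.sum_congr rfl fun _ _ => Finset.sum_congr rfl fun _ _ =>
      Finset.sum_congr rfl fun _ _ => Finset.sum_congr rfl fun _ _ =>
      Finset.sum_congr rfl fun _ _ => Finset.sum_congr rfl fun _ _ => by ring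
  · unfold full divGrad
    simp only [Finset.mul_sum]
    refine (Finset.sum_congr rfl fun _ _ => Finset.sum_comm).trans (Finset.sum_comm.trans ?_)
    refine Finset.sum_congr rfl fun a _ => ?_
    refine (Finset.sum_congr rfl fun _ _ => Finset.sum_comm).trans (Finset.sum_comm.trans ?_)
    exact Finset.sum_congr rfl fun b _ => Finset.sum_congr rfl fun e _ =>
      Finset.sum_congr rfl fun c _ => by ring

/-- The part of `s^{ab} (∇^c ∇_a - ∇_a ∇^c) t_{bc}` that is antisymmetric in `s` and `t`
vanishes. -/
theorem commutator_antisymm {s t : Fin 4 → Fin 4 → EuclideanSpace ℝ (Fin 4) → ℝ}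
    (hs : ∀ i j, ContDiffOn ℝ ∞ (s i j) U) (ht : ∀ i j, ContDiffOn ℝ ∞ (t i j) U)
    (hss : ∀ x ∈ U, ∀ i j, s i j x = s j i x) (hts : ∀ x ∈ U, ∀ i j, t i j x = t j i x) :
    full (fun a b => B.raise2 s a b z) (B.divGrad t z) -
        full (fun a b => B.raise2 t a b z) (B.divGrad s z) =
      full (fun a b => B.raise2 s a b z) (fun a b => B.cov1 (B.div2 t) a b z) -
        full (fun a b => B.raise2 t a b z) (fun a b => B.cov1 (B.div2 s) a b z) := by
  -- The product s_a^b t_{cb}. Its antisymmetrisation `F` has vanishing double divergence, and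
  -- expanding that divergence yields the claim without the Riemann tensor.
  set E : (Fin 4 → Fin 4 → EuclideanSpace ℝ (Fin 4) → ℝ) → (Fin 4 → Fin 4 →
    EuclideanSpace ℝ (Fin 4) → ℝ) → Fin 4 → Fin 4 → EuclideanSpace ℝ (Fin 4) → ℝ :=
    fun s t a c x => ∑ b, ∑ d, B.gi b d x * (s a b x * t c d x) with hE
  have smE : ∀ a c, ContDiffOn ℝ ∞ (E s t a c) U := fun a c =>
    ContDiffOn.sum fun b _ => ContDiffOn.sum fun d _ =>
      (h.contDiffOn_gi b d).mul ((hs a b).mul (ht c d))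
  set F : Fin 4 → Fin 4 → EuclideanSpace ℝ (Fin 4) → ℝ := fun a c x => E s t a c x - E s t c a x
    with hF
  have smF : ∀ a c, ContDiffOn ℝ ∞ (F a c) U := fun a c => (smE a c).sub (smE c a)
  have h0 : B.div1 (B.div2 F) z = 0 :=
    h.div1_div2_antisymm hz smF fun x _ i j => by simp only [hF]; ring
  -- First divergence: in each of the two products the derivative falls on either factor, giving
  -- terms with a divergence and terms with a contracted gradient.
  have hsum : ∀ x ∈ U, ∀ c, B.div2 F c x =
      (B.mulCovec t (B.div2 s) c x - B.mulCovec s (B.div2 t) c x) +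
        (B.mulGrad s t c x - B.mulGrad t s c x) := by
    intro x hx c
    have e1 : ∀ e a, B.cov2 F e a c x = B.cov2 (E s t) e a c x - B.cov2 (E s t) e c a x := by
      intro e a
      unfold cov2
      rw [pd_sub ((smE a c).diffAt h.isOpen hx) ((smE c a).diffAt h.isOpen hx)]
      simp only [hF, mul_sub, Finset.sum_sub_distrib]
      ring
    change ∑ e, ∑ a, B.gi e a x * B.cov2 F e a c x = _
    simp only [e1, hE, h.cov2_contract hx hs ht, mul_sub, mul_add, Finset.sum_sub_distrib,
      Finset.sum_add_distrib]
    have f1 : ∑ e, ∑ a, B.gi e a x * ∑ b, ∑ d, B.gi b d x * (B.cov2 s e a b x * t c d x) =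
        B.mulCovec t (B.div2 s) c x := by
      simp only [mulCovec, div2, Finset.mul_sum]
      refine (Finset.sum_congr rfl fun _ _ => Finset.sum_comm).trans (Finset.sum_comm.trans ?_)
      refine (Finset.sum_congr rfl fun _ _ => (Finset.sum_congr rfl fun _ _ =>
        Finset.sum_comm).trans Finset.sum_comm).trans (Finset.sum_comm.trans ?_)
      refine Finset.sum_congr rfl fun b _ => Finset.sum_congr rfl fun d _ =>
        Finset.sum_congr rfl fun e _ => Finset.sum_congr rfl fun a _ => ?_
      rw [h.gi_symm hx b d]; ring
    have f2 : ∑ e, ∑ a, B.gi e a x * ∑ b, ∑ d, B.gi b d x * (s a b x * B.cov2 t e c d x) =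
        B.mulGrad s t c x := by
      simp only [mulGrad, raise2, Finset.mul_sum, Finset.sum_mul]
      refine Finset.sum_congr rfl fun e _ => ?_
      refine (Finset.sum_congr rfl fun _ _ => Finset.sum_comm).trans (Finset.sum_comm.trans ?_)
      refine Finset.sum_congr rfl fun b _ => Finset.sum_congr rfl fun d _ =>
        Finset.sum_congr rfl fun e _ => ?_
      rw [h.gi_symm hx b e, cov2_symm h.isOpen hx hts]; ring
    have f3 : ∑ e, ∑ a, B.gi e a x * ∑ b, ∑ d, B.gi b d x * (B.cov2 s e c b x * t a d x) =
        B.mulGrad t s c x := by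
      simp only [mulGrad, raise2, Finset.mul_sum, Finset.sum_mul]
      refine Finset.sum_congr rfl fun e _ => ?_
      refine Finset.sum_comm.trans ?_
      refine Finset.sum_congr rfl fun b _ => Finset.sum_congr rfl fun d _ =>
        Finset.sum_congr rfl fun e _ => ?_
      rw [cov2_symm h.isOpen hx hss _ c b]; ring
    have f4 : ∑ e, ∑ a, B.gi e a x * ∑ b, ∑ d, B.gi b d x * (s c b x * B.cov2 t e a d x) =
        B.mulCovec s (B.div2 t) c x := by
      simp only [mulCovec, div2, Finset.mul_sum]
      refine (Finset.sum_congr rfl fun _ _ => Finset.sum_comm).trans (Finset.sum_comm.trans ?_)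
      refine Finset.sum_congr rfl fun b _ => ?_
      refine (Finset.sum_congr rfl fun _ _ => Finset.sum_comm).trans (Finset.sum_comm.trans ?_)
      exact Finset.sum_congr rfl fun d _ =>
        Finset.sum_congr rfl fun e _ => Finset.sum_congr rfl fun a _ => by ring
    rw [f1, f2, f3, f4]
    ring
  have smd := h.contDiffOn_div2 ht
  have smd' := h.contDiffOn_div2 hs
  have c1 := h.contDiffOn_mulCovec ht smd'
  have c2 := h.contDiffOn_mulCovec hs smd
  have c3 := h.contDiffOn_mulGrad hs ht
  have c4 := h.contDiffOn_mulGrad ht hs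
  rw [div1_congr h hz hsum, h.div1_add hz (fun i => (c1 i).sub (c2 i)) (fun i => (c3 i).sub (c4 i)),
    h.div1_sub hz c1 c2, h.div1_sub hz c3 c4, h.div1_mulCovec hz ht smd', h.div1_mulCovec hz hs smd,
    h.div1_mulGrad hz hs ht, h.div1_mulGrad hz ht hs] at h0
  -- The products of two gradients created by the second divergence agree under exchange of `s` and
  -- `t`, so they drop out of the difference.
  have hN : ∑ e, ∑ c, ∑ a, ∑ b, ∑ i, ∑ j, B.gi e c z * B.gi a i z * B.gi b j z *
        (B.cov2 s e i j z * B.cov2 t a b c z) = ∑ e, ∑ c, ∑ a, ∑ b, ∑ i, ∑ j,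
        B.gi e c z * B.gi a i z * B.gi b j z * (B.cov2 t e i j z * B.cov2 s a b c z) := by
    rw [sum_comm_six]
    refine Finset.sum_congr rfl fun a _ => Finset.sum_congr rfl fun i _ =>
      Finset.sum_congr rfl fun e _ => Finset.sum_congr rfl fun j _ =>
      Finset.sum_congr rfl fun c _ => Finset.sum_congr rfl fun b _ => ?_
    rw [cov2_symm h.isOpen hz hss e i j, cov2_symm h.isOpen hz hts a b c, h.gi_symm hz b j]
    ring
  rw [hN, h.gd_comm hz (fun b => B.div2 s b z)] at h0
  linarith

end RegularMetric
end LocalBackground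

/-! ### Regular data, and the operator contracted with a symmetric tensor -/

namespace LocalBackground

/-- Metric, scalar field and potential are smooth and nondegenerate on `U`. -/
structure Regular (B : LocalBackground) (U : Set (EuclideanSpace ℝ (Fin 4))) : Prop extends
    B.RegularMetric U where
  smooth_φ : ContDiffOn ℝ ∞ B.φ U
  α_ne : ∀ z ∈ U, B.α z ≠ 0
  β_ne : ∀ z ∈ U, B.β z ≠ 0

/-- The components are smooth and symmetric on `U`. -/
structure _root_.LinEKG.LocalSection.Regular (Θ : LocalSection)
    (U : Set (EuclideanSpace ℝ (Fin 4))) : Prop where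
  smooth_θ : ∀ i j, ContDiffOn ℝ ∞ (Θ.θ i j) U
  smooth_ζ : ContDiffOn ℝ ∞ Θ.ζ U
  symm : ∀ z ∈ U, ∀ i j, Θ.θ i j z = Θ.θ j i z

theorem full_add (s x y : Fin 4 → Fin 4 → ℝ) :
    full s (fun a b => x a b + y a b) = full s x + full s y := by
  unfold full
  simp only [mul_add, Finset.sum_add_distrib]

theorem full_const_mul (s x : Fin 4 → Fin 4 → ℝ) (c : ℝ) :
    full s (fun a b => c * x a b) = c * full s x := by
  unfold full
  simp only [Finset.mul_sum, mul_left_comm]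

theorem full_congr {s x y : Fin 4 → Fin 4 → ℝ} (hxy : ∀ a b, x a b = y a b) :
    full s x = full s y := by
  unfold full; simp only [hxy]

theorem full_symm {s x : Fin 4 → Fin 4 → ℝ} (hs : ∀ a b, s a b = s b a) :
    full s (fun a b => x b a) = full s x := by
  unfold full
  rw [Finset.sum_comm]
  simp only [hs]

variable {B : LocalBackground} {U : Set (EuclideanSpace ℝ (Fin 4))}
  {z : EuclideanSpace ℝ (Fin 4)} {Θ : LocalSection}

/-- Contraction of `P̄ (θ, ζ)` with a symmetric contravariant tensor. -/
theorem full_PbarTensor {S : Fin 4 → Fin 4 → ℝ} (hS : ∀ a b, S a b = S b a) :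
    full S (fun a b => B.PbarTensor Θ a b z) =
      -full S (B.box2 Θ.θ z) + 2 * full S (B.divGrad Θ.θ z)
      - full S (fun a b => B.G a b z) * B.divdiv2 Θ.θ z
      + 4 * B.ξ * B.φ z / B.α z * full S (fun a b => B.dφ a z * B.div2 Θ.θ b z)
      - 2 * B.ξ * B.φ z / B.α z * full S (fun a b => ∑ c, B.uφ c z * B.cov2 Θ.θ c a b z)
      - 2 / B.α z * B.V0 z * full S (fun a b => Θ.θ a b z)
      - 2 * B.ξ / (B.β z * B.α z) * full S (fun a b => B.dφ a z * B.dφ b z) * B.tr Θ.θ z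
      + 4 * B.ξ * (2 - B.α z) / B.α z ^ 2 *
        full S (fun a b => B.dφ a z * ∑ c, B.uφ c z * Θ.θ b c z)
      - 4 * B.ξ ^ 2 * B.φ z ^ 2 / B.α z ^ 2 * B.nφ z * full S (fun a b => Θ.θ a b z)
      + 4 * B.ξ * B.φ z / B.α z *
        full S (fun a b => ∑ c, ∑ d, B.gi c d z * (B.ddφ d a z * Θ.θ b c z))
      - full S (fun a b => B.dφ a z * pd b Θ.ζ z)
      + B.κ * B.φ z / B.β z * full S (fun a b => B.dφ a z * B.dφ b z) * Θ.ζ z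
      + 1 / 2 * full S (fun a b => B.G a b z) * (∑ c, B.uφ c z * pd c Θ.ζ z)
      + (4 * B.ξ * B.φ z * B.V0 z + B.α z * B.V1 z) / (2 * B.β z) *
        full S (fun a b => B.G a b z) * Θ.ζ z
      - B.κ * B.φ z / (2 * B.β z) * B.nφ z * full S (fun a b => B.G a b z) * Θ.ζ z := by
  -- A symmetric `S` sees only the symmetric part of its partner, so every symmetrised term may be
  -- replaced by one of its two summands.
  have sw : ∀ x : Fin 4 → Fin 4 → ℝ, full S x = full S (fun a b => 1 / 2 * (x a b + x b a)) := by
    intro x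
    have h1 := full_symm (x := x) hS
    have h2 : full S (fun a b => 1 / 2 * (x a b + x b a)) =
        1 / 2 * (full S x + full S fun a b => x b a) := by
      unfold full
      simp only [Finset.mul_sum, ← Finset.sum_add_distrib]
      exact Finset.sum_congr rfl fun _ _ => Finset.sum_congr rfl fun _ _ => by ring
    rw [h2, h1]; ring
  have e1 : ∀ a b, ∑ c, B.uφ c z * (1 / 2 * (B.dφ a z * Θ.θ b c z + B.dφ b z * Θ.θ a c z)) =
      1 / 2 * (B.dφ a z * ∑ c, B.uφ c z * Θ.θ b c z + B.dφ b z * ∑ c, B.uφ c z * Θ.θ a c z) := by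
    intro a b
    simp only [Finset.mul_sum, ← Finset.sum_add_distrib]
    exact Finset.sum_congr rfl fun _ _ => by ring
  have e2 : ∀ a b, ∑ c, ∑ d, B.gi c d z *
        (1 / 2 * (B.ddφ d a z * Θ.θ b c z + B.ddφ d b z * Θ.θ a c z)) =
      1 / 2 * (∑ c, ∑ d, B.gi c d z * (B.ddφ d a z * Θ.θ b c z) +
        ∑ c, ∑ d, B.gi c d z * (B.ddφ d b z * Θ.θ a c z)) := by
    intro a b
    simp only [Finset.mul_sum, ← Finset.sum_add_distrib]
    exact Finset.sum_congr rfl fun _ _ => Finset.sum_congr rfl fun _ _ => by ring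
  have e3 : ∀ a b, ∑ c, ∑ d, B.gi c d z * (B.cov22 Θ.θ c a b d z + B.cov22 Θ.θ c b a d z) =
      B.divGrad Θ.θ z a b + B.divGrad Θ.θ z b a := by
    intro a b
    unfold divGrad
    simp only [mul_add, Finset.sum_add_distrib]
  have hP : ∀ a b, B.PbarTensor Θ a b z =
      (-1) * B.box2 Θ.θ z a b + 2 * (1 / 2 * (B.divGrad Θ.θ z a b + B.divGrad Θ.θ z b a))
      + (- B.divdiv2 Θ.θ z) * B.G a b z
      + 4 * B.ξ * B.φ z / B.α z
        * (1 / 2 * (B.dφ a z * B.div2 Θ.θ b z + B.dφ b z * B.div2 Θ.θ a z))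
      + (-(2 * B.ξ * B.φ z / B.α z)) * (∑ c, B.uφ c z * B.cov2 Θ.θ c a b z)
      + (-(2 / B.α z * B.V0 z)) * Θ.θ a b z
      + (-(2 * B.ξ / (B.β z * B.α z) * B.tr Θ.θ z)) * (B.dφ a z * B.dφ b z)
      + 4 * B.ξ * (2 - B.α z) / B.α z ^ 2 * (1 / 2 *
        (B.dφ a z * (∑ c, B.uφ c z * Θ.θ b c z) + B.dφ b z * ∑ c, B.uφ c z * Θ.θ a c z))
      + (-(4 * B.ξ ^ 2 * B.φ z ^ 2 / B.α z ^ 2 * B.nφ z)) * Θ.θ a b z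
      + 4 * B.ξ * B.φ z / B.α z * (1 / 2 * (∑ c, ∑ d, B.gi c d z * (B.ddφ d a z * Θ.θ b c z) +
        ∑ c, ∑ d, B.gi c d z * (B.ddφ d b z * Θ.θ a c z)))
      + (-1) * (1 / 2 * (B.dφ a z * pd b Θ.ζ z + B.dφ b z * pd a Θ.ζ z))
      + (B.κ * B.φ z / B.β z * Θ.ζ z) * (B.dφ a z * B.dφ b z)
      + (1 / 2 * (∑ c, B.uφ c z * pd c Θ.ζ z)
        + (4 * B.ξ * B.φ z * B.V0 z + B.α z * B.V1 z) / (2 * B.β z) * Θ.ζ z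
        - B.κ * B.φ z / (2 * B.β z) * B.nφ z * Θ.ζ z) * B.G a b z := by
    intro a b
    unfold PbarTensor
    rw [e1, e2, e3]
    unfold box2
    ring
  rw [full_congr hP]
  simp only [full_add]
  rw [full_const_mul S (B.box2 Θ.θ z), full_const_mul _ _ 2, full_const_mul S fun a b => B.G a b z,
    full_const_mul S fun a b => 1 / 2 * (B.dφ a z * B.div2 Θ.θ b z + B.dφ b z * B.div2 Θ.θ a z),
    full_const_mul S fun a b => ∑ c, B.uφ c z * B.cov2 Θ.θ c a b z,
    full_const_mul S fun a b => Θ.θ a b z, full_const_mul S fun a b => B.dφ a z * B.dφ b z,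
    full_const_mul S fun a b => 1 / 2 *
        (B.dφ a z * (∑ c, B.uφ c z * Θ.θ b c z) + B.dφ b z * ∑ c, B.uφ c z * Θ.θ a c z),
    full_const_mul S fun a b => Θ.θ a b z,
    full_const_mul S fun a b => (1 / 2 * (∑ c, ∑ d, B.gi c d z * (B.ddφ d a z * Θ.θ b c z) +
        ∑ c, ∑ d, B.gi c d z * (B.ddφ d b z * Θ.θ a c z))),
    full_const_mul S fun a b => (1 / 2 * (B.dφ a z * pd b Θ.ζ z + B.dφ b z * pd a Θ.ζ z)),
    full_const_mul S fun a b => B.dφ a z * B.dφ b z, full_const_mul S fun a b => B.G a b z]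
  rw [← sw (B.divGrad Θ.θ z), ← sw (fun a b => B.dφ a z * B.div2 Θ.θ b z),
    ← sw (fun a b => B.dφ a z * ∑ c, B.uφ c z * Θ.θ b c z),
    ← sw (fun a b => ∑ c, ∑ d, B.gi c d z * (B.ddφ d a z * Θ.θ b c z)),
    ← sw (fun a b => B.dφ a z * pd b Θ.ζ z)]
  ring

end LocalBackground

/-! ### Symmetries of contractions, and the trace of the Einstein equations -/

namespace LocalBackground

/-- Renaming by an involution of the six indices, the index form of transposing a product of three
matrices in `full_raise2_contract_comm`. -/
theorem sum_comm_six' {A : Type*} [AddCommMonoid A]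
    (F : Fin 4 → Fin 4 → Fin 4 → Fin 4 → Fin 4 → Fin 4 → A) :
    ∑ a, ∑ b, ∑ i, ∑ j, ∑ c, ∑ d, F a b i j c d = ∑ a, ∑ b, ∑ i, ∑ j, ∑ c, ∑ d, F d j c b i a := by
  let e : (Fin 4 × Fin 4 × Fin 4 × Fin 4 × Fin 4 × Fin 4) ≃
      (Fin 4 × Fin 4 × Fin 4 × Fin 4 × Fin 4 × Fin 4) :=
    ⟨fun x => (x.2.2.2.2.2, x.2.2.2.1, x.2.2.2.2.1, x.2.1, x.2.2.1, x.1),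
      fun x => (x.2.2.2.2.2, x.2.2.2.1, x.2.2.2.2.1, x.2.1, x.2.2.1, x.1),
      fun _ => rfl, fun _ => rfl⟩
  have := Equiv.sum_comp e fun x => F x.1 x.2.1 x.2.2.1 x.2.2.2.1 x.2.2.2.2.1 x.2.2.2.2.2
  simp only [Fintype.sum_prod_type] at this
  exact this.symm

variable {B : LocalBackground} {U : Set (EuclideanSpace ℝ (Fin 4))}

namespace RegularMetric

variable (h : B.RegularMetric U) {z : EuclideanSpace ℝ (Fin 4)} (hz : z ∈ U)
include h hz

/-- A symmetric tensor acts on covectors as a self-adjoint map for the metric pairing. -/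
theorem gd_mulCovec {s : Fin 4 → Fin 4 → EuclideanSpace ℝ (Fin 4) → ℝ}
    (hs : ∀ x ∈ U, ∀ i j, s i j x = s j i x) (p q : Fin 4 → EuclideanSpace ℝ (Fin 4) → ℝ) :
    B.gd z (fun a => p a z) (fun a => B.mulCovec s q a z) =
      B.gd z (fun a => B.mulCovec s p a z) fun a => q a z := by
  unfold gd mulCovec
  simp only [Finset.mul_sum, Finset.sum_mul]
  refine (Finset.sum_congr rfl fun _ _ => Finset.sum_comm).trans (Finset.sum_comm.trans ?_)
  refine (Finset.sum_congr rfl fun _ _ => Finset.sum_congr rfl fun _ _ => Finset.sum_comm).trans ?_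
  refine (Finset.sum_congr rfl fun _ _ => Finset.sum_comm).trans ?_
  refine (Finset.sum_congr rfl fun _ _ => Finset.sum_congr rfl fun _ _ => Finset.sum_comm).trans ?_
  refine Finset.sum_congr rfl fun a _ => Finset.sum_congr rfl fun b _ => ?_
  refine Finset.sum_congr rfl fun c _ => Finset.sum_congr rfl fun d _ => ?_
  rw [hs z hz c a, h.gi_symm hz d c]
  ring

theorem uφ_sum (w : Fin 4 → ℝ) : ∑ c, B.uφ c z * w c = B.gd z (fun a => B.dφ a z) w := by
  unfold uφ gd
  rw [Finset.sum_comm]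
  simp only [Finset.sum_mul]
  exact Finset.sum_congr rfl fun a _ => Finset.sum_congr rfl fun b _ => by
    rw [h.gi_symm hz a b]; ring

omit h hz in
theorem _root_.LinEKG.LocalBackground.uφ_mulCovec
    (t : Fin 4 → Fin 4 → EuclideanSpace ℝ (Fin 4) → ℝ) (a : Fin 4) :
    ∑ c, B.uφ c z * t a c z = B.mulCovec t B.dφ a z := by
  unfold uφ mulCovec
  simp only [Finset.sum_mul]
  exact Finset.sum_congr rfl fun a _ => Finset.sum_congr rfl fun b _ => by ring

theorem full_gi_box2 {t : Fin 4 → Fin 4 → EuclideanSpace ℝ (Fin 4) → ℝ}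
    (ht : ∀ i j, ContDiffOn ℝ ∞ (t i j) U) :
    full (fun a b => B.gi a b z) (B.box2 t z) = B.div1 (fun c => pd c (B.tr t)) z := by
  unfold div1
  simp only [h.cov1_pd_tr hz ht]
  unfold full box2
  simp only [Finset.mul_sum]
  refine (Finset.sum_congr rfl fun _ _ => Finset.sum_comm).trans (Finset.sum_comm.trans ?_)
  refine Finset.sum_congr rfl fun a _ => ?_
  refine (Finset.sum_congr rfl fun _ _ => Finset.sum_comm).trans (Finset.sum_comm.trans ?_)
  exact Finset.sum_congr rfl fun b _ => Finset.sum_congr rfl fun c _ =>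
    Finset.sum_congr rfl fun d _ => by ring

theorem full_gi_divGrad {t : Fin 4 → Fin 4 → EuclideanSpace ℝ (Fin 4) → ℝ}
    (hsym : ∀ x ∈ U, ∀ i j, t i j x = t j i x) :
    full (fun a b => B.gi a b z) (B.divGrad t z) = B.divdiv2 t z := by
  unfold full divGrad divdiv2
  simp only [Finset.mul_sum]
  refine Finset.sum_comm.trans ?_
  refine (Finset.sum_congr rfl fun _ _ => (Finset.sum_congr rfl fun _ _ =>
    Finset.sum_comm).trans Finset.sum_comm).trans (Finset.sum_comm.trans ?_)
  refine Finset.sum_congr rfl fun d _ => Finset.sum_congr rfl fun b _ => ?_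
  refine Finset.sum_comm.trans ?_
  refine Finset.sum_congr rfl fun c _ => Finset.sum_congr rfl fun a _ => ?_
  rw [cov22_symm h.isOpen hz hsym c a b d, h.gi_symm hz a b, h.gi_symm hz c d]; ring

theorem full_gi_G : full (fun a b => B.gi a b z) (fun a b => B.G a b z) = 4 := by
  unfold full
  have : ∀ a, ∑ b, B.gi a b z * B.G a b z = 1 := by
    intro a
    rw [← (h.gi_mul_G hz a a).trans (if_pos rfl)]
    exact Finset.sum_congr rfl fun b _ => by rw [h.symm z hz a b]
  simp [this]

theorem full_gi_grad {t : Fin 4 → Fin 4 → EuclideanSpace ℝ (Fin 4) → ℝ}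
    (ht : ∀ i j, ContDiffOn ℝ ∞ (t i j) U) :
    full (fun a b => B.gi a b z) (fun a b => ∑ c, B.uφ c z * B.cov2 t c a b z) =
      B.gd z (fun a => B.dφ a z) fun a => pd a (B.tr t) z := by
  rw [← h.uφ_sum hz]
  simp only [h.pd_tr hz ht]
  unfold full tr
  simp only [Finset.mul_sum]
  refine (Finset.sum_congr rfl fun _ _ => Finset.sum_comm).trans (Finset.sum_comm.trans ?_)
  exact Finset.sum_congr rfl fun b _ => Finset.sum_congr rfl fun c _ =>
    Finset.sum_congr rfl fun d _ => by ring

theorem full_raise2_grad (s t : Fin 4 → Fin 4 → EuclideanSpace ℝ (Fin 4) → ℝ) :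
    full (fun a b => B.raise2 s a b z) (fun a b => ∑ c, B.uφ c z * B.cov2 t c a b z) =
      B.gd z (fun a => B.dφ a z) fun c => B.dot2 s (B.cov2 t c) z := by
  rw [← h.uφ_sum hz]
  simp only [dot2_eq_full _ _ _ (h.gi_symm hz)]
  unfold full
  simp only [Finset.mul_sum]
  refine (Finset.sum_congr rfl fun _ _ => Finset.sum_comm).trans (Finset.sum_comm.trans ?_)
  exact Finset.sum_congr rfl fun b _ => Finset.sum_congr rfl fun c _ =>
    Finset.sum_congr rfl fun d _ => by ring

theorem full_gi_contract (r t : Fin 4 → Fin 4 → EuclideanSpace ℝ (Fin 4) → ℝ)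
    (hr : ∀ i j, r i j z = r j i z) :
    full (fun a b => B.gi a b z) (fun a b => ∑ c, ∑ d, B.gi c d z * (r d a z * t b c z)) =
      B.dot2 r t z := by
  unfold full dot2
  simp only [Finset.mul_sum]
  refine (Finset.sum_congr rfl fun _ _ => (Finset.sum_congr rfl fun _ _ => Finset.sum_comm).trans
    Finset.sum_comm).trans ?_
  refine Finset.sum_congr rfl fun a _ => Finset.sum_congr rfl fun d _ =>
    Finset.sum_congr rfl fun c _ => Finset.sum_congr rfl fun b _ => ?_
  rw [hr d a, h.gi_symm hz d b]; ring

/-- Both sides are traces of a product of the three symmetric tensors s, r, t, and transposition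
reverses their order. With r the Hessian of φ, this removes a term of P̄ from the antisymmetrised
identity. -/
theorem full_raise2_contract_comm {s t : Fin 4 → Fin 4 → EuclideanSpace ℝ (Fin 4) → ℝ}
    (r : Fin 4 → Fin 4 → EuclideanSpace ℝ (Fin 4) → ℝ) (hr : ∀ i j, r i j z = r j i z)
    (hs : ∀ x ∈ U, ∀ i j, s i j x = s j i x) (ht : ∀ x ∈ U, ∀ i j, t i j x = t j i x) :
    full (fun a b => B.raise2 s a b z)
        (fun a b => ∑ c, ∑ d, B.gi c d z * (r d a z * t b c z)) =
      full (fun a b => B.raise2 t a b z)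
        (fun a b => ∑ c, ∑ d, B.gi c d z * (r d a z * s b c z)) := by
  have e : ∀ s t : Fin 4 → Fin 4 → EuclideanSpace ℝ (Fin 4) → ℝ,
      full (fun a b => B.raise2 s a b z) (fun a b => ∑ c, ∑ d, B.gi c d z * (r d a z * t b c z)) =
      ∑ a, ∑ b, ∑ i, ∑ j, ∑ c, ∑ d,
        B.gi a i z * B.gi b j z * s i j z * (B.gi c d z * (r d a z * t b c z)) := by
    intro s t
    unfold full raise2
    simp only [Finset.sum_mul]
    simp only [Finset.mul_sum]
  rw [e, e, sum_comm_six']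
  refine Finset.sum_congr rfl fun a _ => Finset.sum_congr rfl fun b _ =>
    Finset.sum_congr rfl fun i _ => Finset.sum_congr rfl fun j _ =>
    Finset.sum_congr rfl fun c _ => Finset.sum_congr rfl fun d _ => ?_
  rw [h.gi_symm hz d c, h.gi_symm hz j b, h.gi_symm hz i a, hr a d, hs z hz c b, ht z hz j i]
  ring

theorem div1_mul_gd {f : EuclideanSpace ℝ (Fin 4) → ℝ} {w : Fin 4 → EuclideanSpace ℝ (Fin 4) → ℝ}
    (hf : ContDiffOn ℝ ∞ f U) (hw : ∀ i, ContDiffOn ℝ ∞ (w i) U) :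
    B.div1 (fun a x => f x * w a x) z =
      B.gd z (fun a => pd a f z) (fun a => w a z) + f z * B.div1 w z := by
  rw [h.div1_mul hz (hf.diffAt h.isOpen hz) hw]
  congr 1
  unfold gd
  simp only [mul_assoc]

/-- The coefficients of the current depend on the point only through φ, so by the chain rule the
gradient of each is p'(φ)∇φ. -/
theorem div1_coeff_mul {p : ℝ → ℝ} {p' : ℝ} {w : Fin 4 → EuclideanSpace ℝ (Fin 4) → ℝ}
    (hp : HasDerivAt p p' (B.φ z)) (hφ : ContDiffOn ℝ ∞ B.φ U)
    (hw : ∀ i, ContDiffOn ℝ ∞ (w i) U) :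
    B.div1 (fun a x => p (B.φ x) * w a x) z =
      p' * B.gd z (fun a => B.dφ a z) (fun a => w a z) + p (B.φ z) * B.div1 w z := by
  have hd := hφ.diffAt h.isOpen hz
  have hf : DifferentiableAt ℝ (fun x => p (B.φ x)) z := hp.differentiableAt.comp z hd
  rw [h.div1_mul hz hf hw]
  simp only [pd_comp_real hp hd]
  congr 1
  unfold gd dφ
  simp only [Finset.mul_sum]
  exact Finset.sum_congr rfl fun _ _ => Finset.sum_congr rfl fun _ _ => by ring

theorem ddφ_symm (hφ : ContDiffOn ℝ ∞ B.φ U) (a b : Fin 4) : B.ddφ a b z = B.ddφ b a z := by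
  unfold ddφ cov1
  rw [show B.dφ b = pd b B.φ from rfl, show B.dφ a = pd a B.φ from rfl,
    pd_pd_comm hφ h.isOpen hz]
  simp only [h.chr_symm hz _ a b]

theorem div1_dot2_grad {s t : Fin 4 → Fin 4 → EuclideanSpace ℝ (Fin 4) → ℝ}
    (hs : ∀ i j, ContDiffOn ℝ ∞ (s i j) U) (ht : ∀ i j, ContDiffOn ℝ ∞ (t i j) U) :
    B.div1 (fun a => B.dot2 s (B.cov2 t a)) z =
      ∑ a, ∑ b, B.gi a b z * B.dot2 (B.cov2 s a) (B.cov2 t b) z +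
        full (fun a b => B.raise2 s a b z) (B.box2 t z) := by
  unfold div1
  simp only [h.cov1_dot2_cov2 hz hs ht, mul_add, Finset.sum_add_distrib]
  congr 1
  simp only [dot2_eq_full _ _ _ (h.gi_symm hz)]
  unfold full box2
  simp only [Finset.mul_sum]
  refine (Finset.sum_congr rfl fun _ _ => Finset.sum_comm).trans (Finset.sum_comm.trans ?_)
  refine Finset.sum_congr rfl fun a _ => ?_
  refine (Finset.sum_congr rfl fun _ _ => Finset.sum_comm).trans (Finset.sum_comm.trans ?_)
  exact Finset.sum_congr rfl fun b _ => Finset.sum_congr rfl fun c _ =>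
    Finset.sum_congr rfl fun d _ => by ring

theorem grad_grad_comm (s t : Fin 4 → Fin 4 → EuclideanSpace ℝ (Fin 4) → ℝ) :
    ∑ a, ∑ b, B.gi a b z * B.dot2 (B.cov2 s a) (B.cov2 t b) z =
      ∑ a, ∑ b, B.gi a b z * B.dot2 (B.cov2 t a) (B.cov2 s b) z := by
  rw [Finset.sum_comm]
  exact Finset.sum_congr rfl fun a _ => Finset.sum_congr rfl fun b _ => by
    rw [h.gi_symm hz b a, h.dot2_comm hz]

end RegularMetric

/-- The trace of the Einstein equations. -/
theorem RegularMetric.trace_EKGAt (h : B.RegularMetric U) {z : EuclideanSpace ℝ (Fin 4)}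
    (hz : z ∈ U) (hE : B.EKGAt z) :
    B.α z * B.scal z + 6 * B.ξ * B.φ z * B.boxφ z + (6 * B.ξ - 1) * B.nφ z - 4 * B.V0 z = 0 := by
  -- The metric has trace four, so the trace of the Einstein tensor is R − 2R.
  have e1 : full (fun a b => B.gi a b z) (fun a b => B.einstein a b z) = -B.scal z := by
    have : ∀ a b, B.einstein a b z = B.ricci a b z + (-(1 / 2 * B.scal z)) * B.G a b z := by
      intro a b; unfold einstein; ring
    rw [full_congr this, full_add, full_const_mul _ (fun a b => B.G a b z), h.full_gi_G hz]
    rw [show full (fun a b => B.gi a b z) (fun a b => B.ricci a b z) = B.scal z from rfl]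
    ring
  have e2 : full (fun a b => B.gi a b z) (fun a b => B.einstein a b z) =
      (1 - 2 * B.ξ) * B.nφ z - 2 * B.ξ * B.φ z * B.boxφ z - B.ξ * B.scal z * B.φ z ^ 2
        + 4 * (2 * B.ξ * B.φ z * B.boxφ z + (2 * B.ξ - 1 / 2) * B.nφ z - B.V0 z) := by
    have : ∀ a b, B.einstein a b z = (1 - 2 * B.ξ) * (B.dφ a z * B.dφ b z) +
        (-(2 * B.ξ * B.φ z)) * B.ddφ a b z + (B.ξ * B.φ z ^ 2) * B.einstein a b z +
        (2 * B.ξ * B.φ z * B.boxφ z + (2 * B.ξ - 1 / 2) * B.nφ z - B.V0 z) * B.G a b z := by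
      intro a b
      -- Only the left occurrence is replaced: the Einstein tensor inside the stress tensor stays
      -- and is traced by `e1`, which produces the coefficient α of R.
      nth_rewrite 1 [hE.1 a b]
      unfold stress; ring
    rw [full_congr this, full_add, full_add, full_add, full_const_mul _ (fun a b => B.G a b z),
      full_const_mul _ (fun a b => B.dφ a z * B.dφ b z), full_const_mul _ (fun a b => B.ddφ a b z),
      full_const_mul _ (fun a b => B.einstein a b z), h.full_gi_G hz, e1]
    rw [show full (fun a b => B.gi a b z) (fun a b => B.ddφ a b z) = B.boxφ z from rfl,
      show full (fun a b => B.gi a b z) (fun a b => B.dφ a z * B.dφ b z) =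
        B.gd z (fun a => B.dφ a z) (fun a => B.dφ a z) from rfl, ← h.uφ_sum hz]
    unfold nφ
    ring
  unfold α
  linear_combination e1 - e2

end LocalBackground

/-! ### The divergence of one half of the current -/

namespace LocalBackground

variable {B : LocalBackground} {U : Set (EuclideanSpace ℝ (Fin 4))}
  {z : EuclideanSpace ℝ (Fin 4)} {Θ₁ Θ₂ : LocalSection}

/-- `P̄ (θ, ζ)` in coordinates. -/
def PbarLoc (B : LocalBackground) (Θ : LocalSection) : LocalSection :=
  ⟨B.PbarTensor Θ, B.PbarScalar Θ⟩

/-- Grouping by coefficient prepares the product rule. The functions α and β are written out in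
terms of φ so that each coefficient is visibly a function of one real variable composed with φ. -/
theorem jhalf_eq (h : B.RegularMetric U) {x : EuclideanSpace ℝ (Fin 4)} (hx : x ∈ U) (a : Fin 4) :
    B.jhalf Θ₁ Θ₂ a x =
      4 / (1 - B.ξ * B.φ x ^ 2) * (2 * B.mulCovec Θ₁.θ (B.div2 Θ₂.θ) a x
        - B.dot2 Θ₁.θ (B.cov2 Θ₂.θ a) x + Θ₁.ζ x * B.mulCovec Θ₂.θ B.dφ a x)
      - (4 * B.ξ ^ 2 * B.φ x ^ 2 - 2 * (1 + B.κ * B.φ x ^ 2)) /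
          ((1 + B.κ * B.φ x ^ 2) * (1 - B.ξ * B.φ x ^ 2)) * (B.tr Θ₁.θ x * pd a (B.tr Θ₂.θ) x)
      - 2 * B.ξ * B.φ x / (1 + B.κ * B.φ x ^ 2) *
          (B.tr Θ₁.θ x * pd a Θ₂.ζ x + Θ₁.ζ x * pd a (B.tr Θ₂.θ) x)
      - (1 - B.ξ * B.φ x ^ 2) / (1 + B.κ * B.φ x ^ 2) * (Θ₁.ζ x * pd a Θ₂.ζ x)
      + 2 * B.ξ * (2 - (1 - B.ξ * B.φ x ^ 2)) /
          ((1 + B.κ * B.φ x ^ 2) * (1 - B.ξ * B.φ x ^ 2)) *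
          (B.tr Θ₁.θ x * (Θ₂.ζ x * B.dφ a x)) := by
  have e1 : ∑ b, ∑ c, ∑ d, ∑ e,
      B.gi b d x * B.gi c e x * Θ₁.θ d e x * B.cov2 Θ₂.θ a b c x = B.dot2 Θ₁.θ (B.cov2 Θ₂.θ a) x := by
    rw [h.dot2_comm hx]
    unfold dot2
    exact Finset.sum_congr rfl fun _ _ => Finset.sum_congr rfl fun _ _ =>
      Finset.sum_congr rfl fun _ _ => Finset.sum_congr rfl fun _ _ => by ring
  have e2 : ∑ c, ∑ d, B.gi c d x * Θ₁.θ a d x * B.div2 Θ₂.θ c x =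
      B.mulCovec Θ₁.θ (B.div2 Θ₂.θ) a x := by
    unfold mulCovec
    rw [Finset.sum_comm]
    exact Finset.sum_congr rfl fun _ _ => Finset.sum_congr rfl fun _ _ => by
      rw [h.gi_symm hx]; ring
  unfold jhalf
  rw [e1, e2, uφ_mulCovec]
  unfold α β
  ring

theorem gd_add_right (p q r : Fin 4 → ℝ) :
    B.gd z p (fun a => q a + r a) = B.gd z p q + B.gd z p r := by
  unfold gd; simp only [mul_add, Finset.sum_add_distrib]

theorem gd_sub_right (p q r : Fin 4 → ℝ) :
    B.gd z p (fun a => q a - r a) = B.gd z p q - B.gd z p r := by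
  unfold gd; simp only [mul_sub, Finset.sum_sub_distrib]

theorem gd_mul_right (p q : Fin 4 → ℝ) (c : ℝ) :
    B.gd z p (fun a => c * q a) = c * B.gd z p q := by
  unfold gd
  simp only [Finset.mul_sum]
  exact Finset.sum_congr rfl fun _ _ => Finset.sum_congr rfl fun _ _ => by ring

/-- The product rule, applied to one group of `jhalf_eq` after the other. Every tensorial
contraction is kept as one scalar, so that the final comparison with P̄ is an identity between such
scalars. -/
theorem div1_jhalf (h : B.Regular U) (h₁ : Θ₁.Regular U) (h₂ : Θ₂.Regular U) (hz : z ∈ U) :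
    B.div1 (B.jhalf Θ₁ Θ₂) z =
      8 * B.ξ * B.φ z / B.α z ^ 2 *
        (2 * B.gd z (fun a => B.dφ a z) (fun a => B.mulCovec Θ₁.θ (B.div2 Θ₂.θ) a z)
          - B.gd z (fun a => B.dφ a z) (fun a => B.dot2 Θ₁.θ (B.cov2 Θ₂.θ a) z)
          + Θ₁.ζ z * B.gd z (fun a => B.dφ a z) (fun a => B.mulCovec Θ₂.θ B.dφ a z))
      + 4 / B.α z *
        (2 * (B.gd z (fun a => B.div2 Θ₁.θ a z) (fun a => B.div2 Θ₂.θ a z) +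
            full (fun a b => B.raise2 Θ₁.θ a b z) fun a b => B.cov1 (B.div2 Θ₂.θ) a b z)
          - (∑ a, ∑ b, B.gi a b z * B.dot2 (B.cov2 Θ₁.θ a) (B.cov2 Θ₂.θ b) z +
            full (fun a b => B.raise2 Θ₁.θ a b z) (B.box2 Θ₂.θ z))
          + (B.gd z (fun a => pd a Θ₁.ζ z) (fun a => B.mulCovec Θ₂.θ B.dφ a z) +
            Θ₁.ζ z * (B.gd z (fun a => B.div2 Θ₂.θ a z) (fun a => B.dφ a z) +
              full (fun a b => B.raise2 Θ₂.θ a b z) fun a b => B.ddφ a b z)))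
      - (((8 * B.ξ ^ 2 * B.φ z - 4 * B.κ * B.φ z) * (B.β z * B.α z) -
            (4 * B.ξ ^ 2 * B.φ z ^ 2 - 2 * B.β z) *
            (2 * B.κ * B.φ z * B.α z - 2 * B.ξ * B.φ z * B.β z)) / (B.β z * B.α z) ^ 2 *
          (B.tr Θ₁.θ z * B.gd z (fun a => B.dφ a z) (fun a => pd a (B.tr Θ₂.θ) z))
        + (4 * B.ξ ^ 2 * B.φ z ^ 2 - 2 * B.β z) / (B.β z * B.α z) *
          (B.gd z (fun a => pd a (B.tr Θ₁.θ) z) (fun a => pd a (B.tr Θ₂.θ) z) +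
            B.tr Θ₁.θ z * B.div1 (fun a => pd a (B.tr Θ₂.θ)) z))
      - ((2 * B.ξ * B.β z - 4 * B.ξ * B.κ * B.φ z ^ 2) / B.β z ^ 2 *
          (B.tr Θ₁.θ z * B.gd z (fun a => B.dφ a z) (fun a => pd a Θ₂.ζ z) +
            Θ₁.ζ z * B.gd z (fun a => B.dφ a z) (fun a => pd a (B.tr Θ₂.θ) z))
        + 2 * B.ξ * B.φ z / B.β z *
          ((B.gd z (fun a => pd a (B.tr Θ₁.θ) z) (fun a => pd a Θ₂.ζ z) +
              B.tr Θ₁.θ z * B.div1 (fun a => pd a Θ₂.ζ) z) +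
            (B.gd z (fun a => pd a Θ₁.ζ z) (fun a => pd a (B.tr Θ₂.θ) z) +
              Θ₁.ζ z * B.div1 (fun a => pd a (B.tr Θ₂.θ)) z)))
      - ((-(2 * B.ξ * B.φ z) * B.β z - 2 * B.κ * B.φ z * B.α z) / B.β z ^ 2 *
          (Θ₁.ζ z * B.gd z (fun a => B.dφ a z) (fun a => pd a Θ₂.ζ z))
        + B.α z / B.β z * (B.gd z (fun a => pd a Θ₁.ζ z) (fun a => pd a Θ₂.ζ z) +
          Θ₁.ζ z * B.div1 (fun a => pd a Θ₂.ζ) z))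
      + ((4 * B.ξ ^ 2 * B.φ z * (B.β z * B.α z) - 2 * B.ξ * (2 - B.α z) *
            (2 * B.κ * B.φ z * B.α z - 2 * B.ξ * B.φ z * B.β z)) / (B.β z * B.α z) ^ 2 *
          (B.tr Θ₁.θ z * (Θ₂.ζ z * B.gd z (fun a => B.dφ a z) (fun a => B.dφ a z)))
        + 2 * B.ξ * (2 - B.α z) / (B.β z * B.α z) *
          (Θ₂.ζ z * B.gd z (fun a => pd a (B.tr Θ₁.θ) z) (fun a => B.dφ a z) +
            B.tr Θ₁.θ z * (B.gd z (fun a => pd a Θ₂.ζ z) (fun a => B.dφ a z) +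
              Θ₂.ζ z * B.boxφ z))) := by
  have hm := h.toRegularMetric
  have hα : 1 - B.ξ * B.φ z ^ 2 ≠ 0 := h.α_ne z hz
  have hβ : 1 + B.κ * B.φ z ^ 2 ≠ 0 := h.β_ne z hz
  have eα : B.α z = 1 - B.ξ * B.φ z ^ 2 := rfl
  have eβ : B.β z = 1 + B.κ * B.φ z ^ 2 := rfl
  have hA : HasDerivAt (fun p => 1 - B.ξ * p ^ 2) (-(2 * B.ξ * B.φ z)) (B.φ z) :=
    (((hasDerivAt_pow 2 (B.φ z)).const_mul B.ξ).const_sub 1).congr_deriv (by simp; ring)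
  have hB : HasDerivAt (fun p => 1 + B.κ * p ^ 2) (2 * B.κ * B.φ z) (B.φ z) :=
    (((hasDerivAt_pow 2 (B.φ z)).const_mul B.κ).const_add 1).congr_deriv (by simp; ring)
  -- The derivatives with respect to φ of the five coefficient functions of `jhalf_eq`; `v1`, `v3`,
  -- `v45`, `v6`, `v7` below are the smooth covector fields that they multiply.
  have c1 : HasDerivAt (fun p => 4 / (1 - B.ξ * p ^ 2)) (8 * B.ξ * B.φ z / B.α z ^ 2) (B.φ z) :=
    ((hasDerivAt_const (B.φ z) (4 : ℝ)).div hA hα).congr_deriv (by rw [eα]; ring)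
  have c3 : HasDerivAt (fun p => (4 * B.ξ ^ 2 * p ^ 2 - 2 * (1 + B.κ * p ^ 2)) /
      ((1 + B.κ * p ^ 2) * (1 - B.ξ * p ^ 2)))
      (((8 * B.ξ ^ 2 * B.φ z - 4 * B.κ * B.φ z) * (B.β z * B.α z) -
            (4 * B.ξ ^ 2 * B.φ z ^ 2 - 2 * B.β z) *
            (2 * B.κ * B.φ z * B.α z - 2 * B.ξ * B.φ z * B.β z)) / (B.β z * B.α z) ^ 2) (B.φ z) :=
    ((((hasDerivAt_pow 2 (B.φ z)).const_mul (4 * B.ξ ^ 2)).sub (hB.const_mul 2)).div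
      (hB.mul hA) (mul_ne_zero hβ hα)).congr_deriv (by
        rw [eα, eβ]; simp only [Pi.mul_apply, Pi.sub_apply]; congr 1; push_cast; ring)
  have c4 : HasDerivAt (fun p => 2 * B.ξ * p / (1 + B.κ * p ^ 2))
      ((2 * B.ξ * B.β z - 4 * B.ξ * B.κ * B.φ z ^ 2) / B.β z ^ 2) (B.φ z) :=
    (((hasDerivAt_id (B.φ z)).const_mul (2 * B.ξ)).div hB hβ).congr_deriv (by
      rw [eβ]; simp only [id]; congr 1; ring)
  have c6 : HasDerivAt (fun p => (1 - B.ξ * p ^ 2) / (1 + B.κ * p ^ 2))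
      ((-(2 * B.ξ * B.φ z) * B.β z - 2 * B.κ * B.φ z * B.α z) / B.β z ^ 2) (B.φ z) :=
    (hA.div hB hβ).congr_deriv (by rw [eα, eβ]; congr 1; ring)
  have c7 : HasDerivAt (fun p => 2 * B.ξ * (2 - (1 - B.ξ * p ^ 2)) /
          ((1 + B.κ * p ^ 2) * (1 - B.ξ * p ^ 2)))
      ((4 * B.ξ ^ 2 * B.φ z * (B.β z * B.α z) - 2 * B.ξ * (2 - B.α z) *
            (2 * B.κ * B.φ z * B.α z - 2 * B.ξ * B.φ z * B.β z)) / (B.β z * B.α z) ^ 2) (B.φ z) :=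
    (((hA.const_sub 2).const_mul (2 * B.ξ)).div (hB.mul hA) (mul_ne_zero hβ hα)).congr_deriv (by
      rw [eα, eβ]; simp only [Pi.mul_apply]; congr 1; ring)
  have sφ := h.smooth_φ
  have sα : ContDiffOn ℝ ∞ (fun x => 1 - B.ξ * B.φ x ^ 2) U := by fun_prop
  have sβ : ContDiffOn ℝ ∞ (fun x => 1 + B.κ * B.φ x ^ 2) U := by fun_prop
  have nα : ∀ x ∈ U, 1 - B.ξ * B.φ x ^ 2 ≠ 0 := h.α_ne
  have nβ : ∀ x ∈ U, 1 + B.κ * B.φ x ^ 2 ≠ 0 := h.β_ne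
  have nαβ : ∀ x ∈ U, (1 + B.κ * B.φ x ^ 2) * (1 - B.ξ * B.φ x ^ 2) ≠ 0 :=
    fun x hx => mul_ne_zero (nβ x hx) (nα x hx)
  have s1 : ContDiffOn ℝ ∞ (fun x => 4 / (1 - B.ξ * B.φ x ^ 2)) U := (contDiffOn_const (c := (4 : ℝ))).div sα nα
  have s3 : ContDiffOn ℝ ∞ (fun x => (4 * B.ξ ^ 2 * B.φ x ^ 2 - 2 * (1 + B.κ * B.φ x ^ 2)) /
          ((1 + B.κ * B.φ x ^ 2) * (1 - B.ξ * B.φ x ^ 2))) U := (((contDiffOn_const (c := (4 * B.ξ ^ 2))).mul (sφ.pow 2)).sub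
    ((contDiffOn_const (c := (2 : ℝ))).mul sβ)).div (sβ.mul sα) nαβ
  have s4 : ContDiffOn ℝ ∞ (fun x => 2 * B.ξ * B.φ x / (1 + B.κ * B.φ x ^ 2)) U := ((contDiffOn_const (c := 2 * B.ξ)).mul sφ).div sβ nβ
  have s6 : ContDiffOn ℝ ∞ (fun x => (1 - B.ξ * B.φ x ^ 2) / (1 + B.κ * B.φ x ^ 2)) U := sα.div sβ nβ
  have s7 : ContDiffOn ℝ ∞ (fun x => 2 * B.ξ * (2 - (1 - B.ξ * B.φ x ^ 2)) /
          ((1 + B.κ * B.φ x ^ 2) * (1 - B.ξ * B.φ x ^ 2))) U := ((contDiffOn_const (c := 2 * B.ξ)).mul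
    ((contDiffOn_const (c := (2 : ℝ))).sub sα)).div (sβ.mul sα) nαβ
  have sdφ : ∀ a, ContDiffOn ℝ ∞ (B.dφ a) U := fun a => sφ.pd h.isOpen a
  have sdiv := hm.contDiffOn_div2 h₂.smooth_θ
  have sw1 : ∀ a, ContDiffOn ℝ ∞ (B.dot2 Θ₁.θ (B.cov2 Θ₂.θ a)) U := fun a =>
    hm.contDiffOn_dot2 h₁.smooth_θ (hm.contDiffOn_cov2 h₂.smooth_θ a)
  have sw2 := hm.contDiffOn_mulCovec h₁.smooth_θ sdiv
  have sw8 := hm.contDiffOn_mulCovec h₂.smooth_θ sdφ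
  have st1 := hm.contDiffOn_tr h₁.smooth_θ
  have st2 := hm.contDiffOn_tr h₂.smooth_θ
  have sdt2 : ∀ a, ContDiffOn ℝ ∞ (pd a (B.tr Θ₂.θ)) U := fun a => st2.pd h.isOpen a
  have sdy : ∀ a, ContDiffOn ℝ ∞ (pd a Θ₂.ζ) U := fun a => h₂.smooth_ζ.pd h.isOpen a
  have sx := h₁.smooth_ζ
  have sy := h₂.smooth_ζ
  have v2 : ∀ a, ContDiffOn ℝ ∞ (fun x => (2 : ℝ) * B.mulCovec Θ₁.θ (B.div2 Θ₂.θ) a x) U :=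
    fun a => contDiffOn_const.mul (sw2 a)
  have v21 : ∀ a, ContDiffOn ℝ ∞ (fun x => 2 * B.mulCovec Θ₁.θ (B.div2 Θ₂.θ) a x
        - B.dot2 Θ₁.θ (B.cov2 Θ₂.θ a) x) U := fun a => (v2 a).sub (sw1 a)
  have v8 : ∀ a, ContDiffOn ℝ ∞ (fun x => Θ₁.ζ x * B.mulCovec Θ₂.θ B.dφ a x) U :=
    fun a => sx.mul (sw8 a)
  have v1 : ∀ a, ContDiffOn ℝ ∞ (fun x => 2 * B.mulCovec Θ₁.θ (B.div2 Θ₂.θ) a x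
        - B.dot2 Θ₁.θ (B.cov2 Θ₂.θ a) x + Θ₁.ζ x * B.mulCovec Θ₂.θ B.dφ a x) U :=
    fun a => (v21 a).add (v8 a)
  have v3 : ∀ a, ContDiffOn ℝ ∞ (fun x => B.tr Θ₁.θ x * pd a (B.tr Θ₂.θ) x) U :=
    fun a => st1.mul (sdt2 a)
  have v4 : ∀ a, ContDiffOn ℝ ∞ (fun x => B.tr Θ₁.θ x * pd a Θ₂.ζ x) U :=
    fun a => st1.mul (sdy a)
  have v5 : ∀ a, ContDiffOn ℝ ∞ (fun x => Θ₁.ζ x * pd a (B.tr Θ₂.θ) x) U :=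
    fun a => sx.mul (sdt2 a)
  have v45 : ∀ a, ContDiffOn ℝ ∞ (fun x => B.tr Θ₁.θ x * pd a Θ₂.ζ x +
      Θ₁.ζ x * pd a (B.tr Θ₂.θ) x) U := fun a => (v4 a).add (v5 a)
  have v6 : ∀ a, ContDiffOn ℝ ∞ (fun x => Θ₁.ζ x * pd a Θ₂.ζ x) U := fun a => sx.mul (sdy a)
  have v7' : ∀ a, ContDiffOn ℝ ∞ (fun x => Θ₂.ζ x * B.dφ a x) U := fun a => sy.mul (sdφ a)
  have v7 : ∀ a, ContDiffOn ℝ ∞ (fun x => B.tr Θ₁.θ x * (Θ₂.ζ x * B.dφ a x)) U :=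
    fun a => st1.mul (v7' a)
  rw [div1_congr hm hz fun x hx a => jhalf_eq hm hx a,
    hm.div1_add hz (fun a => ((((s1.mul (v1 a)).sub (s3.mul (v3 a))).sub (s4.mul (v45 a))).sub
      (s6.mul (v6 a)))) (fun a => s7.mul (v7 a)),
    hm.div1_sub hz (fun a => (((s1.mul (v1 a)).sub (s3.mul (v3 a))).sub (s4.mul (v45 a))))
      (fun a => s6.mul (v6 a)),
    hm.div1_sub hz (fun a => ((s1.mul (v1 a)).sub (s3.mul (v3 a)))) (fun a => s4.mul (v45 a)),
    hm.div1_sub hz (fun a => s1.mul (v1 a)) (fun a => s3.mul (v3 a)),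
    hm.div1_coeff_mul hz c1 sφ v1, hm.div1_coeff_mul hz c3 sφ v3, hm.div1_coeff_mul hz c4 sφ v45,
    hm.div1_coeff_mul hz c6 sφ v6, hm.div1_coeff_mul hz c7 sφ v7,
    hm.div1_add hz v21 v8, hm.div1_sub hz v2 sw1, hm.div1_mul_gd hz contDiffOn_const sw2,
    hm.div1_mul_gd hz sx sw8, hm.div1_mul_gd hz st1 sdt2, hm.div1_add hz v4 v5,
    hm.div1_mul_gd hz st1 sdy, hm.div1_mul_gd hz sx sdt2, hm.div1_mul_gd hz sx sdy,
    hm.div1_mul_gd hz st1 v7', hm.div1_mul_gd hz sy sdφ, hm.div1_mulCovec hz h₁.smooth_θ sdiv,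
    hm.div1_dot2_grad hz h₁.smooth_θ h₂.smooth_θ, hm.div1_mulCovec hz h₂.smooth_θ sdφ]
  simp only [gd_add_right, gd_sub_right, gd_mul_right, pd_const]
  have g0 : ∀ q, B.gd z (fun _ => 0) q = 0 := fun q => by simp [gd]
  rw [g0, show B.div1 B.dφ z = B.boxφ z from rfl,
    show (fun a b => B.cov1 B.dφ a b z) = fun a b => B.ddφ a b z from rfl, eα, eβ]
  ring

end LocalBackground

/-! ### The operator in scalar contractions, and the divergence identity in coordinates -/

namespace LocalBackground

variable {B : LocalBackground} {U : Set (EuclideanSpace ℝ (Fin 4))}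
  {z : EuclideanSpace ℝ (Fin 4)} {Θ Θ₁ Θ₂ : LocalSection}

theorem pairing_comm (h : B.RegularMetric U) (hz : z ∈ U) :
    B.pairing Θ₁ Θ₂ z = B.pairing Θ₂ Θ₁ z := by
  unfold pairing
  rw [h.dot2_comm hz]; ring

/-- The pairing meets the tensor part of P̄ only through its trace and through its contraction with
θ₁. Here and in `dot2_PbarTensor` these are written in the scalars used by `div1_jhalf`. -/
theorem tr_PbarTensor (h : B.Regular U) (hΘ : Θ.Regular U) (hz : z ∈ U) :
    B.tr (B.PbarTensor Θ) z =
      -B.div1 (fun c => pd c (B.tr Θ.θ)) z - 2 * B.divdiv2 Θ.θ z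
      + 4 * B.ξ * B.φ z / B.α z * B.gd z (fun a => B.dφ a z) (fun a => B.div2 Θ.θ a z)
      - 2 * B.ξ * B.φ z / B.α z * B.gd z (fun a => B.dφ a z) (fun a => pd a (B.tr Θ.θ) z)
      - 2 / B.α z * B.V0 z * B.tr Θ.θ z
      - 2 * B.ξ / (B.β z * B.α z) * B.nφ z * B.tr Θ.θ z
      + 4 * B.ξ * (2 - B.α z) / B.α z ^ 2 *
        B.gd z (fun a => B.dφ a z) (fun a => B.mulCovec Θ.θ B.dφ a z)
      - 4 * B.ξ ^ 2 * B.φ z ^ 2 / B.α z ^ 2 * B.nφ z * B.tr Θ.θ z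
      + 4 * B.ξ * B.φ z / B.α z * full (fun a b => B.raise2 Θ.θ a b z) (fun a b => B.ddφ a b z)
      + B.gd z (fun a => B.dφ a z) (fun a => pd a Θ.ζ z)
      - B.κ * B.φ z / B.β z * B.nφ z * Θ.ζ z
      + 2 * (4 * B.ξ * B.φ z * B.V0 z + B.α z * B.V1 z) / B.β z * Θ.ζ z := by
  have hm := h.toRegularMetric
  have n : full (fun a b => B.gi a b z) (fun a b => B.dφ a z * B.dφ b z) = B.nφ z := by
    unfold nφ
    rw [hm.uφ_sum hz]; rfl
  have e := full_PbarTensor (B := B) (z := z) (Θ := Θ) (S := fun a b => B.gi a b z)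
    (hm.gi_symm hz)
  simp only [uφ_mulCovec] at e
  rw [hm.full_gi_box2 hz hΘ.smooth_θ, hm.full_gi_divGrad hz hΘ.symm, hm.full_gi_G hz,
    hm.full_gi_grad hz hΘ.smooth_θ, n,
    hm.full_gi_contract hz B.ddφ Θ.θ (hm.ddφ_symm hz h.smooth_φ), hm.uφ_sum hz,
    hm.dot2_comm hz, dot2_eq_full _ _ _ (hm.gi_symm hz),
    show full (fun a b => B.gi a b z) (fun a b => Θ.θ a b z) = B.tr Θ.θ z from rfl,
    show full (fun a b => B.gi a b z) (fun a b => B.dφ a z * B.div2 Θ.θ b z) =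
      B.gd z (fun a => B.dφ a z) (fun a => B.div2 Θ.θ a z) from rfl,
    show full (fun a b => B.gi a b z) (fun a b => B.dφ a z * B.mulCovec Θ.θ B.dφ b z) =
      B.gd z (fun a => B.dφ a z) (fun a => B.mulCovec Θ.θ B.dφ a z) from rfl,
    show full (fun a b => B.gi a b z) (fun a b => B.dφ a z * pd b Θ.ζ z) =
      B.gd z (fun a => B.dφ a z) (fun a => pd a Θ.ζ z) from rfl] at e
  rw [show B.tr (B.PbarTensor Θ) z =
    full (fun a b => B.gi a b z) (fun a b => B.PbarTensor Θ a b z) from rfl, e]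
  ring

theorem dot2_PbarTensor (h : B.Regular U) (h₁ : Θ₁.Regular U) (hz : z ∈ U) :
    B.dot2 Θ₁.θ (B.PbarTensor Θ) z =
      -full (fun a b => B.raise2 Θ₁.θ a b z) (B.box2 Θ.θ z)
      + 2 * full (fun a b => B.raise2 Θ₁.θ a b z) (B.divGrad Θ.θ z)
      - B.tr Θ₁.θ z * B.divdiv2 Θ.θ z
      + 4 * B.ξ * B.φ z / B.α z *
        B.gd z (fun a => B.dφ a z) (fun a => B.mulCovec Θ₁.θ (B.div2 Θ.θ) a z)
      - 2 * B.ξ * B.φ z / B.α z *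
        B.gd z (fun a => B.dφ a z) (fun a => B.dot2 Θ₁.θ (B.cov2 Θ.θ a) z)
      - 2 / B.α z * B.V0 z * B.dot2 Θ₁.θ Θ.θ z
      - 2 * B.ξ / (B.β z * B.α z) *
        B.gd z (fun a => B.dφ a z) (fun a => B.mulCovec Θ₁.θ B.dφ a z) * B.tr Θ.θ z
      + 4 * B.ξ * (2 - B.α z) / B.α z ^ 2 *
        B.gd z (fun a => B.mulCovec Θ₁.θ B.dφ a z) (fun a => B.mulCovec Θ.θ B.dφ a z)
      - 4 * B.ξ ^ 2 * B.φ z ^ 2 / B.α z ^ 2 * B.nφ z * B.dot2 Θ₁.θ Θ.θ z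
      + 4 * B.ξ * B.φ z / B.α z * full (fun a b => B.raise2 Θ₁.θ a b z)
        (fun a b => ∑ c, ∑ d, B.gi c d z * (B.ddφ d a z * Θ.θ b c z))
      - B.gd z (fun a => pd a Θ.ζ z) (fun a => B.mulCovec Θ₁.θ B.dφ a z)
      + B.κ * B.φ z / B.β z *
        B.gd z (fun a => B.dφ a z) (fun a => B.mulCovec Θ₁.θ B.dφ a z) * Θ.ζ z
      + 1 / 2 * B.tr Θ₁.θ z * B.gd z (fun a => B.dφ a z) (fun a => pd a Θ.ζ z)
      + (4 * B.ξ * B.φ z * B.V0 z + B.α z * B.V1 z) / (2 * B.β z) * B.tr Θ₁.θ z * Θ.ζ z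
      - B.κ * B.φ z / (2 * B.β z) * B.nφ z * B.tr Θ₁.θ z * Θ.ζ z := by
  have hm := h.toRegularMetric
  have e := full_PbarTensor (B := B) (z := z) (Θ := Θ) (S := fun a b => B.raise2 Θ₁.θ a b z)
    (raise2_symm hz h₁.symm)
  simp only [uφ_mulCovec] at e
  have g : full (fun a b => B.raise2 Θ₁.θ a b z) (fun a b => B.G a b z) = B.tr Θ₁.θ z := by
    rw [← dot2_eq_full _ _ _ (hm.gi_symm hz), hm.dot2_comm hz, hm.dot2_G hz]
  have hp : full (fun a b => B.raise2 Θ₁.θ a b z) (fun a b => B.dφ a z * pd b Θ.ζ z) =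
      B.gd z (fun a => pd a Θ.ζ z) (fun a => B.mulCovec Θ₁.θ B.dφ a z) := by
    rw [hm.full_raise2_mul hz Θ₁.θ (fun a => B.dφ a z) (fun b => pd b Θ.ζ),
      hm.gd_mulCovec hz h₁.symm B.dφ (fun b => pd b Θ.ζ), hm.gd_comm hz]
  rw [g, hm.full_raise2_mul hz Θ₁.θ (fun a => B.dφ a z) (B.div2 Θ.θ), hm.full_raise2_grad hz,
    hm.full_raise2_mul hz Θ₁.θ (fun a => B.dφ a z) B.dφ,
    hm.full_raise2_mul hz Θ₁.θ (fun a => B.dφ a z) (B.mulCovec Θ.θ B.dφ),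
    hm.gd_mulCovec hz h₁.symm B.dφ (B.mulCovec Θ.θ B.dφ), hp, hm.uφ_sum hz,
    ← dot2_eq_full _ _ Θ.θ (hm.gi_symm hz)] at e
  rw [dot2_eq_full _ _ _ (hm.gi_symm hz), e]

theorem PbarScalar_eq (h : B.Regular U) (hz : z ∈ U) :
    B.PbarScalar Θ z =
      4 * (B.ξ * B.φ z / B.α z * B.divdiv2 Θ.θ z
        + B.ξ * B.φ z * (2 * B.ξ * B.α z - B.α z - 2 * B.ξ) / (B.β z * B.α z ^ 2)
            * B.V0 z * B.tr Θ.θ z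
        + (B.ξ * B.α z - B.α z - 2 * B.ξ) / (2 * B.β z * B.α z) * B.V1 z * B.tr Θ.θ z
        + B.ξ * B.φ z / (2 * B.β z) * B.V2 z * B.tr Θ.θ z
        + 3 * B.ξ ^ 2 * B.φ z * (4 * B.ξ - B.β z) / (B.β z ^ 2 * B.α z ^ 2) * B.nφ z * B.tr Θ.θ z
        + (4 * B.ξ + B.α z - 4 * B.ξ * B.α z) / B.α z ^ 2 *
          B.gd z (fun a => B.dφ a z) (fun a => B.div2 Θ.θ a z)
        - B.ξ / (B.β z * B.α z) * B.gd z (fun a => B.dφ a z) (fun a => pd a (B.tr Θ.θ) z)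
        + B.ξ * B.φ z * (8 * B.ξ + B.α z - 4 * B.ξ * B.α z) / B.α z ^ 3 *
          B.gd z (fun a => B.dφ a z) (fun a => B.mulCovec Θ.θ B.dφ a z)
        + (4 * B.ξ + B.α z - 4 * B.ξ * B.α z) / B.α z ^ 2 *
          full (fun a b => B.raise2 Θ.θ a b z) (fun a b => B.ddφ a b z))
      - B.div1 (fun c => pd c Θ.ζ) z
      + (B.ξ * B.scal z
        + 2 * B.ξ * (1 + 3 * B.ξ) / B.β z * B.φ z * B.V1 z
        + B.α z / B.β z * B.V2 z
        - 2 * B.κ * (B.κ * B.φ z ^ 2 - 1) * B.nφ z / B.β z ^ 2) * Θ.ζ z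
      + 2 * B.κ * B.φ z / B.β z * B.gd z (fun a => B.dφ a z) (fun a => pd a Θ.ζ z) := by
  have hm := h.toRegularMetric
  have e1 : ∑ a, ∑ b, B.uφ a z * B.uφ b z * Θ.θ a b z =
      B.gd z (fun a => B.dφ a z) (fun a => B.mulCovec Θ.θ B.dφ a z) := by
    rw [← hm.uφ_sum hz]
    refine Finset.sum_congr rfl fun a _ => ?_
    rw [← uφ_mulCovec, Finset.mul_sum]
    exact Finset.sum_congr rfl fun b _ => by ring
  unfold PbarScalar
  rw [e1, hm.uφ_sum hz, hm.uφ_sum hz, hm.uφ_sum hz, hm.dot2_comm hz,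
    dot2_eq_full _ _ _ (hm.gi_symm hz)]
  rfl

theorem contDiffOn_jhalf (h : B.Regular U) (h₁ : Θ₁.Regular U) (h₂ : Θ₂.Regular U) (a : Fin 4) :
    ContDiffOn ℝ ∞ (B.jhalf Θ₁ Θ₂ a) U := by
  have hm := h.toRegularMetric
  have sφ := h.smooth_φ
  have nα : ∀ x ∈ U, 1 - B.ξ * B.φ x ^ 2 ≠ 0 := h.α_ne
  have nβ : ∀ x ∈ U, 1 + B.κ * B.φ x ^ 2 ≠ 0 := h.β_ne
  have sα : ContDiffOn ℝ ∞ (fun x => 1 - B.ξ * B.φ x ^ 2) U := by fun_prop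
  have sβ : ContDiffOn ℝ ∞ (fun x => 1 + B.κ * B.φ x ^ 2) U := by fun_prop
  have ia := sα.inv nα
  have ib := sβ.inv nβ
  have sdφ : ∀ a, ContDiffOn ℝ ∞ (B.dφ a) U := fun a => sφ.pd h.isOpen a
  have sw1 := hm.contDiffOn_dot2 h₁.smooth_θ (hm.contDiffOn_cov2 h₂.smooth_θ a)
  have sw2 := hm.contDiffOn_mulCovec h₁.smooth_θ (hm.contDiffOn_div2 h₂.smooth_θ) a
  have sw8 := hm.contDiffOn_mulCovec h₂.smooth_θ sdφ a
  have st1 := hm.contDiffOn_tr h₁.smooth_θ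
  have sdt2 := (hm.contDiffOn_tr h₂.smooth_θ).pd h.isOpen a
  have sdy := h₂.smooth_ζ.pd h.isOpen a
  have sx := h₁.smooth_ζ
  have sy := h₂.smooth_ζ
  have sda := sdφ a
  refine ContDiffOn.congr (f := fun x => _) ?_ fun x hx => jhalf_eq hm hx a
  simp only [div_eq_mul_inv, mul_inv]
  fun_prop

theorem contDiffOn_current (h : B.Regular U) (h₁ : Θ₁.Regular U) (h₂ : Θ₂.Regular U) (a : Fin 4) :
    ContDiffOn ℝ ∞ (B.current Θ₁ Θ₂ a) U :=
  (contDiffOn_jhalf h h₁ h₂ a).sub (contDiffOn_jhalf h h₂ h₁ a)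

set_option maxRecDepth 100000 in
set_option maxHeartbeats 4000000 in
/-- The divergence of the current, in coordinates. -/
theorem div1_current (h : B.Regular U) (h₁ : Θ₁.Regular U) (h₂ : Θ₂.Regular U) (hz : z ∈ U)
    (hE : B.EKGAt z) :
    B.div1 (B.current Θ₁ Θ₂) z =
      B.pairing Θ₁ (B.PbarLoc Θ₂) z - B.pairing (B.PbarLoc Θ₁) Θ₂ z := by
  have hm := h.toRegularMetric
  rw [show B.current Θ₁ Θ₂ = fun a x => B.jhalf Θ₁ Θ₂ a x - B.jhalf Θ₂ Θ₁ a x from rfl,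
    hm.div1_sub hz (contDiffOn_jhalf h h₁ h₂) (contDiffOn_jhalf h h₂ h₁),
    div1_jhalf h h₁ h₂ hz, div1_jhalf h h₂ h₁ hz, pairing_comm hm hz (Θ₁ := B.PbarLoc Θ₁)]
  unfold pairing PbarLoc
  simp only []
  rw [dot2_PbarTensor h h₁ hz, dot2_PbarTensor h h₂ hz, tr_PbarTensor h h₁ hz,
    tr_PbarTensor h h₂ hz, PbarScalar_eq h hz, PbarScalar_eq h hz]
  have hα : B.α z ≠ 0 := h.α_ne z hz
  have hβ : B.β z ≠ 0 := h.β_ne z hz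
  -- The background equations enter only here: the trace of the Einstein equations and the
  -- Klein-Gordon equation.
  have eT := hm.trace_EKGAt hz hE
  have eK := hE.2
  -- P̄ contains ∇^c∇_aθ_{bc}, whereas the divergence of the current produces ∇_a∇^cθ_{bc}; after
  -- antisymmetrisation the two may be exchanged.
  have eC := hm.commutator_antisymm hz h₁.smooth_θ h₂.smooth_θ h₁.symm h₂.symm
  have eZ := hm.full_raise2_contract_comm hz B.ddφ (hm.ddφ_symm hz h.smooth_φ) h₁.symm h₂.symm
  have en : B.gd z (fun a => B.dφ a z) (fun a => B.dφ a z) = B.nφ z := by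
    unfold nφ
    rw [hm.uφ_sum hz]
  -- Every symmetric contraction is brought to one fixed order, so that equal quantities become
  -- identical symbols.
  rw [hm.grad_grad_comm hz Θ₂.θ Θ₁.θ, hm.dot2_comm hz Θ₂.θ Θ₁.θ, eZ, en,
    hm.gd_comm hz (fun a => B.mulCovec Θ₂.θ B.dφ a z) (fun a => B.mulCovec Θ₁.θ B.dφ a z),
    hm.gd_comm hz (fun a => B.div2 Θ₂.θ a z) (fun a => B.div2 Θ₁.θ a z),
    hm.gd_comm hz (fun a => pd a Θ₂.ζ z) (fun a => pd a Θ₁.ζ z),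
    hm.gd_comm hz (fun a => pd a (B.tr Θ₂.θ) z) (fun a => pd a (B.tr Θ₁.θ) z),
    hm.gd_comm hz (fun a => B.div2 Θ₂.θ a z) (fun a => B.dφ a z),
    hm.gd_comm hz (fun a => B.div2 Θ₁.θ a z) (fun a => B.dφ a z),
    hm.gd_comm hz (fun a => pd a Θ₂.ζ z) (fun a => B.dφ a z),
    hm.gd_comm hz (fun a => pd a Θ₁.ζ z) (fun a => B.dφ a z),
    hm.gd_comm hz (fun a => pd a (B.tr Θ₂.θ) z) (fun a => B.dφ a z),
    hm.gd_comm hz (fun a => pd a (B.tr Θ₁.θ) z) (fun a => B.dφ a z),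
    hm.gd_comm hz (fun a => pd a Θ₂.ζ z) (fun a => pd a (B.tr Θ₁.θ) z),
    hm.gd_comm hz (fun a => pd a Θ₁.ζ z) (fun a => pd a (B.tr Θ₂.θ) z)]
  have eC' := sub_eq_iff_eq_add.1 eC
  rw [eC']
  -- The wave operator applied to φ is eliminated by the Klein-Gordon equation, also inside the
  -- trace equation.
  have eB : B.boxφ z = B.ξ * B.scal z * B.φ z + B.V1 z := by linear_combination -eK
  rw [eB] at eT
  rw [eB]
  have ea : B.α z = 1 - B.ξ * B.φ z ^ 2 := rfl
  have eb : B.β z = 1 + (6 * B.ξ - 1) * B.ξ * B.φ z ^ 2 := rfl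
  have ek : B.κ = (6 * B.ξ - 1) * B.ξ := rfl
  -- The coefficient of R in the trace equation becomes α + 6ξ²φ² = β, which is nonzero, so R can be
  -- solved for.
  have eS : B.scal z = (-(6 * B.ξ * B.φ z * B.V1 z) - (6 * B.ξ - 1) * B.nφ z + 4 * B.V0 z) / B.β z := by
    rw [eq_div_iff hβ, eb]
    rw [ea] at eT
    linear_combination eT
  rw [eS, ek]
  -- What remains is an identity of rational functions in independent quantities.
  generalize B.ξ = ξ at *
  generalize B.φ z = φ at *
  generalize B.α z = α at *
  generalize B.β z = β at *
  generalize B.V0 z = V0 at *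
  generalize B.V1 z = V1 at *
  generalize B.V2 z = V2 at *
  generalize B.nφ z = n at *
  generalize B.tr Θ₁.θ z = t1
  generalize B.tr Θ₂.θ z = t2
  generalize Θ₁.ζ z = x
  generalize Θ₂.ζ z = y
  clear eT eK eC eZ en eC' eB ek eS
  generalize B.gd z (fun a => B.dφ a z) (fun a => B.mulCovec Θ₁.θ (B.div2 Θ₂.θ) a z) = A1
  generalize B.gd z (fun a => B.dφ a z) (fun a => B.mulCovec Θ₂.θ (B.div2 Θ₁.θ) a z) = A2
  generalize B.gd z (fun a => B.dφ a z) (fun a => B.dot2 Θ₁.θ (B.cov2 Θ₂.θ a) z) = A3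
  generalize B.gd z (fun a => B.dφ a z) (fun a => B.dot2 Θ₂.θ (B.cov2 Θ₁.θ a) z) = A4
  generalize B.gd z (fun a => B.dφ a z) (fun a => B.mulCovec Θ₁.θ B.dφ a z) = A5
  generalize B.gd z (fun a => B.dφ a z) (fun a => B.mulCovec Θ₂.θ B.dφ a z) = A6
  generalize B.gd z (fun a => B.dφ a z) (fun a => B.div2 Θ₁.θ a z) = A7
  generalize B.gd z (fun a => B.dφ a z) (fun a => B.div2 Θ₂.θ a z) = A8
  generalize B.gd z (fun a => B.dφ a z) (fun a => pd a (B.tr Θ₁.θ) z) = A9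
  generalize B.gd z (fun a => B.dφ a z) (fun a => pd a (B.tr Θ₂.θ) z) = A10
  generalize B.gd z (fun a => B.dφ a z) (fun a => pd a Θ₁.ζ z) = A11
  generalize B.gd z (fun a => B.dφ a z) (fun a => pd a Θ₂.ζ z) = A12
  -- α and β are opaque while denominators are cleared. Their relation to φ and ξ is needed only for
  -- the resulting polynomial identity.
  field_simp
  rw [ea, eb]
  ring

end LocalBackground

/-! ## Coordinate changes -/

/-- The Jacobian matrix `∂_i ψ^k`. -/
def jac (ψ : EuclideanSpace ℝ (Fin 4) → EuclideanSpace ℝ (Fin 4)) (k i : Fin 4)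
    (z : EuclideanSpace ℝ (Fin 4)) : ℝ := pd i (fun w => ψ w k) z

/-- Pull-back of covectors, and of covariant tensors of rank two and three, at a point. -/
def pull1 (J : Fin 4 → Fin 4 → ℝ) (w : Fin 4 → ℝ) (a : Fin 4) : ℝ := ∑ p, J p a * w p

def pull2 (J : Fin 4 → Fin 4 → ℝ) (t : Fin 4 → Fin 4 → ℝ) (a b : Fin 4) : ℝ :=
  ∑ p, ∑ q, J p a * J q b * t p q

section Jacobian

variable {U U' : Set (EuclideanSpace ℝ (Fin 4))} {z : EuclideanSpace ℝ (Fin 4)}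
  {ψ : EuclideanSpace ℝ (Fin 4) → EuclideanSpace ℝ (Fin 4)}

theorem jac_eq_fderiv (hψ : DifferentiableAt ℝ ψ z) (p i : Fin 4) :
    jac ψ p i z = fderiv ℝ ψ z (EuclideanSpace.single i 1) p := by
  unfold jac pd
  have : HasFDerivAt (fun w => ψ w p)
      ((EuclideanSpace.proj p : EuclideanSpace ℝ (Fin 4) →L[ℝ] ℝ).comp (fderiv ℝ ψ z)) z :=
    (EuclideanSpace.proj p : EuclideanSpace ℝ (Fin 4) →L[ℝ] ℝ).hasFDerivAt.comp z hψ.hasFDerivAt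
  rw [this.fderiv]; rfl

theorem pd_comp {f : EuclideanSpace ℝ (Fin 4) → ℝ} (hf : DifferentiableAt ℝ f (ψ z))
    (hψ : DifferentiableAt ℝ ψ z) (i : Fin 4) :
    pd i (fun w => f (ψ w)) z = ∑ p, jac ψ p i z * pd p f (ψ z) := by
  have hv : ∀ v : EuclideanSpace ℝ (Fin 4), v = ∑ p, v p • EuclideanSpace.single p (1 : ℝ) := by
    intro v; ext k; simp [Finset.sum_apply, Pi.single_apply]
  unfold pd
  rw [show (fun w => f (ψ w)) = f ∘ ψ from rfl, fderiv_comp z hf hψ]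
  simp only [ContinuousLinearMap.comp_apply]
  rw [hv (fderiv ℝ ψ z (EuclideanSpace.single i 1)), map_sum]
  simp only [map_smul, smul_eq_mul, jac_eq_fderiv hψ]

theorem contDiffOn_jac (hU : IsOpen U) (hψ : ContDiffOn ℝ ∞ ψ U) (k i : Fin 4) :
    ContDiffOn ℝ ∞ (jac ψ k i) U :=
  ContDiffOn.pd (((EuclideanSpace.proj k : EuclideanSpace ℝ (Fin 4) →L[ℝ] ℝ).contDiff).comp_contDiffOn
    hψ) hU i

theorem pd_jac_comm (hU : IsOpen U) (hψ : ContDiffOn ℝ ∞ ψ U) (hz : z ∈ U) (k i j : Fin 4) :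
    pd i (jac ψ k j) z = pd j (jac ψ k i) z :=
  pd_pd_comm (((EuclideanSpace.proj k : EuclideanSpace ℝ (Fin 4) →L[ℝ] ℝ).contDiff).comp_contDiffOn
    hψ) hU hz

/-- Besides the pulled-back derivative a term with second derivatives of ψ appears. It cancels
against the inhomogeneous term in the transformation law of the Christoffel symbols. -/
theorem pd_pull1 (hU : IsOpen U) (hU' : IsOpen U') (hψ : ContDiffOn ℝ ∞ ψ U) (hm : MapsTo ψ U U')
    (hz : z ∈ U) {w : Fin 4 → EuclideanSpace ℝ (Fin 4) → ℝ} (hw : ∀ i, ContDiffOn ℝ ∞ (w i) U')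
    (a b : Fin 4) :
    pd a (fun x => pull1 (fun p i => jac ψ p i x) (fun p => w p (ψ x)) b) z =
      ∑ p, pd a (jac ψ p b) z * w p (ψ z) +
        pull2 (fun p i => jac ψ p i z) (fun p q => pd p (w q) (ψ z)) a b := by
  have dj := fun p i => (contDiffOn_jac hU hψ p i).diffAt hU hz
  have dψ : DifferentiableAt ℝ ψ z :=
    ((hψ z hz).contDiffAt (hU.mem_nhds hz)).differentiableAt (by simp)
  have dw := fun p => (hw p).diffAt hU' (hm hz)
  have dwψ : ∀ p, DifferentiableAt ℝ (fun x => w p (ψ x)) z := fun p => (dw p).comp z dψ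
  unfold pull1 pull2
  beta_reduce
  rw [pd_sum _ (by intros; fun_prop), Finset.sum_comm, ← Finset.sum_add_distrib]
  refine Finset.sum_congr rfl fun q _ => ?_
  rw [pd_mul (dj q b) (dwψ q), pd_comp (dw q) dψ, Finset.mul_sum]
  congr 1
  exact Finset.sum_congr rfl fun p _ => by ring

theorem pd_pull2 (hU : IsOpen U) (hU' : IsOpen U') (hψ : ContDiffOn ℝ ∞ ψ U) (hm : MapsTo ψ U U')
    (hz : z ∈ U) {t : Fin 4 → Fin 4 → EuclideanSpace ℝ (Fin 4) → ℝ}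
    (ht : ∀ i j, ContDiffOn ℝ ∞ (t i j) U') (a b c : Fin 4) :
    pd a (fun x => pull2 (fun p i => jac ψ p i x) (fun p q => t p q (ψ x)) b c) z =
      ∑ p, ∑ q, pd a (jac ψ p b) z * jac ψ q c z * t p q (ψ z) +
      ∑ p, ∑ q, jac ψ p b z * pd a (jac ψ q c) z * t p q (ψ z) +
        ∑ r, jac ψ r a z * pull2 (fun p i => jac ψ p i z) (fun p q => pd r (t p q) (ψ z)) b c := by
  have dj := fun p i => (contDiffOn_jac hU hψ p i).diffAt hU hz
  have dψ : DifferentiableAt ℝ ψ z :=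
    ((hψ z hz).contDiffAt (hU.mem_nhds hz)).differentiableAt (by simp)
  have dt := fun p q => (ht p q).diffAt hU' (hm hz)
  have dtψ : ∀ p q, DifferentiableAt ℝ (fun x => t p q (ψ x)) z := fun p q => (dt p q).comp z dψ
  unfold pull2
  have e : ∑ r, jac ψ r a z * ∑ p, ∑ q, jac ψ p b z * jac ψ q c z * pd r (t p q) (ψ z) =
      ∑ p, ∑ q, jac ψ p b z * jac ψ q c z * ∑ r, jac ψ r a z * pd r (t p q) (ψ z) := by
    simp only [Finset.mul_sum]
    refine Finset.sum_comm.trans (Finset.sum_congr rfl fun p _ => ?_)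
    refine Finset.sum_comm.trans (Finset.sum_congr rfl fun q _ => ?_)
    exact Finset.sum_congr rfl fun r _ => by ring
  rw [e, pd_sum _ (by intros; fun_prop)]
  simp only [← Finset.sum_add_distrib]
  refine Finset.sum_congr rfl fun p _ => ?_
  rw [pd_sum _ (by intros; fun_prop)]
  refine Finset.sum_congr rfl fun q _ => ?_
  rw [pd_mul (by fun_prop) (dtψ p q), pd_mul (dj p b) (dj q c), pd_comp (dt p q) dψ]
  ring

end Jacobian

/-! ### Transformation laws of the metric and of the Levi-Civita connection -/

namespace LocalBackground

/-- The metric of `B` on `U` is the pull-back of the metric of `B'` on `U'` under `ψ`. -/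
structure MetricChange (B B' : LocalBackground) (U U' : Set (EuclideanSpace ℝ (Fin 4)))
    (ψ : EuclideanSpace ℝ (Fin 4) → EuclideanSpace ℝ (Fin 4)) : Prop where
  left : B.RegularMetric U
  right : B'.RegularMetric U'
  smooth : ContDiffOn ℝ ∞ ψ U
  mapsTo : MapsTo ψ U U'
  metric : ∀ z ∈ U, ∀ a b,
    B.G a b z = pull2 (fun p i => jac ψ p i z) (fun p q => B'.G p q (ψ z)) a b

theorem pull2_eq (J t : Fin 4 → Fin 4 → ℝ) (a b : Fin 4) :
    pull2 J t a b = ((Matrix.of J).transpose * Matrix.of t * Matrix.of J) a b := by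
  simp only [pull2, Matrix.mul_apply, Matrix.transpose_apply, Matrix.of_apply, Finset.sum_mul]
  rw [Finset.sum_comm]
  exact Finset.sum_congr rfl fun p _ => Finset.sum_congr rfl fun q _ => by ring

namespace MetricChange

variable {B B' : LocalBackground} {U U' : Set (EuclideanSpace ℝ (Fin 4))}
  {ψ : EuclideanSpace ℝ (Fin 4) → EuclideanSpace ℝ (Fin 4)} (h : B.MetricChange B' U U' ψ)
  {z : EuclideanSpace ℝ (Fin 4)} (hz : z ∈ U)
include h hz

theorem metric_mat : (Matrix.of fun a b => B.G a b z) =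
    (Matrix.of fun p i => jac ψ p i z).transpose * (Matrix.of fun p q => B'.G p q (ψ z)) *
      Matrix.of fun p i => jac ψ p i z := by
  ext a b
  rw [← pull2_eq]
  exact h.metric z hz a b

theorem det_jac_ne : (Matrix.of fun p i => jac ψ p i z).det ≠ 0 := by
  intro h0
  have := h.left.det_ne z hz
  rw [h.metric_mat hz, Matrix.det_mul, h0, mul_zero] at this
  exact this rfl

theorem inv_mat : (Matrix.of fun a b => B'.gi a b (ψ z)) =
    (Matrix.of fun p i => jac ψ p i z) * (Matrix.of fun a b => B.gi a b z) *
      (Matrix.of fun p i => jac ψ p i z).transpose := by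
  set J := Matrix.of fun p i => jac ψ p i z with hJ
  have uJ : IsUnit J.det := isUnit_iff_ne_zero.2 (h.det_jac_ne hz)
  have e : (Matrix.of fun a b => B.gi a b z) = (Matrix.of fun a b => B.G a b z)⁻¹ := rfl
  have e' : (Matrix.of fun a b => B'.gi a b (ψ z)) = (Matrix.of fun a b => B'.G a b (ψ z))⁻¹ := rfl
  have uT : IsUnit J.transpose.det := by rwa [Matrix.det_transpose]
  rw [e, e', h.metric_mat hz, ← hJ, Matrix.mul_inv_rev, Matrix.mul_inv_rev]
  rw [show J * (J⁻¹ * ((Matrix.of fun p q => B'.G p q (ψ z))⁻¹ * J.transpose⁻¹)) * J.transpose =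
    (J * J⁻¹) * (Matrix.of fun p q => B'.G p q (ψ z))⁻¹ * (J.transpose⁻¹ * J.transpose) by
      noncomm_ring, Matrix.mul_nonsing_inv _ uJ, Matrix.nonsing_inv_mul _ uT, one_mul, mul_one]

theorem gi_eq (p q : Fin 4) : B'.gi p q (ψ z) =
    ∑ a, ∑ b, jac ψ p a z * jac ψ q b z * B.gi a b z := by
  have := congrFun₂ (h.inv_mat hz) p q
  simp only [Matrix.mul_apply, Matrix.transpose_apply, Matrix.of_apply, Finset.sum_mul] at this
  rw [this, Finset.sum_comm]
  exact Finset.sum_congr rfl fun p _ => Finset.sum_congr rfl fun q _ => by ring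

/-- The transformation law of the Christoffel symbols. -/
theorem chr_eq (m i j : Fin 4) : ∑ k, jac ψ m k z * B.chr k i j z =
    pull2 (fun p i => jac ψ p i z) (fun p q => B'.chr m p q (ψ z)) i j + pd i (jac ψ m j) z := by
  -- `R` is the asserted right-hand side. In `hpd` the derivative of the pulled-back metric splits
  -- into two terms `K`, containing second derivatives of ψ, and the tensorial term `D`.
  set R : Fin 4 → ℝ := fun r =>
    pull2 (fun p i => jac ψ p i z) (fun p q => B'.chr r p q (ψ z)) i j + pd i (jac ψ r j) z with hR
  set K : Fin 4 → Fin 4 → Fin 4 → ℝ := fun m i j =>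
    ∑ k, ∑ l, pd m (jac ψ k i) z * jac ψ l j z * B'.G k l (ψ z) with hK
  set D : Fin 4 → Fin 4 → Fin 4 → ℝ := fun m i j => ∑ r, jac ψ r m z *
    pull2 (fun p i => jac ψ p i z) (fun p q => pd r (B'.G p q) (ψ z)) i j with hD
  have hpd : ∀ m i j, pd m (B.G i j) z = K m i j + K m j i + D m i j := by
    intro m i j
    rw [pd_congr (g := fun x => pull2 (fun p i => jac ψ p i x) (fun p q => B'.G p q (ψ x)) i j),
      pd_pull2 h.left.isOpen h.right.isOpen h.smooth h.mapsTo hz h.right.smooth]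
    · congr 2
      simp only [hK]
      rw [Finset.sum_comm]
      exact Finset.sum_congr rfl fun k _ => Finset.sum_congr rfl fun l _ => by
        rw [h.right.symm _ (h.mapsTo hz) l k]; ring
    · filter_upwards [h.left.isOpen.mem_nhds hz] with x hx using h.metric x hx i j
  -- Symmetry of second derivatives. In the Christoffel combination four of the six terms `K` cancel
  -- and the other two agree.
  have hKs : ∀ m i j, K m i j = K i m j := by
    intro m i j
    simp only [hK, pd_jac_comm h.left.isOpen h.smooth hz _ m i]
  -- The law is proved with its free index lowered, where the symbols of the first kind can be
  -- compared directly.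
  have hlow : ∀ m, ∑ k, B.G m k z * B.chr k i j z =
      ∑ l, jac ψ l m z * ∑ r, B'.G l r (ψ z) * R r := by
    intro m
    rw [h.left.lower_chr hz, hpd, hpd, hpd]
    have e1 : ∑ l, jac ψ l m z * ∑ r, B'.G l r (ψ z) * R r =
        ∑ l, jac ψ l m z * ∑ r, B'.G l r (ψ z) * pull2 (fun p i => jac ψ p i z)
          (fun p q => B'.chr r p q (ψ z)) i j + K i j m := by
      simp only [hR, hK, mul_add, Finset.sum_add_distrib, add_right_inj]
      simp only [Finset.mul_sum]
      rw [Finset.sum_comm]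
      exact Finset.sum_congr rfl fun k _ => Finset.sum_congr rfl fun l _ => by
        rw [h.right.symm _ (h.mapsTo hz) l k]; ring
    have e2 : ∀ l, ∑ r, B'.G l r (ψ z) * pull2 (fun p i => jac ψ p i z)
          (fun p q => B'.chr r p q (ψ z)) i j =
        ∑ p, ∑ q, jac ψ p i z * jac ψ q j z * (1 / 2 * (pd p (B'.G q l) (ψ z) +
          pd q (B'.G p l) (ψ z) - pd l (B'.G p q) (ψ z))) := by
      intro l
      simp only [← h.right.lower_chr (h.mapsTo hz), pull2, Finset.mul_sum]
      refine Finset.sum_comm.trans (Finset.sum_congr rfl fun p _ => ?_)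
      refine Finset.sum_comm.trans (Finset.sum_congr rfl fun q _ => ?_)
      exact Finset.sum_congr rfl fun r _ => by ring
    have e3 : ∑ l, jac ψ l m z * ∑ r, B'.G l r (ψ z) * pull2 (fun p i => jac ψ p i z)
          (fun p q => B'.chr r p q (ψ z)) i j = 1 / 2 * (D i j m + D j i m - D m i j) := by
      simp only [e2]
      simp only [hD, pull2, Finset.mul_sum, mul_add, mul_sub, Finset.sum_add_distrib,
        Finset.sum_sub_distrib]
      congr 1
      · congr 1
        · refine Finset.sum_comm.trans (Finset.sum_congr rfl fun p _ => ?_)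
          refine Finset.sum_comm.trans (Finset.sum_congr rfl fun q _ => ?_)
          exact Finset.sum_congr rfl fun r _ => by ring
        · refine (Finset.sum_congr rfl fun _ _ => Finset.sum_comm).trans ?_
          refine Finset.sum_comm.trans (Finset.sum_congr rfl fun p _ => ?_)
          refine Finset.sum_comm.trans (Finset.sum_congr rfl fun q _ => ?_)
          exact Finset.sum_congr rfl fun r _ => by ring
      · exact Finset.sum_congr rfl fun p _ => Finset.sum_congr rfl fun q _ =>
          Finset.sum_congr rfl fun r _ => by ring
    rw [e1, e3, hKs i m j, hKs j m i, hKs j i m]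
    ring
  set J := Matrix.of fun p i => jac ψ p i z with hJ
  set G' := Matrix.of fun p q => B'.G p q (ψ z) with hG'
  have uT : IsUnit J.transpose.det := by
    rw [Matrix.det_transpose]; exact isUnit_iff_ne_zero.2 (h.det_jac_ne hz)
  have uG : IsUnit G'.det := isUnit_iff_ne_zero.2 (h.right.det_ne _ (h.mapsTo hz))
  -- The lowered identity says that both sides of the law have the same image under JᵀG', and this
  -- matrix is invertible.
  have hv : (J.transpose * G').mulVec (J.mulVec fun k => B.chr k i j z) =
      (J.transpose * G').mulVec R := by
    rw [Matrix.mulVec_mulVec, ← h.metric_mat hz]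
    ext m
    rw [← Matrix.mulVec_mulVec]
    exact hlow m
  have uJG : IsUnit (J.transpose * G') := (Matrix.isUnit_iff_isUnit_det _).2 (by
    rw [Matrix.det_mul]; exact uT.mul uG)
  exact congrFun (Matrix.mulVec_injective_of_isUnit uJG hv) m

/-- The second derivatives of ψ from `pd_pull1` and from `chr_eq` are contracted with the same
components and cancel; what remains is tensorial. -/
theorem cov1_eq {w w' : Fin 4 → EuclideanSpace ℝ (Fin 4) → ℝ} (hw' : ∀ i, ContDiffOn ℝ ∞ (w' i) U')
    (hw : ∀ x ∈ U, ∀ a, w a x = pull1 (fun p i => jac ψ p i x) (fun p => w' p (ψ x)) a)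
    (a b : Fin 4) :
    B.cov1 w a b z =
      pull2 (fun p i => jac ψ p i z) (fun p q => B'.cov1 w' p q (ψ z)) a b := by
  unfold cov1
  rw [pd_congr (g := fun x => pull1 (fun p i => jac ψ p i x) (fun p => w' p (ψ x)) b),
    pd_pull1 h.left.isOpen h.right.isOpen h.smooth h.mapsTo hz hw']
  · have e : ∑ l, B.chr l a b z * w l z = ∑ p, w' p (ψ z) * (pull2 (fun p i => jac ψ p i z)
        (fun q r => B'.chr p q r (ψ z)) a b + pd a (jac ψ p b) z) := by
      simp only [← h.chr_eq hz, hw z hz, pull1, Finset.mul_sum]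
      refine Finset.sum_comm.trans ?_
      exact Finset.sum_congr rfl fun k _ => Finset.sum_congr rfl fun l _ => by ring
    rw [e]
    have e2 : pull2 (fun p i => jac ψ p i z) (fun p q => pd p (w' q) (ψ z) -
        ∑ l, B'.chr l p q (ψ z) * w' l (ψ z)) a b =
        pull2 (fun p i => jac ψ p i z) (fun p q => pd p (w' q) (ψ z)) a b - ∑ p, w' p (ψ z) *
          pull2 (fun p i => jac ψ p i z) (fun q r => B'.chr p q r (ψ z)) a b := by
      unfold pull2
      simp only [mul_sub, Finset.sum_sub_distrib, Finset.mul_sum]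
      congr 1
      refine (Finset.sum_congr rfl fun _ _ => Finset.sum_comm).trans (Finset.sum_comm.trans ?_)
      exact Finset.sum_congr rfl fun k _ => Finset.sum_congr rfl fun l _ =>
        Finset.sum_congr rfl fun l _ => by ring
    rw [e2]
    simp only [mul_add, Finset.sum_add_distrib, mul_comm (w' _ _) (pd _ _ _)]
    ring
  · filter_upwards [h.left.isOpen.mem_nhds hz] with x hx using hw x hx b

theorem cov2_eq {t t' : Fin 4 → Fin 4 → EuclideanSpace ℝ (Fin 4) → ℝ}
    (ht' : ∀ i j, ContDiffOn ℝ ∞ (t' i j) U')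
    (ht : ∀ x ∈ U, ∀ a b, t a b x = pull2 (fun p i => jac ψ p i x) (fun p q => t' p q (ψ x)) a b)
    (a b c : Fin 4) :
    B.cov2 t a b c z = ∑ r, jac ψ r a z *
      pull2 (fun p i => jac ψ p i z) (fun p q => B'.cov2 t' r p q (ψ z)) b c := by
  unfold cov2
  rw [pd_congr (g := fun x => pull2 (fun p i => jac ψ p i x) (fun p q => t' p q (ψ x)) b c),
    pd_pull2 h.left.isOpen h.right.isOpen h.smooth h.mapsTo hz ht']
  · have e1 : ∑ l, B.chr l a b z * t l c z = ∑ p, ∑ q, (pull2 (fun p i => jac ψ p i z)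
        (fun q r => B'.chr p q r (ψ z)) a b + pd a (jac ψ p b) z) * jac ψ q c z * t' p q (ψ z) := by
      simp only [← h.chr_eq hz]
      simp only [ht z hz, pull2, Finset.mul_sum, Finset.sum_mul]
      refine Finset.sum_comm.trans (Finset.sum_congr rfl fun p _ => Finset.sum_comm.trans ?_)
      exact Finset.sum_congr rfl fun k _ => Finset.sum_congr rfl fun l _ => by ring
    have e2 : ∑ l, B.chr l a c z * t b l z = ∑ p, ∑ q, jac ψ p b z * (pull2 (fun p i => jac ψ p i z)
        (fun p r => B'.chr q p r (ψ z)) a c + pd a (jac ψ q c) z) * t' p q (ψ z) := by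
      simp only [← h.chr_eq hz]
      simp only [ht z hz, pull2, Finset.mul_sum, Finset.sum_mul]
      refine Finset.sum_comm.trans (Finset.sum_congr rfl fun p _ => Finset.sum_comm.trans ?_)
      exact Finset.sum_congr rfl fun k _ => Finset.sum_congr rfl fun l _ => by ring
    have e3 : ∑ r, jac ψ r a z * pull2 (fun p i => jac ψ p i z) (fun p q => pd r (t' p q) (ψ z)
          - ∑ l, B'.chr l r p (ψ z) * t' l q (ψ z) - ∑ l, B'.chr l r q (ψ z) * t' p l (ψ z)) b c =
        ∑ r, jac ψ r a z * pull2 (fun p i => jac ψ p i z) (fun p q => pd r (t' p q) (ψ z)) b c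
        - ∑ p, ∑ q, pull2 (fun p i => jac ψ p i z)
            (fun q r => B'.chr p q r (ψ z)) a b * jac ψ q c z * t' p q (ψ z)
        - ∑ p, ∑ q, jac ψ p b z * pull2 (fun p i => jac ψ p i z)
            (fun p r => B'.chr q p r (ψ z)) a c * t' p q (ψ z) := by
      simp only [pull2, mul_sub, Finset.sum_sub_distrib, Finset.mul_sum, Finset.sum_mul]
      congr 1
      · congr 1
        refine (Finset.sum_congr rfl fun _ _ => Finset.sum_congr rfl fun _ _ =>
          Finset.sum_comm).trans ?_
        refine (Finset.sum_congr rfl fun _ _ => Finset.sum_comm).trans (Finset.sum_comm.trans ?_)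
        refine Finset.sum_congr rfl fun l _ => ?_
        refine (Finset.sum_congr rfl fun _ _ => Finset.sum_comm).trans (Finset.sum_comm.trans ?_)
        exact Finset.sum_congr rfl fun q _ => Finset.sum_congr rfl fun r _ =>
          Finset.sum_congr rfl fun p _ => by ring
      · refine Finset.sum_comm.trans (Finset.sum_congr rfl fun p _ => ?_)
        refine (Finset.sum_congr rfl fun _ _ => Finset.sum_comm).trans (Finset.sum_comm.trans ?_)
        exact Finset.sum_congr rfl fun q _ => Finset.sum_congr rfl fun r _ =>
          Finset.sum_congr rfl fun p _ => by ring
    rw [e1, e2, e3]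
    simp only [add_mul, mul_add, Finset.sum_add_distrib]
    ring
  · filter_upwards [h.left.isOpen.mem_nhds hz] with x hx using ht x hx b c

end MetricChange
end LocalBackground

/-! ### Covariance of contractions and of the current -/

namespace LocalBackground
namespace MetricChange

variable {B B' : LocalBackground} {U U' : Set (EuclideanSpace ℝ (Fin 4))}
  {ψ : EuclideanSpace ℝ (Fin 4) → EuclideanSpace ℝ (Fin 4)} (h : B.MetricChange B' U U' ψ)
  {z : EuclideanSpace ℝ (Fin 4)} (hz : z ∈ U)
include h hz

/-- The inverse metric is pushed forward by the Jacobian matrix while a covariant tensor is pulled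
back by it, so the contraction is invariant. -/
theorem contract (T : Fin 4 → Fin 4 → ℝ) :
    ∑ a, ∑ b, B.gi a b z * pull2 (fun p i => jac ψ p i z) T a b =
      ∑ p, ∑ q, B'.gi p q (ψ z) * T p q := by
  simp only [h.gi_eq hz, pull2, Finset.mul_sum, Finset.sum_mul]
  refine (Finset.sum_congr rfl fun _ _ => Finset.sum_comm).trans (Finset.sum_comm.trans ?_)
  refine Finset.sum_congr rfl fun p _ => ?_
  refine (Finset.sum_congr rfl fun _ _ => Finset.sum_comm).trans (Finset.sum_comm.trans ?_)
  exact Finset.sum_congr rfl fun q _ => Finset.sum_congr rfl fun a _ =>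
    Finset.sum_congr rfl fun b _ => by ring

/-- The two index pairs are contracted one after the other, each time by `contract`. -/
theorem contract_dot (T S : Fin 4 → Fin 4 → ℝ) :
    ∑ a, ∑ b, ∑ c, ∑ d, B.gi a c z * B.gi b d z * pull2 (fun p i => jac ψ p i z) T a b *
        pull2 (fun p i => jac ψ p i z) S c d =
      ∑ a, ∑ b, ∑ c, ∑ d, B'.gi a c (ψ z) * B'.gi b d (ψ z) * T a b * S c d := by
  have e1 : ∀ a c, ∑ b, ∑ d, B.gi b d z * (pull2 (fun p i => jac ψ p i z) T a b *
      pull2 (fun p i => jac ψ p i z) S c d) = pull2 (fun p i => jac ψ p i z) (fun p q =>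
        ∑ r, ∑ s, B'.gi r s (ψ z) * (T p r * S q s)) a c := by
    intro a c
    have e2 : ∀ b d, pull2 (fun p i => jac ψ p i z) T a b *
        pull2 (fun p i => jac ψ p i z) S c d = pull2 (fun p i => jac ψ p i z) (fun r s =>
          (∑ p, jac ψ p a z * T p r) * ∑ q, jac ψ q c z * S q s) b d := by
      intro b d
      have e3 : ∀ (T : Fin 4 → Fin 4 → ℝ) (a b : Fin 4), pull2 (fun p i => jac ψ p i z) T a b =
          ∑ r, jac ψ r b z * ∑ p, jac ψ p a z * T p r := by
        intro T a b
        simp only [pull2, Finset.mul_sum]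
        rw [Finset.sum_comm]
        exact Finset.sum_congr rfl fun p _ => Finset.sum_congr rfl fun q _ => by ring
      rw [e3 T, e3 S, Finset.sum_mul_sum, pull2]
      exact Finset.sum_congr rfl fun p _ => Finset.sum_congr rfl fun q _ => by ring
    simp only [e2, h.contract hz]
    simp only [Finset.sum_mul_sum]
    simp only [pull2, Finset.mul_sum]
    refine (Finset.sum_congr rfl fun _ _ => Finset.sum_comm).trans (Finset.sum_comm.trans ?_)
    refine Finset.sum_congr rfl fun p _ => ?_
    refine (Finset.sum_congr rfl fun _ _ => Finset.sum_comm).trans (Finset.sum_comm.trans ?_)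
    exact Finset.sum_congr rfl fun q _ => Finset.sum_congr rfl fun a _ =>
      Finset.sum_congr rfl fun b _ => by ring
  have e4 : ∀ (C : LocalBackground) (w : EuclideanSpace ℝ (Fin 4)) (T S : Fin 4 → Fin 4 → ℝ),
      ∑ a, ∑ b, ∑ c, ∑ d, C.gi a c w * C.gi b d w * T a b * S c d =
        ∑ a, ∑ c, C.gi a c w * ∑ b, ∑ d, C.gi b d w * (T a b * S c d) := by
    intro C w T S
    refine Finset.sum_congr rfl fun a _ => ?_
    simp only [Finset.mul_sum]
    rw [Finset.sum_comm]
    exact Finset.sum_congr rfl fun p _ => Finset.sum_congr rfl fun q _ =>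
      Finset.sum_congr rfl fun b _ => by ring
  rw [e4 B, e4 B']
  simp only [e1, h.contract hz]

theorem tr_eq {t t' : Fin 4 → Fin 4 → EuclideanSpace ℝ (Fin 4) → ℝ}
    (ht : ∀ x ∈ U, ∀ a b, t a b x = pull2 (fun p i => jac ψ p i x) (fun p q => t' p q (ψ x)) a b) :
    B.tr t z = B'.tr t' (ψ z) := by
  unfold tr
  simp only [ht z hz, h.contract hz]

theorem div1_eq {w w' : Fin 4 → EuclideanSpace ℝ (Fin 4) → ℝ} (hw' : ∀ i, ContDiffOn ℝ ∞ (w' i) U')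
    (hw : ∀ x ∈ U, ∀ a, w a x = pull1 (fun p i => jac ψ p i x) (fun p => w' p (ψ x)) a) :
    B.div1 w z = B'.div1 w' (ψ z) := by
  unfold div1
  simp only [h.cov1_eq hz hw' hw, h.contract hz]

theorem pd_eq {f f' : EuclideanSpace ℝ (Fin 4) → ℝ} (hf' : ContDiffOn ℝ ∞ f' U')
    (hf : ∀ x ∈ U, f x = f' (ψ x)) (a : Fin 4) :
    pd a f z = pull1 (fun p i => jac ψ p i z) (fun p => pd p f' (ψ z)) a := by
  rw [pd_congr (g := fun x => f' (ψ x)), pd_comp (hf'.diffAt h.right.isOpen (h.mapsTo hz))]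
  · rfl
  · exact ((h.smooth z hz).contDiffAt (h.left.isOpen.mem_nhds hz)).differentiableAt (by simp)
  · filter_upwards [h.left.isOpen.mem_nhds hz] with x hx using hf x hx

theorem div2_eq {t t' : Fin 4 → Fin 4 → EuclideanSpace ℝ (Fin 4) → ℝ}
    (ht' : ∀ i j, ContDiffOn ℝ ∞ (t' i j) U')
    (ht : ∀ x ∈ U, ∀ a b, t a b x = pull2 (fun p i => jac ψ p i x) (fun p q => t' p q (ψ x)) a b)
    (b : Fin 4) :
    B.div2 t b z = pull1 (fun p i => jac ψ p i z) (fun p => B'.div2 t' p (ψ z)) b := by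
  unfold div2 pull1
  have e : ∀ c d, B.cov2 t c d b z = pull2 (fun p i => jac ψ p i z)
      (fun r p => ∑ q, jac ψ q b z * B'.cov2 t' r p q (ψ z)) c d := by
    intro c d
    rw [h.cov2_eq hz ht' ht]
    simp only [pull2, Finset.mul_sum]
    exact Finset.sum_congr rfl fun p _ => Finset.sum_congr rfl fun q _ =>
      Finset.sum_congr rfl fun r _ => by ring
  simp only [e, h.contract hz, Finset.mul_sum]
  refine (Finset.sum_congr rfl fun _ _ => Finset.sum_comm).trans (Finset.sum_comm.trans ?_)
  exact Finset.sum_congr rfl fun p _ => Finset.sum_congr rfl fun q _ =>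
      Finset.sum_congr rfl fun r _ => by ring

theorem mulCovec_eq {t t' : Fin 4 → Fin 4 → EuclideanSpace ℝ (Fin 4) → ℝ}
    {v v' : Fin 4 → EuclideanSpace ℝ (Fin 4) → ℝ}
    (ht : ∀ x ∈ U, ∀ a b, t a b x = pull2 (fun p i => jac ψ p i x) (fun p q => t' p q (ψ x)) a b)
    (hv : ∀ a, v a z = pull1 (fun p i => jac ψ p i z) (fun p => v' p (ψ z)) a) (a : Fin 4) :
    B.mulCovec t v a z =
      pull1 (fun p i => jac ψ p i z) (fun p => B'.mulCovec t' v' p (ψ z)) a := by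
  unfold mulCovec
  have e : ∀ b c, t a b z * v c z = pull2 (fun p i => jac ψ p i z)
      (fun p q => (∑ r, jac ψ r a z * t' r p (ψ z)) * v' q (ψ z)) b c := by
    intro b c
    rw [ht z hz, hv]
    simp only [pull1, pull2, Finset.mul_sum, Finset.sum_mul]
    refine (Finset.sum_congr rfl fun _ _ => Finset.sum_comm).trans (Finset.sum_comm.trans ?_)
    exact Finset.sum_congr rfl fun p _ => Finset.sum_congr rfl fun q _ =>
      Finset.sum_congr rfl fun r _ => by ring
  simp only [e, h.contract hz, pull1, Finset.mul_sum, Finset.sum_mul]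
  refine (Finset.sum_congr rfl fun _ _ => Finset.sum_comm).trans (Finset.sum_comm.trans ?_)
  exact Finset.sum_congr rfl fun p _ => Finset.sum_congr rfl fun q _ =>
      Finset.sum_congr rfl fun r _ => by ring

theorem dot2_cov2_eq {t t' s s' : Fin 4 → Fin 4 → EuclideanSpace ℝ (Fin 4) → ℝ}
    (ht' : ∀ i j, ContDiffOn ℝ ∞ (t' i j) U')
    (ht : ∀ x ∈ U, ∀ a b, t a b x = pull2 (fun p i => jac ψ p i x) (fun p q => t' p q (ψ x)) a b)
    (hs : ∀ x ∈ U, ∀ a b, s a b x = pull2 (fun p i => jac ψ p i x) (fun p q => s' p q (ψ x)) a b)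
    (a : Fin 4) :
    B.dot2 s (B.cov2 t a) z =
      pull1 (fun p i => jac ψ p i z) (fun p => B'.dot2 s' (B'.cov2 t' p) (ψ z)) a := by
  unfold dot2
  have e : ∀ b c, B.cov2 t a b c z = pull2 (fun p i => jac ψ p i z)
      (fun p q => ∑ r, jac ψ r a z * B'.cov2 t' r p q (ψ z)) b c := by
    intro b c
    rw [h.cov2_eq hz ht' ht]
    simp only [pull2, Finset.mul_sum]
    refine Finset.sum_comm.trans (Finset.sum_congr rfl fun p _ => ?_)
    refine Finset.sum_comm.trans ?_
    exact Finset.sum_congr rfl fun q _ => Finset.sum_congr rfl fun r _ => by ring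
  simp only [e, hs z hz, h.contract_dot hz, pull1, Finset.mul_sum]
  refine (Finset.sum_congr rfl fun _ _ => Finset.sum_congr rfl fun _ _ =>
    Finset.sum_congr rfl fun _ _ => Finset.sum_comm).trans ?_
  refine (Finset.sum_congr rfl fun _ _ => Finset.sum_congr rfl fun _ _ => Finset.sum_comm).trans ?_
  refine (Finset.sum_congr rfl fun _ _ => Finset.sum_comm).trans (Finset.sum_comm.trans ?_)
  exact Finset.sum_congr rfl fun _ _ => Finset.sum_congr rfl fun _ _ =>
    Finset.sum_congr rfl fun _ _ => Finset.sum_congr rfl fun _ _ => Finset.sum_congr rfl fun _ _ => by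
      ring

/-- Only first covariant derivatives occur in the current, so the laws for `cov1` and `cov2` are
enough. No law for second covariant derivatives is required, since P̄ and the pairing are evaluated
only at the centre of the chart that defines them. -/
theorem jhalf_transform {Θ₁ Θ₂ Θ₁' Θ₂' : LocalSection} (hξ : B.ξ = B'.ξ)
    (sφ : ContDiffOn ℝ ∞ B'.φ U') (hφ : ∀ x ∈ U, B.φ x = B'.φ (ψ x))
    (h₂ : Θ₂'.Regular U')
    (t₁ : ∀ x ∈ U, ∀ a b, Θ₁.θ a b x =
      pull2 (fun p i => jac ψ p i x) (fun p q => Θ₁'.θ p q (ψ x)) a b)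
    (t₂ : ∀ x ∈ U, ∀ a b, Θ₂.θ a b x =
      pull2 (fun p i => jac ψ p i x) (fun p q => Θ₂'.θ p q (ψ x)) a b)
    (z₁ : ∀ x ∈ U, Θ₁.ζ x = Θ₁'.ζ (ψ x)) (z₂ : ∀ x ∈ U, Θ₂.ζ x = Θ₂'.ζ (ψ x)) (a : Fin 4) :
    B.jhalf Θ₁ Θ₂ a z =
      pull1 (fun p i => jac ψ p i z) (fun p => B'.jhalf Θ₁' Θ₂' p (ψ z)) a := by
  have dφ_eq : ∀ a, B.dφ a z = pull1 (fun p i => jac ψ p i z) (fun p => B'.dφ p (ψ z)) a :=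
    h.pd_eq hz sφ hφ
  have eR : ∀ p, B'.jhalf Θ₁' Θ₂' p (ψ z) = _ := fun p => jhalf_eq h.right (h.mapsTo hz) p
  simp only [eR]
  have eκ : B.κ = B'.κ := by unfold κ; rw [hξ]
  rw [jhalf_eq h.left hz, h.mulCovec_eq hz t₁ (h.div2_eq hz h₂.smooth_θ t₂),
    h.dot2_cov2_eq hz h₂.smooth_θ t₂ t₁, h.mulCovec_eq hz t₂ dφ_eq, h.tr_eq hz t₁,
    h.pd_eq hz (h.right.contDiffOn_tr h₂.smooth_θ) (fun x hx => h.tr_eq hx t₂),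
    h.pd_eq hz h₂.smooth_ζ z₂, dφ_eq, z₁ z hz, z₂ z hz, hξ, eκ, hφ z hz]
  simp only [pull1, Fin.sum_univ_four]
  ring

theorem current_transform {Θ₁ Θ₂ Θ₁' Θ₂' : LocalSection} (hξ : B.ξ = B'.ξ)
    (sφ : ContDiffOn ℝ ∞ B'.φ U') (hφ : ∀ x ∈ U, B.φ x = B'.φ (ψ x))
    (h₁ : Θ₁'.Regular U') (h₂ : Θ₂'.Regular U')
    (t₁ : ∀ x ∈ U, ∀ a b, Θ₁.θ a b x =
      pull2 (fun p i => jac ψ p i x) (fun p q => Θ₁'.θ p q (ψ x)) a b)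
    (t₂ : ∀ x ∈ U, ∀ a b, Θ₂.θ a b x =
      pull2 (fun p i => jac ψ p i x) (fun p q => Θ₂'.θ p q (ψ x)) a b)
    (z₁ : ∀ x ∈ U, Θ₁.ζ x = Θ₁'.ζ (ψ x)) (z₂ : ∀ x ∈ U, Θ₂.ζ x = Θ₂'.ζ (ψ x)) (a : Fin 4) :
    B.current Θ₁ Θ₂ a z =
      pull1 (fun p i => jac ψ p i z) (fun p => B'.current Θ₁' Θ₂' p (ψ z)) a := by
  simp only [current]
  rw [h.jhalf_transform hz hξ sφ hφ h₂ t₁ t₂ z₁ z₂, h.jhalf_transform hz hξ sφ hφ h₁ t₂ t₁ z₂ z₁]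
  simp only [pull1, ← Finset.sum_sub_distrib, mul_sub]

end MetricChange
end LocalBackground

/-! ## Components in charts -/

section Charts

variable {n : ℕ} {X : Type*} [TopologicalSpace X] [ChartedSpace (EuclideanSpace ℝ (Fin n)) X]

/-- All tangent spaces are copies of one Euclidean space, so forms at two equal points can be
compared on the same vectors. Identities of linear algebra are likewise proved on that model space
and then applied to tangent vectors. -/
theorem form_congr (h : FormField n X) {x y : X} (hxy : x = y) (u v : EuclideanSpace ℝ (Fin n)) :
    h x u v = h y u v := by
  subst hxy; rfl

theorem covec_congr (j : ∀ x : X, TangentSpace (𝓡 n) x →L[ℝ] ℝ) {x y : X} (hxy : x = y)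
    (u : EuclideanSpace ℝ (Fin n)) : j x u = j y u := by
  subst hxy; rfl

theorem euclidean_eq_sum {m : ℕ} (v : EuclideanSpace ℝ (Fin m)) :
    v = ∑ k, v k • EuclideanSpace.single k (1 : ℝ) := by
  ext k; simp [Finset.sum_apply, Pi.single_apply]

theorem mfderiv_symm_eq_sum (x₀ : X) (z v : EuclideanSpace ℝ (Fin n)) :
    (mfderiv 𝓘(ℝ, EuclideanSpace ℝ (Fin n)) (𝓡 n) (extChartAt (𝓡 n) x₀).symm z v :
      EuclideanSpace ℝ (Fin n)) = ∑ k, v k • (frame x₀ z k : EuclideanSpace ℝ (Fin n)) := by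
  conv_lhs => rw [euclidean_eq_sum v]
  erw [map_sum]
  exact Finset.sum_congr rfl fun k _ => map_smul _ _ _

variable [IsManifold (𝓡 n) ∞ X]

theorem mdifferentiableAt_extChartAt_symm {x₀ : X} {z : EuclideanSpace ℝ (Fin n)}
    (hz : z ∈ (extChartAt (𝓡 n) x₀).target) :
    MDifferentiableAt 𝓘(ℝ, EuclideanSpace ℝ (Fin n)) (𝓡 n) (extChartAt (𝓡 n) x₀).symm z :=
  ((contMDiffOn_extChartAt_symm (n := ∞) x₀ z hz).contMDiffAt
    ((isOpen_extChartAt_target x₀).mem_nhds hz)).mdifferentiableAt (by simp)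

theorem mdifferentiableAt_extChartAt_of_mem {x₀ y : X} (hy : y ∈ (extChartAt (𝓡 n) x₀).source) :
    MDifferentiableAt (𝓡 n) 𝓘(ℝ, EuclideanSpace ℝ (Fin n)) (extChartAt (𝓡 n) x₀) y :=
  mdifferentiableAt_extChartAt (by rwa [extChartAt_source] at hy)

/-- The field z ↦ dκ_z(u) is the tangent map of κ composed with the section z ↦ (z, u) of constant
value, and both are smooth. -/
theorem contMDiffOn_mfderiv_apply {m : ℕ} {κ : EuclideanSpace ℝ (Fin m) → X}
    {W : Set (EuclideanSpace ℝ (Fin m))} (hW : IsOpen W)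
    (hκ : ContMDiffOn 𝓘(ℝ, EuclideanSpace ℝ (Fin m)) (𝓡 n) ∞ κ W) (u : EuclideanSpace ℝ (Fin m)) :
    ContMDiffOn 𝓘(ℝ, EuclideanSpace ℝ (Fin m)) ((𝓡 n).prod 𝓘(ℝ, EuclideanSpace ℝ (Fin n))) ∞
      (fun z => Bundle.TotalSpace.mk' (EuclideanSpace ℝ (Fin n)) (E := TangentSpace (𝓡 n)) (κ z)
        (mfderiv 𝓘(ℝ, EuclideanSpace ℝ (Fin m)) (𝓡 n) κ z u)) W := by
  have h1 := hκ.contMDiffOn_tangentMapWithin (m := ∞) (by simp) hW.uniqueMDiffOn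
  have h2 : ContMDiffOn 𝓘(ℝ, EuclideanSpace ℝ (Fin m))
      (𝓘(ℝ, EuclideanSpace ℝ (Fin m)).prod 𝓘(ℝ, EuclideanSpace ℝ (Fin m))) ∞
      (fun z => (⟨z, u⟩ : TangentBundle 𝓘(ℝ, EuclideanSpace ℝ (Fin m))
        (EuclideanSpace ℝ (Fin m)))) W := by
    intro z _
    exact Bundle.contMDiffWithinAt_section.2 (by
      simpa using contMDiffWithinAt_const)
  refine (h1.comp h2 fun z hz => hz).congr fun z hz => ?_
  simp only [Function.comp_apply, tangentMapWithin]
  rw [mfderivWithin_of_isOpen hW hz]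

theorem contDiffOn_form_apply₂ {m : ℕ} {h : FormField n X} (hh : SmoothForm h)
    {κ : EuclideanSpace ℝ (Fin m) → X} {W : Set (EuclideanSpace ℝ (Fin m))}
    (hκ : ContMDiffOn 𝓘(ℝ, EuclideanSpace ℝ (Fin m)) (𝓡 n) ∞ κ W)
    {u v : ∀ z, TangentSpace (𝓡 n) (κ z)}
    (hu : ContMDiffOn 𝓘(ℝ, EuclideanSpace ℝ (Fin m))
      ((𝓡 n).prod 𝓘(ℝ, EuclideanSpace ℝ (Fin n))) ∞
      (fun z => Bundle.TotalSpace.mk' (EuclideanSpace ℝ (Fin n)) (E := TangentSpace (𝓡 n)) (κ z)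
        (u z)) W)
    (hv : ContMDiffOn 𝓘(ℝ, EuclideanSpace ℝ (Fin m))
      ((𝓡 n).prod 𝓘(ℝ, EuclideanSpace ℝ (Fin n))) ∞
      (fun z => Bundle.TotalSpace.mk' (EuclideanSpace ℝ (Fin n)) (E := TangentSpace (𝓡 n)) (κ z)
        (v z)) W) :
    ContDiffOn ℝ ∞ (fun z => h (κ z) (u z) (v z)) W := by
  have h3 : ContMDiffOn 𝓘(ℝ, EuclideanSpace ℝ (Fin m))
      ((𝓡 n).prod 𝓘(ℝ, EuclideanSpace ℝ (Fin n) →L[ℝ] EuclideanSpace ℝ (Fin n) →L[ℝ] ℝ)) ∞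
      (fun z => Bundle.TotalSpace.mk'
        (EuclideanSpace ℝ (Fin n) →L[ℝ] EuclideanSpace ℝ (Fin n) →L[ℝ] ℝ)
        (E := fun x => TangentSpace (𝓡 n) x →L[ℝ] TangentSpace (𝓡 n) x →L[ℝ] ℝ) (κ z) (h (κ z))) W :=
    ContMDiff.comp_contMDiffOn hh hκ
  have h4 := ContMDiffOn.clm_bundle_apply₂ (F₁ := EuclideanSpace ℝ (Fin n))
    (F₂ := EuclideanSpace ℝ (Fin n)) (F₃ := ℝ) (E₁ := TangentSpace (𝓡 n))
    (E₂ := TangentSpace (𝓡 n)) (E₃ := Bundle.Trivial X ℝ) h3 hu hv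
  intro z hz
  have := h4 z hz
  rw [Bundle.contMDiffWithinAt_totalSpace] at this
  exact this.2.contDiffWithinAt

theorem contDiffOn_form_apply {m : ℕ} {h : FormField n X} (hh : SmoothForm h)
    {κ : EuclideanSpace ℝ (Fin m) → X} {W : Set (EuclideanSpace ℝ (Fin m))} (hW : IsOpen W)
    (hκ : ContMDiffOn 𝓘(ℝ, EuclideanSpace ℝ (Fin m)) (𝓡 n) ∞ κ W)
    (u v : EuclideanSpace ℝ (Fin m)) :
    ContDiffOn ℝ ∞ (fun z => h (κ z) (mfderiv 𝓘(ℝ, EuclideanSpace ℝ (Fin m)) (𝓡 n) κ z u)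
      (mfderiv 𝓘(ℝ, EuclideanSpace ℝ (Fin m)) (𝓡 n) κ z v)) W :=
  contDiffOn_form_apply₂ hh hκ (contMDiffOn_mfderiv_apply hW hκ u) (contMDiffOn_mfderiv_apply hW hκ v)

theorem contDiffOn_comp {h : FormField n X} (hh : SmoothForm h) (x₀ : X) (i j : Fin n) :
    ContDiffOn ℝ ∞ (comp h x₀ i j) (extChartAt (𝓡 n) x₀).target :=
  contDiffOn_form_apply hh (isOpen_extChartAt_target x₀) (contMDiffOn_extChartAt_symm x₀) _ _

/-- The derivative of a map into a manifold, expressed in a chart. -/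
theorem mfderiv_eq_chart {m : ℕ} {κ : EuclideanSpace ℝ (Fin m) → X}
    {z v : EuclideanSpace ℝ (Fin m)}
    (hκ : MDifferentiableAt 𝓘(ℝ, EuclideanSpace ℝ (Fin m)) (𝓡 n) κ z) {y : X}
    (hy : κ z ∈ (extChartAt (𝓡 n) y).source) :
    (mfderiv 𝓘(ℝ, EuclideanSpace ℝ (Fin m)) (𝓡 n) κ z v : EuclideanSpace ℝ (Fin n)) =
      mfderiv 𝓘(ℝ, EuclideanSpace ℝ (Fin n)) (𝓡 n) (extChartAt (𝓡 n) y).symm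
        (extChartAt (𝓡 n) y (κ z)) (fderiv ℝ (fun w => extChartAt (𝓡 n) y (κ w)) z v) := by
  have h1 : MDifferentiableAt 𝓘(ℝ, EuclideanSpace ℝ (Fin m)) 𝓘(ℝ, EuclideanSpace ℝ (Fin n))
      (fun w => extChartAt (𝓡 n) y (κ w)) z := (mdifferentiableAt_extChartAt_of_mem hy).comp z hκ
  have h2 := mdifferentiableAt_extChartAt_symm ((extChartAt (𝓡 n) y).map_source hy)
  have h3 : κ =ᶠ[𝓝 z] fun w => (extChartAt (𝓡 n) y).symm (extChartAt (𝓡 n) y (κ w)) := by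
    filter_upwards [hκ.continuousAt.preimage_mem_nhds
      ((isOpen_extChartAt_source y).mem_nhds hy)] with w hw
    exact ((extChartAt (𝓡 n) y).left_inv hw).symm
  have h4 := h3.mfderiv_eq (I := 𝓘(ℝ, EuclideanSpace ℝ (Fin m))) (I' := 𝓡 n)
  have h5 := mfderiv_comp z h2 h1
  rw [mfderiv_eq_fderiv] at h5
  have h6 := DFunLike.congr_fun (h4.trans h5) v
  exact h6

/-- The transformation law of coordinate vectors. -/
theorem frame_eq_sum {x₀ y : X} {z : EuclideanSpace ℝ (Fin n)}
    (hz : z ∈ (extChartAt (𝓡 n) x₀).target)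
    (hy : (extChartAt (𝓡 n) x₀).symm z ∈ (extChartAt (𝓡 n) y).source) (i : Fin n) :
    (frame x₀ z i : EuclideanSpace ℝ (Fin n)) =
      ∑ k, (fderiv ℝ (fun w => extChartAt (𝓡 n) y ((extChartAt (𝓡 n) x₀).symm w)) z
        (EuclideanSpace.single i 1)) k •
        (frame y (extChartAt (𝓡 n) y ((extChartAt (𝓡 n) x₀).symm z)) k :
          EuclideanSpace ℝ (Fin n)) := by
  rw [← mfderiv_symm_eq_sum]
  exact mfderiv_eq_chart (mdifferentiableAt_extChartAt_symm hz) hy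

theorem mfderiv_extChartAt_frame {x₀ : X} {z : EuclideanSpace ℝ (Fin n)}
    (hz : z ∈ (extChartAt (𝓡 n) x₀).target) (v : EuclideanSpace ℝ (Fin n)) :
    mfderiv (𝓡 n) 𝓘(ℝ, EuclideanSpace ℝ (Fin n)) (extChartAt (𝓡 n) x₀)
      ((extChartAt (𝓡 n) x₀).symm z)
      (mfderiv 𝓘(ℝ, EuclideanSpace ℝ (Fin n)) (𝓡 n) (extChartAt (𝓡 n) x₀).symm z v) = v := by
  have h1 := mfderiv_comp z (mdifferentiableAt_extChartAt_of_mem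
    ((extChartAt (𝓡 n) x₀).map_target hz)) (mdifferentiableAt_extChartAt_symm hz)
  have h2 : (extChartAt (𝓡 n) x₀) ∘ (extChartAt (𝓡 n) x₀).symm =ᶠ[𝓝 z] id := by
    filter_upwards [(isOpen_extChartAt_target x₀).mem_nhds hz] with w hw
    exact (extChartAt (𝓡 n) x₀).right_inv hw
  rw [h2.mfderiv_eq, mfderiv_id] at h1
  exact (DFunLike.congr_fun h1 v).symm

theorem frame_mfderiv_extChartAt {x₀ y : X} (hy : y ∈ (extChartAt (𝓡 n) x₀).source)
    (v : EuclideanSpace ℝ (Fin n)) :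
    (mfderiv 𝓘(ℝ, EuclideanSpace ℝ (Fin n)) (𝓡 n) (extChartAt (𝓡 n) x₀).symm
      (extChartAt (𝓡 n) x₀ y)
      (mfderiv (𝓡 n) 𝓘(ℝ, EuclideanSpace ℝ (Fin n)) (extChartAt (𝓡 n) x₀) y v) :
        EuclideanSpace ℝ (Fin n)) = v := by
  have h1 := mfderiv_comp y (mdifferentiableAt_extChartAt_symm
    ((extChartAt (𝓡 n) x₀).map_source hy)) (mdifferentiableAt_extChartAt_of_mem hy)
  have h2 : (extChartAt (𝓡 n) x₀).symm ∘ (extChartAt (𝓡 n) x₀) =ᶠ[𝓝 y] id := by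
    filter_upwards [(isOpen_extChartAt_source x₀).mem_nhds hy] with w hw
    exact (extChartAt (𝓡 n) x₀).left_inv hw
  rw [h2.mfderiv_eq, mfderiv_id] at h1
  exact (DFunLike.congr_fun h1 v).symm

theorem coframe_frame (x : X) (i j : Fin n) :
    coframe x i (frame x (extChartAt (𝓡 n) x x) j : EuclideanSpace ℝ (Fin n)) =
      if i = j then 1 else 0 := by
  have h := mfderiv_extChartAt_frame (mem_extChartAt_target (I := 𝓡 n) x) (EuclideanSpace.single j 1)
  have e := extChartAt_to_inv (I := 𝓡 n) x
  have h2 : mfderiv (𝓡 n) 𝓘(ℝ, EuclideanSpace ℝ (Fin n)) (extChartAt (𝓡 n) x) x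
      (mfderiv 𝓘(ℝ, EuclideanSpace ℝ (Fin n)) (𝓡 n) (extChartAt (𝓡 n) x).symm
        (extChartAt (𝓡 n) x x) (EuclideanSpace.single j (1 : ℝ)) : EuclideanSpace ℝ (Fin n)) =
      EuclideanSpace.single j (1 : ℝ) := by
    rw [← h]
    congr 2
    all_goals exact e.symm
  have h3 := congrArg (fun v : EuclideanSpace ℝ (Fin n) => v i) h2
  refine h3.trans ?_
  simp

/-- The transformation law of the components of a field of bilinear forms. -/
theorem comp_transform (h : FormField n X) {x₀ y : X} {z : EuclideanSpace ℝ (Fin n)}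
    (hz : z ∈ (extChartAt (𝓡 n) x₀).target)
    (hy : (extChartAt (𝓡 n) x₀).symm z ∈ (extChartAt (𝓡 n) y).source) (i j : Fin n) :
    comp h x₀ i j z = ∑ k, ∑ l,
      (fderiv ℝ (fun w => extChartAt (𝓡 n) y ((extChartAt (𝓡 n) x₀).symm w)) z
        (EuclideanSpace.single i 1)) k *
      (fderiv ℝ (fun w => extChartAt (𝓡 n) y ((extChartAt (𝓡 n) x₀).symm w)) z
        (EuclideanSpace.single j 1)) l *
      comp h y k l (extChartAt (𝓡 n) y ((extChartAt (𝓡 n) x₀).symm z)) := by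
  have key : ∀ (T : EuclideanSpace ℝ (Fin n) →L[ℝ] EuclideanSpace ℝ (Fin n) →L[ℝ] ℝ)
      (a b : Fin n → ℝ) (f : Fin n → EuclideanSpace ℝ (Fin n)),
      T (∑ k, a k • f k) (∑ k, b k • f k) = ∑ k, ∑ l, a k * b l * T (f k) (f l) := by
    intro T a b f
    simp only [map_sum, map_smul, _root_.sum_apply, _root_.smul_apply, smul_eq_mul,
      Finset.mul_sum]
    rw [Finset.sum_comm]
    exact Finset.sum_congr rfl fun k _ => Finset.sum_congr rfl fun l _ => by ring
  have e := (extChartAt (𝓡 n) y).left_inv hy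
  have h1 : comp h x₀ i j z = h ((extChartAt (𝓡 n) y).symm
      (extChartAt (𝓡 n) y ((extChartAt (𝓡 n) x₀).symm z)))
        (frame x₀ z i : EuclideanSpace ℝ (Fin n)) (frame x₀ z j : EuclideanSpace ℝ (Fin n)) :=
    form_congr h e.symm _ _
  rw [h1, frame_eq_sum hz hy i, frame_eq_sum hz hy j]
  exact key _ _ _ _

theorem contDiffOn_transition (x₀ y : X) :
    ContDiffOn ℝ ∞ (fun w => extChartAt (𝓡 n) y ((extChartAt (𝓡 n) x₀).symm w))
      ((extChartAt (𝓡 n) x₀).target ∩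
        (extChartAt (𝓡 n) x₀).symm ⁻¹' (extChartAt (𝓡 n) y).source) := by
  rw [← contMDiffOn_iff_contDiffOn]
  have h1 := contMDiffOn_extChartAt (I := 𝓡 n) (n := ∞) (x := y)
  refine h1.comp ((contMDiffOn_extChartAt_symm (n := ∞) x₀).mono inter_subset_left) fun w hw => ?_
  simpa only [extChartAt_source] using hw.2

omit [IsManifold (𝓡 n) ∞ X] in
theorem isOpen_transition_domain (x₀ y : X) : IsOpen ((extChartAt (𝓡 n) x₀).target ∩
    (extChartAt (𝓡 n) x₀).symm ⁻¹' (extChartAt (𝓡 n) y).source) :=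
  (continuousOn_extChartAt_symm x₀).isOpen_inter_preimage (isOpen_extChartAt_target x₀)
    (isOpen_extChartAt_source y)

end Charts

theorem LocalBackground.RegularMetric.mono {B : LocalBackground}
    {U U' : Set (EuclideanSpace ℝ (Fin 4))} (h : B.RegularMetric U) (hU' : IsOpen U')
    (hs : U' ⊆ U) : B.RegularMetric U' where
  isOpen := hU'
  smooth i j := (h.smooth i j).mono hs
  symm z hz := h.symm z (hs hz)
  det_ne z hz := h.det_ne z (hs hz)

/-! ### The background in charts, and the divergence identity on the manifold -/

section Background

variable {M : Type*} [TopologicalSpace M] [ChartedSpace (EuclideanSpace ℝ (Fin 4)) M]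
  [IsManifold (𝓡 4) ∞ M]

/-- A vector orthogonal to everything is orthogonal to a timelike `u`; on the complement of `u` the
metric is positive definite, yet the vector has norm zero. -/
theorem LorentzMetric.nondegenerate (g : LorentzMetric M) {x : M} {v : TangentSpace (𝓡 4) x}
    (hv : ∀ w, g.val x v w = 0) : v = 0 := by
  by_contra h0
  obtain ⟨u, _, hu⟩ := g.lorentz x
  exact (hu v h0 (by rw [g.symm]; exact hv u)).ne' (hv v)

/-- A vector in the kernel of the component matrix would be the coordinate vector of a tangent
vector orthogonal to the whole frame. -/
theorem LorentzMetric.det_comp_ne (g : LorentzMetric M) (x₀ : M) {z : EuclideanSpace ℝ (Fin 4)}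
    (hz : z ∈ (extChartAt (𝓡 4) x₀).target) :
    (Matrix.of fun i j => comp g.val x₀ i j z).det ≠ 0 := by
  intro h0
  obtain ⟨c, hc, hc0⟩ := Matrix.exists_mulVec_eq_zero_iff.2 h0
  set v : EuclideanSpace ℝ (Fin 4) := ∑ k, c k • (frame x₀ z k : EuclideanSpace ℝ (Fin 4)) with hv
  have hvc : v = mfderiv 𝓘(ℝ, EuclideanSpace ℝ (Fin 4)) (𝓡 4) (extChartAt (𝓡 4) x₀).symm z
      (WithLp.toLp 2 c : EuclideanSpace ℝ (Fin 4)) := (mfderiv_symm_eq_sum x₀ z _).symm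
  have key : ∀ (T : EuclideanSpace ℝ (Fin 4) →L[ℝ] ℝ) (f : Fin 4 → EuclideanSpace ℝ (Fin 4)),
      T (∑ k, c k • f k) = ∑ k, T (f k) * c k := by
    intro T f
    simp only [map_sum, map_smul, smul_eq_mul]
    exact Finset.sum_congr rfl fun k _ => mul_comm _ _
  have h1 : ∀ i, g.val ((extChartAt (𝓡 4) x₀).symm z) (frame x₀ z i) v = 0 := fun i =>
    (key _ _).trans (congrFun hc0 i)
  have h2 : ∀ w : EuclideanSpace ℝ (Fin 4), g.val ((extChartAt (𝓡 4) x₀).symm z) v w = 0 := by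
    intro w
    have e := frame_mfderiv_extChartAt ((extChartAt (𝓡 4) x₀).map_target hz) w
    rw [(extChartAt (𝓡 4) x₀).right_inv hz] at e
    erw [← e, mfderiv_symm_eq_sum]
    have key2 : ∀ (T : EuclideanSpace ℝ (Fin 4) →L[ℝ] ℝ) (f : Fin 4 → EuclideanSpace ℝ (Fin 4))
        (d : Fin 4 → ℝ), (∀ k, T (f k) = 0) → T (∑ k, d k • f k) = 0 := by
      intro T f d hT
      simp [map_sum, hT]
    exact key2 _ _ _ fun k => (g.symm _ _ _).trans (h1 k)
  have h3 : v = 0 := g.nondegenerate h2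
  have h4 := mfderiv_extChartAt_frame hz (WithLp.toLp 2 c : EuclideanSpace ℝ (Fin 4))
  have h5 : (WithLp.toLp 2 c : EuclideanSpace ℝ (Fin 4)) = 0 := by
    rw [← h4]
    erw [← hvc, h3]
    exact map_zero _
  exact hc (by ext k; exact congrArg (fun v : EuclideanSpace ℝ (Fin 4) => v k) h5)

variable {b : Background M}

theorem Background.loc_regular (hnd : b.NonDegenerate) (x₀ : M) :
    (b.loc x₀).Regular (extChartAt (𝓡 4) x₀).target where
  isOpen := isOpen_extChartAt_target x₀
  smooth := contDiffOn_comp b.g.smooth x₀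
  symm _ _ _ _ := b.g.symm _ _ _
  det_ne _ hz := b.g.det_comp_ne x₀ hz
  smooth_φ := by
    rw [← contMDiffOn_iff_contDiffOn]
    exact b.φ_smooth.comp_contMDiffOn (contMDiffOn_extChartAt_symm x₀)
  α_ne _ _ := (hnd _).1
  β_ne _ _ := (hnd _).2

theorem IsSection.regular {Θ : FieldPair M} (hΘ : IsSection Θ) (x₀ : M) :
    (localSection Θ x₀).Regular (extChartAt (𝓡 4) x₀).target where
  smooth_θ := contDiffOn_comp hΘ.2.1 x₀
  smooth_ζ := by
    rw [← contMDiffOn_iff_contDiffOn]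
    exact hΘ.2.2.comp_contMDiffOn (contMDiffOn_extChartAt_symm x₀)
  symm _ _ _ _ := hΘ.1 _ _ _

/-- Coordinate changes in the form of Jacobian matrices. -/
theorem jac_transition (x₀ y : M) {z : EuclideanSpace ℝ (Fin 4)}
    (hz : z ∈ (extChartAt (𝓡 4) x₀).target ∩
      (extChartAt (𝓡 4) x₀).symm ⁻¹' (extChartAt (𝓡 4) y).source) (k i : Fin 4) :
    jac (fun w => extChartAt (𝓡 4) y ((extChartAt (𝓡 4) x₀).symm w)) k i z =
      (fderiv ℝ (fun w => extChartAt (𝓡 4) y ((extChartAt (𝓡 4) x₀).symm w)) z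
        (EuclideanSpace.single i 1)) k := by
  have hd := ((contDiffOn_transition x₀ y z hz).contDiffAt
    ((isOpen_transition_domain x₀ y).mem_nhds hz)).differentiableAt (by simp)
  exact jac_eq_fderiv hd k i

theorem comp_eq_pull2 (h : FormField 4 M) (x₀ y : M) {z : EuclideanSpace ℝ (Fin 4)}
    (hz : z ∈ (extChartAt (𝓡 4) x₀).target ∩
      (extChartAt (𝓡 4) x₀).symm ⁻¹' (extChartAt (𝓡 4) y).source) (i j : Fin 4) :
    comp h x₀ i j z = pull2
      (fun p i => jac (fun w => extChartAt (𝓡 4) y ((extChartAt (𝓡 4) x₀).symm w)) p i z)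
      (fun p q => comp h y p q (extChartAt (𝓡 4) y ((extChartAt (𝓡 4) x₀).symm z))) i j := by
  unfold pull2
  simp only [jac_transition x₀ y hz]
  exact comp_transform h hz.1 hz.2 i j

theorem Background.metricChange (hnd : b.NonDegenerate) (x₀ y : M) :
    (b.loc x₀).MetricChange (b.loc y) ((extChartAt (𝓡 4) x₀).target ∩
      (extChartAt (𝓡 4) x₀).symm ⁻¹' (extChartAt (𝓡 4) y).source) (extChartAt (𝓡 4) y).target
      (fun w => extChartAt (𝓡 4) y ((extChartAt (𝓡 4) x₀).symm w)) where
  left := (loc_regular hnd x₀).toRegularMetric.mono (isOpen_transition_domain x₀ y)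
    inter_subset_left
  right := (loc_regular hnd y).toRegularMetric
  smooth := contDiffOn_transition x₀ y
  mapsTo _ hz := (extChartAt (𝓡 4) y).map_source hz.2
  metric _ hz a c := comp_eq_pull2 b.g.val x₀ y hz a c

/-- At every point the current is defined through the chart centred at that point, so its smoothness
is not evident. Covariance identifies its components in one fixed chart with the local formula,
which can be differentiated. -/
theorem Background.comp1_current (hnd : b.NonDegenerate) {Θ₁ Θ₂ : FieldPair M}
    (h₁ : IsSection Θ₁) (h₂ : IsSection Θ₂) (y : M) {z : EuclideanSpace ℝ (Fin 4)}
    (hz : z ∈ (extChartAt (𝓡 4) y).target) (a : Fin 4) :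
    comp1 (b.current Θ₁ Θ₂) y a z =
      (b.loc y).current (localSection Θ₁ y) (localSection Θ₂ y) a z := by
  set x := (extChartAt (𝓡 4) y).symm z with hx
  have hzU : z ∈ (extChartAt (𝓡 4) y).target ∩
      (extChartAt (𝓡 4) y).symm ⁻¹' (extChartAt (𝓡 4) x).source :=
    ⟨hz, mem_extChartAt_source (I := 𝓡 4) x⟩
  have inv : ∀ w ∈ (extChartAt (𝓡 4) y).target ∩
      (extChartAt (𝓡 4) y).symm ⁻¹' (extChartAt (𝓡 4) x).source,
      (extChartAt (𝓡 4) y).symm w = (extChartAt (𝓡 4) x).symm (extChartAt (𝓡 4) x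
        ((extChartAt (𝓡 4) y).symm w)) := fun w hw => ((extChartAt (𝓡 4) x).left_inv hw.2).symm
  rw [(metricChange hnd y x).current_transform hzU (Θ₁' := localSection Θ₁ x)
    (Θ₂' := localSection Θ₂ x) rfl (loc_regular hnd x).smooth_φ
    (fun w hw => congrArg b.φ (inv w hw)) (h₁.regular x) (h₂.regular x)
    (fun w hw => comp_eq_pull2 Θ₁.θ y x hw) (fun w hw => comp_eq_pull2 Θ₂.θ y x hw)
    (fun w hw => congrArg Θ₁.ζ (inv w hw)) (fun w hw => congrArg Θ₂.ζ (inv w hw))]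
  -- The coordinate vector of the fixed chart is expanded in the frame of the chart centred at `x`,
  -- to which the coframe defining the current is dual.
  have e1 : comp1 (b.current Θ₁ Θ₂) y a z = b.current Θ₁ Θ₂ x
      (∑ k, jac (fun w => extChartAt (𝓡 4) x ((extChartAt (𝓡 4) y).symm w)) k a z •
        (frame x (extChartAt (𝓡 4) x x) k : EuclideanSpace ℝ (Fin 4))) := by
    simp only [jac_transition y x hzU]
    exact congrArg (b.current Θ₁ Θ₂ x) (frame_eq_sum hzU.1 hzU.2 a)
  rw [e1]
  unfold current pull1
  have key : ∀ (c d : Fin 4 → ℝ) (T : Fin 4 → EuclideanSpace ℝ (Fin 4) →L[ℝ] ℝ)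
      (f : Fin 4 → EuclideanSpace ℝ (Fin 4)), (∀ i j, T i (f j) = if i = j then 1 else 0) →
      (∑ i, c i • T i) (∑ k, d k • f k) = ∑ k, d k * c k := by
    intro c d T f hT
    simp [map_sum, _root_.sum_apply, hT, mul_comm]
  exact key _ _ _ _ (coframe_frame x)

/-- This holds at the centre of the chart, where coframe and frame are dual; nothing is claimed at
other points of the chart. -/
theorem Background.comp_Pbar (Θ : FieldPair M) (x : M) (i j : Fin 4) :
    comp (b.Pbar Θ).θ x i j (extChartAt (𝓡 4) x x) =
      (b.loc x).PbarTensor (localSection Θ x) i j (extChartAt (𝓡 4) x x) := by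
  have e1 : comp (b.Pbar Θ).θ x i j (extChartAt (𝓡 4) x x) = (b.Pbar Θ).θ x
      (frame x (extChartAt (𝓡 4) x x) i : EuclideanSpace ℝ (Fin 4))
      (frame x (extChartAt (𝓡 4) x x) j : EuclideanSpace ℝ (Fin 4)) :=
    form_congr _ (extChartAt_to_inv (I := 𝓡 4) x) _ _
  rw [e1]
  have key : ∀ (P : Fin 4 → Fin 4 → ℝ) (T : Fin 4 → EuclideanSpace ℝ (Fin 4) →L[ℝ] ℝ)
      (f : Fin 4 → EuclideanSpace ℝ (Fin 4)), (∀ i j, T i (f j) = if i = j then 1 else 0) →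
      (∑ k, ∑ l, P k l • (T k).smulRight (T l)) (f i) (f j) = P i j := by
    intro P T f hT
    simp [_root_.sum_apply, hT]
  exact key (fun i j => (b.loc x).PbarTensor (localSection Θ x) i j (extChartAt (𝓡 4) x x))
    (fun i => coframe x i) (fun i => frame x (extChartAt (𝓡 4) x x) i) (coframe_frame x)

theorem LocalBackground.pairing_congr {B : LocalBackground} {Θ₁ Θ₂ Θ₁' Θ₂' : LocalSection}
    {z : EuclideanSpace ℝ (Fin 4)} (h₁ : ∀ i j, Θ₁.θ i j z = Θ₁'.θ i j z)
    (h₂ : ∀ i j, Θ₂.θ i j z = Θ₂'.θ i j z) (z₁ : Θ₁.ζ z = Θ₁'.ζ z) (z₂ : Θ₂.ζ z = Θ₂'.ζ z) :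
    B.pairing Θ₁ Θ₂ z = B.pairing Θ₁' Θ₂' z := by
  unfold pairing dot2 tr
  simp only [h₁, h₂, z₁, z₂]

theorem Background.divergence_current (hE : b.OnShell) (hnd : b.NonDegenerate)
    {Θ₁ Θ₂ : FieldPair M} (h₁ : IsSection Θ₁) (h₂ : IsSection Θ₂) (x : M) :
    b.divergence (b.current Θ₁ Θ₂) x =
      b.pairing Θ₁ (b.Pbar Θ₂) x - b.pairing (b.Pbar Θ₁) Θ₂ x := by
  have hx := mem_extChartAt_target (I := 𝓡 4) x
  have e := extChartAt_to_inv (I := 𝓡 4) x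
  unfold divergence
  rw [LocalBackground.div1_congr (loc_regular hnd x).toRegularMetric hx
      (fun w hw a => comp1_current hnd h₁ h₂ x hw a),
    LocalBackground.div1_current (loc_regular hnd x) (h₁.regular x) (h₂.regular x) hx (hE x)]
  unfold pairing
  congr 1
  · exact LocalBackground.pairing_congr (fun _ _ => rfl) (fun i j => (comp_Pbar Θ₂ x i j).symm) rfl
      (congrArg (b.Pbar Θ₂).ζ e).symm
  · exact LocalBackground.pairing_congr (fun i j => (comp_Pbar Θ₁ x i j).symm) (fun _ _ => rfl)
      (congrArg (b.Pbar Θ₁).ζ e).symm rfl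

end Background

/-! ## The volume measure in charts -/

theorem det_eq_det_matrix {n : ℕ} (T : EuclideanSpace ℝ (Fin n) →L[ℝ] EuclideanSpace ℝ (Fin n)) :
    T.det = (Matrix.of fun i j => T (EuclideanSpace.single j 1) i).det := by
  have := LinearMap.det_toMatrix (EuclideanSpace.basisFun (Fin n) ℝ).toBasis
    (T : EuclideanSpace ℝ (Fin n) →ₗ[ℝ] EuclideanSpace ℝ (Fin n))
  rw [ContinuousLinearMap.det, ← this]
  congr 1

section Volume

variable {n : ℕ} {X : Type*} [TopologicalSpace X] [ChartedSpace (EuclideanSpace ℝ (Fin n)) X]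

/-- The volume density `√|det h_{ij}|` in a chart. -/
def density (h : FormField n X) (x₀ : X) (z : EuclideanSpace ℝ (Fin n)) : ℝ :=
  √|(Matrix.of fun i j => comp h x₀ i j z).det|

/-- The volume measure of a chart. -/
def chartMeasure [MeasurableSpace X] (h : FormField n X) (x₀ : X) : Measure X :=
  Measure.map (extChartAt (𝓡 n) x₀).symm
    ((volume.restrict (extChartAt (𝓡 n) x₀).target).withDensity fun z =>
      ENNReal.ofReal (density h x₀ z))

/-- The components of the form field are continuous in all charts. -/
def ContinuousComp (h : FormField n X) : Prop :=
  ∀ x₀ i j, ContinuousOn (comp h x₀ i j) (extChartAt (𝓡 n) x₀).target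

theorem ContinuousComp.density {h : FormField n X} (hh : ContinuousComp h) (x₀ : X) :
    ContinuousOn (density h x₀) (extChartAt (𝓡 n) x₀).target := by
  refine (ContinuousOn.abs ?_).sqrt
  rw [continuousOn_iff_continuous_domRestrict]
  refine Continuous.matrix_det (continuous_matrix fun i j => ?_)
  exact continuousOn_iff_continuous_domRestrict.1 (hh x₀ i j)

theorem ContinuousComp.aemeasurable_density {h : FormField n X} (hh : ContinuousComp h) (x₀ : X) :
    AEMeasurable (fun z => ENNReal.ofReal (LinEKG.density h x₀ z))
      (volume.restrict (extChartAt (𝓡 n) x₀).target) :=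
  ((hh.density x₀).aemeasurable (isOpen_extChartAt_target x₀).measurableSet).ennreal_ofReal

variable [MeasurableSpace X] [BorelSpace X]

theorem aemeasurable_chart_symm (h : FormField n X) (x₀ : X) :
    AEMeasurable (extChartAt (𝓡 n) x₀).symm
      ((volume.restrict (extChartAt (𝓡 n) x₀).target).withDensity fun z =>
        ENNReal.ofReal (density h x₀ z)) :=
  ((continuousOn_extChartAt_symm x₀).aemeasurable
    (isOpen_extChartAt_target x₀).measurableSet).mono_ac (withDensity_absolutelyContinuous _ _)

theorem chartMeasure_apply (h : FormField n X) (x₀ : X) {A : Set X} (hA : MeasurableSet A) :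
    chartMeasure h x₀ A = ∫⁻ z in (extChartAt (𝓡 n) x₀).symm ⁻¹' A ∩ (extChartAt (𝓡 n) x₀).target,
      ENNReal.ofReal (density h x₀ z) := by
  rw [chartMeasure, Measure.map_apply_of_aemeasurable (aemeasurable_chart_symm h x₀) hA,
    withDensity_apply', Measure.restrict_restrict' (isOpen_extChartAt_target x₀).measurableSet]

theorem chartMeasure_inter_source (h : FormField n X) (x₀ : X) {A : Set X} (hA : MeasurableSet A) :
    chartMeasure h x₀ (A ∩ (extChartAt (𝓡 n) x₀).source) = chartMeasure h x₀ A := by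
  rw [chartMeasure_apply h x₀ hA, chartMeasure_apply h x₀
    (hA.inter (isOpen_extChartAt_source x₀).measurableSet)]
  congr 2
  ext z
  exact ⟨fun hz => ⟨hz.1.1, hz.2⟩, fun hz => ⟨⟨hz.1, (extChartAt (𝓡 n) x₀).map_target hz.2⟩, hz.2⟩⟩

variable [IsManifold (𝓡 n) ∞ X]

omit [MeasurableSpace X] [BorelSpace X] in
-- The component matrices are congruent through the Jacobian matrix, so its determinant appears
-- squared below the root.
theorem density_transform (h : FormField n X) {x₀ y : X} {z : EuclideanSpace ℝ (Fin n)}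
    (hz : z ∈ (extChartAt (𝓡 n) x₀).target)
    (hy : (extChartAt (𝓡 n) x₀).symm z ∈ (extChartAt (𝓡 n) y).source) :
    density h x₀ z =
      |(fderiv ℝ (fun w => extChartAt (𝓡 n) y ((extChartAt (𝓡 n) x₀).symm w)) z).det| *
        density h y (extChartAt (𝓡 n) y ((extChartAt (𝓡 n) x₀).symm z)) := by
  set ψ := fun w => extChartAt (𝓡 n) y ((extChartAt (𝓡 n) x₀).symm w) with hψ
  have e : (Matrix.of fun i j => comp h x₀ i j z) =
      (Matrix.of fun i j => fderiv ℝ ψ z (EuclideanSpace.single j 1) i).transpose *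
        (Matrix.of fun i j => comp h y i j (ψ z)) *
        Matrix.of fun i j => fderiv ℝ ψ z (EuclideanSpace.single j 1) i := by
    ext i j
    simp only [Matrix.mul_apply, Matrix.transpose_apply, Matrix.of_apply, Finset.sum_mul]
    rw [comp_transform h hz hy, Finset.sum_comm]
    exact Finset.sum_congr rfl fun k _ => Finset.sum_congr rfl fun l _ => by ring
  unfold density
  rw [e, Matrix.det_mul, Matrix.det_mul, Matrix.det_transpose, ← det_eq_det_matrix, mul_right_comm,
    abs_mul, Real.sqrt_mul (abs_nonneg _), ← sq, abs_sq, Real.sqrt_sq_eq_abs]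

/-- The change of variables formula for the transition map: its Jacobian factor is the one by which
the densities differ. -/
theorem chartMeasure_eq (h : FormField n X) (x₀ y : X) {A : Set X} (hA : MeasurableSet A)
    (h₀ : A ⊆ (extChartAt (𝓡 n) x₀).source) (hy : A ⊆ (extChartAt (𝓡 n) y).source) :
    chartMeasure h x₀ A = chartMeasure h y A := by
  rw [chartMeasure_apply h x₀ hA, chartMeasure_apply h y hA]
  set ψ := fun w => extChartAt (𝓡 n) y ((extChartAt (𝓡 n) x₀).symm w) with hψ
  set P := (extChartAt (𝓡 n) x₀).symm ⁻¹' A ∩ (extChartAt (𝓡 n) x₀).target with hP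
  -- The inverse chart is continuous only on its target, so measurability is obtained on that
  -- subspace and carried over.
  have hPm : MeasurableSet P := by
    have := (isOpen_extChartAt_target (I := 𝓡 n) x₀).measurableSet.subtype_image
      ((continuousOn_iff_continuous_domRestrict.1
        (continuousOn_extChartAt_symm (I := 𝓡 n) x₀)).measurable hA)
    convert this using 1
    ext z
    simp [hP, and_comm]
  have himg : ψ '' P = (extChartAt (𝓡 n) y).symm ⁻¹' A ∩ (extChartAt (𝓡 n) y).target := by
    ext w
    constructor
    · rintro ⟨z, hz, rfl⟩
      have := hy hz.1
      exact ⟨by simpa only [hψ, mem_preimage, (extChartAt (𝓡 n) y).left_inv this] using hz.1,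
        (extChartAt (𝓡 n) y).map_source this⟩
    · rintro ⟨hw, hwt⟩
      refine ⟨extChartAt (𝓡 n) x₀ ((extChartAt (𝓡 n) y).symm w), ⟨?_,
        (extChartAt (𝓡 n) x₀).map_source (h₀ hw)⟩, ?_⟩
      · rw [mem_preimage, (extChartAt (𝓡 n) x₀).left_inv (h₀ hw)]
        exact hw
      · simp only [hψ]
        rw [(extChartAt (𝓡 n) x₀).left_inv (h₀ hw), (extChartAt (𝓡 n) y).right_inv hwt]
  have hinj : InjOn ψ P := by
    intro z hz w hw hzw
    have := (extChartAt (𝓡 n) y).injOn (hy hz.1) (hy hw.1) hzw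
    exact (extChartAt (𝓡 n) x₀).symm.injOn hz.2 hw.2 this
  rw [← himg, lintegral_image_eq_lintegral_abs_det_fderiv_mul volume hPm (f' := fderiv ℝ ψ)
    (fun z hz => ?_) hinj]
  · refine setLIntegral_congr_fun hPm fun z hz => ?_
    rw [density_transform h hz.2 (hy hz.1), ENNReal.ofReal_mul (abs_nonneg _)]
  · have hzd : z ∈ (extChartAt (𝓡 n) x₀).target ∩
        (extChartAt (𝓡 n) x₀).symm ⁻¹' (extChartAt (𝓡 n) y).source := ⟨hz.2, hy hz.1⟩
    exact (((contDiffOn_transition x₀ y z hzd).contDiffAt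
      ((isOpen_transition_domain x₀ y).mem_nhds hzd)).differentiableAt
        (by simp)).hasFDerivAt.hasFDerivWithinAt

variable [SecondCountableTopology X]

omit [MeasurableSpace X] [BorelSpace X] [IsManifold (𝓡 n) ∞ X] in
theorem exists_countable_charts [Nonempty X] :
    ∃ c : ℕ → X, (⋃ k, (extChartAt (𝓡 n) (c k)).source) = univ := by
  obtain ⟨s, hs, hsu⟩ := TopologicalSpace.countable_cover_nhds
    (f := fun x : X => (extChartAt (𝓡 n) x).source) fun x =>
      (isOpen_extChartAt_source x).mem_nhds (mem_extChartAt_source x)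
  have hne : s.Nonempty := by
    by_contra h
    rw [not_nonempty_iff_eq_empty] at h
    subst h
    obtain ⟨x⟩ := ‹Nonempty X›
    have : x ∈ (univ : Set X) := mem_univ x
    rw [← hsu] at this
    simp at this
  obtain ⟨c, hc⟩ := hs.exists_eq_range hne
  refine ⟨c, ?_⟩
  rw [← hsu, hc, biUnion_range]

/-- The volume measure, restricted to the domain of a chart. -/
theorem volMeasure_restrict_source (h : FormField n X) (x₀ : X) :
    (volMeasure h).restrict (extChartAt (𝓡 n) x₀).source = chartMeasure h x₀ := by
  have : Nonempty X := ⟨x₀⟩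
  have hc := exists_countable_charts (n := n) (X := X)
  have hsm := (isOpen_extChartAt_source (I := 𝓡 n) x₀).measurableSet
  have hD : ∀ k, MeasurableSet
      (disjointed (fun m => (extChartAt (𝓡 n) (hc.choose m)).source) k) :=
    MeasurableSet.disjointed fun m => (isOpen_extChartAt_source _).measurableSet
  ext A hA
  rw [Measure.restrict_apply hA, volMeasure, dif_pos hc, Measure.sum_apply _ (hA.inter hsm)]
  -- Each piece of the decomposition, intersected with the given chart domain, lies in both chart
  -- domains, where the two chart measures agree.
  have h1 : ∀ k, ((chartMeasure h (hc.choose k)).restrict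
      (disjointed (fun m => (extChartAt (𝓡 n) (hc.choose m)).source) k))
        (A ∩ (extChartAt (𝓡 n) x₀).source) = chartMeasure h x₀
          (A ∩ (extChartAt (𝓡 n) x₀).source ∩
            disjointed (fun m => (extChartAt (𝓡 n) (hc.choose m)).source) k) := by
    intro k
    rw [Measure.restrict_apply (hA.inter hsm)]
    exact chartMeasure_eq h _ _ ((hA.inter hsm).inter (hD k))
      (inter_subset_right.trans (disjointed_subset _ k))
      (inter_subset_left.trans inter_subset_right)
  refine (tsum_congr h1).trans ?_
  rw [← measure_iUnion, ← inter_iUnion, iUnion_disjointed, hc.choose_spec, inter_univ,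
    chartMeasure_inter_source h x₀ hA]
  · intro i j hij
    exact (disjoint_disjointed _ hij).mono inter_subset_right inter_subset_right
  · exact fun k => (hA.inter hsm).inter (hD k)

/-- Integrals over the domain of a chart. -/
theorem integral_volMeasure {h : FormField n X} (hh : ContinuousComp h) (x₀ : X) {f : X → ℝ}
    (hf : AEStronglyMeasurable f (volMeasure h))
    (hs : ∀ x, x ∉ (extChartAt (𝓡 n) x₀).source → f x = 0) :
    ∫ x, f x ∂(volMeasure h) = ∫ z in (extChartAt (𝓡 n) x₀).target,
      density h x₀ z * f ((extChartAt (𝓡 n) x₀).symm z) := by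
  rw [← setIntegral_eq_integral_of_forall_compl_eq_zero hs, volMeasure_restrict_source,
    chartMeasure, integral_map (aemeasurable_chart_symm h x₀),
    integral_withDensity_eq_integral_toReal_smul₀ (hh.aemeasurable_density x₀)
      (by filter_upwards with z using ENNReal.ofReal_lt_top)]
  · refine integral_congr_ae (Eventually.of_forall fun z => ?_)
    simp only
    rw [ENNReal.toReal_ofReal (show 0 ≤ density h x₀ z from Real.sqrt_nonneg _), smul_eq_mul]
  · have := hf.restrict (s := (extChartAt (𝓡 n) x₀).source)
    rwa [volMeasure_restrict_source] at this

/-- A coordinate ball whose closure is a compact subset of the target has finite measure because the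
continuous density is bounded there. -/
theorem isLocallyFiniteMeasure_volMeasure {h : FormField n X} (hh : ContinuousComp h) :
    IsLocallyFiniteMeasure (volMeasure h) := by
  refine ⟨fun x₀ => ?_⟩
  obtain ⟨r, hr, hrs⟩ := Metric.nhds_basis_closedBall.mem_iff.1
    ((isOpen_extChartAt_target (I := 𝓡 n) x₀).mem_nhds (mem_extChartAt_target x₀))
  set V : Set X := (extChartAt (𝓡 n) x₀).source ∩
    extChartAt (𝓡 n) x₀ ⁻¹' Metric.ball (extChartAt (𝓡 n) x₀ x₀) r with hV
  have hVo : IsOpen V := (continuousOn_extChartAt x₀).isOpen_inter_preimage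
    (isOpen_extChartAt_source x₀) Metric.isOpen_ball
  refine ⟨V, hVo.mem_nhds ⟨mem_extChartAt_source x₀, Metric.mem_ball_self hr⟩, ?_⟩
  have h1 : volMeasure h V = chartMeasure h x₀ V := by
    rw [← volMeasure_restrict_source, Measure.restrict_apply hVo.measurableSet,
      inter_eq_left.2 inter_subset_left]
  rw [h1, chartMeasure_apply h x₀ hVo.measurableSet]
  have hK : IsCompact (Metric.closedBall (extChartAt (𝓡 n) x₀ x₀) r) := isCompact_closedBall _ _
  obtain ⟨C, hC⟩ := (hK.image_of_continuousOn ((hh.density x₀).mono hrs)).bddAbove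
  calc _ ≤ ∫⁻ z in Metric.closedBall (extChartAt (𝓡 n) x₀ x₀) r,
        ENNReal.ofReal (LinEKG.density h x₀ z) := by
        refine lintegral_mono_set fun z hz => ?_
        have := hz.1.2
        rw [mem_preimage, (extChartAt (𝓡 n) x₀).right_inv hz.2] at this
        exact Metric.ball_subset_closedBall this
    _ ≤ ∫⁻ _ in Metric.closedBall (extChartAt (𝓡 n) x₀ x₀) r, ENNReal.ofReal C := by
        refine setLIntegral_mono measurable_const fun z hz => ?_
        exact ENNReal.ofReal_le_ofReal (hC ⟨z, hz, rfl⟩)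
    _ < ⊤ := by
        rw [setLIntegral_const]
        exact ENNReal.mul_lt_top ENNReal.ofReal_lt_top hK.measure_lt_top

end Volume

/-! ## Cauchy sets of a chronological relation -/

/-- The properties of the chronological relation `R` of a spacetime and of its inextendible
timelike curves that the theory of Cauchy surfaces uses. -/
structure Chronology {M : Type*} [TopologicalSpace M] (R : M → M → Prop) (Γ : Set (ℝ → M)) :
    Prop where
  trans : ∀ {x y z}, R x y → R y z → R x z
  isOpen_future : ∀ x, IsOpen {y | R x y}
  isOpen_past : ∀ x, IsOpen {y | R y x}
  exists_future : ∀ x, ∀ U ∈ 𝓝 x, ∃ y ∈ U, y ≠ x ∧ R x y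
  exists_past : ∀ x, ∀ U ∈ 𝓝 x, ∃ y ∈ U, y ≠ x ∧ R y x
  continuous : ∀ γ ∈ Γ, Continuous γ
  mono : ∀ γ ∈ Γ, ∀ s t, s < t → R (γ s) (γ t)
  chain : ∀ x : ℤ → M, (∀ n, R (x n) (x (n + 1))) →
    (¬ ∃ p, Tendsto (fun n : ℕ => x n) atTop (𝓝 p)) →
    (¬ ∃ p, Tendsto (fun n : ℕ => x (-n)) atTop (𝓝 p)) → ∃ γ ∈ Γ, ∀ n : ℤ, γ n = x n

/-- A set that is met exactly once by every curve in `Γ`. -/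
def MeetsOnce {M : Type*} (Γ : Set (ℝ → M)) (C : Set M) : Prop := ∀ γ ∈ Γ, ∃! t, γ t ∈ C

/-- The points that are related to some point of `C`. -/
def future {M : Type*} (R : M → M → Prop) (C : Set M) : Set M := {y | ∃ x ∈ C, R x y}

namespace Chronology

variable {M : Type*} [TopologicalSpace M] {R : M → M → Prop} {Γ : Set (ℝ → M)}

/-- Time reversal: every statement about futures yields the corresponding one about pasts. -/
theorem flip (h : Chronology R Γ) : Chronology (flip R) {γ | (fun t => γ (-t)) ∈ Γ} where
  trans h₁ h₂ := h.trans h₂ h₁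
  isOpen_future := h.isOpen_past
  isOpen_past := h.isOpen_future
  exists_future := h.exists_past
  exists_past := h.exists_future
  continuous γ hγ := by
    simpa [Function.comp_def] using (h.continuous _ hγ).comp continuous_neg
  mono γ hγ s t hst := by simpa [_root_.flip] using h.mono _ hγ (-t) (-s) (by linarith)
  chain x hx h₁ h₂ := by
    obtain ⟨γ, hγ, hγx⟩ := h.chain (fun n => x (-n)) (fun n => by
      have := hx (-(n + 1))
      rwa [show -(n + 1) + 1 = -n by ring] at this) h₂ (by simpa using h₁)
    refine ⟨fun t => γ (-t), by simpa using hγ, fun n => ?_⟩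
    have := hγx (-n)
    push_cast at this
    rw [neg_neg] at this
    exact this

omit [TopologicalSpace M] in
theorem _root_.LinEKG.MeetsOnce.flip {C : Set M} (hC : MeetsOnce Γ C) :
    MeetsOnce {γ | (fun t => γ (-t)) ∈ Γ} C := by
  intro γ hγ
  obtain ⟨t, ht, hu⟩ := hC _ hγ
  exact ⟨-t, ht, fun s hs => by rw [← hu (-s) (by simpa using hs), neg_neg]⟩

variable (h : Chronology R Γ)
include h

theorem isOpen_future_set (C : Set M) : IsOpen (future R C) := by
  have : future R C = ⋃ x ∈ C, {y | R x y} := by ext; simp [future]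
  rw [this]
  exact isOpen_biUnion fun x _ => h.isOpen_future x

/-- A greedy construction: each step covers at least half of the distance available, capped at one.
Were there a limit, the steps would shrink to zero although some point different from the limit
stayed reachable. -/
theorem exists_forward [TopologicalSpace.MetrizableSpace M] (p : M) : ∃ x : ℕ → M, x 0 = p ∧
    (∀ n, R (x n) (x (n + 1))) ∧ ¬ ∃ q, Tendsto x atTop (𝓝 q) := by
  let _ := TopologicalSpace.metrizableSpaceMetric M
  have hne : ∀ p : M, ∃ q, q ≠ p ∧ R p q := fun p => by
    obtain ⟨q, _, hq⟩ := h.exists_future p univ univ_mem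
    exact ⟨q, hq⟩
  -- The supremum of the distances, capped at one, of the points reachable from `p`; the cap keeps
  -- it finite.
  set s : M → ℝ := fun p => sSup ((fun y => min 1 (dist p y)) '' {y | R p y}) with hs
  have hb : ∀ p, BddAbove ((fun y => min 1 (dist p y)) '' {y | R p y}) := fun p =>
    ⟨1, by rintro _ ⟨y, _, rfl⟩; exact min_le_left _ _⟩
  have hle : ∀ p y, R p y → min 1 (dist p y) ≤ s p := fun p y hy => le_csSup (hb p) ⟨y, hy, rfl⟩
  have hpos : ∀ p, 0 < s p := fun p => by
    obtain ⟨q, hq, hpq⟩ := hne p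
    exact (lt_min one_pos (dist_pos.2 hq.symm)).trans_le (hle p q hpq)
  have hnext : ∀ p, ∃ q, R p q ∧ s p / 2 < min 1 (dist p q) := fun p => by
    obtain ⟨_, ⟨q, hq, rfl⟩, hlt⟩ := exists_lt_of_lt_csSup
      (by obtain ⟨q, _, hpq⟩ := hne p; exact ⟨_, q, hpq, rfl⟩) (half_lt_self (hpos p))
    exact ⟨q, hq, hlt⟩
  choose f hf hfs using hnext
  have hstep : ∀ n, f^[n + 1] p = f (f^[n] p) := fun n => Function.iterate_succ_apply' f n p
  refine ⟨fun n => f^[n] p, rfl, fun n => by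
    simp only [hstep]; exact hf _, ?_⟩
  rintro ⟨q, hq⟩
  -- A point `y` in the future of the supposed limit is reachable from all late members of the
  -- chain, because its past is open.
  obtain ⟨y, hy, hqy⟩ := hne q
  have h1 : ∀ᶠ n in atTop, R (f^[n] p) y := hq.eventually ((h.isOpen_past y).mem_nhds hqy)
  have h2 : Tendsto (fun n => 2 * dist (f^[n] p) (f^[n + 1] p)) atTop (𝓝 0) := by
    have := (hq.dist ((tendsto_add_atTop_iff_nat 1).2 hq)).const_mul 2
    simpa using this
  have h3 : Tendsto (fun n => min 1 (dist (f^[n] p) y)) atTop (𝓝 (min 1 (dist q y))) :=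
    tendsto_const_nhds.min (hq.dist tendsto_const_nhds)
  have h4 : min 1 (dist q y) ≤ 0 := by
    refine le_of_tendsto_of_tendsto h3 h2 ?_
    filter_upwards [h1] with n hn
    have a := hle _ _ hn
    have b := hfs (f^[n] p)
    have c : min 1 (dist (f^[n] p) (f^[n + 1] p)) ≤ dist (f^[n] p) (f^[n + 1] p) := min_le_right _ _
    rw [hstep] at c ⊢
    linarith
  exact absurd h4 (not_le.2 (lt_min one_pos (dist_pos.2 hy.symm)))

theorem exists_backward [TopologicalSpace.MetrizableSpace M] (p : M) : ∃ x : ℕ → M, x 0 = p ∧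
    (∀ n, R (x (n + 1)) (x n)) ∧ ¬ ∃ q, Tendsto x atTop (𝓝 q) := h.flip.exists_forward p

/-- A forward chain without a limit and a backward one, with related starting points, are parts of
a curve. -/
theorem exists_curve_of_chains {x y : ℕ → M} (hx : ∀ n, R (x n) (x (n + 1)))
    (hy : ∀ n, R (y (n + 1)) (y n)) (hyx : R (y 0) (x 0)) (hxl : ¬ ∃ q, Tendsto x atTop (𝓝 q))
    (hyl : ¬ ∃ q, Tendsto y atTop (𝓝 q)) :
    ∃ γ ∈ Γ, (∀ n : ℕ, γ n = x n) ∧ ∀ n : ℕ, γ (-(n + 1)) = y n := by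
  -- The forward chain occupies the integers from 0 on; the backward chain occupies the negative
  -- ones, with `y n` at −(n+1).
  obtain ⟨γ, hγ, hγx⟩ := h.chain (fun n => match n with
    | Int.ofNat n => x n
    | Int.negSucc n => y n) (fun n => by
      match n with
      | Int.ofNat n => exact hx n
      | Int.negSucc 0 => exact hyx
      | Int.negSucc (n + 1) => exact hy n) hxl (by
        rintro ⟨q, hq⟩
        refine hyl ⟨q, ?_⟩
        exact ((tendsto_add_atTop_iff_nat 1).2 hq))
  refine ⟨γ, hγ, fun n => by simpa using hγx n, fun n => ?_⟩
  have := hγx (Int.negSucc n)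
  rw [Int.negSucc_eq] at this
  push_cast at this
  rw [this]
  rfl

variable [TopologicalSpace.MetrizableSpace M] {C : Set M} (hC : MeetsOnce Γ C)

theorem exists_curve_of_rel {p q : M} (hpq : R p q) :
    ∃ γ ∈ Γ, γ 0 = q ∧ γ (-1) = p := by
  obtain ⟨x, hx0, hx, hxl⟩ := h.exists_forward q
  obtain ⟨y, hy0, hy, hyl⟩ := h.exists_backward p
  obtain ⟨γ, hγ, h1, h2⟩ := h.exists_curve_of_chains hx hy (by rwa [hx0, hy0]) hxl hyl
  exact ⟨γ, hγ, by simpa [hx0] using h1 0, by simpa [hy0] using h2 0⟩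

include hC

/-- Two related points lie at different times on a common curve in `Γ`, which would then meet `C`
twice. -/
theorem achronal {p q : M} (hp : p ∈ C) (hq : q ∈ C) : ¬ R p q := by
  intro hpq
  obtain ⟨γ, hγ, h0, h1⟩ := h.exists_curve_of_rel hpq
  have := (hC γ hγ).unique (y₁ := 0) (y₂ := -1) (by rwa [h0]) (by rwa [h1])
  norm_num at this

/-- A curve in `Γ` through `p` meets `C` before, at, or after its passage through `p`. -/
theorem mem_or_future_or_past (p : M) :
    p ∈ C ∨ p ∈ future R C ∨ p ∈ future (_root_.flip R) C := by
  obtain ⟨q, _, _, hpq⟩ := h.exists_past p univ univ_mem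
  obtain ⟨γ, hγ, h0, _⟩ := h.exists_curve_of_rel hpq
  obtain ⟨t, ht, _⟩ := hC γ hγ
  rcases lt_trichotomy t 0 with h1 | h1 | h1
  · exact Or.inr (Or.inl ⟨γ t, ht, h0 ▸ h.mono γ hγ t 0 h1⟩)
  · exact Or.inl (by rwa [← h0, ← h1])
  · exact Or.inr (Or.inr ⟨γ t, ht, h0 ▸ h.mono γ hγ 0 t h1⟩)

theorem disjoint_future : Disjoint C (future R C) := by
  rw [disjoint_left]
  rintro p hp ⟨q, hq, hqp⟩
  exact h.achronal hC hq hp hqp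

theorem disjoint_future_past : Disjoint (future R C) (future (_root_.flip R) C) := by
  rw [disjoint_left]
  rintro p ⟨q, hq, hqp⟩ ⟨r, hr, hpr⟩
  exact h.achronal hC hq hr (h.trans hqp hpr)

theorem compl_eq : Cᶜ = future R C ∪ future (_root_.flip R) C := by
  ext p
  refine ⟨fun hp => (h.mem_or_future_or_past hC p).resolve_left hp, ?_⟩
  rintro (hp | hp) hpC
  · exact disjoint_left.1 (h.disjoint_future hC) hpC hp
  · exact disjoint_left.1 (h.flip.disjoint_future hC.flip) hpC hp

theorem isClosed : IsClosed C := by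
  rw [← isOpen_compl_iff, h.compl_eq hC]
  exact (h.isOpen_future_set C).union (h.flip.isOpen_future_set C)

/-- A closed timelike loop gives a curve that runs back and forth between two distinct points for
ever in both directions. It has no end points, so it meets `C`, but it visits `p` both before and
after doing so. -/
theorem irrefl (p : M) : ¬ R p p := by
  intro hpp
  -- If `p` precedes itself, its past is an open neighbourhood of `p`, so the past also contains a
  -- point `q` of the future of `p` other than `p`.
  obtain ⟨q, hqp, hne, hpq⟩ := h.exists_future p _ ((h.isOpen_past p).mem_nhds hpp)
  have hlim : ∀ x : ℕ → M, (∀ n, x (2 * n) = p) → (∀ n, x (2 * n + 1) = q) →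
      ¬ ∃ r, Tendsto x atTop (𝓝 r) := by
    rintro x hp hq ⟨r, hr⟩
    have t1 : Tendsto (fun n : ℕ => 2 * n) atTop atTop :=
      tendsto_atTop_mono (fun n => show n ≤ _ by omega) tendsto_id
    have t2 : Tendsto (fun n : ℕ => 2 * n + 1) atTop atTop := 
      tendsto_atTop_mono (fun n => show n ≤ _ by omega) tendsto_id
    have h1 := hr.comp t1
    have h2 := hr.comp t2
    rw [show x ∘ (fun n => 2 * n) = fun _ => p from funext hp] at h1
    rw [show x ∘ (fun n => 2 * n + 1) = fun _ => q from funext hq] at h2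
    exact hne ((tendsto_const_nhds_iff.1 h2).trans (tendsto_const_nhds_iff.1 h1).symm)
  -- The same alternating sequence serves as forward and as backward chain, since `p` and `q`
  -- precede each other. Having two accumulation points, it has no limit.
  set x : ℕ → M := fun n => if Even n then p else q with hx
  have hxR : ∀ n, R (x n) (x (n + 1)) ∧ R (x (n + 1)) (x n) := by
    intro n
    by_cases hn : Even n
    · simp only [hx, hn, if_true, Nat.even_add_one, not_true, if_false]
      exact ⟨hpq, hqp⟩
    · simp only [hx, hn, if_false, Nat.even_add_one, not_false_eq_true, if_true]
      exact ⟨hqp, hpq⟩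
  have hxl := hlim x (fun n => by simp [hx]) (fun n => by simp [hx])
  obtain ⟨γ, hγ, h1, h2⟩ := h.exists_curve_of_chains (fun n => (hxR n).1) (fun n => (hxR n).2)
    (by simpa [hx] using hpp) hxl hxl
  obtain ⟨t, ht, _⟩ := hC γ hγ
  obtain ⟨n, hn⟩ := exists_nat_gt |t|
  have hp1 : γ ((2 * n : ℕ) : ℝ) = p := by rw [h1]; simp [hx]
  have hp2 : γ (-(((2 * n : ℕ) : ℝ) + 1)) = p := by rw [h2]; simp [hx]
  have habs := abs_lt.1 hn
  -- The curve is at `p` at the times 2n and −(2n+1), and `n` was chosen so large that the crossing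
  -- time lies strictly between them.
  have m1 : p ∈ future R C := ⟨γ t, ht, by
    rw [← hp1]
    exact h.mono γ hγ _ _ (by push_cast; linarith [abs_nonneg t])⟩
  have m2 : p ∈ future (_root_.flip R) C := ⟨γ t, ht, by
    rw [← hp2]
    exact h.mono γ hγ _ _ (by push_cast; linarith [abs_nonneg t])⟩
  exact disjoint_left.1 (h.disjoint_future_past hC) m1 m2

omit hC in
-- Without a limit the chain would continue to a curve in `Γ`; after its crossing of `C` the curve,
-- and with it the chain, lies in the future of `C`.
theorem not_tendsto_of_chain {x : ℕ → M} (hx : ∀ n, R (x n) (x (n + 1)))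
    (hC : MeetsOnce Γ C) (hxC : ∀ n, x n ∉ future R C) : ∃ q, Tendsto x atTop (𝓝 q) := by
  by_contra hl
  obtain ⟨y, hy0, hy, hyl⟩ := h.exists_backward (x 0)
  obtain ⟨γ, hγ, h1, _⟩ := h.exists_curve_of_chains hx (fun n => hy (n + 1)) (hy0 ▸ hy 0) hl
    (fun ⟨q, hq⟩ => hyl ⟨q, (tendsto_add_atTop_iff_nat 1).1 hq⟩)
  obtain ⟨t, ht, _⟩ := hC γ hγ
  obtain ⟨n, hn⟩ := exists_nat_gt t
  exact hxC n ⟨γ t, ht, h1 n ▸ h.mono γ hγ t n hn⟩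

omit hC [TopologicalSpace.MetrizableSpace M] in
/-- The frontier of an open future set between two Cauchy sets is a Cauchy set. -/
theorem meetsOnce_frontier {Cm D : Set M} (hC : MeetsOnce Γ C) (hCm : MeetsOnce Γ Cm)
    (hD : IsOpen D) (hfut : ∀ x ∈ D, ∀ y, R x y → y ∈ D)
    (hsub : future R C ∩ future R Cm ⊆ D) (hdis : Disjoint D (future (_root_.flip R) Cm)) :
    MeetsOnce Γ (frontier D) := by
  intro γ hγ
  have hcont := h.continuous γ hγ
  have hmono := h.mono γ hγ
  -- Pasts are open, so a point following a limit of points of `D` also follows a point of `D`.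
  have hcl : ∀ x ∈ closure D, ∀ y, R x y → y ∈ D := by
    intro x hx y hxy
    obtain ⟨d, hdy, hd⟩ := mem_closure_iff.1 hx _ (h.isOpen_past y) hxy
    exact hfut d hd y hdy
  rw [hD.frontier_eq]
  obtain ⟨t₁, ht₁, _⟩ := hC γ hγ
  obtain ⟨t₂, ht₂, _⟩ := hCm γ hγ
  -- The times spent in `D`. The curve enters `D` after both crossings and is not in `D` before its
  -- crossing of `Cm`; the infimum is the time at which it meets the frontier.
  set S : Set ℝ := {t | γ t ∈ D} with hS
  have hSo : IsOpen S := hD.preimage hcont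
  have hSne : S.Nonempty := ⟨max t₁ t₂ + 1, hsub
    ⟨⟨_, ht₁, hmono _ _ (by linarith [le_max_left t₁ t₂])⟩,
      ⟨_, ht₂, hmono _ _ (by linarith [le_max_right t₁ t₂])⟩⟩⟩
  have hSb : ∀ t ∈ S, t₂ ≤ t := by
    intro t ht
    by_contra hlt
    exact disjoint_left.1 hdis ht ⟨_, ht₂, hmono _ _ (not_le.1 hlt)⟩
  have hbdd : BddBelow S := ⟨t₂, hSb⟩
  refine ⟨sInf S, ⟨?_, fun hmem => ?_⟩, ?_⟩
  · have : sInf S ∈ closure S := csInf_mem_closure hSne hbdd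
    exact hcont.closure_preimage_subset D this
  · obtain ⟨ε, hε, hball⟩ := Metric.isOpen_iff.1 hSo (sInf S) hmem
    have h1 : sInf S - ε / 2 ∈ S := hball (by
      rw [Metric.mem_ball, Real.dist_eq, abs_lt]; constructor <;> linarith)
    linarith [csInf_le hbdd h1]
  · have huniq : ∀ s t, γ s ∈ closure D \ D → γ t ∈ closure D \ D → ¬ s < t := fun s t hs ht hst =>
      ht.2 (hcl _ hs.1 _ (hmono s t hst))
    have hinf : γ (sInf S) ∈ closure D \ D := by
      refine ⟨hcont.closure_preimage_subset D (csInf_mem_closure hSne hbdd), fun hmem => ?_⟩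
      obtain ⟨ε, hε, hball⟩ := Metric.isOpen_iff.1 hSo (sInf S) hmem
      have h1 : sInf S - ε / 2 ∈ S := hball (by
        rw [Metric.mem_ball, Real.dist_eq, abs_lt]; constructor <;> linarith)
      linarith [csInf_le hbdd h1]
    intro t ht
    exact le_antisymm (not_lt.1 (huniq _ _ hinf ht)) (not_lt.1 (huniq _ _ ht hinf))

omit hC in
/-- The part of a space-like compact closed set between two Cauchy sets is compact. -/
theorem isCompact_slab {A Cm : Set M} (hC : MeetsOnce Γ C) (hCm : MeetsOnce Γ Cm)
    (hA : IsClosed A) (hcpt : ∀ D, MeetsOnce Γ D → IsCompact (A ∩ D)) :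
    IsCompact (A \ (future R C ∪ future (_root_.flip R) Cm)) := by
  let _ := TopologicalSpace.metrizableSpaceMetric M
  set K := A \ (future R C ∪ future (_root_.flip R) Cm) with hK
  have hKc : IsClosed K := hA.sdiff ((h.isOpen_future_set C).union (h.flip.isOpen_future_set Cm))
  rw [isCompact_iff_isSeqCompact]
  intro x hx
  suffices hs : ∃ q, ∃ φ : ℕ → ℕ, StrictMono φ ∧ Tendsto (x ∘ φ) atTop (𝓝 q) by
    obtain ⟨q, φ, hφ, hq⟩ := hs
    exact ⟨q, hKc.mem_of_tendsto hq (Eventually.of_forall fun n => hx _), φ, hφ, hq⟩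
  have : IsTrans M R := ⟨fun _ _ _ => h.trans⟩
  have : IsTrans M (_root_.flip R) := ⟨fun _ _ _ => h.flip.trans⟩
  -- Ramsey's theorem, used once for the relation and once for its converse, leaves three kinds of
  -- subsequence: increasing, decreasing, or pairwise unrelated.
  obtain ⟨φ, hφ⟩ := exists_increasing_or_nonincreasing_subseq R x
  rcases hφ with hφ | hφ
  · obtain ⟨q, hq⟩ := h.not_tendsto_of_chain (x := x ∘ φ)
      (fun n => hφ n (n + 1) (Nat.lt_succ_self n)) hC fun n hn => (hx (φ n)).2 (Or.inl hn)
    exact ⟨q, φ, φ.strictMono, hq⟩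
  obtain ⟨ψ, hψ⟩ := exists_increasing_or_nonincreasing_subseq (_root_.flip R) (x ∘ φ)
  rcases hψ with hψ | hψ
  · obtain ⟨q, hq⟩ := h.flip.not_tendsto_of_chain (x := x ∘ φ ∘ ψ)
      (fun n => hψ n (n + 1) (Nat.lt_succ_self n)) hCm.flip fun n hn => (hx _).2 (Or.inr hn)
    exact ⟨q, φ ∘ ψ, φ.strictMono.comp ψ.strictMono, hq⟩
  set y := x ∘ φ ∘ ψ with hy
  -- The two applications cover m < n and m > n; irreflexivity covers m = n.
  have hyR : ∀ m n, ¬ R (y m) (y n) := by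
    intro m n
    rcases lt_trichotomy m n with hmn | rfl | hmn
    · exact hφ _ _ (ψ.strictMono hmn)
    · exact h.irrefl hC _
    · exact hψ _ _ hmn
  have hyK : ∀ n, y n ∈ K := fun n => hx _
  -- The future of the unrelated points, enlarged so that every curve eventually enters it.
  -- Intersecting the two futures means that no order between `C` and `Cm` has to be assumed.
  set D := (future R C ∩ future R Cm) ∪ future R (range y) with hD
  have hDo : IsOpen D := ((h.isOpen_future_set C).inter (h.isOpen_future_set Cm)).union
    (h.isOpen_future_set _)
  have hFC : MeetsOnce Γ (frontier D) := by
    refine h.meetsOnce_frontier hC hCm hDo ?_ subset_union_left ?_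
    · rintro p (⟨⟨a, ha, hap⟩, c, hc, hcp⟩ | ⟨a, ha, hap⟩) q hpq
      · exact Or.inl ⟨⟨a, ha, h.trans hap hpq⟩, c, hc, h.trans hcp hpq⟩
      · exact Or.inr ⟨a, ha, h.trans hap hpq⟩
    · rw [disjoint_left]
      rintro p (⟨_, hp⟩ | ⟨_, ⟨n, rfl⟩, hap⟩) hpm
      · exact disjoint_left.1 (h.disjoint_future_past hCm) hp hpm
      · obtain ⟨c, hc, hpc⟩ := hpm
        exact (hyK n).2 (Or.inr ⟨c, hc, h.trans hap hpc⟩)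
  -- Each `y n` is a limit of points of its own future, and it lies outside `D` because it is
  -- neither in the future of `C` nor in that of any `y m`.
  have hyF : ∀ n, y n ∈ A ∩ frontier D := by
    intro n
    refine ⟨(hyK n).1, ?_⟩
    rw [hDo.frontier_eq]
    refine ⟨mem_closure_iff_nhds.2 fun U hU => ?_, ?_⟩
    · obtain ⟨q, hqU, _, hq⟩ := h.exists_future (y n) U hU
      exact ⟨q, hqU, Or.inr ⟨y n, ⟨n, rfl⟩, hq⟩⟩
    · rintro (⟨hp, _⟩ | ⟨_, ⟨m, rfl⟩, hm⟩)
      · exact (hyK n).2 (Or.inl hp)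
      · exact hyR m n hm
  obtain ⟨q, _, χ, hχ, hq⟩ := (hcpt _ hFC).isSeqCompact hyF
  exact ⟨q, φ ∘ ψ ∘ χ, φ.strictMono.comp (ψ.strictMono.comp hχ), hq⟩

end Chronology

/-! ## Piecewise smooth curves -/

section Curves

variable {M : Type*} [TopologicalSpace M] [ChartedSpace (EuclideanSpace ℝ (Fin 4)) M]
  {C C' : ∀ x : M, TangentSpace (𝓡 4) x → Prop} {γ γ' : ℝ → M} {a b a' b' : ℝ}

theorem class_congr (C : ∀ x : M, TangentSpace (𝓡 4) x → Prop) {x y : M} (hxy : x = y)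
    {v : EuclideanSpace ℝ (Fin 4)} (hv : C x v) : C y v := by
  subst hxy; exact hv

theorem ArcOn.of_hasMFDerivWithinAt (hab : a < b)
    (h : ContMDiffOn 𝓘(ℝ, ℝ) (𝓡 4) 1 γ (Icc a b))
    (h' : ∀ r ∈ Icc a b, ∃ L, HasMFDerivWithinAt 𝓘(ℝ, ℝ) (𝓡 4) γ (Icc a b) r L ∧
      C (γ r) (L (1 : ℝ))) : ArcOn C γ a b := by
  refine ⟨h, fun r hr => ?_⟩
  obtain ⟨L, hL, hC⟩ := h' r hr
  rwa [hL.mfderivWithin ((uniqueDiffOn_Icc hab).uniqueMDiffOn r hr)]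

theorem ArcOn.hasMFDerivWithinAt (h : ArcOn C γ a b) {r : ℝ} (hr : r ∈ Icc a b) :
    HasMFDerivWithinAt 𝓘(ℝ, ℝ) (𝓡 4) γ (Icc a b) r
      (mfderivWithin 𝓘(ℝ, ℝ) (𝓡 4) γ (Icc a b) r) :=
  ((h.1 r hr).mdifferentiableWithinAt (by simp)).hasMFDerivWithinAt

theorem ArcOn.mono (h : ArcOn C γ a b) (ha : a ≤ a') (hb : b' ≤ b) (hab : a' < b') :
    ArcOn C γ a' b' := by
  have hs : Icc a' b' ⊆ Icc a b := Icc_subset_Icc ha hb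
  exact .of_hasMFDerivWithinAt hab (h.1.mono hs) fun r hr =>
    ⟨_, (h.hasMFDerivWithinAt (hs hr)).mono hs, h.2 r (hs hr)⟩

theorem ArcOn.congr (h : ArcOn C γ a b) (hab : a < b) (he : EqOn γ' γ (Icc a b)) :
    ArcOn C γ' a b := by
  refine .of_hasMFDerivWithinAt hab (h.1.congr he) fun r hr => ?_
  have h1 := (h.hasMFDerivWithinAt hr).congr_of_eventuallyEq
    (eventuallyEq_of_mem self_mem_nhdsWithin he) (he hr)
  exact ⟨_, h1, class_congr C (he hr).symm (h.2 r hr)⟩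

theorem ArcOn.imp (h : ArcOn C γ a b) (hC : ∀ x v, C x v → C' x v) : ArcOn C' γ a b :=
  ⟨h.1, fun r hr => hC _ _ (h.2 r hr)⟩

theorem ArcOn.comp_affine (hC : ∀ x v (c : ℝ), 0 < c → C x v → C x (c • v)) {c d : ℝ} (hc : 0 < c)
    (hab : a < b) (h : ArcOn C γ (c * a + d) (c * b + d)) :
    ArcOn C (fun r => γ (c * r + d)) a b := by
  have hm : MapsTo (fun r => c * r + d) (Icc a b) (Icc (c * a + d) (c * b + d)) := fun r hr =>
    ⟨by nlinarith [hr.1], by nlinarith [hr.2]⟩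
  have hsm : ContMDiff 𝓘(ℝ, ℝ) 𝓘(ℝ, ℝ) 1 (fun r : ℝ => c * r + d) :=
    contMDiff_iff_contDiff.2 (by fun_prop)
  refine .of_hasMFDerivWithinAt hab (h.1.comp hsm.contMDiffOn hm) fun r hr => ?_
  have hd : HasFDerivWithinAt (fun r : ℝ => c * r + d)
      (ContinuousLinearMap.toSpanSingleton ℝ c) (Icc a b) r := by
    have : HasDerivAt (fun r : ℝ => c * r + d) c r := by
      simpa using ((hasDerivAt_id r).const_mul c).add_const d
    exact this.hasFDerivAt.hasFDerivWithinAt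
  refine ⟨_, (h.hasMFDerivWithinAt (hm hr)).comp r hd.hasMFDerivWithinAt
    (show Icc a b ⊆ (fun r => c * r + d) ⁻¹' Icc (c * a + d) (c * b + d) from hm), ?_⟩
  have := hC _ _ c hc (h.2 _ (hm hr))
  convert this using 1
  refine Eq.trans ?_ (map_smul (mfderivWithin 𝓘(ℝ, ℝ) (𝓡 4) γ (Icc (c * a + d) (c * b + d))
    (c * r + d)) c (1 : ℝ))
  refine congrArg (mfderivWithin 𝓘(ℝ, ℝ) (𝓡 4) γ (Icc (c * a + d) (c * b + d)) (c * r + d)) ?_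
  exact (one_mul c).trans (mul_one c).symm

theorem ArcOn.curveOn (h : ArcOn C γ a b) : CurveOn C γ (Icc a b) := by
  refine fun t ht => ⟨fun ⟨u, hu, htu⟩ => ⟨u, hu, htu, h.mono ht.1 hu.2 htu⟩,
    fun ⟨u, hu, htu⟩ => ⟨u, hu, htu, h.mono hu.1 ht.2 htu⟩⟩

theorem CurveOn.mono_Icc {s : Set ℝ} (h : CurveOn C γ s) (hs : Icc a b ⊆ s) :
    CurveOn C γ (Icc a b) := by
  intro t ht
  constructor
  · rintro ⟨u, hu, htu⟩
    obtain ⟨v, _, htv, hv⟩ := (h t (hs ht)).1 ⟨u, hs hu, htu⟩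
    exact ⟨min u v, ⟨ht.1.trans (le_min htu.le htv.le), (min_le_left _ _).trans hu.2⟩,
      lt_min htu htv, hv.mono le_rfl (min_le_right _ _) (lt_min htu htv)⟩
  · rintro ⟨u, hu, htu⟩
    obtain ⟨v, _, htv, hv⟩ := (h t (hs ht)).2 ⟨u, hs hu, htu⟩
    exact ⟨max u v, ⟨hu.1.trans (le_max_left _ _), (max_le htu.le htv.le).trans ht.2⟩,
      max_lt htu htv, hv.mono (le_max_right _ _) le_rfl (max_lt htu htv)⟩

theorem CurveOn.congr (h : CurveOn C γ (Icc a b)) (he : EqOn γ' γ (Icc a b)) :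
    CurveOn C γ' (Icc a b) := by
  intro t ht
  constructor
  · intro hu
    obtain ⟨v, hv, htv, hA⟩ := (h t ht).1 hu
    exact ⟨v, hv, htv, hA.congr htv (he.mono (Icc_subset_Icc ht.1 hv.2))⟩
  · intro hu
    obtain ⟨v, hv, htv, hA⟩ := (h t ht).2 hu
    exact ⟨v, hv, htv, hA.congr htv (he.mono (Icc_subset_Icc hv.1 ht.2))⟩

theorem CurveOn.imp {s : Set ℝ} (h : CurveOn C γ s) (hC : ∀ x v, C x v → C' x v) :
    CurveOn C' γ s := by
  refine fun t ht => ⟨fun hu => ?_, fun hu => ?_⟩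
  · obtain ⟨v, hv, htv, hA⟩ := (h t ht).1 hu
    exact ⟨v, hv, htv, hA.imp hC⟩
  · obtain ⟨v, hv, htv, hA⟩ := (h t ht).2 hu
    exact ⟨v, hv, htv, hA.imp hC⟩

theorem CurveOn.comp_affine (hC : ∀ x v (c : ℝ), 0 < c → C x v → C x (c • v)) {c d : ℝ}
    (hc : 0 < c) (h : CurveOn C γ (Icc (c * a + d) (c * b + d))) :
    CurveOn C (fun r => γ (c * r + d)) (Icc a b) := by
  have hmem : ∀ r, c * r + d ∈ Icc (c * a + d) (c * b + d) ↔ r ∈ Icc a b := fun r => by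
    simp [mem_Icc, mul_le_mul_iff_right₀ hc]
  have hlt : ∀ r s, c * r + d < c * s + d ↔ r < s := fun r s => by simp [hc]
  have hinv : ∀ u, c * ((u - d) / c) + d = u := fun u => by field_simp; ring
  refine fun t ht => ⟨fun ⟨u, hu, htu⟩ => ?_, fun ⟨u, hu, htu⟩ => ?_⟩
  · obtain ⟨v, hv, htv, hA⟩ := (h _ ((hmem t).2 ht)).1 ⟨_, (hmem u).2 hu, (hlt _ _).2 htu⟩
    rw [← hinv v] at hv htv hA
    exact ⟨(v - d) / c, (hmem _).1 hv, (hlt _ _).1 htv, hA.comp_affine hC hc ((hlt _ _).1 htv)⟩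
  · obtain ⟨v, hv, htv, hA⟩ := (h _ ((hmem t).2 ht)).2 ⟨_, (hmem u).2 hu, (hlt _ _).2 htu⟩
    rw [← hinv v] at hv htv hA
    exact ⟨(v - d) / c, (hmem _).1 hv, (hlt _ _).1 htv, hA.comp_affine hC hc ((hlt _ _).1 htv)⟩

/-- Reparametrisation of a curve to a given compact interval. -/
theorem CurveOn.reparam (hC : ∀ x v (c : ℝ), 0 < c → C x v → C x (c • v)) (hab : a < b)
    (hab' : a' < b') (h : CurveOn C γ (Icc a b)) :
    ∃ γ' : ℝ → M, CurveOn C γ' (Icc a' b') ∧ γ' a' = γ a ∧ γ' b' = γ b := by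
  have hne : b' - a' ≠ 0 := (sub_pos.2 hab').ne'
  set c := (b - a) / (b' - a') with hc
  have h1 : c * a' + (a - c * a') = a := by ring
  have h2 : c * b' + (a - c * a') = b := by rw [hc]; field_simp; ring
  refine ⟨fun r => γ (c * r + (a - c * a')), CurveOn.comp_affine hC
    (div_pos (sub_pos.2 hab) (sub_pos.2 hab')) ?_, by simp only [h1], by simp only [h2]⟩
  rwa [h1, h2]

theorem CurveOn.glue {c : ℝ} (h : CurveOn C γ (Icc a b)) (h' : CurveOn C γ (Icc b c)) (hab : a < b)
    (hbc : b < c) : CurveOn C γ (Icc a c) := by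
  intro t ht
  constructor
  · rintro ⟨u, hu, htu⟩
    rcases lt_or_ge t b with htb | htb
    · obtain ⟨v, hv, htv, hA⟩ := (h t ⟨ht.1, htb.le⟩).1 ⟨b, ⟨hab.le, le_rfl⟩, htb⟩
      exact ⟨v, ⟨hv.1, hv.2.trans hbc.le⟩, htv, hA⟩
    · obtain ⟨v, hv, htv, hA⟩ := (h' t ⟨htb, ht.2⟩).1 ⟨u, ⟨htb.trans htu.le, hu.2⟩, htu⟩
      exact ⟨v, ⟨hab.le.trans hv.1, hv.2⟩, htv, hA⟩
  · rintro ⟨u, hu, hut⟩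
    rcases le_or_gt t b with htb | htb
    · obtain ⟨v, hv, htv, hA⟩ := (h t ⟨ht.1, htb⟩).2 ⟨u, ⟨hu.1, hut.le.trans htb⟩, hut⟩
      exact ⟨v, ⟨hv.1, hv.2.trans hbc.le⟩, htv, hA⟩
    · obtain ⟨v, hv, htv, hA⟩ := (h' t ⟨htb.le, ht.2⟩).2 ⟨b, ⟨le_rfl, hbc.le⟩, htb⟩
      exact ⟨v, ⟨hab.le.trans hv.1, hv.2⟩, htv, hA⟩

theorem curveOn_univ (h : ∀ n : ℤ, CurveOn C γ (Icc (n : ℝ) (n + 1))) : CurveOn C γ univ := by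
  intro t _
  constructor
  · intro _
    have h1 := Int.floor_le t
    have h2 := Int.lt_floor_add_one t
    obtain ⟨v, _, htv, hA⟩ := (h ⌊t⌋ t ⟨h1, h2.le⟩).1 ⟨⌊t⌋ + 1, ⟨by linarith, le_rfl⟩, h2⟩
    exact ⟨v, mem_univ _, htv, hA⟩
  · intro _
    -- For the left-hand arc at an integer time the preceding unit interval is required, hence the
    -- ceiling in place of the floor.
    have h1 := Int.le_ceil t
    have h2 := Int.ceil_lt_add_one t
    obtain ⟨v, _, htv, hA⟩ := (h (⌈t⌉ - 1) t ⟨by push_cast; linarith, by push_cast; linarith⟩).2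
      ⟨((⌈t⌉ - 1 : ℤ) : ℝ), ⟨le_rfl, by linarith⟩, by push_cast; linarith⟩
    exact ⟨v, mem_univ _, htv, hA⟩

theorem CurveOn.continuous (h : CurveOn C γ univ) : Continuous γ := by
  refine continuous_iff_continuousAt.2 fun t => ?_
  obtain ⟨u, _, htu, hu⟩ := (h t (mem_univ _)).1 ⟨t + 1, mem_univ _, by linarith⟩
  obtain ⟨v, _, hvt, hv⟩ := (h t (mem_univ _)).2 ⟨t - 1, mem_univ _, by linarith⟩
  have h1 := (hu.1.continuousOn t ⟨le_rfl, htu.le⟩).union (hv.1.continuousOn t ⟨hvt.le, le_rfl⟩)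
  rw [union_comm, Icc_union_Icc_eq_Icc hvt.le htu.le] at h1
  exact h1.continuousAt (Icc_mem_nhds hvt htu)

end Curves

/-! ## The chronological relation -/

section Chron

variable {M : Type*} [TopologicalSpace M] [ChartedSpace (EuclideanSpace ℝ (Fin 4)) M]
  [IsManifold (𝓡 4) ∞ M] {g : LorentzMetric M} {τ : TimeOrientation g}

theorem FutureTimelike.smul {x : M} {v : TangentSpace (𝓡 4) x} (hv : FutureTimelike g τ x v) {c : ℝ}
    (hc : 0 < c) : FutureTimelike g τ x (c • v) := by
  have h1 : g.val x (c • v) (c • v) = c * (c * g.val x v v) := by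
    simp
  have h2 : g.val x (c • v) (τ.vec x) = c * g.val x v (τ.vec x) := by
    simp
  exact ⟨by rw [h1]; exact mul_neg_of_pos_of_neg hc (mul_neg_of_pos_of_neg hc hv.1),
    by rw [h2]; exact mul_neg_of_pos_of_neg hc hv.2⟩

variable (g τ) in
/-- `p` and `q` are joined by a future directed timelike curve. -/
def Chron (p q : M) : Prop := ∃ (γ : ℝ → M) (a b : ℝ), a < b ∧
  CurveOn (FutureTimelike g τ) γ (Icc a b) ∧ γ a = p ∧ γ b = q

theorem Chron.exists_curve {p q : M} (h : Chron g τ p q) {a b : ℝ} (hab : a < b) :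
    ∃ γ : ℝ → M, CurveOn (FutureTimelike g τ) γ (Icc a b) ∧ γ a = p ∧ γ b = q := by
  obtain ⟨γ, a', b', hab', hγ, rfl, rfl⟩ := h
  exact hγ.reparam (fun _ _ _ hc hv => hv.smul hc) hab' hab

/-- Curves are only piecewise differentiable, so two of them can be joined without smoothing the
corner. -/
theorem Chron.trans {p q r : M} (h : Chron g τ p q) (h' : Chron g τ q r) : Chron g τ p r := by
  obtain ⟨γ, hγ, rfl, rfl⟩ := h.exists_curve (zero_lt_one (α := ℝ))
  obtain ⟨γ', hγ', h1, rfl⟩ := h'.exists_curve (one_lt_two (α := ℝ))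
  refine ⟨fun t => if t ≤ 1 then γ t else γ' t, 0, 2, two_pos, CurveOn.glue (b := 1) ?_ ?_
    one_pos one_lt_two, by simp, by simp⟩
  · exact hγ.congr fun t ht => if_pos ht.2
  · refine hγ'.congr fun t ht => ?_
    rcases ht.1.eq_or_lt with rfl | h2
    · simp [h1]
    · exact if_neg (not_le.2 h2)

theorem future_subset_JPlus (A : Set M) : future (Chron g τ) A ⊆ JPlus g τ A := by
  rintro q ⟨p, hp, hpq⟩
  obtain ⟨γ, hγ, rfl, rfl⟩ := hpq.exists_curve (zero_lt_one (α := ℝ))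
  exact Or.inr ⟨γ, hγ.imp fun _ _ hv => ⟨hv.1.le, hv.2⟩, hp, rfl⟩

theorem past_subset_JMinus (A : Set M) : future (flip (Chron g τ)) A ⊆ JMinus g τ A := by
  rintro q ⟨p, hp, hpq⟩
  obtain ⟨γ, hγ, rfl, rfl⟩ := Chron.exists_curve hpq (zero_lt_one (α := ℝ))
  exact Or.inr ⟨γ, hγ.imp fun _ _ hv => ⟨hv.1.le, hv.2⟩, rfl, hp⟩

/-- Timelike segments are concatenated over the unit intervals. A limit of the curve at either end
would be a limit of the chain along the integers. -/
theorem exists_inextendible_of_chain {x : ℤ → M}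
    (hx : ∀ n, Chron g τ (x n) (x (n + 1)))
    (h₁ : ¬ ∃ p, Tendsto (fun n : ℕ => x n) atTop (𝓝 p))
    (h₂ : ¬ ∃ p, Tendsto (fun n : ℕ => x (-n)) atTop (𝓝 p)) :
    ∃ γ, InextendibleTimelike g τ γ ∧ ∀ n : ℤ, γ n = x n := by
  choose γ hγ ha hb using fun n : ℤ => (hx n).exists_curve (lt_add_one (n : ℝ))
  set Γ : ℝ → M := fun t => γ ⌊t⌋ t with hΓ
  have hΓn : ∀ n : ℤ, Γ n = x n := fun n => by simp [hΓ, ha]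
  have he : ∀ n : ℤ, EqOn Γ (γ n) (Icc (n : ℝ) (n + 1)) := by
    intro n t ht
    rcases ht.2.eq_or_lt with rfl | h2
    · have := hΓn (n + 1)
      push_cast at this
      rw [this, hb]
    · have : ⌊t⌋ = n := Int.floor_eq_iff.2 ⟨ht.1, h2⟩
      simp [hΓ, this]
  refine ⟨Γ, ⟨curveOn_univ fun n => (hγ n).congr (he n), ?_, ?_⟩, hΓn⟩
  · rintro ⟨p, hp⟩
    refine h₁ ⟨p, (hp.comp tendsto_natCast_atTop_atTop).congr fun n => ?_⟩
    simpa using hΓn n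
  · rintro ⟨p, hp⟩
    refine h₂ ⟨p, (hp.comp (tendsto_neg_atTop_atBot.comp tendsto_natCast_atTop_atTop)).congr
      fun n => ?_⟩
    simpa using hΓn (-n)

end Chron

/-! ### Timelike cones in charts, and openness of the chronological relation -/

section Cone

variable {M : Type*} [TopologicalSpace M] [ChartedSpace (EuclideanSpace ℝ (Fin 4)) M]
  [IsManifold (𝓡 4) ∞ M] {g : LorentzMetric M} {τ : TimeOrientation g}

/-- The components `g(∂_i, T)` of the time orientation are smooth in charts. -/
theorem contDiffOn_frame_vec (x₀ : M) (i : Fin 4) :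
    ContDiffOn ℝ ∞ (fun z => g.val ((extChartAt (𝓡 4) x₀).symm z) (frame x₀ z i)
      (τ.vec ((extChartAt (𝓡 4) x₀).symm z))) (extChartAt (𝓡 4) x₀).target := by
  have hW := isOpen_extChartAt_target (I := 𝓡 4) x₀
  have hκ := contMDiffOn_extChartAt_symm (I := 𝓡 4) (n := ∞) x₀
  exact contDiffOn_form_apply₂ g.smooth hκ (contMDiffOn_mfderiv_apply hW hκ _)
    (τ.smooth.comp_contMDiffOn hκ)

omit [IsManifold (𝓡 4) ∞ M] in
theorem form_symm_apply (h : FormField 4 M) (x₀ : M) (z v w : EuclideanSpace ℝ (Fin 4)) :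
    h ((extChartAt (𝓡 4) x₀).symm z)
      (mfderiv 𝓘(ℝ, EuclideanSpace ℝ (Fin 4)) (𝓡 4) (extChartAt (𝓡 4) x₀).symm z v)
      (mfderiv 𝓘(ℝ, EuclideanSpace ℝ (Fin 4)) (𝓡 4) (extChartAt (𝓡 4) x₀).symm z w) =
      ∑ i, ∑ j, v i * w j * comp h x₀ i j z := by
  have key : ∀ (T : EuclideanSpace ℝ (Fin 4) →L[ℝ] EuclideanSpace ℝ (Fin 4) →L[ℝ] ℝ)
      (a b : Fin 4 → ℝ) (f : Fin 4 → EuclideanSpace ℝ (Fin 4)),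
      T (∑ k, a k • f k) (∑ k, b k • f k) = ∑ k, ∑ l, a k * b l * T (f k) (f l) := by
    intro T a b f
    simp only [map_sum, map_smul, _root_.sum_apply, _root_.smul_apply, smul_eq_mul,
      Finset.mul_sum]
    rw [Finset.sum_comm]
    exact Finset.sum_congr rfl fun k _ => Finset.sum_congr rfl fun l _ => by ring
  erw [mfderiv_symm_eq_sum x₀ z v, mfderiv_symm_eq_sum x₀ z w]
  exact key _ _ _ _

omit [IsManifold (𝓡 4) ∞ M] in
theorem form_symm_apply_left (h : FormField 4 M) (x₀ : M) (z v w : EuclideanSpace ℝ (Fin 4)) :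
    h ((extChartAt (𝓡 4) x₀).symm z)
      (mfderiv 𝓘(ℝ, EuclideanSpace ℝ (Fin 4)) (𝓡 4) (extChartAt (𝓡 4) x₀).symm z v) w =
      ∑ i, v i * h ((extChartAt (𝓡 4) x₀).symm z) (frame x₀ z i) w := by
  have key : ∀ (T : EuclideanSpace ℝ (Fin 4) →L[ℝ] EuclideanSpace ℝ (Fin 4) →L[ℝ] ℝ)
      (a : Fin 4 → ℝ) (f : Fin 4 → EuclideanSpace ℝ (Fin 4)),
      T (∑ k, a k • f k) w = ∑ k, a k * T (f k) w := by
    intro T a f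
    simp only [map_sum, map_smul, _root_.sum_apply, _root_.smul_apply, smul_eq_mul]
  erw [mfderiv_symm_eq_sum x₀ z v]
  exact key _ _ _

/-- In chart coordinates both defining conditions are strict inequalities between continuous
functions of point and vector. -/
theorem isOpen_futureTimelike (x₀ : M) :
    IsOpen {p : EuclideanSpace ℝ (Fin 4) × EuclideanSpace ℝ (Fin 4) |
      p.1 ∈ (extChartAt (𝓡 4) x₀).target ∧ FutureTimelike g τ ((extChartAt (𝓡 4) x₀).symm p.1)
        (mfderiv 𝓘(ℝ, EuclideanSpace ℝ (Fin 4)) (𝓡 4) (extChartAt (𝓡 4) x₀).symm p.1 p.2)} := by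
  have hT := (isOpen_extChartAt_target (I := 𝓡 4) x₀).preimage
    (continuous_fst (X := EuclideanSpace ℝ (Fin 4)) (Y := EuclideanSpace ℝ (Fin 4)))
  have c2 : ∀ i, Continuous fun p : EuclideanSpace ℝ (Fin 4) × EuclideanSpace ℝ (Fin 4) => p.2 i :=
    fun i => by fun_prop
  have h1 : ContinuousOn (fun p : EuclideanSpace ℝ (Fin 4) × EuclideanSpace ℝ (Fin 4) =>
      ∑ i, ∑ j, p.2 i * p.2 j * comp g.val x₀ i j p.1)
      (Prod.fst ⁻¹' (extChartAt (𝓡 4) x₀).target) :=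
    continuousOn_finsetSum _ fun i _ => continuousOn_finsetSum _ fun j _ =>
      (((c2 i).mul (c2 j)).continuousOn).mul
        ((contDiffOn_comp g.smooth x₀ i j).continuousOn.comp continuousOn_fst fun _ hp => hp)
  have h2 : ContinuousOn (fun p : EuclideanSpace ℝ (Fin 4) × EuclideanSpace ℝ (Fin 4) =>
      ∑ i, p.2 i * g.val ((extChartAt (𝓡 4) x₀).symm p.1) (frame x₀ p.1 i)
        (τ.vec ((extChartAt (𝓡 4) x₀).symm p.1)))
      (Prod.fst ⁻¹' (extChartAt (𝓡 4) x₀).target) :=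
    continuousOn_finsetSum _ fun i _ => (c2 i).continuousOn.mul
      ((contDiffOn_frame_vec x₀ i).continuousOn.comp continuousOn_fst fun _ hp => hp)
  have h3 := (h1.isOpen_inter_preimage hT isOpen_Iio (t := Iio 0)).inter
    (h2.isOpen_inter_preimage hT isOpen_Iio (t := Iio 0))
  convert h3 using 1
  ext p
  have e1 := form_symm_apply g.val x₀ p.1 p.2 p.2
  have e2 := form_symm_apply_left g.val x₀ p.1 p.2 (τ.vec ((extChartAt (𝓡 4) x₀).symm p.1))
  constructor
  · rintro ⟨ht, hq1, hq2⟩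
    exact ⟨⟨ht, e1.symm.trans_lt hq1⟩, ⟨ht, e2.symm.trans_lt hq2⟩⟩
  · rintro ⟨⟨ht, hq1⟩, ⟨_, hq2⟩⟩
    exact ⟨ht, e1.trans_lt hq1, e2.trans_lt hq2⟩

/-- Nearby points whose coordinate difference is close to a timelike direction are
chronologically related. -/
theorem exists_cone {x₀ : M} {w₀ : EuclideanSpace ℝ (Fin 4)}
    (hw : FutureTimelike g τ x₀ (mfderiv 𝓘(ℝ, EuclideanSpace ℝ (Fin 4)) (𝓡 4)
      (extChartAt (𝓡 4) x₀).symm (extChartAt (𝓡 4) x₀ x₀) w₀ : EuclideanSpace ℝ (Fin 4))) :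
    ∃ ε > 0, Metric.ball (extChartAt (𝓡 4) x₀ x₀) ε ⊆ (extChartAt (𝓡 4) x₀).target ∧
      ∀ z ∈ Metric.ball (extChartAt (𝓡 4) x₀ x₀) ε, ∀ z' ∈ Metric.ball (extChartAt (𝓡 4) x₀ x₀) ε,
        ∀ δ : ℝ, 0 < δ → δ⁻¹ • (z' - z) ∈ Metric.ball w₀ ε →
          Chron g τ ((extChartAt (𝓡 4) x₀).symm z) ((extChartAt (𝓡 4) x₀).symm z') := by
  have hmem : (extChartAt (𝓡 4) x₀ x₀, w₀) ∈
      {p : EuclideanSpace ℝ (Fin 4) × EuclideanSpace ℝ (Fin 4) |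
      p.1 ∈ (extChartAt (𝓡 4) x₀).target ∧ FutureTimelike g τ ((extChartAt (𝓡 4) x₀).symm p.1)
        (mfderiv 𝓘(ℝ, EuclideanSpace ℝ (Fin 4)) (𝓡 4) (extChartAt (𝓡 4) x₀).symm p.1 p.2)} :=
    ⟨mem_extChartAt_target x₀, class_congr (FutureTimelike g τ)
      (extChartAt_to_inv (I := 𝓡 4) x₀).symm hw⟩
  obtain ⟨ε, hε, hball⟩ := Metric.isOpen_iff.1 (isOpen_futureTimelike x₀) _ hmem
  have hb : ∀ z ∈ Metric.ball (extChartAt (𝓡 4) x₀ x₀) ε, ∀ w ∈ Metric.ball w₀ ε, _ :=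
    fun z hz w hw => hball (show (z, w) ∈ Metric.ball (extChartAt (𝓡 4) x₀ x₀, w₀) ε by
      rw [← ball_prod_same]; exact ⟨hz, hw⟩)
  have hbt : Metric.ball (extChartAt (𝓡 4) x₀ x₀) ε ⊆ (extChartAt (𝓡 4) x₀).target := fun z hz =>
    (hb z hz w₀ (Metric.mem_ball_self hε)).1
  refine ⟨ε, hε, hbt, fun z hz z' hz' δ hδ hw' => ?_⟩
  set w := δ⁻¹ • (z' - z) with hwdef
  -- The coordinate segment stays in the ball by convexity. Its constant velocity `w` is within ε of
  -- w₀, hence future timelike at every point of it.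
  have hline : ∀ s ∈ Icc 0 δ, z + s • w ∈ Metric.ball (extChartAt (𝓡 4) x₀ x₀) ε := by
    intro s hs
    have : z + s • w = (1 - s / δ) • z + (s / δ) • z' := by
      rw [hwdef, smul_smul, div_eq_mul_inv]
      module
    rw [this]
    refine convex_ball _ _ hz hz' ?_ (by have := hs.1; positivity) (by ring)
    rw [sub_nonneg, div_le_one hδ]
    exact hs.2
  have hsm : ContDiff ℝ ∞ fun s : ℝ => z + s • w := by fun_prop
  have hA : ArcOn (FutureTimelike g τ) (fun s => (extChartAt (𝓡 4) x₀).symm (z + s • w)) 0 δ := by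
    refine .of_hasMFDerivWithinAt hδ ?_ fun r hr => ?_
    · refine (contMDiffOn_extChartAt_symm (n := 1) x₀).comp
        (contMDiff_iff_contDiff.2 (hsm.of_le (by simp))).contMDiffOn fun s hs => hbt (hline s hs)
    · have h1 := (mdifferentiableAt_extChartAt_symm (hbt (hline r hr))).hasMFDerivAt
      have h2 : HasFDerivAt (fun s : ℝ => z + s • w) (ContinuousLinearMap.toSpanSingleton ℝ w) r := by
        have : HasDerivAt (fun s : ℝ => z + s • w) w r := by
          simpa using ((hasDerivAt_id r).smul_const w).const_add z
        exact this.hasFDerivAt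
      refine ⟨_, (h1.comp r h2.hasMFDerivAt).hasMFDerivWithinAt, ?_⟩
      have h3 := (hb _ (hline r hr) w hw').2
      have h4 : (ContinuousLinearMap.toSpanSingleton ℝ w) (1 : ℝ) = w := one_smul ℝ w
      change FutureTimelike g τ _ (mfderiv 𝓘(ℝ, EuclideanSpace ℝ (Fin 4)) (𝓡 4)
        (extChartAt (𝓡 4) x₀).symm (z + r • w) (ContinuousLinearMap.toSpanSingleton ℝ w (1 : ℝ)))
      rw [h4]
      exact h3
  refine ⟨_, 0, δ, hδ, hA.curveOn, by simp, ?_⟩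
  rw [hwdef, smul_inv_smul₀ hδ.ne', add_sub_cancel]

/-- The timelike direction of an arc at a point, in the chart at that point. -/
theorem ArcOn.hasDerivWithinAt_chart {γ : ℝ → M} {a b r : ℝ} (h : ArcOn (FutureTimelike g τ) γ a b)
    (hr : r ∈ Icc a b) : ∃ w₀ : EuclideanSpace ℝ (Fin 4),
      HasDerivWithinAt (fun s => extChartAt (𝓡 4) (γ r) (γ s)) w₀ (Icc a b) r ∧
      FutureTimelike g τ (γ r) (mfderiv 𝓘(ℝ, EuclideanSpace ℝ (Fin 4)) (𝓡 4)
        (extChartAt (𝓡 4) (γ r)).symm (extChartAt (𝓡 4) (γ r) (γ r)) w₀ :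
          EuclideanSpace ℝ (Fin 4)) := by
  have hs := mem_extChartAt_source (I := 𝓡 4) (γ r)
  have h1 := (mdifferentiableAt_extChartAt_of_mem hs).hasMFDerivAt.comp_hasMFDerivWithinAt r
    (h.hasMFDerivWithinAt hr)
  refine ⟨mfderiv (𝓡 4) 𝓘(ℝ, EuclideanSpace ℝ (Fin 4)) (extChartAt (𝓡 4) (γ r)) (γ r)
    (mfderivWithin 𝓘(ℝ, ℝ) (𝓡 4) γ (Icc a b) r (1 : ℝ)), ?_, ?_⟩
  · have key : ∀ L : ℝ →L[ℝ] EuclideanSpace ℝ (Fin 4), HasFDerivWithinAt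
        (fun s => extChartAt (𝓡 4) (γ r) (γ s)) L (Icc a b) r → HasDerivWithinAt
        (fun s => extChartAt (𝓡 4) (γ r) (γ s)) (L 1) (Icc a b) r :=
      fun L hL => hL.hasDerivWithinAt
    exact key _ (hasMFDerivWithinAt_iff_hasFDerivWithinAt.1 h1)
  · have h2 := frame_mfderiv_extChartAt hs (mfderivWithin 𝓘(ℝ, ℝ) (𝓡 4) γ (Icc a b) r (1 : ℝ))
    have h3 := h.2 r hr
    rw [← h2] at h3
    exact h3

/-- The difference quotient at the end point tends to the timelike velocity, so for `s` close to `b`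
the coordinate chord points into the cone of `exists_cone`. That is an open condition on the end of
the chord, which may therefore be moved. -/
theorem ArcOn.eventually_chron_right {γ : ℝ → M} {a b : ℝ} (hab : a < b)
    (h : ArcOn (FutureTimelike g τ) γ a b) :
    ∃ s ∈ Ioo a b, ∀ᶠ q in 𝓝 (γ b), Chron g τ (γ s) q := by
  have hb : b ∈ Icc a b := ⟨hab.le, le_rfl⟩
  obtain ⟨w₀, hd, hw⟩ := h.hasDerivWithinAt_chart hb
  obtain ⟨ε, hε, hεt, hcone⟩ := exists_cone hw
  have hs := isOpen_extChartAt_source (I := 𝓡 4) (γ b)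
  have hc := continuousAt_extChartAt (I := 𝓡 4) (γ b)
  have hd' := hd.mono Ioo_subset_Icc_self
  have hne : NeBot (𝓝[Ioo a b] b) := by rw [nhdsWithin_Ioo_eq_nhdsLT hab]; infer_instance
  have e1 : ∀ᶠ s in 𝓝[Ioo a b] b, extChartAt (𝓡 4) (γ b) (γ s) ∈
      Metric.ball (extChartAt (𝓡 4) (γ b) (γ b)) ε :=
    hd'.continuousWithinAt (Metric.ball_mem_nhds _ hε)
  have e2 : ∀ᶠ s in 𝓝[Ioo a b] b, γ s ∈ (extChartAt (𝓡 4) (γ b)).source :=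
    ((h.1.continuousOn b hb).mono Ioo_subset_Icc_self) (hs.mem_nhds (mem_extChartAt_source _))
  have e3 := (hasDerivWithinAt_iff_tendsto_slope' (by simp)).1 hd'
  obtain ⟨s, hsI, h1, h2, h3⟩ := ((eventually_mem_nhdsWithin.and (e1.and (e2.and
    (e3.eventually (Metric.ball_mem_nhds w₀ hε)))))).exists
  refine ⟨s, hsI, ?_⟩
  have hδ : 0 < b - s := sub_pos.2 hsI.2
  have h4 : Tendsto (fun q => (b - s)⁻¹ • (extChartAt (𝓡 4) (γ b) q - extChartAt (𝓡 4) (γ b) (γ s)))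
      (𝓝 (γ b)) (𝓝 ((b - s)⁻¹ • (extChartAt (𝓡 4) (γ b) (γ b) - extChartAt (𝓡 4) (γ b) (γ s)))) :=
    (hc.tendsto.sub_const _).const_smul _
  have h5 : (b - s)⁻¹ • (extChartAt (𝓡 4) (γ b) (γ b) - extChartAt (𝓡 4) (γ b) (γ s)) ∈
      Metric.ball w₀ ε := by
    rw [slope_comm, slope_def_module] at h3
    exact h3
  filter_upwards [hs.mem_nhds (mem_extChartAt_source _), hc (Metric.ball_mem_nhds _ hε),
    h4 (Metric.isOpen_ball.mem_nhds h5)] with q hq1 hq2 hq3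
  have := hcone _ h1 _ hq2 _ hδ hq3
  rwa [(extChartAt (𝓡 4) (γ b)).left_inv hq1, (extChartAt (𝓡 4) (γ b)).left_inv h2] at this

theorem ArcOn.eventually_chron_left {γ : ℝ → M} {a b : ℝ} (hab : a < b)
    (h : ArcOn (FutureTimelike g τ) γ a b) :
    ∃ s ∈ Ioo a b, ∀ᶠ q in 𝓝 (γ a), Chron g τ q (γ s) := by
  have ha : a ∈ Icc a b := ⟨le_rfl, hab.le⟩
  obtain ⟨w₀, hd, hw⟩ := h.hasDerivWithinAt_chart ha
  obtain ⟨ε, hε, hεt, hcone⟩ := exists_cone hw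
  have hs := isOpen_extChartAt_source (I := 𝓡 4) (γ a)
  have hc := continuousAt_extChartAt (I := 𝓡 4) (γ a)
  have hd' := hd.mono Ioo_subset_Icc_self
  have hne : NeBot (𝓝[Ioo a b] a) := by rw [nhdsWithin_Ioo_eq_nhdsGT hab]; infer_instance
  have e1 : ∀ᶠ s in 𝓝[Ioo a b] a, extChartAt (𝓡 4) (γ a) (γ s) ∈
      Metric.ball (extChartAt (𝓡 4) (γ a) (γ a)) ε :=
    hd'.continuousWithinAt (Metric.ball_mem_nhds _ hε)
  have e2 : ∀ᶠ s in 𝓝[Ioo a b] a, γ s ∈ (extChartAt (𝓡 4) (γ a)).source :=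
    ((h.1.continuousOn a ha).mono Ioo_subset_Icc_self) (hs.mem_nhds (mem_extChartAt_source _))
  have e3 := (hasDerivWithinAt_iff_tendsto_slope' (by simp)).1 hd'
  obtain ⟨s, hsI, h1, h2, h3⟩ := ((eventually_mem_nhdsWithin.and (e1.and (e2.and
    (e3.eventually (Metric.ball_mem_nhds w₀ hε)))))).exists
  refine ⟨s, hsI, ?_⟩
  have hδ : 0 < s - a := sub_pos.2 hsI.1
  have h4 : Tendsto (fun q => (s - a)⁻¹ • (extChartAt (𝓡 4) (γ a) (γ s) - extChartAt (𝓡 4) (γ a) q))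
      (𝓝 (γ a)) (𝓝 ((s - a)⁻¹ • (extChartAt (𝓡 4) (γ a) (γ s) - extChartAt (𝓡 4) (γ a) (γ a)))) :=
    (hc.tendsto.const_sub _).const_smul _
  have h5 : (s - a)⁻¹ • (extChartAt (𝓡 4) (γ a) (γ s) - extChartAt (𝓡 4) (γ a) (γ a)) ∈
      Metric.ball w₀ ε := by
    rw [slope_def_module] at h3
    exact h3
  filter_upwards [hs.mem_nhds (mem_extChartAt_source _), hc (Metric.ball_mem_nhds _ hε),
    h4 (Metric.isOpen_ball.mem_nhds h5)] with q hq1 hq2 hq3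
  have := hcone _ hq2 _ h1 _ hδ hq3
  rwa [(extChartAt (𝓡 4) (γ a)).left_inv hq1, (extChartAt (𝓡 4) (γ a)).left_inv h2] at this

theorem isOpen_chron_right (p : M) : IsOpen {q | Chron g τ p q} := by
  rw [isOpen_iff_mem_nhds]
  rintro _ ⟨γ, a, b, hab, hγ, rfl, rfl⟩
  obtain ⟨u, hu, hub, hA⟩ := (hγ b ⟨hab.le, le_rfl⟩).2 ⟨a, ⟨le_rfl, hab.le⟩, hab⟩
  obtain ⟨s, hs, hev⟩ := hA.eventually_chron_right hub
  have has : a < s := hu.1.trans_lt hs.1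
  filter_upwards [hev] with q hq
  exact Chron.trans ⟨γ, a, s, has, hγ.mono_Icc (Icc_subset_Icc le_rfl hs.2.le), rfl, rfl⟩ hq

theorem isOpen_chron_left (p : M) : IsOpen {q | Chron g τ q p} := by
  rw [isOpen_iff_mem_nhds]
  rintro _ ⟨γ, a, b, hab, hγ, rfl, rfl⟩
  obtain ⟨u, hu, hub, hA⟩ := (hγ a ⟨le_rfl, hab.le⟩).1 ⟨b, ⟨hab.le, le_rfl⟩, hab⟩
  obtain ⟨s, hs, hev⟩ := hA.eventually_chron_left hub
  have hsb : s < b := hs.2.trans_le hu.2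
  filter_upwards [hev] with q hq
  exact Chron.trans hq ⟨γ, s, b, hsb, hγ.mono_Icc (Icc_subset_Icc hs.1.le le_rfl), rfl, rfl⟩

variable (τ) in
/-- The coordinate vector of the time orientation at the centre of a chart. -/
theorem exists_timelike_direction (x : M) : ∃ w₀ : EuclideanSpace ℝ (Fin 4), w₀ ≠ 0 ∧
    FutureTimelike g τ x (mfderiv 𝓘(ℝ, EuclideanSpace ℝ (Fin 4)) (𝓡 4)
      (extChartAt (𝓡 4) x).symm (extChartAt (𝓡 4) x x) w₀ : EuclideanSpace ℝ (Fin 4)) := by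
  have h2 := frame_mfderiv_extChartAt (mem_extChartAt_source (I := 𝓡 4) x) (τ.vec x)
  have h1 : FutureTimelike g τ x (τ.vec x) := ⟨τ.timelike x, τ.timelike x⟩
  refine ⟨mfderiv (𝓡 4) 𝓘(ℝ, EuclideanSpace ℝ (Fin 4)) (extChartAt (𝓡 4) x) x (τ.vec x), ?_, ?_⟩
  · intro h0
    rw [h0] at h2
    have h3 : τ.vec x = 0 := h2.symm.trans (map_zero _)
    have := τ.timelike x
    rw [h3] at this
    simp at this
  · rw [← h2] at h1
    exact h1

/-- A short displacement along or against a timelike coordinate direction stays in `U`, moves the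
point, and is covered by `exists_cone`. -/
theorem exists_chron_near (x : M) {U : Set M} (hU : U ∈ 𝓝 x) :
    (∃ y ∈ U, y ≠ x ∧ Chron g τ x y) ∧ ∃ y ∈ U, y ≠ x ∧ Chron g τ y x := by
  obtain ⟨w₀, hw0, hw⟩ := exists_timelike_direction τ x
  obtain ⟨ε, hε, hεt, hcone⟩ := exists_cone hw
  set z₀ := extChartAt (𝓡 4) x x with hz₀
  have hz₀b : z₀ ∈ Metric.ball z₀ ε := Metric.mem_ball_self hε
  have hx : (extChartAt (𝓡 4) x).symm z₀ = x := extChartAt_to_inv (I := 𝓡 4) x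
  have hU' : (extChartAt (𝓡 4) x).symm ⁻¹' U ∈ 𝓝 z₀ := by
    have := continuousAt_extChartAt_symm (I := 𝓡 4) x
    refine this.preimage_mem_nhds ?_
    rwa [← hz₀, hx]
  have hinj : ∀ z ∈ Metric.ball z₀ ε, z ≠ z₀ → (extChartAt (𝓡 4) x).symm z ≠ x := by
    intro z hz hne he
    exact hne ((extChartAt (𝓡 4) x).symm.injOn (hεt hz) (hεt hz₀b) (he.trans hx.symm))
  have ht : ∀ c : ℝ, ∀ᶠ δ in 𝓝[>] (0 : ℝ), z₀ + (c * δ) • w₀ ∈ Metric.ball z₀ ε ∧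
      z₀ + (c * δ) • w₀ ∈ (extChartAt (𝓡 4) x).symm ⁻¹' U := by
    intro c
    have h1 : Tendsto (fun δ : ℝ => z₀ + (c * δ) • w₀) (𝓝 0) (𝓝 z₀) := by
      have : Continuous fun δ : ℝ => z₀ + (c * δ) • w₀ := by fun_prop
      simpa using this.tendsto 0
    exact nhdsWithin_le_nhds (h1 (inter_mem (Metric.ball_mem_nhds z₀ hε) hU'))
  have hne : ∀ c δ : ℝ, c ≠ 0 → 0 < δ → z₀ + (c * δ) • w₀ ≠ z₀ := by
    intro c δ hc hδ h0
    rw [add_eq_left, smul_eq_zero] at h0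
    rcases h0 with h0 | h0
    · exact (mul_ne_zero hc hδ.ne') h0
    · exact hw0 h0
  constructor
  · obtain ⟨δ, hδ, h1, h2⟩ := (eventually_mem_nhdsWithin.and (ht 1)).exists
    refine ⟨_, h2, hinj _ h1 (hne 1 δ one_ne_zero hδ), ?_⟩
    have := hcone _ hz₀b _ h1 δ hδ (by
      rw [one_mul, add_sub_cancel_left, inv_smul_smul₀ (ne_of_gt hδ)]
      exact Metric.mem_ball_self hε)
    rwa [hx] at this
  · obtain ⟨δ, hδ, h1, h2⟩ := (eventually_mem_nhdsWithin.and (ht (-1))).exists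
    refine ⟨_, h2, hinj _ h1 (hne (-1) δ (by norm_num) hδ), ?_⟩
    have := hcone _ h1 _ hz₀b δ hδ (by
      rw [neg_one_mul, neg_smul, sub_add_cancel_left, neg_neg, inv_smul_smul₀ (ne_of_gt hδ)]
      exact Metric.mem_ball_self hε)
    rwa [hx] at this

variable (g τ) in
theorem chronology : Chronology (Chron g τ) {γ | InextendibleTimelike g τ γ} where
  trans h₁ h₂ := h₁.trans h₂
  isOpen_future := isOpen_chron_right
  isOpen_past := isOpen_chron_left
  exists_future x _ hU := (exists_chron_near x hU).1
  exists_past x _ hU := (exists_chron_near x hU).2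
  continuous _ hγ := hγ.1.continuous
  mono γ hγ s t hst := ⟨γ, s, t, hst, hγ.1.mono_Icc (subset_univ _), rfl, rfl⟩
  chain _ hx h₁ h₂ := exists_inextendible_of_chain hx h₁ h₂

end Cone

/-! ## The divergence theorem in a half space -/

/-- The point of `ℝ⁴` with coordinates `(t, y)`. -/
def consPt (t : ℝ) (y : EuclideanSpace ℝ (Fin 3)) : EuclideanSpace ℝ (Fin 4) :=
  WithLp.toLp 2 (Fin.cons t y : Fin 4 → ℝ)

/-- The last three coordinates. -/
def tailPt (w : EuclideanSpace ℝ (Fin 4)) : EuclideanSpace ℝ (Fin 3) :=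
  WithLp.toLp 2 fun i => w i.succ

@[simp] theorem consPt_zero (t : ℝ) (y : EuclideanSpace ℝ (Fin 3)) : consPt t y 0 = t := rfl

@[simp] theorem consPt_succ (t : ℝ) (y : EuclideanSpace ℝ (Fin 3)) (i : Fin 3) :
    consPt t y i.succ = y i := rfl

@[simp] theorem tailPt_consPt (t : ℝ) (y : EuclideanSpace ℝ (Fin 3)) : tailPt (consPt t y) = y := rfl

theorem consPt_tailPt (w : EuclideanSpace ℝ (Fin 4)) : consPt (w 0) (tailPt w) = w := by
  ext i
  refine Fin.cases rfl (fun i => rfl) i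

theorem contDiff_tailPt : ContDiff ℝ ∞ tailPt :=
  contDiff_euclidean.2 fun i => by
    have : ContDiff ℝ ∞ fun w : EuclideanSpace ℝ (Fin 4) => w i.succ := by fun_prop
    exact this

theorem continuous_consPt : Continuous fun p : ℝ × EuclideanSpace ℝ (Fin 3) => consPt p.1 p.2 := by
  refine (PiLp.continuous_toLp 2 _).comp (continuous_pi fun i => ?_)
  refine Fin.cases ?_ (fun i => ?_) i
  · exact continuous_fst
  · simp only [Fin.cons_succ]
    fun_prop

theorem consPt_eq (t : ℝ) (y : EuclideanSpace ℝ (Fin 3)) :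
    consPt t y = consPt 0 y + t • EuclideanSpace.single 0 1 := by
  ext i
  refine Fin.cases ?_ (fun i => ?_) i <;> simp

theorem integral_eq_integral_consPt {f : EuclideanSpace ℝ (Fin 4) → ℝ} (hf : Integrable f) :
    ∫ w, f w = ∫ y : EuclideanSpace ℝ (Fin 3), ∫ t : ℝ, f (consPt t y) := by
  have e4 := (EuclideanSpace.volume_preserving_symm_measurableEquiv_toLp (Fin 4)).symm
  have e3 := EuclideanSpace.volume_preserving_symm_measurableEquiv_toLp (Fin 3)
  have ep := (volume_preserving_piFinSuccAbove (fun _ : Fin 4 => ℝ) 0).symm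
  have h := (e4.comp ep)
  have hE : MeasurableEmbedding ((MeasurableEquiv.toLp 2 (Fin 4 → ℝ)) ∘
      (MeasurableEquiv.piFinSuccAbove (fun _ : Fin 4 => ℝ) 0).symm) :=
    (MeasurableEquiv.measurableEmbedding _).comp (MeasurableEquiv.measurableEmbedding _)
  have h1 := h.integral_comp hE f
  have h2 : Integrable (f ∘ ((MeasurableEquiv.toLp 2 (Fin 4 → ℝ)) ∘
      (MeasurableEquiv.piFinSuccAbove (fun _ : Fin 4 => ℝ) 0).symm)) (volume.prod volume) :=
    h.integrable_comp_of_integrable hf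
  rw [← h1]
  refine (integral_prod_symm _ h2).trans ?_
  rw [← e3.integral_comp' ]
  refine integral_congr_ae (Eventually.of_forall fun y => ?_)
  refine integral_congr_ae (Eventually.of_forall fun t => ?_)
  simp only [Function.comp_apply]
  congr 1
  ext i
  refine Fin.cases rfl (fun i => rfl) i

section HalfSpace

variable {H : EuclideanSpace ℝ (Fin 4) → ℝ} (hH : ContDiff ℝ ∞ H) (hc : HasCompactSupport H)
include hH hc

omit hH in
theorem hasCompactSupport_pd (a : Fin 4) : HasCompactSupport (pd a H) :=
  hc.fderiv_apply ℝ _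

theorem integrable_pd (a : Fin 4) : Integrable (pd a H) := by
  have : Continuous (pd a H) := (hH.continuous_fderiv (by simp)).clm_apply continuous_const
  exact this.integrable_of_hasCompactSupport (hasCompactSupport_pd hc a)

/-- When the set is invariant under translations in direction `a`, cutting off with its indicator
preserves differentiability along that direction; integration by parts against a constant leaves
nothing. -/
theorem integral_indicator_pd_eq_zero (a : Fin 4) {s : Set (EuclideanSpace ℝ (Fin 4))}
    (hs : MeasurableSet s) (hinv : ∀ w (t : ℝ), w + t • EuclideanSpace.single a 1 ∈ s ↔ w ∈ s) :
    ∫ w in s, pd a H w = 0 := by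
  have h1 : ∀ w, HasLineDerivAt ℝ (s.indicator H) (s.indicator (pd a H) w) w
      (EuclideanSpace.single a 1) := by
    intro w
    have hd : HasLineDerivAt ℝ H (pd a H w) w (EuclideanSpace.single a 1) :=
      ((hH.differentiable (by simp)) w).hasFDerivAt.hasLineDerivAt _
    unfold HasLineDerivAt at hd ⊢
    by_cases hw : w ∈ s
    · rw [indicator_of_mem hw]
      refine hd.congr_of_eventuallyEq (Eventually.of_forall fun t => ?_)
      exact indicator_of_mem ((hinv w t).2 hw) _
    · rw [indicator_of_notMem hw]
      refine (hasDerivAt_const (0 : ℝ) (0 : ℝ)).congr_of_eventuallyEq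
        (Eventually.of_forall fun t => ?_)
      exact indicator_of_notMem (fun h => hw ((hinv w t).1 h)) _
  -- The second factor is the constant function 1, whose derivative vanishes.
  have h2 := integral_bilinear_hasLineDerivAt_right_eq_neg_left_of_integrable
    (μ := (volume : Measure (EuclideanSpace ℝ (Fin 4))))
    (B := ContinuousLinearMap.mul ℝ ℝ) (f := s.indicator H) (f' := s.indicator (pd a H))
    (g := fun _ => 1) (g' := fun _ => 0) (v := EuclideanSpace.single a 1)
    (by simpa using (integrable_pd hH hc a).indicator hs) (by simp)
    (by simpa using (hH.continuous.integrable_of_hasCompactSupport hc).indicator hs)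
    (fun w _ => h1 w) (fun w _ => by
      unfold HasLineDerivAt; exact hasDerivAt_const (0 : ℝ) (1 : ℝ))
  simp only [ContinuousLinearMap.mul_apply', mul_zero, mul_one, integral_zero] at h2
  rw [← integral_indicator hs]
  linarith

theorem integral_pd_eq_zero (a : Fin 4) : ∫ w, pd a H w = 0 := by
  have := integral_indicator_pd_eq_zero hH hc a MeasurableSet.univ (by simp)
  rwa [setIntegral_univ] at this

/-- Tangential derivatives integrate to zero because the half space is invariant under tangential
translations. The normal derivative is integrated over the half line by the fundamental theorem of
calculus, after Fubini. -/
theorem integral_halfSpace_pd (a : Fin 4) : ∫ w in {w | 0 < w 0}, pd a H w =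
    if a = 0 then -∫ y, H (consPt 0 y) else 0 := by
  have hs : MeasurableSet {w : EuclideanSpace ℝ (Fin 4) | 0 < w 0} :=
    (isOpen_lt continuous_const (by fun_prop)).measurableSet
  split_ifs with ha
  · subst ha
    rw [← integral_indicator hs, integral_eq_integral_consPt ((integrable_pd hH hc 0).indicator hs),
      ← integral_neg]
    refine integral_congr_ae (Eventually.of_forall fun y => ?_)
    have hl : ContDiff ℝ ∞ fun t : ℝ => consPt 0 y + t • EuclideanSpace.single (0 : Fin 4) (1 : ℝ) :=
      by fun_prop
    have h1 : ∀ t, deriv (fun t => H (consPt t y)) t = pd 0 H (consPt t y) := by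
      intro t
      have h2 : HasDerivAt (fun t : ℝ => consPt t y) (EuclideanSpace.single 0 1) t := by
        rw [show (fun t : ℝ => consPt t y) = fun t => consPt 0 y + t • EuclideanSpace.single 0 1 from
          funext fun t => consPt_eq t y]
        simpa using ((hasDerivAt_id t).smul_const (EuclideanSpace.single (0 : Fin 4) (1 : ℝ))).const_add
          (consPt 0 y)
      exact (((hH.differentiable (by simp)) _).hasFDerivAt.comp_hasDerivAt t h2).deriv
    have h3 : ContDiff ℝ 1 fun t => H (consPt t y) := by
      rw [show (fun t : ℝ => H (consPt t y)) = fun t => H (consPt 0 y + t • EuclideanSpace.single 0 1)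
        from funext fun t => congrArg H (consPt_eq t y)]
      exact (hH.comp hl).of_le (by simp)
    have h4 : HasCompactSupport fun t => H (consPt t y) := by
      refine HasCompactSupport.intro (hc.isCompact.image
        (f := fun w : EuclideanSpace ℝ (Fin 4) => w 0) (by fun_prop)) fun t ht => ?_
      by_contra h0
      exact ht ⟨consPt t y, subset_tsupport _ h0, rfl⟩
    have h5 := h4.integral_Ioi_deriv_eq h3 0
    simp only at h5 ⊢
    rw [← h5, ← integral_indicator measurableSet_Ioi]
    refine integral_congr_ae (Eventually.of_forall fun t => ?_)
    by_cases ht : 0 < t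
    · rw [indicator_of_mem (show t ∈ Ioi 0 from ht), h1]
      exact indicator_of_mem (show consPt t y ∈ {w : EuclideanSpace ℝ (Fin 4) | 0 < w 0} from ht) _
    · rw [indicator_of_notMem (show t ∉ Ioi 0 from ht)]
      exact indicator_of_notMem (show consPt t y ∉ {w : EuclideanSpace ℝ (Fin 4) | 0 < w 0} from ht) _
  · refine integral_indicator_pd_eq_zero hH hc a hs fun w t => ?_
    simp [Ne.symm ha]

end HalfSpace

/-- A smooth function on an open set that vanishes outside a compact subset extends by zero. -/
theorem contDiff_indicator {W K : Set (EuclideanSpace ℝ (Fin 4))}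
    {H : EuclideanSpace ℝ (Fin 4) → ℝ} (hW : IsOpen W) (hK : IsCompact K) (hKW : K ⊆ W)
    (hH : ContDiffOn ℝ ∞ H W) (h0 : ∀ w ∈ W, w ∉ K → H w = 0) :
    ContDiff ℝ ∞ (W.indicator H) ∧ HasCompactSupport (W.indicator H) ∧
      (∀ a, ∀ w ∈ W, pd a (W.indicator H) w = pd a H w) ∧
      ∀ a, ∀ w ∉ W, pd a (W.indicator H) w = 0 := by
  have hz : ∀ w, w ∉ K → W.indicator H w = 0 := fun w hw => by
    by_cases hwW : w ∈ W
    · rw [indicator_of_mem hwW, h0 w hwW hw]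
    · exact indicator_of_notMem hwW _
  refine ⟨contDiff_iff_contDiffAt.2 fun w => ?_, HasCompactSupport.intro hK hz, fun a w hw => ?_,
    fun a w hw => ?_⟩
  · by_cases hw : w ∈ W
    · refine ((hH w hw).contDiffAt (hW.mem_nhds hw)).congr_of_eventuallyEq ?_
      filter_upwards [hW.mem_nhds hw] with x hx using indicator_of_mem hx _
    · refine (contDiffAt_const (c := (0 : ℝ))).congr_of_eventuallyEq ?_
      filter_upwards [hK.isClosed.isOpen_compl.mem_nhds fun h => hw (hKW h)] with x hx using hz x hx
  · refine pd_congr ?_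
    filter_upwards [hW.mem_nhds hw] with x hx using indicator_of_mem hx _
  · rw [pd_congr (g := fun _ => 0)]
    · simp [pd]
    · filter_upwards [hK.isClosed.isOpen_compl.mem_nhds fun h => hw (hKW h)] with x hx using hz x hx

/-! ## The divergence theorem in coordinates -/

open Matrix in
/-- Comparison of the flux through a hyperplane with the flux along its unit normal `ν`. -/
theorem normal_flux {J G : Matrix (Fin 4) (Fin 4) ℝ} (hJ : J.det ≠ 0) (hG : G.det ≠ 0)
    (hGs : Gᵀ = G)     {ν F : Fin 4 → ℝ} (hn : ∀ i : Fin 3, (Jᵀ *ᵥ (G *ᵥ ν)) i.succ = 0)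
    (h1 : ν ⬝ᵥ (G *ᵥ ν) = -1) (h0 : (Jᵀ *ᵥ (G *ᵥ ν)) 0 < 0) :
    ((Jᵀ * G * J).submatrix Fin.succ Fin.succ).det ≠ 0 ∧
    √|((Jᵀ * G * J).submatrix Fin.succ Fin.succ).det| * (F ⬝ᵥ ν) =
      -(√|(Jᵀ * G * J).det| * ∑ b, (Jᵀ * G * J)⁻¹ 0 b * (Jᵀ *ᵥ F) b) := by
  set g := Jᵀ * G * J with hg
  set m := (Jᵀ *ᵥ (G *ᵥ ν)) 0 with hm
  have uJ : IsUnit J.det := isUnit_iff_ne_zero.2 hJ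
  have hgd : g.det ≠ 0 := by
    rw [hg, det_mul, det_mul, det_transpose]
    exact mul_ne_zero (mul_ne_zero hJ hG) hJ
  have ug : IsUnit g.det := isUnit_iff_ne_zero.2 hgd
  -- The components of the normal in the adapted coordinates. Lowering its index with the
  -- pulled-back metric `g` leaves only the component 0, equal to `m`, so `n` is m times the zeroth
  -- column of g⁻¹.
  set n := J⁻¹ *ᵥ ν with hnn
  have hJn : J *ᵥ n = ν := by rw [hnn, mulVec_mulVec, mul_nonsing_inv _ uJ, one_mulVec]
  have hgn : g *ᵥ n = Pi.single 0 m := by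
    rw [hg, ← mulVec_mulVec, hJn, ← mulVec_mulVec]
    funext j
    refine Fin.cases ?_ (fun i => ?_) j
    · simp [hm]
    · rw [hn i]; simp
  have hn' : ∀ b, n b = m * g⁻¹ b 0 := by
    intro b
    have : n = g⁻¹ *ᵥ Pi.single 0 m := by
      rw [← hgn, mulVec_mulVec, nonsing_inv_mul _ ug, one_mulVec]
    rw [this]; simp [mul_comm]
  -- The normalisation of ν. Together with `hn'` it says m²g⁰⁰ = −1.
  have hn0 : n 0 * m = -1 := by
    have : n ⬝ᵥ (g *ᵥ n) = -1 := by
      rw [hg, ← mulVec_mulVec, hJn, ← mulVec_mulVec, ← h1, ← hJn]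
      rw [dotProduct_mulVec, vecMul_transpose]
    rwa [hgn, dotProduct_single] at this
  have hgs : ∀ b, g⁻¹ 0 b = g⁻¹ b 0 := by
    have : (g⁻¹)ᵀ = g⁻¹ := by
      rw [transpose_nonsing_inv, hg]
      simp only [transpose_mul, transpose_transpose, hGs, Matrix.mul_assoc]
    intro b
    exact congrFun₂ this b 0
  have hF : F ⬝ᵥ ν = m * ∑ b, g⁻¹ 0 b * (Jᵀ *ᵥ F) b := by
    rw [← hJn, dotProduct_mulVec, ← mulVec_transpose, dotProduct, Finset.mul_sum]
    exact Finset.sum_congr rfl fun b _ => by rw [hn' b, hgs b]; ring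
  -- Cramer's rule: the cofactor of the entry 00 is the determinant of the metric induced on the
  -- hyperplane.
  have hq : g.det * g⁻¹ 0 0 = (g.submatrix Fin.succ Fin.succ).det := by
    rw [inv_def, Ring.inverse_eq_inv', Matrix.smul_apply, adjugate_fin_succ_eq_det_submatrix]
    simp only [Fin.val_zero, add_zero, pow_zero, one_mul, smul_eq_mul]
    rw [← mul_assoc, mul_inv_cancel₀ hgd, one_mul]
    rfl
  -- The volume densities thus differ by the factor |m| = −m. This cancels the m in F(ν) = m Σ
  -- g⁰ᵇF_b and leaves the minus sign.
  have hdet : |g.det| = m ^ 2 * |(g.submatrix Fin.succ Fin.succ).det| := by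
    have e : g.det = -(m ^ 2 * (g.submatrix Fin.succ Fin.succ).det) := by
      rw [hn' 0] at hn0
      rw [← hq]; linear_combination g.det * hn0
    rw [e, abs_neg, abs_mul, abs_sq]
  refine ⟨fun h => hgd (by rwa [h, abs_zero, mul_zero, abs_eq_zero] at hdet), ?_⟩
  rw [hF, hdet, Real.sqrt_mul (sq_nonneg _), Real.sqrt_sq_eq_abs, abs_of_neg h0]
  ring

namespace LocalBackground

/-- Components of the vector density `√|det g| w^a`. -/
def flux (B : LocalBackground) (w : Fin 4 → EuclideanSpace ℝ (Fin 4) → ℝ) (a : Fin 4)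
    (z : EuclideanSpace ℝ (Fin 4)) : ℝ := B.dens z * ∑ b, B.gi a b z * w b z

namespace RegularMetric

variable {B : LocalBackground} {W K : Set (EuclideanSpace ℝ (Fin 4))} (h : B.RegularMetric W)
  {w : Fin 4 → EuclideanSpace ℝ (Fin 4) → ℝ} (hw : ∀ i, ContDiffOn ℝ ∞ (w i) W)
  (hK : IsCompact K) (hKW : K ⊆ W) (h0 : ∀ z ∈ W, z ∉ K → ∀ a, w a z = 0)
include h hw hK hKW h0

theorem indicator_flux (a : Fin 4) : ContDiff ℝ ∞ (W.indicator (B.flux w a)) ∧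
    HasCompactSupport (W.indicator (B.flux w a)) ∧
      (∀ c, ∀ z ∈ W, pd c (W.indicator (B.flux w a)) z = pd c (B.flux w a) z) ∧
      ∀ c, ∀ z ∉ W, pd c (W.indicator (B.flux w a)) z = 0 := by
  refine contDiff_indicator h.isOpen hK hKW ?_ fun z hz hzK => ?_
  · exact h.contDiffOn_dens.mul (ContDiffOn.sum fun b _ => (h.contDiffOn_gi a b).mul (hw b))
  · simp [flux, h0 z hz hzK]

theorem indicator_dens_mul_div1 (z : EuclideanSpace ℝ (Fin 4)) :
    W.indicator (fun z => B.dens z * B.div1 w z) z =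
      ∑ a, pd a (W.indicator (B.flux w a)) z := by
  by_cases hz : z ∈ W
  · rw [indicator_of_mem hz, h.dens_mul_div1 hz hw]
    refine Finset.sum_congr rfl fun a _ => ?_
    rw [(h.indicator_flux hw hK hKW h0 a).2.2.1 a z hz]
    rfl
  · rw [indicator_of_notMem hz]
    exact (Finset.sum_eq_zero fun a _ => (h.indicator_flux hw hK hKW h0 a).2.2.2 a z hz).symm

theorem integral_dens_mul_div1 : ∫ z in W, B.dens z * B.div1 w z = 0 := by
  have hf := h.indicator_flux hw hK hKW h0
  rw [← integral_indicator h.isOpen.measurableSet]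
  simp only [h.indicator_dens_mul_div1 hw hK hKW h0]
  rw [integral_finsetSum _ fun a _ => integrable_pd (hf a).1 (hf a).2.1 a]
  exact Finset.sum_eq_zero fun a _ => integral_pd_eq_zero (hf a).1 (hf a).2.1 a

theorem integral_halfSpace_dens_mul_div1 :
    ∫ z in W ∩ {z | 0 < z 0}, B.dens z * B.div1 w z =
      -∫ y, W.indicator (B.flux w 0) (consPt 0 y) := by
  have hf := h.indicator_flux hw hK hKW h0
  rw [inter_comm, ← setIntegral_indicator h.isOpen.measurableSet]
  simp only [h.indicator_dens_mul_div1 hw hK hKW h0]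
  rw [integral_finsetSum _ fun a _ => (integrable_pd (hf a).1 (hf a).2.1 a).integrableOn,
    Finset.sum_congr rfl fun a _ => integral_halfSpace_pd (hf a).1 (hf a).2.1 a]
  simp

end RegularMetric

namespace MetricChange

variable {B B' : LocalBackground} {W U' K : Set (EuclideanSpace ℝ (Fin 4))}
  {ψ : EuclideanSpace ℝ (Fin 4) → EuclideanSpace ℝ (Fin 4)} (h : B.MetricChange B' W U' ψ)
include h

theorem dens_eq {z : EuclideanSpace ℝ (Fin 4)} (hz : z ∈ W) :
    B.dens z = |(fderiv ℝ ψ z).det| * B'.dens (ψ z) := by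
  have hd : DifferentiableAt ℝ ψ z :=
    ((h.smooth z hz).contDiffAt (h.left.isOpen.mem_nhds hz)).differentiableAt (by simp)
  have e : (fderiv ℝ ψ z).det = (Matrix.of fun p i => jac ψ p i z).det := by
    rw [det_eq_det_matrix]
    simp only [jac_eq_fderiv hd]
  unfold dens
  rw [h.metric_mat hz, Matrix.det_mul, Matrix.det_mul, Matrix.det_transpose, e, mul_right_comm,
    abs_mul, Real.sqrt_mul (abs_nonneg _), ← sq, abs_sq, Real.sqrt_sq_eq_abs]

/-- Changing variables by ψ turns the integral over a curved region into one over a half space.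
Density and divergence both transform so that the integrand keeps its form, with the pulled-back
metric and covector field. -/
theorem integral_image (hinj : InjOn ψ W)
    {w' : Fin 4 → EuclideanSpace ℝ (Fin 4) → ℝ} (hw' : ∀ i, ContDiffOn ℝ ∞ (w' i) U')
    (hK : IsCompact K) (hKW : K ⊆ W) (h0 : ∀ z ∈ W, z ∉ K → ∀ a, w' a (ψ z) = 0) :
    ∫ x in ψ '' (W ∩ {z | 0 < z 0}), B'.dens x * B'.div1 w' x =
      -∫ y, W.indicator (B.flux (fun a z => pull1 (fun p i => jac ψ p i z)
        (fun p => w' p (ψ z)) a) 0) (consPt 0 y) := by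
  have hm : MeasurableSet (W ∩ {z : EuclideanSpace ℝ (Fin 4) | 0 < z 0}) :=
    (h.left.isOpen.inter (isOpen_lt continuous_const (by fun_prop))).measurableSet
  have hd : ∀ z ∈ W, DifferentiableAt ℝ ψ z := fun z hz =>
    ((h.smooth z hz).contDiffAt (h.left.isOpen.mem_nhds hz)).differentiableAt (by simp)
  rw [integral_image_eq_integral_abs_det_fderiv_smul volume hm
    (fun z hz => (hd z hz.1).hasFDerivAt.hasFDerivWithinAt) (hinj.mono inter_subset_left)]
  rw [← h.left.integral_halfSpace_dens_mul_div1 _ hK hKW]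
  · refine setIntegral_congr_fun hm fun z hz => ?_
    simp only [smul_eq_mul]
    rw [h.dens_eq hz.1, h.div1_eq hz.1 hw' fun _ _ _ => rfl, mul_assoc]
  · intro z hz hzK a
    simp [pull1, h0 z hz hzK]
  · intro i
    have : ContDiffOn ℝ ∞ (fun z => ∑ p, jac ψ p i z * w' p (ψ z)) W :=
      ContDiffOn.sum fun p _ =>
        (contDiffOn_jac h.left.isOpen h.smooth p i).mul ((hw' p).comp h.smooth h.mapsTo)
    exact this

end MetricChange

/-- The pull-back of a metric in coordinates. -/
def pullMetric (B' : LocalBackground)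
    (ψ : EuclideanSpace ℝ (Fin 4) → EuclideanSpace ℝ (Fin 4)) : LocalBackground where
  G a b z := pull2 (fun p i => jac ψ p i z) (fun p q => B'.G p q (ψ z)) a b
  -- Only the metric of this background is used; the remaining data are filler.
  φ := 0
  ξ := 0
  V := 0

theorem RegularMetric.metricChange_pullMetric {B' : LocalBackground}
    {W U' : Set (EuclideanSpace ℝ (Fin 4))} (h : B'.RegularMetric U')
    {ψ : EuclideanSpace ℝ (Fin 4) → EuclideanSpace ℝ (Fin 4)} (hW : IsOpen W)
    (hψ : ContDiffOn ℝ ∞ ψ W) (hm : MapsTo ψ W U')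
    (hd : ∀ z ∈ W, (Matrix.of fun p i => jac ψ p i z).det ≠ 0) :
    (B'.pullMetric ψ).MetricChange B' W U' ψ where
  left :=
    { isOpen := hW
      smooth := fun i j => by
        have : ContDiffOn ℝ ∞ (fun z => ∑ p, ∑ q, jac ψ p i z * jac ψ q j z * B'.G p q (ψ z)) W :=
          ContDiffOn.sum fun p _ => ContDiffOn.sum fun q _ =>
            ((contDiffOn_jac hW hψ p i).mul (contDiffOn_jac hW hψ q j)).mul
              ((h.smooth p q).comp hψ hm)
        exact this
      symm := fun z hz i j => by
        simp only [pullMetric, pull2]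
        refine Finset.sum_comm.trans ?_
        exact Finset.sum_congr rfl fun p _ => Finset.sum_congr rfl fun q _ => by
          rw [h.symm _ (hm hz) q p]; ring
      det_ne := fun z hz => by
        have : (Matrix.of fun k l => (B'.pullMetric ψ).G k l z) =
            (Matrix.of fun p i => jac ψ p i z).transpose * (Matrix.of fun p q => B'.G p q (ψ z)) *
              Matrix.of fun p i => jac ψ p i z := by
          ext a b
          rw [← pull2_eq]
          rfl
        rw [this, Matrix.det_mul, Matrix.det_mul, Matrix.det_transpose]
        exact mul_ne_zero (mul_ne_zero (hd z hz) (h.det_ne _ (hm hz))) (hd z hz) }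
  right := h
  smooth := hψ
  mapsTo := hm
  metric := fun _ _ _ _ => rfl

end LocalBackground

/-! ## Coordinates adapted to a hypersurface -/

section Collar

variable {M : Type*} [TopologicalSpace M] [ChartedSpace (EuclideanSpace ℝ (Fin 4)) M]
  [IsManifold (𝓡 4) ∞ M]

/-- The coordinate vector of the time orientation in the chart around `x₀`. -/
def vecRep {g : LorentzMetric M} (τ : TimeOrientation g) (x₀ : M) (z : EuclideanSpace ℝ (Fin 4)) :
    EuclideanSpace ℝ (Fin 4) :=
  mfderiv (𝓡 4) 𝓘(ℝ, EuclideanSpace ℝ (Fin 4)) (extChartAt (𝓡 4) x₀)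
    ((extChartAt (𝓡 4) x₀).symm z) (τ.vec ((extChartAt (𝓡 4) x₀).symm z))

theorem mfderiv_symm_vecRep {g : LorentzMetric M} (τ : TimeOrientation g) {x₀ : M}
    {z : EuclideanSpace ℝ (Fin 4)} (hz : z ∈ (extChartAt (𝓡 4) x₀).target) :
    (mfderiv 𝓘(ℝ, EuclideanSpace ℝ (Fin 4)) (𝓡 4) (extChartAt (𝓡 4) x₀).symm z (vecRep τ x₀ z) :
      EuclideanSpace ℝ (Fin 4)) = τ.vec ((extChartAt (𝓡 4) x₀).symm z) := by
  have h := frame_mfderiv_extChartAt ((extChartAt (𝓡 4) x₀).map_target hz)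
    (τ.vec ((extChartAt (𝓡 4) x₀).symm z))
  rw [(extChartAt (𝓡 4) x₀).right_inv hz] at h
  exact h

/-- The covariant components g(∂_i, T) are already known to be smooth; raising the index with the
inverse metric recovers the coordinate vector. -/
theorem contDiffOn_vecRep {b : Background M} (hnd : b.NonDegenerate) (τ : TimeOrientation b.g)
    (x₀ : M) : ContDiffOn ℝ ∞ (vecRep τ x₀) (extChartAt (𝓡 4) x₀).target := by
  have hr := (Background.loc_regular hnd x₀).toRegularMetric
  rw [contDiffOn_euclidean]
  intro k
  have h1 : ContDiffOn ℝ ∞ (fun z => ∑ i, (b.loc x₀).gi k i z *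
      b.g.val ((extChartAt (𝓡 4) x₀).symm z) (frame x₀ z i)
      (τ.vec ((extChartAt (𝓡 4) x₀).symm z))) (extChartAt (𝓡 4) x₀).target :=
    ContDiffOn.sum fun i _ => (hr.contDiffOn_gi k i).mul (contDiffOn_frame_vec x₀ i)
  refine h1.congr fun z hz => ?_
  have h2 : ∀ i, b.g.val ((extChartAt (𝓡 4) x₀).symm z) (frame x₀ z i)
      (τ.vec ((extChartAt (𝓡 4) x₀).symm z)) = ∑ j, (b.loc x₀).G i j z * vecRep τ x₀ z j := by
    intro i
    have h3 := form_symm_apply b.g.val x₀ z (EuclideanSpace.single i 1) (vecRep τ x₀ z)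
    have h4 := mfderiv_symm_vecRep τ hz
    have key : ∀ (T : EuclideanSpace ℝ (Fin 4) →L[ℝ] ℝ) (u v : EuclideanSpace ℝ (Fin 4)),
        u = v → T u = T v := fun T u v h => by rw [h]
    refine (key _ _ _ h4).symm.trans (h3.trans ?_)
    rw [Finset.sum_eq_single i]
    · refine Finset.sum_congr rfl fun j _ => ?_
      simp only [PiLp.single_apply, if_true, one_mul]
      exact mul_comm _ _
    · intro j _ hj
      simp [hj]
    · simp
  simp only [h2, Finset.mul_sum]
  rw [Finset.sum_comm]
  simp only [← mul_assoc, ← Finset.sum_mul, hr.gi_mul_G hz]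
  simp

/-- The last three coordinates, as a continuous linear map. -/
def tailCLM : EuclideanSpace ℝ (Fin 4) →L[ℝ] EuclideanSpace ℝ (Fin 3) :=
  LinearMap.toContinuousLinearMap
    { toFun := tailPt
      map_add' := fun _ _ => rfl
      map_smul' := fun _ _ => rfl }

theorem hasFDerivAt_tailPt (w : EuclideanSpace ℝ (Fin 4)) : HasFDerivAt tailPt tailCLM w :=
  tailCLM.hasFDerivAt

variable {S : Type*} [TopologicalSpace S] [ChartedSpace (EuclideanSpace ℝ (Fin 3)) S]

/-- Coordinates of `M` near the point `ι s₀` of a hypersurface, in which the hypersurface is the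
zero set of the first coordinate, whose coordinate vector is there the time orientation. -/
structure Collar {g : LorentzMetric M} (τ : TimeOrientation g) (ι : S → M) (s₀ : S) where
  P : OpenPartialHomeomorph (EuclideanSpace ℝ (Fin 4)) (EuclideanSpace ℝ (Fin 4))
  smooth : ContDiffOn ℝ ∞ P P.source
  mapsTo : MapsTo P P.source (extChartAt (𝓡 4) (ι s₀)).target
  det_ne : ∀ w ∈ P.source, (Matrix.of fun p i => jac P p i w).det ≠ 0
  mem : consPt 0 (extChartAt (𝓡 3) s₀ s₀) ∈ P.source
  tail_mem : ∀ w ∈ P.source, tailPt w ∈ (extChartAt (𝓡 3) s₀).target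
  eq_ι : ∀ w ∈ P.source, w 0 = 0 →
    (extChartAt (𝓡 4) (ι s₀)).symm (P w) = ι ((extChartAt (𝓡 3) s₀).symm (tailPt w))
  future : ∀ w ∈ P.source, 0 < w 0 →
    (extChartAt (𝓡 4) (ι s₀)).symm (P w) ∈ future (Chron g τ) (range ι)
  past : ∀ w ∈ P.source, w 0 < 0 →
    (extChartAt (𝓡 4) (ι s₀)).symm (P w) ∈ LinEKG.future (flip (Chron g τ)) (range ι)
  fderiv_zero : ∀ w ∈ P.source, w 0 = 0 →
    (mfderiv 𝓘(ℝ, EuclideanSpace ℝ (Fin 4)) (𝓡 4) (extChartAt (𝓡 4) (ι s₀)).symm (P w)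
      (fderiv ℝ P w (EuclideanSpace.single 0 1)) : EuclideanSpace ℝ (Fin 4)) =
        τ.vec ((extChartAt (𝓡 4) (ι s₀)).symm (P w))
  fderiv_succ : ∀ w ∈ P.source, w 0 = 0 → ∀ i : Fin 3,
    (mfderiv 𝓘(ℝ, EuclideanSpace ℝ (Fin 4)) (𝓡 4) (extChartAt (𝓡 4) (ι s₀)).symm (P w)
      (fderiv ℝ P w (EuclideanSpace.single i.succ 1)) : EuclideanSpace ℝ (Fin 4)) =
        mfderiv (𝓡 3) (𝓡 4) ι ((extChartAt (𝓡 3) s₀).symm (tailPt w)) (frame s₀ (tailPt w) i)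

end Collar

/-! ### Construction of the adapted coordinates -/

section CollarMap

variable {M : Type*} [TopologicalSpace M] [ChartedSpace (EuclideanSpace ℝ (Fin 4)) M]
  [IsManifold (𝓡 4) ∞ M]
  {S : Type*} [TopologicalSpace S] [ChartedSpace (EuclideanSpace ℝ (Fin 3)) S]

/-- The coordinate expression of a hypersurface. -/
def slice (ι : S → M) (s₀ : S) (y : EuclideanSpace ℝ (Fin 3)) : EuclideanSpace ℝ (Fin 4) :=
  extChartAt (𝓡 4) (ι s₀) (ι ((extChartAt (𝓡 3) s₀).symm y))

/-- The domain of the coordinate expression of a hypersurface. -/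
def sliceDomain (ι : S → M) (s₀ : S) : Set (EuclideanSpace ℝ (Fin 3)) :=
  (extChartAt (𝓡 3) s₀).target ∩
    (fun y => ι ((extChartAt (𝓡 3) s₀).symm y)) ⁻¹' (extChartAt (𝓡 4) (ι s₀)).source

/-- The map that moves the hypersurface along the time orientation, in coordinates. -/
def collarMap {g : LorentzMetric M} (τ : TimeOrientation g) (ι : S → M) (s₀ : S)
    (w : EuclideanSpace ℝ (Fin 4)) : EuclideanSpace ℝ (Fin 4) :=
  slice ι s₀ (tailPt w) + w 0 • vecRep τ (ι s₀) (slice ι s₀ (tailPt w))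

omit [IsManifold (𝓡 4) ∞ M] in
theorem slice_mem_target {ι : S → M} {s₀ : S} {y : EuclideanSpace ℝ (Fin 3)}
    (hy : y ∈ sliceDomain ι s₀) : slice ι s₀ y ∈ (extChartAt (𝓡 4) (ι s₀)).target :=
  (extChartAt (𝓡 4) (ι s₀)).map_source hy.2

omit [IsManifold (𝓡 4) ∞ M] in
theorem symm_slice {ι : S → M} {s₀ : S} {y : EuclideanSpace ℝ (Fin 3)}
    (hy : y ∈ sliceDomain ι s₀) : (extChartAt (𝓡 4) (ι s₀)).symm (slice ι s₀ y) =
      ι ((extChartAt (𝓡 3) s₀).symm y) :=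
  (extChartAt (𝓡 4) (ι s₀)).left_inv hy.2

omit [IsManifold (𝓡 4) ∞ M] in
theorem mem_sliceDomain (ι : S → M) (s₀ : S) :
    extChartAt (𝓡 3) s₀ s₀ ∈ sliceDomain ι s₀ := by
  refine ⟨mem_extChartAt_target s₀, ?_⟩
  rw [mem_preimage, extChartAt_to_inv]
  exact mem_extChartAt_source (I := 𝓡 4) (ι s₀)

omit [IsManifold (𝓡 4) ∞ M] in
theorem slice_self (ι : S → M) (s₀ : S) :
    slice ι s₀ (extChartAt (𝓡 3) s₀ s₀) = extChartAt (𝓡 4) (ι s₀) (ι s₀) := by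
  rw [slice, extChartAt_to_inv]

variable [IsManifold (𝓡 3) ∞ S] {ι : S → M} (hι : ContMDiff (𝓡 3) (𝓡 4) ∞ ι) (s₀ : S)
include hι

omit [IsManifold (𝓡 4) ∞ M] in
theorem contMDiffOn_comp_symm : ContMDiffOn 𝓘(ℝ, EuclideanSpace ℝ (Fin 3)) (𝓡 4) ∞
    (fun y => ι ((extChartAt (𝓡 3) s₀).symm y)) (extChartAt (𝓡 3) s₀).target :=
  hι.comp_contMDiffOn (contMDiffOn_extChartAt_symm (I := 𝓡 3) (n := ∞) s₀)

omit [IsManifold (𝓡 4) ∞ M] in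
theorem isOpen_sliceDomain : IsOpen (sliceDomain ι s₀) :=
  (contMDiffOn_comp_symm hι s₀).continuousOn.isOpen_inter_preimage (isOpen_extChartAt_target s₀)
    (isOpen_extChartAt_source _)

theorem contDiffOn_slice : ContDiffOn ℝ ∞ (slice ι s₀) (sliceDomain ι s₀) := by
  rw [← contMDiffOn_iff_contDiffOn]
  have h1 := contMDiffOn_extChartAt (I := 𝓡 4) (n := ∞) (x := ι s₀)
  rw [← extChartAt_source (I := 𝓡 4)] at h1
  exact h1.comp ((contMDiffOn_comp_symm hι s₀).mono inter_subset_left) inter_subset_right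

variable {s₀}

theorem differentiableAt_slice {y : EuclideanSpace ℝ (Fin 3)} (hy : y ∈ sliceDomain ι s₀) :
    DifferentiableAt ℝ (slice ι s₀) y :=
  ((contDiffOn_slice hι s₀ y hy).contDiffAt ((isOpen_sliceDomain hι s₀).mem_nhds hy)).differentiableAt
    (by simp)

theorem mfderiv_symm_slice {y : EuclideanSpace ℝ (Fin 3)} (hy : y ∈ sliceDomain ι s₀)
    (v : EuclideanSpace ℝ (Fin 3)) :
    (mfderiv 𝓘(ℝ, EuclideanSpace ℝ (Fin 4)) (𝓡 4) (extChartAt (𝓡 4) (ι s₀)).symm (slice ι s₀ y)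
      (fderiv ℝ (slice ι s₀) y v) : EuclideanSpace ℝ (Fin 4)) =
      mfderiv (𝓡 3) (𝓡 4) ι ((extChartAt (𝓡 3) s₀).symm y)
        (mfderiv 𝓘(ℝ, EuclideanSpace ℝ (Fin 3)) (𝓡 3) (extChartAt (𝓡 3) s₀).symm y v) := by
  have h1 : MDifferentiableAt 𝓘(ℝ, EuclideanSpace ℝ (Fin 3)) (𝓡 4)
      (fun y => ι ((extChartAt (𝓡 3) s₀).symm y)) y :=
    ((contMDiffOn_comp_symm hι s₀ y hy.1).contMDiffAt
      ((isOpen_extChartAt_target s₀).mem_nhds hy.1)).mdifferentiableAt (by simp)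
  have h2 := mfderiv_eq_chart (v := v) h1 hy.2
  have h3 := mfderiv_comp y ((hι ((extChartAt (𝓡 3) s₀).symm y)).mdifferentiableAt (by simp))
    (mdifferentiableAt_extChartAt_symm hy.1)
  exact h2.symm.trans (DFunLike.congr_fun h3 v)

variable {b : Background M} (hnd : b.NonDegenerate) (τ : TimeOrientation b.g)
include hnd

theorem contDiffOn_collarMap :
    ContDiffOn ℝ ∞ (collarMap τ ι s₀) (tailPt ⁻¹' sliceDomain ι s₀) := by
  have h1 : ContDiffOn ℝ ∞ (fun w => slice ι s₀ (tailPt w)) (tailPt ⁻¹' sliceDomain ι s₀) :=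
    (contDiffOn_slice hι s₀).comp contDiff_tailPt.contDiffOn fun _ h => h
  have h2 : ContDiffOn ℝ ∞ (fun w => vecRep τ (ι s₀) (slice ι s₀ (tailPt w)))
      (tailPt ⁻¹' sliceDomain ι s₀) :=
    (contDiffOn_vecRep hnd τ (ι s₀)).comp h1 fun w hw => slice_mem_target hw
  have h3 : ContDiff ℝ ∞ fun w : EuclideanSpace ℝ (Fin 4) => w 0 := by fun_prop
  exact h1.add (h3.contDiffOn.smul h2)

/-- On the hypersurface the factor `w 0` vanishes, so the derivative of the vector field along the
slice does not contribute. -/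
theorem hasFDerivAt_collarMap {w : EuclideanSpace ℝ (Fin 4)} (hw : tailPt w ∈ sliceDomain ι s₀)
    (h0 : w 0 = 0) : HasFDerivAt (collarMap τ ι s₀)
      ((fderiv ℝ (slice ι s₀) (tailPt w)).comp tailCLM +
        (EuclideanSpace.proj 0 : EuclideanSpace ℝ (Fin 4) →L[ℝ] ℝ).smulRight
          (vecRep τ (ι s₀) (slice ι s₀ (tailPt w)))) w := by
  have h1 : HasFDerivAt (fun w => slice ι s₀ (tailPt w))
      ((fderiv ℝ (slice ι s₀) (tailPt w)).comp tailCLM) w :=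
    (differentiableAt_slice hι hw).hasFDerivAt.comp w (hasFDerivAt_tailPt w)
  have hT := (((contDiffOn_vecRep hnd τ (ι s₀)) _ (slice_mem_target hw)).contDiffAt
    ((isOpen_extChartAt_target _).mem_nhds (slice_mem_target hw))).differentiableAt (by simp)
  have hd : DifferentiableAt ℝ (fun w => vecRep τ (ι s₀) (slice ι s₀ (tailPt w))) w :=
    hT.fun_comp' w h1.differentiableAt
  have h2 := hd.hasFDerivAt
  have h3 : HasFDerivAt (fun w : EuclideanSpace ℝ (Fin 4) => w 0)
      (EuclideanSpace.proj 0 : EuclideanSpace ℝ (Fin 4) →L[ℝ] ℝ) w :=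
    (EuclideanSpace.proj 0 : EuclideanSpace ℝ (Fin 4) →L[ℝ] ℝ).hasFDerivAt
  have h4 := h1.add (h3.smul h2)
  rw [h0, zero_smul, zero_add] at h4
  exact h4

theorem mfderiv_fderiv_collarMap {w : EuclideanSpace ℝ (Fin 4)}
    (hw : tailPt w ∈ sliceDomain ι s₀) (h0 : w 0 = 0) (v : EuclideanSpace ℝ (Fin 4)) :
    (mfderiv 𝓘(ℝ, EuclideanSpace ℝ (Fin 4)) (𝓡 4) (extChartAt (𝓡 4) (ι s₀)).symm
      (collarMap τ ι s₀ w) (fderiv ℝ (collarMap τ ι s₀) w v) : EuclideanSpace ℝ (Fin 4)) =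
    (mfderiv (𝓡 3) (𝓡 4) ι ((extChartAt (𝓡 3) s₀).symm (tailPt w))
        (mfderiv 𝓘(ℝ, EuclideanSpace ℝ (Fin 3)) (𝓡 3) (extChartAt (𝓡 3) s₀).symm (tailPt w)
          (tailPt v)) : EuclideanSpace ℝ (Fin 4)) +
      v 0 • (τ.vec (ι ((extChartAt (𝓡 3) s₀).symm (tailPt w))) : EuclideanSpace ℝ (Fin 4)) := by
  have e1 : collarMap τ ι s₀ w = slice ι s₀ (tailPt w) := by simp [collarMap, h0]
  have e2 : fderiv ℝ (collarMap τ ι s₀) w v = fderiv ℝ (slice ι s₀) (tailPt w) (tailPt v) +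
      v 0 • vecRep τ (ι s₀) (slice ι s₀ (tailPt w)) := by
    rw [(hasFDerivAt_collarMap hι hnd τ hw h0).fderiv]
    rfl
  have key : ∀ (T : EuclideanSpace ℝ (Fin 4) →L[ℝ] EuclideanSpace ℝ (Fin 4))
      (u u' x x' : EuclideanSpace ℝ (Fin 4)) (t : ℝ), T u = u' → T x = x' →
      T (u + t • x) = u' + t • x' := fun T u u' x x' t h h' => by
    rw [map_add, map_smul, h, h']
  rw [e1, e2]
  refine key _ _ _ _ _ _ (mfderiv_symm_slice hι hw _) ?_
  rw [← symm_slice hw]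
  exact mfderiv_symm_vecRep τ (slice_mem_target hw)

variable {ν : ∀ s : S, TangentSpace (𝓡 4) (ι s)} (hν : IsFutureUnitNormal b.g τ ι ν)
  (hsp : ∀ (s : S) (v : TangentSpace (𝓡 3) s), v ≠ 0 → 0 < pullback b.g ι s v v)
include hν hsp

/-- Pairing a kernel vector with ν removes its tangential part and leaves v₀ g(ν, T) = 0, where g(ν,
T) < 0, so v₀ = 0. The tangential part then vanishes because the induced metric is positive
definite. -/
theorem injective_fderiv_collarMap {w : EuclideanSpace ℝ (Fin 4)}
    (hw : tailPt w ∈ sliceDomain ι s₀) (h0 : w 0 = 0) :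
    Function.Injective (fderiv ℝ (collarMap τ ι s₀) w) := by
  rw [injective_iff_map_eq_zero]
  intro v hv
  have h1 := mfderiv_fderiv_collarMap hι hnd τ hw h0 v
  set s := (extChartAt (𝓡 3) s₀).symm (tailPt w) with hs
  set u : EuclideanSpace ℝ (Fin 3) :=
    mfderiv 𝓘(ℝ, EuclideanSpace ℝ (Fin 3)) (𝓡 3) (extChartAt (𝓡 3) s₀).symm (tailPt w)
      (tailPt v) with hu
  have h2 : (mfderiv (𝓡 3) (𝓡 4) ι s u : EuclideanSpace ℝ (Fin 4)) +
      v 0 • (τ.vec (ι s) : EuclideanSpace ℝ (Fin 4)) = 0 := by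
    rw [← h1, hv]
    exact map_zero _
  have key : ∀ (T : EuclideanSpace ℝ (Fin 4) →L[ℝ] ℝ) (x y : EuclideanSpace ℝ (Fin 4)) (t : ℝ),
      x + t • y = 0 → T x = 0 → T y < 0 → t = 0 := by
    intro T x y t hxy hx hy
    have := congrArg T hxy
    rw [map_add, map_smul, hx, map_zero, zero_add, smul_eq_mul] at this
    exact (mul_eq_zero.1 this).resolve_right hy.ne
  have hv0 : v 0 = 0 := key (b.g.val (ι s) (ν s)) _ _ _ h2 ((hν s).2.2 u) (hν s).2.1.2
  rw [hv0, zero_smul, add_zero] at h2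
  have hu0 : u = 0 := by
    by_contra hne
    have h3 := hsp s u hne
    have key2 : ∀ (T : EuclideanSpace ℝ (Fin 4) →L[ℝ] EuclideanSpace ℝ (Fin 4) →L[ℝ] ℝ)
      (x : EuclideanSpace ℝ (Fin 4)), x = 0 → T x x = 0 := by
      intro T x hx; rw [hx, map_zero]
    exact h3.ne' (key2 (b.g.val (ι s)) _ h2)
  have ht : tailPt v = 0 := by
    have h3 := mfderiv_extChartAt_frame hw.1 (tailPt v)
    rw [← h3]
    have key3 : ∀ (T : EuclideanSpace ℝ (Fin 3) →L[ℝ] EuclideanSpace ℝ (Fin 3))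
      (x : EuclideanSpace ℝ (Fin 3)), x = 0 → T x = 0 := by
      intro T x hx; rw [hx, map_zero]
    exact key3 _ _ hu0
  rw [← consPt_tailPt v, hv0, ht]
  ext i
  refine Fin.cases rfl (fun i => rfl) i

/-- The inverse function theorem at the base point yields the coordinates, and restriction to a
small neighbourhood secures the remaining properties. Points off the hypersurface differ from their
foot point by `w 0` times the time orientation, so `exists_cone` decides whether they lie in its
future or past. -/
theorem exists_collar : Nonempty (Collar τ ι s₀) := by
  set f := collarMap τ ι s₀ with hf
  set Ω : Set (EuclideanSpace ℝ (Fin 4)) := tailPt ⁻¹' sliceDomain ι s₀ with hΩ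
  have hΩo : IsOpen Ω := (isOpen_sliceDomain hι s₀).preimage contDiff_tailPt.continuous
  have hfs : ContDiffOn ℝ ∞ f Ω := contDiffOn_collarMap hι hnd τ
  set w₀ := consPt 0 (extChartAt (𝓡 3) s₀ s₀) with hw₀
  have hw₀Ω : w₀ ∈ Ω := mem_sliceDomain ι s₀
  have hfa : ContDiffAt ℝ ∞ f w₀ := (hfs w₀ hw₀Ω).contDiffAt (hΩo.mem_nhds hw₀Ω)
  have hinj : Function.Injective (fderiv ℝ f w₀) :=
    injective_fderiv_collarMap hι hnd τ hν hsp hw₀Ω rfl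
  set L := (LinearEquiv.ofInjectiveEndo (fderiv ℝ f w₀ : EuclideanSpace ℝ (Fin 4) →ₗ[ℝ]
    EuclideanSpace ℝ (Fin 4)) hinj).toContinuousLinearEquiv with hL
  have hLe : (L : EuclideanSpace ℝ (Fin 4) →L[ℝ] EuclideanSpace ℝ (Fin 4)) = fderiv ℝ f w₀ := by
    ext v; rfl
  have hfd : HasFDerivAt f (L : EuclideanSpace ℝ (Fin 4) →L[ℝ] EuclideanSpace ℝ (Fin 4)) w₀ := by
    rw [hLe]; exact (hfa.differentiableAt (by simp)).hasFDerivAt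
  have hdet : (Matrix.of fun p i => jac f p i w₀).det ≠ 0 := by
    have e : (Matrix.of fun p i => jac f p i w₀).det = (fderiv ℝ f w₀).det := by
      rw [det_eq_det_matrix]
      simp only [jac_eq_fderiv (hfa.differentiableAt (by simp))]
    rw [e]
    exact (LinearEquiv.isUnit_det' (LinearEquiv.ofInjectiveEndo
      (fderiv ℝ f w₀ : EuclideanSpace ℝ (Fin 4) →ₗ[ℝ] EuclideanSpace ℝ (Fin 4)) hinj)).ne_zero
  have hz₀ := mem_extChartAt_target (I := 𝓡 4) (ι s₀)
  have hw : FutureTimelike b.g τ (ι s₀) (mfderiv 𝓘(ℝ, EuclideanSpace ℝ (Fin 4)) (𝓡 4)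
      (extChartAt (𝓡 4) (ι s₀)).symm (extChartAt (𝓡 4) (ι s₀) (ι s₀))
      (vecRep τ (ι s₀) (extChartAt (𝓡 4) (ι s₀) (ι s₀))) : EuclideanSpace ℝ (Fin 4)) := by
    have h1 := mfderiv_symm_vecRep τ hz₀
    have h2 : FutureTimelike b.g τ
        ((extChartAt (𝓡 4) (ι s₀)).symm (extChartAt (𝓡 4) (ι s₀) (ι s₀))) (τ.vec _) :=
      ⟨τ.timelike _, τ.timelike _⟩
    rw [h1]
    exact class_congr (FutureTimelike b.g τ) (extChartAt_to_inv (I := 𝓡 4) (ι s₀)) h2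
  obtain ⟨ε, hε, hεt, hcone⟩ := exists_cone hw
  have hc1 : ContinuousAt (fun w => slice ι s₀ (tailPt w)) w₀ :=
    ContinuousAt.comp (f := tailPt) (x := w₀) (differentiableAt_slice hι hw₀Ω).continuousAt
      contDiff_tailPt.continuous.continuousAt
  have e1 : slice ι s₀ (tailPt w₀) = extChartAt (𝓡 4) (ι s₀) (ι s₀) := slice_self ι s₀
  have hc2 : ContinuousAt (vecRep τ (ι s₀)) (slice ι s₀ (tailPt w₀)) :=
    (contDiffOn_vecRep hnd τ (ι s₀)).continuousOn.continuousAt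
      ((isOpen_extChartAt_target _).mem_nhds (by rw [e1]; exact hz₀))
  have hc3 : ContinuousAt (fun w => vecRep τ (ι s₀) (slice ι s₀ (tailPt w))) w₀ :=
    ContinuousAt.comp (f := fun w => slice ι s₀ (tailPt w)) hc2 hc1
  have e2 : f w₀ = extChartAt (𝓡 4) (ι s₀) (ι s₀) := by
    rw [hf, collarMap, e1]
    simp [hw₀]
  have hc4 : ContinuousAt (fun w => (Matrix.of fun p i => jac f p i w).det) w₀ :=
    (contDiffOn_det fun p i => contDiffOn_jac hΩo hfs p i).continuousOn.continuousAt
      (hΩo.mem_nhds hw₀Ω)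
  -- All requirements are open conditions valid at the base point: foot point and image lie in the
  -- cone neighbourhood, the displacement direction is close to the central one, and the Jacobian
  -- determinant is nonzero.
  have hev : ∀ᶠ w in 𝓝 w₀, w ∈ Ω ∧
      slice ι s₀ (tailPt w) ∈ Metric.ball (extChartAt (𝓡 4) (ι s₀) (ι s₀)) ε ∧
      f w ∈ Metric.ball (extChartAt (𝓡 4) (ι s₀) (ι s₀)) ε ∧
      vecRep τ (ι s₀) (slice ι s₀ (tailPt w)) ∈
        Metric.ball (vecRep τ (ι s₀) (extChartAt (𝓡 4) (ι s₀) (ι s₀))) ε ∧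
      (Matrix.of fun p i => jac f p i w).det ≠ 0 := by
    refine (hΩo.eventually_mem hw₀Ω).and ?_
    refine (hc1.eventually (by beta_reduce; rw [e1]; exact Metric.ball_mem_nhds _ hε)).and ?_
    refine (hfa.continuousAt.eventually (by rw [e2]; exact Metric.ball_mem_nhds _ hε)).and ?_
    exact (hc3.eventually (by beta_reduce; rw [e1]; exact Metric.ball_mem_nhds _ hε)).and
      (hc4.eventually_ne hdet)
  obtain ⟨W, hW, hWo, hwW⟩ := eventually_nhds_iff.1 hev
  set Q := hfa.toOpenPartialHomeomorph f hfd (by simp) with hQ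
  have hQf : (Q : EuclideanSpace ℝ (Fin 4) → EuclideanSpace ℝ (Fin 4)) = f :=
    hfa.toOpenPartialHomeomorph_coe hfd (by simp)
  have hP : (Q.restrOpen W hWo : EuclideanSpace ℝ (Fin 4) → EuclideanSpace ℝ (Fin 4)) = f := hQf
  have hPs : ∀ w ∈ (Q.restrOpen W hWo).source, w ∈ W := fun w hw => by
    rw [OpenPartialHomeomorph.restrOpen_source] at hw; exact hw.2
  have hmem : ∀ w ∈ W, ι ((extChartAt (𝓡 3) s₀).symm (tailPt w)) ∈ range ι := fun w _ => ⟨_, rfl⟩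
  refine ⟨⟨Q.restrOpen W hWo, ?_, ?_, ?_, ?_, ?_, ?_, ?_, ?_, ?_, ?_⟩⟩
  · rw [hP]
    exact hfs.mono fun w hw => (hW w (hPs w hw)).1
  · rw [hP]
    exact fun w hw => hεt (hW w (hPs w hw)).2.2.1
  · rw [hP]
    exact fun w hw => (hW w (hPs w hw)).2.2.2.2
  · rw [OpenPartialHomeomorph.restrOpen_source]
    exact ⟨hfa.mem_toOpenPartialHomeomorph_source hfd (by simp), hwW⟩
  · exact fun w hw => (hW w (hPs w hw)).1.1
  · rw [hP]
    intro w hw h0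
    rw [hf, collarMap, h0, zero_smul, add_zero]
    exact symm_slice (hW w (hPs w hw)).1
  · rw [hP]
    intro w hw h0
    obtain ⟨g1, g2, g3, g4, _⟩ := hW w (hPs w hw)
    refine ⟨_, ⟨(extChartAt (𝓡 3) s₀).symm (tailPt w), rfl⟩, ?_⟩
    rw [← symm_slice g1]
    -- With δ equal to the first coordinate, the rescaled displacement is exactly the time
    -- orientation at the foot point.
    refine hcone _ g2 _ g3 (w 0) h0 ?_
    rw [hf, collarMap, add_sub_cancel_left, smul_smul, inv_mul_cancel₀ h0.ne', one_smul]
    exact g4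
  · rw [hP]
    intro w hw h0
    obtain ⟨g1, g2, g3, g4, _⟩ := hW w (hPs w hw)
    refine ⟨_, ⟨(extChartAt (𝓡 3) s₀).symm (tailPt w), rfl⟩, ?_⟩
    rw [← symm_slice g1]
    refine hcone _ g3 _ g2 (-w 0) (neg_pos.2 h0) ?_
    rw [hf, collarMap, sub_add_cancel_left, ← neg_smul, smul_smul,
      inv_mul_cancel₀ (neg_pos.2 h0).ne', one_smul]
    exact g4
  · rw [hP]
    intro w hw h0
    have h1 := mfderiv_fderiv_collarMap hι hnd τ (hW w (hPs w hw)).1 h0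
      (EuclideanSpace.single 0 1)
    have hx : (extChartAt (𝓡 4) (ι s₀)).symm (f w) = ι ((extChartAt (𝓡 3) s₀).symm (tailPt w)) := by
      rw [hf, collarMap, h0, zero_smul, add_zero]
      exact symm_slice (hW w (hPs w hw)).1
    have hvec : ∀ x y : M, x = y → (τ.vec x : EuclideanSpace ℝ (Fin 4)) = τ.vec y := by
      rintro x _ rfl; rfl
    have key : ∀ (T : EuclideanSpace ℝ (Fin 3) →L[ℝ] EuclideanSpace ℝ (Fin 4))
        (T' : EuclideanSpace ℝ (Fin 3) →L[ℝ] EuclideanSpace ℝ (Fin 3))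
        (v : EuclideanSpace ℝ (Fin 4)), T (T' (tailPt (EuclideanSpace.single 0 1))) +
          (EuclideanSpace.single 0 1 : EuclideanSpace ℝ (Fin 4)) 0 • v = v := by
      intro T T' v
      have : tailPt (EuclideanSpace.single 0 1) = 0 := by ext i; simp [tailPt]
      simp [this]
    exact h1.trans ((key _ _ _).trans (hvec _ _ hx.symm))
  · rw [hP]
    intro w hw h0 i
    have h1 := mfderiv_fderiv_collarMap hι hnd τ (hW w (hPs w hw)).1 h0
      (EuclideanSpace.single i.succ 1)
    have key : ∀ (T : EuclideanSpace ℝ (Fin 3) →L[ℝ] EuclideanSpace ℝ (Fin 4))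
        (T' : EuclideanSpace ℝ (Fin 3) →L[ℝ] EuclideanSpace ℝ (Fin 3))
        (v : EuclideanSpace ℝ (Fin 4)), T (T' (tailPt (EuclideanSpace.single i.succ 1))) +
          (EuclideanSpace.single i.succ 1 : EuclideanSpace ℝ (Fin 4)) 0 • v =
        T (T' (EuclideanSpace.single i 1)) := by
      intro T T' v
      have : tailPt (EuclideanSpace.single i.succ 1) = EuclideanSpace.single i 1 := by
        ext j; simp [tailPt]
      simp [this]
    exact h1.trans (key _ _ _)

end CollarMap

/-! ## Smooth covector fields and their divergence -/

section Covectors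

variable {M : Type*} [TopologicalSpace M] [ChartedSpace (EuclideanSpace ℝ (Fin 4)) M]

/-- The components of the covector field `F` are smooth in all charts. -/
def SmoothCovec (F : ∀ x : M, TangentSpace (𝓡 4) x →L[ℝ] ℝ) : Prop :=
  ∀ y a, ContDiffOn ℝ ∞ (comp1 F y a) (extChartAt (𝓡 4) y).target

theorem SmoothCovec.sub {F G : ∀ x : M, TangentSpace (𝓡 4) x →L[ℝ] ℝ} (hF : SmoothCovec F)
    (hG : SmoothCovec G) : SmoothCovec fun x => F x - G x := fun y a => (hF y a).sub (hG y a)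

theorem comp1_symm_apply (F : ∀ x : M, TangentSpace (𝓡 4) x →L[ℝ] ℝ) (x₀ : M)
    (z v : EuclideanSpace ℝ (Fin 4)) :
    F ((extChartAt (𝓡 4) x₀).symm z)
      (mfderiv 𝓘(ℝ, EuclideanSpace ℝ (Fin 4)) (𝓡 4) (extChartAt (𝓡 4) x₀).symm z v) =
      ∑ i, v i * comp1 F x₀ i z := by
  have key : ∀ (T : EuclideanSpace ℝ (Fin 4) →L[ℝ] ℝ) (a : Fin 4 → ℝ)
      (f : Fin 4 → EuclideanSpace ℝ (Fin 4)), T (∑ k, a k • f k) = ∑ k, a k * T (f k) := by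
    intro T a f; simp
  erw [mfderiv_symm_eq_sum x₀ z v]
  exact key _ _ _

variable [IsManifold (𝓡 4) ∞ M]

theorem SmoothCovec.smul {f : M → ℝ} (hf : ContMDiff (𝓡 4) 𝓘(ℝ, ℝ) ∞ f)
    {F : ∀ x : M, TangentSpace (𝓡 4) x →L[ℝ] ℝ} (hF : SmoothCovec F) :
    SmoothCovec fun x => f x • F x := fun y a => by
  have h1 : ContDiffOn ℝ ∞ (fun z => f ((extChartAt (𝓡 4) y).symm z))
      (extChartAt (𝓡 4) y).target := by
    rw [← contMDiffOn_iff_contDiffOn]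
    exact hf.comp_contMDiffOn (contMDiffOn_extChartAt_symm (I := 𝓡 4) (n := ∞) y)
  exact h1.mul (hF y a)

theorem comp1_eq_pull1 (F : ∀ x : M, TangentSpace (𝓡 4) x →L[ℝ] ℝ) (x₀ y : M)
    {z : EuclideanSpace ℝ (Fin 4)} (hz : z ∈ (extChartAt (𝓡 4) x₀).target ∩
      (extChartAt (𝓡 4) x₀).symm ⁻¹' (extChartAt (𝓡 4) y).source) (i : Fin 4) :
    comp1 F x₀ i z = pull1
      (fun p i => jac (fun w => extChartAt (𝓡 4) y ((extChartAt (𝓡 4) x₀).symm w)) p i z)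
      (fun p => comp1 F y p (extChartAt (𝓡 4) y ((extChartAt (𝓡 4) x₀).symm z))) i := by
  unfold pull1
  simp only [jac_transition x₀ y hz]
  rw [← comp1_symm_apply]
  have e := (extChartAt (𝓡 4) y).left_inv hz.2
  have h1 := mfderiv_eq_chart (v := EuclideanSpace.single i 1)
    (mdifferentiableAt_extChartAt_symm hz.1) hz.2
  rw [← h1]
  exact covec_congr F e.symm _

namespace Background

variable {b : Background M} {F G : ∀ x : M, TangentSpace (𝓡 4) x →L[ℝ] ℝ}

theorem divergence_congr {x : M} (h : ∀ᶠ y in 𝓝 x, F y = G y) :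
    b.divergence F x = b.divergence G x := by
  have hx := mem_extChartAt_target (I := 𝓡 4) x
  have hc : ContinuousAt (extChartAt (𝓡 4) x).symm (extChartAt (𝓡 4) x x) :=
    continuousAt_extChartAt_symm x
  have h1 : ∀ᶠ z in 𝓝 (extChartAt (𝓡 4) x x), ∀ a, comp1 F x a z = comp1 G x a z := by
    have h2 := hc.eventually (p := fun y => F y = G y) (by rwa [extChartAt_to_inv])
    filter_upwards [h2] with z hz a
    unfold comp1
    rw [hz]
  unfold divergence LocalBackground.div1 LocalBackground.cov1
  refine Finset.sum_congr rfl fun a _ => Finset.sum_congr rfl fun c _ => ?_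
  rw [pd_congr (h1.mono fun z hz => hz c)]
  simp only [h1.self_of_nhds]

theorem divergence_zero (x : M) : b.divergence (fun _ => 0) x = 0 := by
  have h1 : ∀ a, comp1 (fun y : M => (0 : TangentSpace (𝓡 4) y →L[ℝ] ℝ)) x a = fun _ => 0 :=
    fun a => rfl
  unfold divergence LocalBackground.div1 LocalBackground.cov1
  simp [h1, pd]

theorem divergence_eq_zero {K : Set M} (hK : IsClosed K) (h0 : ∀ x ∉ K, F x = 0) {x : M}
    (hx : x ∉ K) : b.divergence F x = 0 := by
  rw [divergence_congr (G := fun _ => 0), divergence_zero]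
  filter_upwards [hK.isOpen_compl.mem_nhds hx] with y hy using h0 y hy

variable (hnd : b.NonDegenerate)
include hnd

/-- The divergence at `x` is defined in the chart centred at `x`. Covariance of `div1` allows any
chart containing `x`, which makes continuity and integration accessible. -/
theorem divergence_eq (hF : SmoothCovec F) {x y : M}
    (hx : x ∈ (extChartAt (𝓡 4) y).source) :
    b.divergence F x = (b.loc y).div1 (comp1 F y) (extChartAt (𝓡 4) y x) := by
  have hm := mem_extChartAt_target (I := 𝓡 4) x
  have e := extChartAt_to_inv (I := 𝓡 4) x
  have hz : extChartAt (𝓡 4) x x ∈ (extChartAt (𝓡 4) x).target ∩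
      (extChartAt (𝓡 4) x).symm ⁻¹' (extChartAt (𝓡 4) y).source :=
    ⟨hm, by rw [mem_preimage, e]; exact hx⟩
  have h := (metricChange hnd x y).div1_eq hz (hF y) fun w hw a => comp1_eq_pull1 F x y hw a
  unfold divergence
  rw [h, e]

theorem divergence_eq_symm (hF : SmoothCovec F) (y : M) {z : EuclideanSpace ℝ (Fin 4)}
    (hz : z ∈ (extChartAt (𝓡 4) y).target) :
    b.divergence F ((extChartAt (𝓡 4) y).symm z) = (b.loc y).div1 (comp1 F y) z := by
  rw [divergence_eq hnd hF ((extChartAt (𝓡 4) y).map_target hz), (extChartAt (𝓡 4) y).right_inv hz]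

theorem continuous_divergence (hF : SmoothCovec F) : Continuous (b.divergence F) := by
  rw [continuous_iff_continuousAt]
  intro x
  have hr := (loc_regular hnd x).toRegularMetric
  have h1 : ContDiffOn ℝ ∞ ((b.loc x).div1 (comp1 F x)) (extChartAt (𝓡 4) x).target :=
    ContDiffOn.sum fun a _ => ContDiffOn.sum fun c _ =>
      (hr.contDiffOn_gi a c).mul (hr.contDiffOn_cov1 (hF x) a c)
  have h2 : ContinuousAt (fun y => (b.loc x).div1 (comp1 F x) (extChartAt (𝓡 4) x y)) x :=
    ContinuousAt.comp (g := (b.loc x).div1 (comp1 F x))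
      (h1.continuousOn.continuousAt
        ((isOpen_extChartAt_target x).mem_nhds (mem_extChartAt_target x)))
      (continuousAt_extChartAt x)
  refine h2.congr ?_
  filter_upwards [(isOpen_extChartAt_source (I := 𝓡 4) x).mem_nhds (mem_extChartAt_source x)]
    with y hy using (divergence_eq hnd hF hy).symm

theorem divergence_sub (hF : SmoothCovec F) (hG : SmoothCovec G) (x : M) :
    b.divergence (fun y => F y - G y) x = b.divergence F x - b.divergence G x := by
  have hx := mem_extChartAt_target (I := 𝓡 4) x
  have hr := (loc_regular hnd x).toRegularMetric
  exact hr.div1_sub hx (hF x) (hG x)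

theorem divergence_sum {ι : Type*} (t : Finset ι)
    {F : ι → ∀ x : M, TangentSpace (𝓡 4) x →L[ℝ] ℝ} (hF : ∀ i, SmoothCovec (F i)) (x : M) :
    b.divergence (fun y => ∑ i ∈ t, F i y) x = ∑ i ∈ t, b.divergence (F i) x := by
  classical
  have hx := mem_extChartAt_target (I := 𝓡 4) x
  have hr := (loc_regular hnd x).toRegularMetric
  have key : ∀ t : Finset ι, SmoothCovec (fun y => ∑ i ∈ t, F i y) ∧
      b.divergence (fun y => ∑ i ∈ t, F i y) x = ∑ i ∈ t, b.divergence (F i) x := by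
    intro t
    induction t using Finset.induction_on with
    | empty =>
      refine ⟨fun y a => contDiffOn_const (c := (0 : ℝ)), ?_⟩
      simp only [Finset.sum_empty]
      exact divergence_zero x
    | insert i t hi ih =>
      simp only [Finset.sum_insert hi]
      refine ⟨fun y a => (hF i y a).add (ih.1 y a), ?_⟩
      rw [← ih.2]
      exact hr.div1_add hx (hF i x) (ih.1 x)
  exact (key t).2

variable [SecondCountableTopology M] [MeasurableSpace M] [BorelSpace M] [T2Space M]

/-- The divergence theorem for a covector field with support in a chart. -/
theorem integral_divergence_of_subset_source (hF : SmoothCovec F) {K : Set M} (hK : IsCompact K)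
    {x₀ : M} (hKs : K ⊆ (extChartAt (𝓡 4) x₀).source) (h0 : ∀ x ∉ K, F x = 0) :
    ∫ x, b.divergence F x ∂(volMeasure b.g.val) = 0 := by
  have hcc : ContinuousComp b.g.val := fun x i j => (contDiffOn_comp b.g.smooth x i j).continuousOn
  rw [integral_volMeasure hcc x₀ (continuous_divergence hnd hF).aestronglyMeasurable
    fun x hx => divergence_eq_zero hK.isClosed h0 fun h => hx (hKs h)]
  have hr := (loc_regular hnd x₀).toRegularMetric
  rw [← hr.integral_dens_mul_div1 (hF x₀)
    (hK.image_of_continuousOn ((continuousOn_extChartAt x₀).mono hKs))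
    (image_subset_iff.2 fun x hx => (extChartAt (𝓡 4) x₀).map_source (hKs hx)) ?_]
  · refine setIntegral_congr_fun (isOpen_extChartAt_target x₀).measurableSet fun z hz => ?_
    rw [divergence_eq_symm hnd hF x₀ hz]
    rfl
  · intro z hz hzK a
    have : (extChartAt (𝓡 4) x₀).symm z ∉ K := fun h =>
      hzK ⟨_, h, (extChartAt (𝓡 4) x₀).right_inv hz⟩
    unfold comp1
    rw [h0 _ this]
    rfl

end Background

end Covectors

/-! ## The divergence theorem near a hypersurface -/

section LocalStokes

variable {M : Type*} [TopologicalSpace M] [ChartedSpace (EuclideanSpace ℝ (Fin 4)) M]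
  [IsManifold (𝓡 4) ∞ M]
  {S : Type*} [TopologicalSpace S] [ChartedSpace (EuclideanSpace ℝ (Fin 3)) S]
  {b : Background M} {τ : TimeOrientation b.g} {ι : S → M} {s₀ : S}
  {ν : ∀ s : S, TangentSpace (𝓡 4) (ι s)}

namespace Collar

variable (C : Collar τ ι s₀)

theorem differentiableAt {w : EuclideanSpace ℝ (Fin 4)} (hw : w ∈ C.P.source) :
    DifferentiableAt ℝ C.P w :=
  ((C.smooth w hw).contDiffAt (C.P.open_source.mem_nhds hw)).differentiableAt (by simp)

open Matrix in
-- Identifies the matrix expression of `normal_flux` with the metric products of the adapted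
-- coordinate vectors and the vector with components `N`.
theorem mulVec_eq {w : EuclideanSpace ℝ (Fin 4)} (hw : w ∈ C.P.source)
    (N : EuclideanSpace ℝ (Fin 4)) (a : Fin 4) :
    ((Matrix.of fun p i => jac C.P p i w)ᵀ *ᵥ
      ((Matrix.of fun p q => (b.loc (ι s₀)).G p q (C.P w)) *ᵥ N)) a =
    b.g.val ((extChartAt (𝓡 4) (ι s₀)).symm (C.P w))
      (mfderiv 𝓘(ℝ, EuclideanSpace ℝ (Fin 4)) (𝓡 4) (extChartAt (𝓡 4) (ι s₀)).symm (C.P w)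
        (fderiv ℝ C.P w (EuclideanSpace.single a 1)))
      (mfderiv 𝓘(ℝ, EuclideanSpace ℝ (Fin 4)) (𝓡 4) (extChartAt (𝓡 4) (ι s₀)).symm (C.P w) N) := by
  refine Eq.trans ?_ (form_symm_apply b.g.val (ι s₀) (C.P w) _ _).symm
  simp only [mulVec, dotProduct, transpose_apply, of_apply, Finset.mul_sum,
    jac_eq_fderiv (C.differentiableAt hw)]
  refine Finset.sum_congr rfl fun p _ => Finset.sum_congr rfl fun q _ => ?_
  simp only [Background.loc]
  ring

theorem pullMetric_eq {w : EuclideanSpace ℝ (Fin 4)} (hw : w ∈ C.P.source) (i j : Fin 4) :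
    ((b.loc (ι s₀)).pullMetric C.P).G i j w =
    b.g.val ((extChartAt (𝓡 4) (ι s₀)).symm (C.P w))
      (mfderiv 𝓘(ℝ, EuclideanSpace ℝ (Fin 4)) (𝓡 4) (extChartAt (𝓡 4) (ι s₀)).symm (C.P w)
        (fderiv ℝ C.P w (EuclideanSpace.single i 1)))
      (mfderiv 𝓘(ℝ, EuclideanSpace ℝ (Fin 4)) (𝓡 4) (extChartAt (𝓡 4) (ι s₀)).symm (C.P w)
        (fderiv ℝ C.P w (EuclideanSpace.single j 1))) := by
  refine Eq.trans ?_ (form_symm_apply b.g.val (ι s₀) (C.P w) _ _).symm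
  simp only [LocalBackground.pullMetric, pull2, jac_eq_fderiv (C.differentiableAt hw)]
  rfl

/-- The metric of the hypersurface in adapted coordinates. -/
theorem comp_pullback_eq {y : EuclideanSpace ℝ (Fin 3)} (hy : consPt 0 y ∈ C.P.source)
    (i j : Fin 3) : comp (pullback b.g ι) s₀ i j y =
      ((b.loc (ι s₀)).pullMetric C.P).G i.succ j.succ (consPt 0 y) := by
  rw [C.pullMetric_eq hy]
  have h1 := C.fderiv_succ _ hy rfl i
  have h2 := C.fderiv_succ _ hy rfl j
  have h3 := C.eq_ι _ hy rfl
  rw [tailPt_consPt] at h1 h2 h3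
  have key : ∀ u v u' v' : EuclideanSpace ℝ (Fin 4), u = u' → v = v' →
      b.g.val ((extChartAt (𝓡 4) (ι s₀)).symm (C.P (consPt 0 y))) u v =
        b.g.val (ι ((extChartAt (𝓡 3) s₀).symm y)) u' v' := by
    rintro u v _ _ rfl rfl
    exact form_congr b.g.val h3 u v
  exact (key _ _ _ _ h1 h2).symm

variable (hν : IsFutureUnitNormal b.g τ ι ν)
include hν

open Matrix in
/-- The flux of a covector field through the hypersurface in adapted coordinates. -/
theorem flux_eq (F : ∀ x : M, TangentSpace (𝓡 4) x →L[ℝ] ℝ) {y : EuclideanSpace ℝ (Fin 3)}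
    (hy : consPt 0 y ∈ C.P.source) :
    density (pullback b.g ι) s₀ y ≠ 0 ∧
    density (pullback b.g ι) s₀ y * F (ι ((extChartAt (𝓡 3) s₀).symm y))
      (ν ((extChartAt (𝓡 3) s₀).symm y)) =
    -((b.loc (ι s₀)).pullMetric C.P).flux (fun a z => pull1 (fun p i => jac C.P p i z)
        (fun p => comp1 F (ι s₀) p (C.P z)) a) 0 (consPt 0 y) := by
  set w := consPt 0 y with hw
  set s := (extChartAt (𝓡 3) s₀).symm y with hs
  have hz := C.mapsTo hy
  have hx : (extChartAt (𝓡 4) (ι s₀)).symm (C.P w) = ι s := C.eq_ι w hy rfl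
  have hsrc : ι s ∈ (extChartAt (𝓡 4) (ι s₀)).source := by
    rw [← hx]; exact (extChartAt (𝓡 4) (ι s₀)).map_target hz
  set N : EuclideanSpace ℝ (Fin 4) := mfderiv (𝓡 4) 𝓘(ℝ, EuclideanSpace ℝ (Fin 4))
    (extChartAt (𝓡 4) (ι s₀)) (ι s) (ν s) with hN
  have hDN : (mfderiv 𝓘(ℝ, EuclideanSpace ℝ (Fin 4)) (𝓡 4) (extChartAt (𝓡 4) (ι s₀)).symm
      (C.P w) N : EuclideanSpace ℝ (Fin 4)) = ν s := by
    have h := frame_mfderiv_extChartAt hsrc (ν s)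
    rw [← hx, (extChartAt (𝓡 4) (ι s₀)).right_inv hz, hx] at h
    exact h
  have key : ∀ u v u' v' : EuclideanSpace ℝ (Fin 4), u = u' → v = v' →
      b.g.val ((extChartAt (𝓡 4) (ι s₀)).symm (C.P w)) u v = b.g.val (ι s) v' u' := by
    rintro u v _ _ rfl rfl
    exact (form_congr b.g.val hx u v).trans (b.g.symm _ _ _)
  have hvec : ∀ x y : M, x = y → (τ.vec x : EuclideanSpace ℝ (Fin 4)) = τ.vec y := by
    rintro x _ rfl; rfl
  set J := Matrix.of fun p i => jac C.P p i w with hJ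
  set G := Matrix.of fun p q => (b.loc (ι s₀)).G p q (C.P w) with hG
  have hg : J.transpose * G * J =
      Matrix.of fun k l => ((b.loc (ι s₀)).pullMetric C.P).G k l w := by
    ext i j
    rw [hJ, hG, ← LocalBackground.pull2_eq]
    rfl
  -- The hypotheses of the linear algebra are the three properties of ν: orthogonality to the
  -- tangential coordinate vectors, unit length, and negative product with the zeroth coordinate
  -- vector, which is the time orientation.
  have h1 := normal_flux (J := J) (G := G) (ν := N)
    (F := fun p => comp1 F (ι s₀) p (C.P w)) (C.det_ne w hy)
    (b.g.det_comp_ne (ι s₀) hz) (by ext p q; exact b.g.symm _ _ _)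
    (fun i => (C.mulVec_eq hy N i.succ).trans
      ((key _ _ _ _ (C.fderiv_succ w hy rfl i) hDN).trans ((hν s).2.2 _)))
    (by
      have h2 := form_symm_apply b.g.val (ι s₀) (C.P w) N N
      have h3 := (key _ _ _ _ hDN hDN).trans (hν s).1
      rw [h3] at h2
      rw [h2]
      simp only [mulVec, dotProduct, Finset.mul_sum]
      refine Finset.sum_congr rfl fun p _ => Finset.sum_congr rfl fun q _ => ?_
      simp only [hG, of_apply, Background.loc]
      ring)
    (by
      rw [C.mulVec_eq hy N 0]
      have h4 := (C.fderiv_zero w hy rfl).trans (hvec _ (ι s) hx)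
      exact (key _ _ _ _ h4 hDN).trans_lt (hν s).2.1.2)
  have hFN : (fun p => comp1 F (ι s₀) p (C.P w)) ⬝ᵥ N = F (ι s) (ν s) := by
    have h2 := comp1_symm_apply F (ι s₀) (C.P w) N
    have h3 : ∀ u v : EuclideanSpace ℝ (Fin 4), u = v →
        F ((extChartAt (𝓡 4) (ι s₀)).symm (C.P w)) u = F (ι s) v := by
      rintro u _ rfl; exact covec_congr F hx u
    rw [← h3 _ _ hDN, h2, dotProduct]
    exact Finset.sum_congr rfl fun p _ => mul_comm _ _
  have hsub : (J.transpose * G * J).submatrix Fin.succ Fin.succ =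
      Matrix.of fun i j => comp (pullback b.g ι) s₀ i j y := by
    rw [hg]
    ext i j
    exact (C.comp_pullback_eq hy i j).symm
  rw [hFN, hsub, hg] at h1
  exact ⟨(Real.sqrt_pos.2 (abs_pos.2 h1.1)).ne', h1.2⟩

end Collar

end LocalStokes

/-! ### The divergence theorem in adapted coordinates -/

section CollarStokes

variable {M : Type*} [TopologicalSpace M] [ChartedSpace (EuclideanSpace ℝ (Fin 4)) M]
  [IsManifold (𝓡 4) ∞ M]
  {S : Type*} [TopologicalSpace S] [ChartedSpace (EuclideanSpace ℝ (Fin 3)) S]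
  {b : Background M} {τ : TimeOrientation b.g} {ι : S → M} {s₀ : S}
  {ν : ∀ s : S, TangentSpace (𝓡 4) (ι s)}
  {F : ∀ x : M, TangentSpace (𝓡 4) x →L[ℝ] ℝ}

namespace Collar

variable (C : Collar τ ι s₀)

theorem metricChange (hnd : b.NonDegenerate) :
    ((b.loc (ι s₀)).pullMetric C.P).MetricChange (b.loc (ι s₀)) C.P.source
      (extChartAt (𝓡 4) (ι s₀)).target C.P :=
  (Background.loc_regular hnd (ι s₀)).toRegularMetric.metricChange_pullMetric C.P.open_source
    C.smooth C.mapsTo C.det_ne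

theorem continuousOn_flux (hnd : b.NonDegenerate) (hF : SmoothCovec F) :
    ContinuousOn (((b.loc (ι s₀)).pullMetric C.P).flux (fun a z => pull1 (fun p i => jac C.P p i z)
        (fun p => comp1 F (ι s₀) p (C.P z)) a) 0) C.P.source := by
  have hl := (C.metricChange hnd).left
  have h1 : ∀ i, ContDiffOn ℝ ∞ (fun z => ∑ p, jac C.P p i z * comp1 F (ι s₀) p (C.P z))
      C.P.source := fun i => ContDiffOn.sum fun p _ =>
    (contDiffOn_jac C.P.open_source C.smooth p i).mul ((hF (ι s₀) p).comp C.smooth C.mapsTo)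
  have h2 : ContDiffOn ℝ ∞ (((b.loc (ι s₀)).pullMetric C.P).flux
      (fun a z => pull1 (fun p i => jac C.P p i z)
        (fun p => comp1 F (ι s₀) p (C.P z)) a) 0) C.P.source :=
    hl.contDiffOn_dens.mul (ContDiffOn.sum fun c _ => (hl.contDiffOn_gi 0 c).mul (h1 c))
  exact h2.continuousOn

/-- Points of the hypersurface in the domain of the adapted coordinates. -/
theorem mem_of_eq_symm [TopologicalSpace.MetrizableSpace M] (hC : IsCauchy b.g τ (range ι))
    (hinj : Function.Injective ι) {s : S} {z : EuclideanSpace ℝ (Fin 4)} (hz : z ∈ C.P.target)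
    (hs : (extChartAt (𝓡 4) (ι s₀)).symm z = ι s) :
    s ∈ (extChartAt (𝓡 3) s₀).source ∧ consPt 0 (extChartAt (𝓡 3) s₀ s) ∈ C.P.source := by
  have hch := chronology b.g τ
  have hw := C.P.map_target hz
  set w := C.P.symm z with hwd
  have hPw : C.P w = z := C.P.right_inv hz
  -- A nonzero first coordinate would place a point of the Cauchy surface in its own chronological
  -- future or past.
  have hw0 : w 0 = 0 := by
    rcases lt_trichotomy (w 0) 0 with h | h | h
    · have h1 := C.past w hw h
      rw [hPw, hs] at h1
      exact (disjoint_left.1 (hch.flip.disjoint_future (MeetsOnce.flip hC)) ⟨s, rfl⟩ h1).elim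
    · exact h
    · have h1 := C.future w hw h
      rw [hPw, hs] at h1
      exact (disjoint_left.1 (hch.disjoint_future hC) ⟨s, rfl⟩ h1).elim
  have h1 := C.eq_ι w hw hw0
  rw [hPw, hs] at h1
  have h2 := C.tail_mem w hw
  have h3 := hinj h1
  refine ⟨by rw [h3]; exact (extChartAt (𝓡 3) s₀).map_target h2, ?_⟩
  rw [h3, (extChartAt (𝓡 3) s₀).right_inv h2, ← hw0, consPt_tailPt]
  exact hw

end Collar

variable [IsManifold (𝓡 3) ∞ S] (hnd : b.NonDegenerate) (hι : ContMDiff (𝓡 3) (𝓡 4) ∞ ι)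
  (hν : IsFutureUnitNormal b.g τ ι ν)
include hι

omit [IsManifold (𝓡 4) ∞ M] in
theorem continuousComp_pullback [IsManifold (𝓡 4) ∞ M] (g : LorentzMetric M) :
    ContinuousComp (pullback g ι) := by
  intro s₀ i j
  have h1 := (contDiffOn_form_apply g.smooth (isOpen_extChartAt_target (I := 𝓡 3) s₀)
    (contMDiffOn_comp_symm hι s₀) (EuclideanSpace.single i 1)
    (EuclideanSpace.single j 1)).continuousOn
  refine h1.congr fun y hy => ?_
  have h3 := mfderiv_comp y ((hι ((extChartAt (𝓡 3) s₀).symm y)).mdifferentiableAt (by simp))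
    (mdifferentiableAt_extChartAt_symm hy)
  have key : ∀ u v u' v' : EuclideanSpace ℝ (Fin 4), u = u' → v = v' →
      g.val (ι ((extChartAt (𝓡 3) s₀).symm y)) u v =
        g.val (ι ((extChartAt (𝓡 3) s₀).symm y)) u' v' := by
    rintro u v _ _ rfl rfl; rfl
  exact (key _ _ _ _ (DFunLike.congr_fun h3 _) (DFunLike.congr_fun h3 _)).symm

include hnd hν
variable (hsp : ∀ (s : S) (v : TangentSpace (𝓡 3) s), v ≠ 0 → 0 < pullback b.g ι s v v)
  (hF : SmoothCovec F)
include hsp hF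

/-- Continuity of ν is not part of its definition. The flux formula exhibits F(ν) as a quotient of
continuous functions in adapted coordinates, with nonvanishing denominator. -/
theorem continuous_normal : Continuous fun s => F (ι s) (ν s) := by
  rw [continuous_iff_continuousAt]
  intro s₀
  obtain ⟨C⟩ := exists_collar (s₀ := s₀) hι hnd τ hν hsp
  set y₀ := extChartAt (𝓡 3) s₀ s₀ with hy₀
  have hc : ContinuousAt (fun y => consPt 0 y) y₀ :=
    (continuous_consPt.comp (Continuous.prodMk_right (0 : ℝ))).continuousAt
  have hW := C.P.open_source.mem_nhds C.mem
  have h1 : ContinuousAt (fun y => ((b.loc (ι s₀)).pullMetric C.P).flux (fun a z => pull1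
      (fun p i => jac C.P p i z) (fun p => comp1 F (ι s₀) p (C.P z)) a) 0 (consPt 0 y)) y₀ :=
    ContinuousAt.comp (f := fun y => consPt 0 y) (x := y₀)
      ((C.continuousOn_flux hnd hF).continuousAt hW) hc
  have h2 : ContinuousAt (density (pullback b.g ι) s₀) y₀ :=
    ((continuousComp_pullback hι b.g).density s₀).continuousAt
      ((isOpen_extChartAt_target s₀).mem_nhds (mem_extChartAt_target s₀))
  have h3 := (h1.neg.div h2 (C.flux_eq hν F C.mem).1).comp (f := extChartAt (𝓡 3) s₀)
    (x := s₀) (continuousAt_extChartAt (I := 𝓡 3) s₀)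
  refine h3.congr ?_
  have hev := (ContinuousAt.comp (g := fun y => consPt 0 y) (f := extChartAt (𝓡 3) s₀)
    (x := s₀) hc (continuousAt_extChartAt (I := 𝓡 3) s₀)).eventually_mem hW
  filter_upwards [hev, (isOpen_extChartAt_source (I := 𝓡 3) s₀).mem_nhds
    (mem_extChartAt_source s₀)] with s hs hss
  have h4 := C.flux_eq hν F hs
  rw [(extChartAt (𝓡 3) s₀).left_inv hss] at h4
  simp only [Function.comp_apply, Pi.div_apply, Pi.neg_apply]
  rw [← h4.2, mul_div_cancel_left₀ _ h4.1]

variable [SecondCountableTopology M] [MeasurableSpace M] [BorelSpace M]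
  [TopologicalSpace.MetrizableSpace M] [SecondCountableTopology S] [MeasurableSpace S]
  [BorelSpace S] (hC : IsCauchy b.g τ (range ι)) (hinj : Function.Injective ι)
include hC hinj

/-- The divergence theorem for a covector field with support in adapted coordinates. -/
theorem Collar.integral_divergence (C : Collar τ ι s₀) {K : Set M} (hK : IsCompact K)
    (hKs : K ⊆ (extChartAt (𝓡 4) (ι s₀)).symm '' C.P.target) (h0 : ∀ x ∉ K, F x = 0) :
    ∫ x in LinEKG.future (Chron b.g τ) (range ι), b.divergence F x ∂(volMeasure b.g.val) =
      ∫ s, F (ι s) (ν s) ∂(volMeasure (pullback b.g ι)) := by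
  have hch := chronology b.g τ
  have hcc : ContinuousComp b.g.val := fun x i j => (contDiffOn_comp b.g.smooth x i j).continuousOn
  have hfm := (hch.isOpen_future_set (range ι)).measurableSet
  have hPT : C.P.target ⊆ (extChartAt (𝓡 4) (ι s₀)).target := fun z hz => by
    rw [← C.P.right_inv hz]; exact C.mapsTo (C.P.map_target hz)
  have hKsrc : K ⊆ (extChartAt (𝓡 4) (ι s₀)).source := fun x hx => by
    obtain ⟨z, hz, rfl⟩ := hKs hx
    exact (extChartAt (𝓡 4) (ι s₀)).map_target (hPT hz)
  have hKP : ∀ x ∈ K, extChartAt (𝓡 4) (ι s₀) x ∈ C.P.target := fun x hx => by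
    obtain ⟨z, hz, rfl⟩ := hKs hx
    rwa [(extChartAt (𝓡 4) (ι s₀)).right_inv (hPT hz)]
  have hKc := hK.image_of_continuousOn ((continuousOn_extChartAt (I := 𝓡 4) (ι s₀)).mono hKsrc)
  have hKc2 := hKc.image_of_continuousOn (C.P.continuousOn_symm.mono (image_subset_iff.2 hKP))
  have hL : ∫ x in LinEKG.future (Chron b.g τ) (range ι), b.divergence F x ∂(volMeasure b.g.val) =
      ∫ z in C.P '' (C.P.source ∩ {w | 0 < w 0}),
        (b.loc (ι s₀)).dens z * (b.loc (ι s₀)).div1 (comp1 F (ι s₀)) z := by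
    rw [← integral_indicator hfm, integral_volMeasure hcc (ι s₀)
      ((Background.continuous_divergence hnd hF).aestronglyMeasurable.indicator hfm)]
    · have hA : IsOpen (C.P '' (C.P.source ∩ {w | 0 < w 0})) :=
        C.P.isOpen_image_of_subset_source
          (C.P.open_source.inter (isOpen_lt continuous_const (by fun_prop))) inter_subset_left
      rw [setIntegral_eq_of_subset_of_forall_sdiff_eq_zero
        (isOpen_extChartAt_target (I := 𝓡 4) (ι s₀)).measurableSet
        (s := C.P '' (C.P.source ∩ {w | 0 < w 0}))]
      · refine setIntegral_congr_fun hA.measurableSet ?_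
        rintro _ ⟨w, hw, rfl⟩
        beta_reduce
        rw [indicator_of_mem (C.future w hw.1 hw.2),
          Background.divergence_eq_symm hnd hF _ (C.mapsTo hw.1)]
        rfl
      · rintro _ ⟨w, hw, rfl⟩
        exact C.mapsTo hw.1
      · rintro z ⟨hz, hzA⟩
        rw [mul_eq_zero]
        right
        by_cases hzK : (extChartAt (𝓡 4) (ι s₀)).symm z ∈ K
        · have hzT := hKP _ hzK
          rw [(extChartAt (𝓡 4) (ι s₀)).right_inv hz] at hzT
          have hw := C.P.map_target hzT
          have hPw := C.P.right_inv hzT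
          refine indicator_of_notMem (fun hf => ?_) _
          -- Inside the collar the chronological future of the surface is exactly the part with
          -- positive first coordinate.
          rcases lt_trichotomy (C.P.symm z 0) 0 with h | h | h
          · have h1 := C.past _ hw h
            rw [hPw] at h1
            exact disjoint_left.1 (hch.disjoint_future_past hC) hf h1
          · have h1 := C.eq_ι _ hw h
            rw [hPw] at h1
            exact disjoint_left.1 (hch.disjoint_future hC) ⟨_, h1.symm⟩ hf
          · exact hzA ⟨_, ⟨hw, h⟩, hPw⟩
        · refine indicator_apply_eq_zero.2 fun _ => ?_
          exact Background.divergence_eq_zero hK.isClosed h0 hzK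
    · intro x hx
      refine indicator_apply_eq_zero.2 fun _ => ?_
      exact Background.divergence_eq_zero hK.isClosed h0 fun h => hx (hKsrc h)
  rw [hL, (C.metricChange hnd).integral_image C.P.injOn (hF (ι s₀)) hKc2]
  · have hmem : ∀ s, ι s ∈ K → s ∈ (extChartAt (𝓡 3) s₀).source ∧
        consPt 0 (extChartAt (𝓡 3) s₀ s) ∈ C.P.source := fun s hs => by
      obtain ⟨z, hz, hzs⟩ := hKs hs
      exact C.mem_of_eq_symm hC hinj hz hzs
    rw [integral_volMeasure (continuousComp_pullback hι b.g) s₀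
      (continuous_normal hnd hι hν hsp hF).aestronglyMeasurable]
    · rw [← integral_neg, ← setIntegral_eq_integral_of_forall_compl_eq_zero
        (s := (extChartAt (𝓡 3) s₀).target)]
      · refine setIntegral_congr_fun (isOpen_extChartAt_target (I := 𝓡 3) s₀).measurableSet
          fun y hy => ?_
        by_cases hyW : consPt 0 y ∈ C.P.source
        · rw [indicator_of_mem hyW, ← (C.flux_eq hν F hyW).2]
        · rw [indicator_of_notMem hyW, neg_zero, h0 (ι ((extChartAt (𝓡 3) s₀).symm y))]
          · exact (mul_zero _).symm
          · intro h
            have h1 := (hmem _ h).2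
            rw [(extChartAt (𝓡 3) s₀).right_inv hy] at h1
            exact hyW h1
      · intro y hy
        rw [indicator_of_notMem, neg_zero]
        exact fun h => hy (C.tail_mem _ h)
    · intro s hs
      rw [h0 (ι s) fun h => hs (hmem s h).1]
      rfl
  · rintro _ ⟨_, ⟨x, hx, rfl⟩, rfl⟩
    exact C.P.map_target (hKP x hx)
  · intro w hw hwK a
    have h1 : (extChartAt (𝓡 4) (ι s₀)).symm (C.P w) ∉ K := fun h => by
      refine hwK ⟨_, ⟨_, h, (extChartAt (𝓡 4) (ι s₀)).right_inv (C.mapsTo hw)⟩, ?_⟩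
      exact C.P.left_inv hw
    unfold comp1
    rw [h0 _ h1]
    rfl

end CollarStokes

/-! ## The divergence theorem for compactly supported covector fields -/

section Stokes

variable {M : Type*} [TopologicalSpace M] [ChartedSpace (EuclideanSpace ℝ (Fin 4)) M]
  [IsManifold (𝓡 4) ∞ M] [T2Space M] [SigmaCompactSpace M]

theorem exists_smooth_partition {O : M → Set M} (hO : ∀ x, IsOpen (O x)) (hx : ∀ x, x ∈ O x)
    {K : Set M} (hK : IsCompact K) : ∃ (t : Finset M) (ρ : t → M → ℝ),
      (∀ i, ContMDiff (𝓡 4) 𝓘(ℝ, ℝ) ∞ (ρ i)) ∧ (∀ i, tsupport (ρ i) ⊆ O i) ∧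
      ∀ x ∈ K, ∑ i, ρ i x = 1 := by
  obtain ⟨t, ht⟩ := hK.elim_finite_subcover O hO fun x _ => mem_iUnion.2 ⟨x, hx x⟩
  obtain ⟨ρ, hρ⟩ := SmoothPartitionOfUnity.exists_isSubordinate (𝓡 4) hK.isClosed
    (fun i : t => O i) (fun i => hO i) (by
      intro x hx
      obtain ⟨i, hi, hxi⟩ := mem_iUnion₂.1 (ht hx)
      exact mem_iUnion.2 ⟨⟨i, hi⟩, hxi⟩)
  refine ⟨t, fun i => ρ i, fun i => (ρ i).contMDiff, hρ, fun x hx => ?_⟩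
  rw [← finsum_eq_sum_of_fintype]
  exact ρ.sum_eq_one hx

variable [SecondCountableTopology M] [MeasurableSpace M] [BorelSpace M]
  {b : Background M} (hnd : b.NonDegenerate) {F : ∀ x : M, TangentSpace (𝓡 4) x →L[ℝ] ℝ}
  (hF : SmoothCovec F) {K : Set M} (hK : IsCompact K) (h0 : ∀ x ∉ K, F x = 0)
include hnd hF hK h0

omit [SigmaCompactSpace M] in
theorem Background.integrable_divergence :
    Integrable (b.divergence F) (volMeasure b.g.val) := by
  have hcc : ContinuousComp b.g.val := fun x i j => (contDiffOn_comp b.g.smooth x i j).continuousOn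
  have := isLocallyFiniteMeasure_volMeasure hcc
  exact (continuous_divergence hnd hF).integrable_of_hasCompactSupport
    (HasCompactSupport.intro hK fun x hx => divergence_eq_zero hK.isClosed h0 hx)

omit [SecondCountableTopology M] [MeasurableSpace M] [BorelSpace M] in
/-- Localisation: a compactly supported covector field is a finite sum of covector fields with
supports in given open sets. -/
theorem exists_decomposition {O : M → Set M} (hO : ∀ x, IsOpen (O x)) (hx : ∀ x, x ∈ O x) :
    ∃ (t : Finset M) (G : t → ∀ x : M, TangentSpace (𝓡 4) x →L[ℝ] ℝ) (L : t → Set M),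
      (∀ i, SmoothCovec (G i)) ∧ (∀ i, IsCompact (L i) ∧ L i ⊆ O i ∧ ∀ x ∉ L i, G i x = 0) ∧
      (∀ x, F x = ∑ i, G i x) ∧ ∀ x, b.divergence F x = ∑ i, b.divergence (G i) x := by
  obtain ⟨t, ρ, hρ, hs, h1⟩ := exists_smooth_partition hO hx hK
  have hG : ∀ i, SmoothCovec fun x => ρ i x • F x := fun i => hF.smul (hρ i)
  have hsum : ∀ x, F x = ∑ i, ρ i x • F x := fun x => by
    by_cases hxK : x ∈ K
    · rw [← Finset.sum_smul, h1 x hxK, one_smul]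
    · simp [h0 x hxK]
  -- The pieces have compact support because the supports of the partition functions are intersected
  -- with the compact set `K`.
  refine ⟨t, fun i x => ρ i x • F x, fun i => tsupport (ρ i) ∩ K, hG, fun i => ⟨?_, ?_, ?_⟩,
    hsum, fun x => ?_⟩
  · exact hK.inter_left (isClosed_tsupport _)
  · exact inter_subset_left.trans (hs i)
  · intro x hx
    beta_reduce at hx ⊢
    by_cases hxK : x ∈ K
    · rw [image_eq_zero_of_notMem_tsupport fun h => hx ⟨h, hxK⟩, zero_smul]
    · rw [h0 x hxK, smul_zero]
  · rw [← Background.divergence_sum hnd Finset.univ hG]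
    exact Background.divergence_congr (.of_forall hsum)

/-- The divergence theorem on a manifold without boundary. -/
theorem Background.integral_divergence_eq_zero :
    ∫ x, b.divergence F x ∂(volMeasure b.g.val) = 0 := by
  obtain ⟨t, G, L, hG, hL, -, hdiv⟩ := exists_decomposition hnd hF hK h0
    (O := fun x => (extChartAt (𝓡 4) x).source) (fun x => isOpen_extChartAt_source x)
    (fun x => mem_extChartAt_source x)
  simp only [hdiv]
  rw [integral_finsetSum _ fun i _ => integrable_divergence hnd (hG i) (hL i).1 (hL i).2.2]
  exact Finset.sum_eq_zero fun i _ =>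
    integral_divergence_of_subset_source hnd (hG i) (hL i).1 (hL i).2.1 (hL i).2.2

variable [TopologicalSpace.MetrizableSpace M] {τ : TimeOrientation b.g}
  {S : Type*} [TopologicalSpace S] [ChartedSpace (EuclideanSpace ℝ (Fin 3)) S]
  [IsManifold (𝓡 3) ∞ S] [SecondCountableTopology S] [MeasurableSpace S] [BorelSpace S]
  {ι : S → M} {ν : ∀ s : S, TangentSpace (𝓡 4) (ι s)} (hι : ContMDiff (𝓡 3) (𝓡 4) ∞ ι)
  (hν : IsFutureUnitNormal b.g τ ι ν)
  (hsp : ∀ (s : S) (v : TangentSpace (𝓡 3) s), v ≠ 0 → 0 < pullback b.g ι s v v)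
  (hC : IsCauchy b.g τ (range ι)) (hemb : IsEmbedding ι)
include hι hν hsp hC hemb

omit [SigmaCompactSpace M] [SecondCountableTopology M] [MeasurableSpace M] [BorelSpace M] in
-- A Cauchy surface is closed, so the embedding is closed and the preimage of `K` is compact; a
-- continuous function with compact support is integrable for a locally finite measure.
theorem integrable_normal : Integrable (fun s => F (ι s) (ν s)) (volMeasure (pullback b.g ι)) := by
  have := isLocallyFiniteMeasure_volMeasure (continuousComp_pullback hι b.g)
  have hcl : IsClosedEmbedding ι := ⟨hemb, (chronology b.g τ).isClosed hC⟩
  refine (continuous_normal hnd hι hν hsp hF).integrable_of_hasCompactSupport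
    (HasCompactSupport.intro' (hcl.isCompact_preimage hK) (hK.isClosed.preimage hι.continuous)
      fun s hs => ?_)
  rw [h0 (ι s) hs]
  rfl

/-- The divergence theorem for the future of a Cauchy surface. -/
theorem Background.integral_divergence_future :
    ∫ x in future (Chron b.g τ) (range ι), b.divergence F x ∂(volMeasure b.g.val) =
      ∫ s, F (ι s) (ν s) ∂(volMeasure (pullback b.g ι)) := by
  have hch := chronology b.g τ
  -- Every point has a neighbourhood such that the theorem holds for fields supported in it. On the
  -- surface this is the collar; in its future only the boundaryless divergence theorem is involved;
  -- in its past both sides vanish.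
  have hloc : ∀ x : M, ∃ O : Set M, IsOpen O ∧ x ∈ O ∧
      ∀ G : ∀ x : M, TangentSpace (𝓡 4) x →L[ℝ] ℝ, SmoothCovec G → ∀ L : Set M, IsCompact L →
        L ⊆ O → (∀ x ∉ L, G x = 0) →
        ∫ x in future (Chron b.g τ) (range ι), b.divergence G x ∂(volMeasure b.g.val) =
          ∫ s, G (ι s) (ν s) ∂(volMeasure (pullback b.g ι)) := by
    intro x
    rcases hch.mem_or_future_or_past hC x with ⟨s, rfl⟩ | hx | hx
    · obtain ⟨C⟩ := exists_collar (s₀ := s) hι hnd τ hν hsp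
      have hPT : C.P.target ⊆ (extChartAt (𝓡 4) (ι s)).target := fun z hz => by
        rw [← C.P.right_inv hz]; exact C.mapsTo (C.P.map_target hz)
      refine ⟨(extChartAt (𝓡 4) (ι s)).symm '' C.P.target, ?_, ?_, fun G hG L hL hLO hL0 =>
        C.integral_divergence hnd hι hν hsp hG hC hemb.injective hL hLO hL0⟩
      · rw [(extChartAt (𝓡 4) (ι s)).symm_image_eq_source_inter_preimage hPT]
        exact (continuousOn_extChartAt (ι s)).isOpen_inter_preimage (isOpen_extChartAt_source _)
          C.P.open_target
      · refine ⟨C.P _, C.P.map_source C.mem, ?_⟩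
        rw [C.eq_ι _ C.mem rfl, tailPt_consPt, extChartAt_to_inv]
    · refine ⟨(extChartAt (𝓡 4) x).source ∩ future (Chron b.g τ) (range ι),
        (isOpen_extChartAt_source x).inter (hch.isOpen_future_set _),
        ⟨mem_extChartAt_source x, hx⟩, fun G hG L hL hLO hL0 => ?_⟩
      rw [setIntegral_eq_integral_of_forall_compl_eq_zero,
        integral_divergence_of_subset_source hnd hG hL (hLO.trans inter_subset_left) hL0]
      · refine (integral_eq_zero_of_ae (.of_forall fun s => ?_)).symm
        rw [hL0 (ι s) fun h => disjoint_left.1 (hch.disjoint_future hC) ⟨s, rfl⟩ (hLO h).2]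
        rfl
      · exact fun y hy => divergence_eq_zero hL.isClosed hL0 fun h => hy (hLO h).2
    · refine ⟨future (flip (Chron b.g τ)) (range ι), hch.flip.isOpen_future_set _, hx,
        fun G hG L hL hLO hL0 => ?_⟩
      rw [setIntegral_eq_zero_of_forall_eq_zero]
      · refine (integral_eq_zero_of_ae (.of_forall fun s => ?_)).symm
        rw [hL0 (ι s) fun h => disjoint_left.1
          (hch.flip.disjoint_future (MeetsOnce.flip hC)) ⟨s, rfl⟩ (hLO h)]
        rfl
      · exact fun y hy => divergence_eq_zero hL.isClosed hL0 fun h =>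
          disjoint_left.1 (hch.disjoint_future_past hC) hy (hLO h)
  choose O hO hxO hSt using hloc
  obtain ⟨t, G, L, hG, hL, hsum, hdiv⟩ := exists_decomposition hnd hF hK h0 hO hxO
  simp only [hdiv]
  rw [integral_finsetSum _ fun i _ =>
    (integrable_divergence hnd (hG i) (hL i).1 (hL i).2.2).integrableOn]
  have e : ∀ s, F (ι s) (ν s) = ∑ i, G i (ι s) (ν s) := fun s => by
    rw [hsum]
    exact _root_.sum_apply _ _ _
  simp only [e]
  rw [integral_finsetSum _ fun i _ =>
    integrable_normal hnd (hG i) (hL i).1 (hL i).2.2 hι hν hsp hC hemb]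
  exact Finset.sum_congr rfl fun i _ => hSt i (G i) (hG i) (L i) (hL i).1 (hL i).2.1 (hL i).2.2

end Stokes

/-! ## Locality of the current -/

namespace LocalBackground

variable (B : LocalBackground) {Θ₁ Θ₂ Θ₁' Θ₂' : LocalSection} {z : EuclideanSpace ℝ (Fin 4)}

theorem jhalf_congr (h₁ : ∀ᶠ x in 𝓝 z, (∀ i j, Θ₁.θ i j x = Θ₁'.θ i j x) ∧ Θ₁.ζ x = Θ₁'.ζ x)
    (h₂ : ∀ᶠ x in 𝓝 z, (∀ i j, Θ₂.θ i j x = Θ₂'.θ i j x) ∧ Θ₂.ζ x = Θ₂'.ζ x) (a : Fin 4) :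
    B.jhalf Θ₁ Θ₂ a z = B.jhalf Θ₁' Θ₂' a z := by
  have e1 := h₁.self_of_nhds
  have e2 := h₂.self_of_nhds
  have p1 : ∀ a i j, pd a (Θ₂.θ i j) z = pd a (Θ₂'.θ i j) z := fun a i j =>
    pd_congr (h₂.mono fun x hx => hx.1 i j)
  have p2 : pd a Θ₂.ζ z = pd a Θ₂'.ζ z := pd_congr (h₂.mono fun x hx => hx.2)
  have t1 : B.tr Θ₁.θ z = B.tr Θ₁'.θ z := by simp only [tr, e1.1]
  have p3 : pd a (B.tr Θ₂.θ) z = pd a (B.tr Θ₂'.θ) z :=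
    pd_congr (h₂.mono fun x hx => by simp only [tr, hx.1])
  have c2 : ∀ a i j, B.cov2 Θ₂.θ a i j z = B.cov2 Θ₂'.θ a i j z := fun a i j => by
    simp only [cov2, p1, e2.1]
  simp only [jhalf, div2, c2, t1, p2, p3, e1.1, e1.2, e2.1, e2.2]

theorem jhalf_zero_left (Θ : LocalSection) (a : Fin 4) :
    B.jhalf ⟨fun _ _ _ => 0, fun _ => 0⟩ Θ a z = 0 := by
  simp [jhalf, tr]

theorem jhalf_zero_right (Θ : LocalSection) (a : Fin 4) :
    B.jhalf Θ ⟨fun _ _ _ => 0, fun _ => 0⟩ a z = 0 := by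
  have h1 : B.tr (fun _ _ _ => 0) = fun _ => 0 := by funext x; simp [tr]
  have h2 : ∀ a i j, B.cov2 (fun _ _ _ => 0) a i j z = 0 := fun a i j => by simp [cov2, pd]
  simp [jhalf, div2, h1, h2, pd]

end LocalBackground

section Current

variable {M : Type*} [TopologicalSpace M] [ChartedSpace (EuclideanSpace ℝ (Fin 4)) M]
  [IsManifold (𝓡 4) ∞ M] {b : Background M} {Θ₁ Θ₁' Θ₂ : FieldPair M}

omit [IsManifold (𝓡 4) ∞ M] in
theorem eventually_localSection {x : M}
    (h : ∀ᶠ y in 𝓝 x, Θ₁.θ y = Θ₁'.θ y ∧ Θ₁.ζ y = Θ₁'.ζ y) :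
    ∀ᶠ z in 𝓝 (extChartAt (𝓡 4) x x), (∀ i j, (localSection Θ₁ x).θ i j z =
      (localSection Θ₁' x).θ i j z) ∧ (localSection Θ₁ x).ζ z = (localSection Θ₁' x).ζ z := by
  have hc : ContinuousAt (extChartAt (𝓡 4) x).symm (extChartAt (𝓡 4) x x) :=
    continuousAt_extChartAt_symm x
  have h2 := hc.eventually (p := fun y => Θ₁.θ y = Θ₁'.θ y ∧ Θ₁.ζ y = Θ₁'.ζ y)
    (by rwa [extChartAt_to_inv])
  filter_upwards [h2] with z hz
  refine ⟨fun i j => ?_, hz.2⟩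
  simp only [localSection, comp, hz.1]

omit [IsManifold (𝓡 4) ∞ M] in
theorem eventually_eq_zero_of_notMem_supp {x : M} (hx : x ∉ supp Θ₁) :
    ∀ᶠ y in 𝓝 x, Θ₁.θ y = 0 ∧ Θ₁.ζ y = 0 := by
  have : ∀ᶠ y in 𝓝 x, y ∉ supp Θ₁ := isClosed_closure.isOpen_compl.mem_nhds hx
  filter_upwards [this] with y hy
  by_contra h
  exact hy (subset_closure (by rwa [not_and_or] at h))

namespace Background

theorem current_congr {x : M} (h : ∀ᶠ y in 𝓝 x, Θ₁.θ y = Θ₁'.θ y ∧ Θ₁.ζ y = Θ₁'.ζ y) :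
    b.current Θ₁ Θ₂ x = b.current Θ₁' Θ₂ x := by
  unfold current LocalBackground.current
  refine Finset.sum_congr rfl fun a _ => ?_
  rw [(b.loc x).jhalf_congr (eventually_localSection h) (.of_forall fun _ => ⟨fun _ _ => rfl, rfl⟩),
    (b.loc x).jhalf_congr (.of_forall fun _ => ⟨fun _ _ => rfl, rfl⟩) (eventually_localSection h)]

theorem current_eq_neg (Θ₁ Θ₂ : FieldPair M) (x : M) :
    b.current Θ₁ Θ₂ x = -b.current Θ₂ Θ₁ x := by
  unfold current LocalBackground.current
  rw [← Finset.sum_neg_distrib]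
  refine Finset.sum_congr rfl fun a _ => ?_
  have key : ∀ (p q : ℝ) (c : EuclideanSpace ℝ (Fin 4) →L[ℝ] ℝ), (p - q) • c = -((q - p) • c) :=
    fun p q c => by module
  exact key _ _ _

theorem current_eq_zero {x : M} (h : ∀ᶠ y in 𝓝 x, Θ₁.θ y = 0 ∧ Θ₁.ζ y = 0) :
    b.current Θ₁ Θ₂ x = 0 := by
  rw [current_congr (Θ₁' := ⟨fun _ => 0, fun _ => 0⟩) h]
  have e : localSection (⟨fun _ => 0, fun _ => 0⟩ : FieldPair M) x =
      ⟨fun _ _ _ => 0, fun _ => 0⟩ := rfl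
  unfold current LocalBackground.current
  rw [e]
  exact Finset.sum_eq_zero fun a _ => by
    rw [LocalBackground.jhalf_zero_left, LocalBackground.jhalf_zero_right, sub_zero, zero_smul]

theorem current_eq_zero_of_notMem {x : M} (h : x ∉ supp Θ₁ ∩ supp Θ₂) :
    b.current Θ₁ Θ₂ x = 0 := by
  rw [mem_inter_iff, not_and_or] at h
  rcases h with h | h
  · exact current_eq_zero (eventually_eq_zero_of_notMem_supp h)
  · rw [current_eq_neg, current_eq_zero (eventually_eq_zero_of_notMem_supp h), neg_zero]

theorem smoothCovec_current (hnd : b.NonDegenerate) (h₁ : IsSection Θ₁) (h₂ : IsSection Θ₂) :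
    SmoothCovec (b.current Θ₁ Θ₂) := fun y a =>
  (LocalBackground.contDiffOn_current (loc_regular hnd y) (h₁.regular y) (h₂.regular y) a).congr
    fun _ hz => comp1_current hnd h₁ h₂ y hz a

theorem pairing_eq_zero_right (hΘ : ∀ x, Θ₂.θ x = 0 ∧ Θ₂.ζ x = 0) (x : M) :
    b.pairing Θ₁ Θ₂ x = 0 := by
  have e : localSection Θ₂ x = ⟨fun _ _ _ => 0, fun _ => 0⟩ := by
    unfold localSection
    congr 1
    · funext i j z
      simp only [comp, (hΘ _).1]
      rfl
    · funext z
      exact (hΘ _).2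
  simp [pairing, e, LocalBackground.pairing, LocalBackground.dot2, LocalBackground.tr]

theorem pairing_eq_zero_left (hΘ : ∀ x, Θ₁.θ x = 0 ∧ Θ₁.ζ x = 0) (x : M) :
    b.pairing Θ₁ Θ₂ x = 0 := by
  have e : localSection Θ₁ x = ⟨fun _ _ _ => 0, fun _ => 0⟩ := by
    unfold localSection
    congr 1
    · funext i j z
      simp only [comp, (hΘ _).1]
      rfl
    · funext z
      exact (hΘ _).2
  simp [pairing, e, LocalBackground.pairing, LocalBackground.dot2, LocalBackground.tr]

end Background

end Current

/-! ## The symplectic form as an integral over a Cauchy surface -/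

section Final

variable {M : Type*} [TopologicalSpace M] [ChartedSpace (EuclideanSpace ℝ (Fin 4)) M]
  [IsManifold (𝓡 4) ∞ M] [T2Space M] [SigmaCompactSpace M]

/-- The value 1 is attained on a neighbourhood of every point of `K`, so multiplication by χ changes
neither a field nor its divergence there. -/
theorem exists_cutoff {K : Set M} (hK : IsCompact K) : ∃ (χ : M → ℝ) (L : Set M),
    ContMDiff (𝓡 4) 𝓘(ℝ, ℝ) ∞ χ ∧ IsCompact L ∧ (∀ x ∉ L, χ x = 0) ∧
      ∀ x ∈ K, ∀ᶠ y in 𝓝 x, χ y = 1 := by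
  have : LocallyCompactSpace M := ChartedSpace.locallyCompactSpace (EuclideanSpace ℝ (Fin 4)) M
  obtain ⟨L, hL, hKL⟩ := exists_compact_superset hK
  obtain ⟨L', hL', hLL'⟩ := exists_compact_superset hL
  obtain ⟨f, hf0, hf1, -⟩ := exists_contMDiffMap_zero_one_of_isClosed (n := ⊤) (𝓡 4)
    (s := (interior L')ᶜ) (t := L) isOpen_interior.isClosed_compl hL.isClosed
    (disjoint_left.2 fun x hx hxL => hx (hLL' hxL))
  refine ⟨f, L', f.contMDiff, hL', fun x hx => hf0 fun h => hx (interior_subset h), fun x hx => ?_⟩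
  filter_upwards [isOpen_interior.mem_nhds (hKL hx)] with y hy using hf1 (interior_subset hy)

variable [SecondCountableTopology M] [MeasurableSpace M] [BorelSpace M]
  [TopologicalSpace.MetrizableSpace M] {b : Background M} (hE : b.OnShell) (hnd : b.NonDegenerate)
  {τ : TimeOrientation b.g} {Θ₁ Θ₂ Θ₁p : FieldPair M} (h₁ : Θ₁ ∈ b.Sol) (h₂ : Θ₂ ∈ b.Sol)
  (hA' : SpacelikeCompact b.g τ (supp Θ₁ ∩ supp Θ₂)) (hp : b.IsFuturePart τ Θ₁ Θ₁p)
  (hA : SpacelikeCompact b.g τ (supp Θ₁p ∩ supp Θ₂))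
  {S : Type*} [TopologicalSpace S] [ChartedSpace (EuclideanSpace ℝ (Fin 3)) S]
  [IsManifold (𝓡 3) ∞ S] [MeasurableSpace S] [BorelSpace S] {ι : S → M}
  {ν : ∀ s : S, TangentSpace (𝓡 4) (ι s)} (hι : IsSmoothCauchy b.g τ ι)
  (hν : IsFutureUnitNormal b.g τ ι ν)
include hE hnd h₁ h₂ hA' hp hA hι hν

/-- No single multiple of a current has compact support without changing its divergence. The
manifold is therefore split along Σ, with J⁺ − J used in its chronological future and J⁺ on the
complement; J is the difference of the two boundary fluxes. -/
theorem Background.integral_pairing_Pbar :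
    Integrable (b.pairing (b.Pbar Θ₁p) Θ₂) (volMeasure b.g.val) ∧
      Integrable (fun s => b.current Θ₁ Θ₂ (ι s) (ν s)) (volMeasure (pullback b.g ι)) ∧
      ∫ x, b.pairing (b.Pbar Θ₁p) Θ₂ x ∂(volMeasure b.g.val) =
        ∫ s, b.current Θ₁ Θ₂ (ι s) (ν s) ∂(volMeasure (pullback b.g ι)) := by
  obtain ⟨hemb', hC, hsp⟩ := hι
  have hemb : IsEmbedding ι := hemb'.isEmbedding
  have hsm := hemb'.contMDiff
  have : SecondCountableTopology S := hemb.secondCountableTopology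
  obtain ⟨hsec, Cp, Cm, hCp, hCm, hplus, hminus⟩ := hp
  have hch := chronology b.g τ
  set Jp := b.current Θ₁p Θ₂ with hJp
  set J := b.current Θ₁ Θ₂ with hJ
  set I := future (Chron b.g τ) (range ι) with hI
  have hIo : IsOpen I := hch.isOpen_future_set _
  have sJp : SmoothCovec Jp := smoothCovec_current hnd hsec h₂.1
  have sJ : SmoothCovec J := smoothCovec_current hnd h₁.1 h₂.1
  set A := supp Θ₁p ∩ supp Θ₂ with hAd
  set A' := supp Θ₁ ∩ supp Θ₂ with hAd'
  have cA : IsClosed A := isClosed_closure.inter isClosed_closure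
  have cA' : IsClosed A' := isClosed_closure.inter isClosed_closure
  have zA : ∀ x ∉ A, Jp x = 0 := fun x hx => current_eq_zero_of_notMem hx
  have zA' : ∀ x ∉ A', J x = 0 := fun x hx => current_eq_zero_of_notMem hx
  -- Both arguments of this current are solutions, so it is conserved.
  have dJ : ∀ x, b.divergence J x = 0 := fun x => by
    rw [divergence_current hE hnd h₁.1 h₂.1, pairing_eq_zero_right h₂.2,
      pairing_eq_zero_left h₁.2, sub_zero]
  have dJp : ∀ x, b.pairing (b.Pbar Θ₁p) Θ₂ x = -b.divergence Jp x := fun x => by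
    rw [divergence_current hE hnd hsec h₂.1, pairing_eq_zero_right h₂.2]
    ring
  have eplus : ∀ x ∈ future (Chron b.g τ) Cp, Jp x = J x := fun x hx => by
    refine current_congr ?_
    filter_upwards [(hch.isOpen_future_set Cp).mem_nhds hx] with y hy
    exact hplus y (future_subset_JPlus Cp hy)
  have eminus : ∀ x ∈ future (flip (Chron b.g τ)) Cm, Jp x = 0 := fun x hx => by
    refine current_eq_zero ?_
    filter_upwards [(hch.flip.isOpen_future_set Cm).mem_nhds hx] with y hy
    exact hminus y (past_subset_JMinus Cm hy)
  -- Three compact pieces: the support of J⁺ between Σ⁻ and Σ, the supports of J⁺ and J between Σ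
  -- and Σ⁺, and the support of J on Σ itself, where the flux has to be unaffected by the cutoff.
  set K : Set M := (A \ (I ∪ future (flip (Chron b.g τ)) Cm)) ∪
    (((A ∪ A') \ (future (Chron b.g τ) Cp ∪ future (flip (Chron b.g τ)) (range ι))) ∪
      (A' ∩ range ι)) with hK
  have cK : IsCompact K := by
    refine (hch.isCompact_slab hC hCm cA hA).union
      ((hch.isCompact_slab hCp hC (cA.union cA') fun D hD => ?_).union (hA' _ hC))
    rw [union_inter_distrib_right]
    exact (hA D hD).union (hA' D hD)
  obtain ⟨χ, L, hχ, hL, hχ0, hχ1⟩ := exists_cutoff cK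
  set F₁ : ∀ x : M, TangentSpace (𝓡 4) x →L[ℝ] ℝ := fun x => χ x • (Jp x - J x) with hF₁
  set F₂ : ∀ x : M, TangentSpace (𝓡 4) x →L[ℝ] ℝ := fun x => χ x • Jp x with hF₂
  have sF₁ : SmoothCovec F₁ := (sJp.sub sJ).smul hχ
  have sF₂ : SmoothCovec F₂ := sJp.smul hχ
  have zF₁ : ∀ x ∉ L, F₁ x = 0 := fun x hx => by
    rw [hF₁]; beta_reduce; rw [hχ0 x hx, zero_smul]
  have zF₂ : ∀ x ∉ L, F₂ x = 0 := fun x hx => by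
    rw [hF₂]; beta_reduce; rw [hχ0 x hx, zero_smul]
  -- Beyond Σ⁺ the fields J⁺ and J agree near the point, off the supports both vanish, and elsewhere
  -- χ = 1 nearby; in every case `F₁` agrees with J⁺ − J there.
  have d₁ : ∀ x ∈ I, b.divergence Jp x = b.divergence F₁ x := fun x hx => by
    have e : b.divergence Jp x = b.divergence (fun y => Jp y - J y) x := by
      rw [divergence_sub hnd sJp sJ, dJ, sub_zero]
    rw [e]
    refine divergence_congr ?_
    by_cases hxp : x ∈ future (Chron b.g τ) Cp
    · filter_upwards [(hch.isOpen_future_set Cp).mem_nhds hxp] with y hy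
      rw [hF₁]
      beta_reduce
      rw [eplus y hy, sub_self, smul_zero]
    · by_cases hxA : x ∈ A ∪ A'
      · have hxK : x ∈ K := Or.inr (Or.inl ⟨hxA, fun h => h.elim hxp fun h =>
          disjoint_left.1 (hch.disjoint_future_past hC) hx h⟩)
        filter_upwards [hχ1 x hxK] with y hy
        rw [hF₁]
        beta_reduce
        rw [hy, one_smul]
      · filter_upwards [(cA.union cA').isOpen_compl.mem_nhds hxA] with y hy
        rw [hF₁]
        beta_reduce
        rw [zA y fun h => hy (Or.inl h), zA' y fun h => hy (Or.inr h), sub_self, smul_zero]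
  -- The same comparison for J⁺ alone, which vanishes before Σ⁻. The neighbourhoods used do not have
  -- to stay inside the complement, so points of Σ cause no difficulty.
  have d₂ : ∀ x ∈ Iᶜ, b.divergence Jp x = b.divergence F₂ x := fun x hx => by
    refine divergence_congr ?_
    by_cases hxm : x ∈ future (flip (Chron b.g τ)) Cm
    · filter_upwards [(hch.flip.isOpen_future_set Cm).mem_nhds hxm] with y hy
      rw [hF₂]
      beta_reduce
      rw [eminus y hy, smul_zero]
    · by_cases hxA : x ∈ A
      · have hxK : x ∈ K := Or.inl ⟨hxA, fun h => h.elim hx hxm⟩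
        filter_upwards [hχ1 x hxK] with y hy
        rw [hF₂]
        beta_reduce
        rw [hy, one_smul]
      · filter_upwards [cA.isOpen_compl.mem_nhds hxA] with y hy
        rw [hF₂]
        beta_reduce
        rw [zA y hy, smul_zero]
  -- The difference of the two cut-off fields is χJ, and on Σ either χ = 1 or J = 0.
  have eν : ∀ s, J (ι s) (ν s) = F₂ (ι s) (ν s) - F₁ (ι s) (ν s) := fun s => by
    have key : ∀ (c : ℝ) (p q : EuclideanSpace ℝ (Fin 4) →L[ℝ] ℝ) (v : EuclideanSpace ℝ (Fin 4)),
        (c = 1 ∨ q = 0) → q v = (c • p) v - (c • (p - q)) v := by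
      rintro c p q v (rfl | rfl) <;> simp
    refine key _ _ _ _ ?_
    by_cases hs : ι s ∈ A'
    · exact Or.inl (hχ1 _ (Or.inr (Or.inr ⟨hs, s, rfl⟩))).self_of_nhds
    · exact Or.inr (zA' _ hs)
  have i₁ := integrable_divergence hnd sF₁ hL zF₁
  have i₂ := integrable_divergence hnd sF₂ hL zF₂
  have n₁ := integrable_normal hnd sF₁ hL zF₁ hsm hν hsp hC hemb
  have n₂ := integrable_normal hnd sF₂ hL zF₂ hsm hν hsp hC hemb
  have s₁ := integral_divergence_future hnd sF₁ hL zF₁ hsm hν hsp hC hemb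
  have s₂ := integral_divergence_future hnd sF₂ hL zF₂ hsm hν hsp hC hemb
  have s₃ := integral_divergence_eq_zero hnd sF₂ hL zF₂
  have iI : IntegrableOn (b.divergence Jp) I (volMeasure b.g.val) :=
    (integrableOn_congr_fun d₁ hIo.measurableSet).2 i₁.integrableOn
  have iIc : IntegrableOn (b.divergence Jp) Iᶜ (volMeasure b.g.val) :=
    (integrableOn_congr_fun d₂ hIo.measurableSet.compl).2 i₂.integrableOn
  have iJp : Integrable (b.divergence Jp) (volMeasure b.g.val) := by
    rw [← integrableOn_univ, ← union_compl_self I]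
    exact iI.union iIc
  refine ⟨iJp.neg.congr (.of_forall fun x => (dJp x).symm),
    (n₂.sub n₁).congr (.of_forall fun s => (eν s).symm), ?_⟩
  -- The integral of div `F₂` over M vanishes, so over the complement of I it is minus the flux of
  -- `F₂`. Adding the flux of `F₁` from I and reversing the sign gives the flux of J.
  simp only [dJp, eν]
  rw [integral_neg, integral_sub n₂ n₁, ← integral_add_compl hIo.measurableSet iJp,
    setIntegral_congr_fun hIo.measurableSet d₁, setIntegral_congr_fun hIo.measurableSet.compl d₂,
    ← s₁, ← s₂]
  have := integral_add_compl hIo.measurableSet i₂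
  linarith

end Final

end LinEKG
end

theorem mainTheorem8 {M : Type*} [TopologicalSpace M] [T2Space M]
    [SecondCountableTopology M] [ConnectedSpace M] [ChartedSpace (EuclideanSpace ℝ (Fin 4)) M]
    [IsManifold (𝓡 4) ∞ M] [MeasurableSpace M] [BorelSpace M]
    (b : Background M) (τ : TimeOrientation b.g) (hM : GloballyHyperbolic b.g τ)
    (hE : b.OnShell) (hnd : b.NonDegenerate) :
    (∀ Θ₁ Θ₂ : FieldPair M, IsSection Θ₁ → IsSection Θ₂ → ∀ x,
      b.divergence (b.current Θ₁ Θ₂) x =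
        b.pairing Θ₁ (b.Pbar Θ₂) x - b.pairing (b.Pbar Θ₁) Θ₂ x) ∧
    (∀ Θ₁ ∈ b.Sol, ∀ Θ₂ ∈ b.Sol, SpacelikeCompact b.g τ (supp Θ₁ ∩ supp Θ₂) →
      ∀ Θ₁p : FieldPair M, b.IsFuturePart τ Θ₁ Θ₁p →
        SpacelikeCompact b.g τ (supp Θ₁p ∩ supp Θ₂) →
      ∀ (S : Type*) [TopologicalSpace S] [ChartedSpace (EuclideanSpace ℝ (Fin 3)) S]
        [IsManifold (𝓡 3) ∞ S] [MeasurableSpace S] [BorelSpace S] (ι : S → M)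
        (ν : ∀ s : S, TangentSpace (𝓡 4) (ι s)),
        IsSmoothCauchy b.g τ ι → IsFutureUnitNormal b.g τ ι ν →
          Integrable (b.pairing (b.Pbar Θ₁p) Θ₂) (volMeasure b.g.val) ∧
          Integrable (fun s => b.current Θ₁ Θ₂ (ι s) (ν s)) (volMeasure (pullback b.g ι)) ∧
          ∫ x, b.pairing (b.Pbar Θ₁p) Θ₂ x ∂(volMeasure b.g.val) =
            ∫ s, b.current Θ₁ Θ₂ (ι s) (ν s) ∂(volMeasure (pullback b.g ι))) := by
  have : LocallyCompactSpace M := ChartedSpace.locallyCompactSpace (EuclideanSpace ℝ (Fin 4)) M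
  have : TopologicalSpace.MetrizableSpace M := TopologicalSpace.metrizableSpace_of_t3_secondCountable M
  refine ⟨fun Θ₁ Θ₂ h₁ h₂ x => Background.divergence_current hE hnd h₁ h₂ x, ?_⟩
  intro Θ₁ h₁ Θ₂ h₂ hA' Θ₁p hp hA S _ _ _ _ _ ι ν hι hν
  exact Background.integral_pairing_Pbar hE hnd h₁ h₂ hA' hp hA hι hν
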